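/- **Setting.** Let $S^1=\mathbb R/2\pi\mathbb Z$ and let $H^\sigma(S^1)$ be the Sobolev space of complex-valued $u=\sum_k\hat u_ke^{ik\varphi}$ with $\|u\|_{H^\sigma}^2=\sum_{k\in\mathbb Z}(1+k^2)^\sigma|\hat u_k|^2<\infty$. Put $X=H^2\times H^1\times H^1\times L^2$ and $Y=H^3\times H^2\times H^2\times H^1$ (all on $S^1$). Let $0<r_0\le r_1$, $s_1=\log r_1$, $J_-=(-\infty,s_1]$, let $\theta\in C_0^\infty(B_{r_0}(0);\mathbb R)$ be a radial function on $\mathbb R^2$, and put $\tilde\theta(s)=\theta(e^s)$, where $\theta(r)$ denotes the radial profile. Let $\tilde{\mathcal R}=L^2((-\infty,s_1];H^{1/2}(S^1),e^{2s}ds)$. For $\lambda\in\mathbb R$ and $\tilde\rho\in\tilde{\mathcal R}$ consider on $J_-$ the system $U'=A(s;\lambda,\tilde\rho)U$ for $U=(u_1,u_2,u_3,u_4)$, i.e. $$u_1'=u_2,\quad u_2'=-\partial_\varphi^2u_1+e^{2s}u_3,\quad u_3'=u_4,\quad u_4'=(\lambda-\tilde\theta(s)-\tilde\rho(s,\cdot))e^{2s}u_1-\partial_\varphi^2u_3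 .$$ A *weak solution* on an interval $J$ with interior $J^\circ$ is a function $U\in C(J;X)\cap L^2_{loc}(J^\circ;Y)\cap H^1_{loc}(J^\circ;X)$ such that $-\int_J\langle U,V'\rangle ds=\int_J\langle A(s;\lambda,\tilde\rho)U,V\rangle ds$ for all $V\in C_0^\infty(J^\circ;X)$, where $\langle\cdot,\cdot\rangle$ is the $L^2(S^1)^4$ inner product. The system has an *exponential dichotomy in $X$ on $J_-$ with constant $K>0$ and rates $\kappa^-<\kappa^+$*, with projections $P(s)\in\mathcal L(X)$ ($s\in J_-$) and evolution operators $\Phi^-(s,t)\in\mathcal L(X)$ ($t\le s\le s_1$), $\Phi^+(s,t)\in\mathcal L(X)$ ($s\le t\le s_1$), if $P(s)^2=P(s)$, $P(\cdot)U\in C(J_-;X)$ for every $U\in X$, and for all $t\in J_-$, $U\in X$: 1. $\Phi^-(\cdot,t)U$ is a weak solution on $[t,s_1]$, the unique one with value $P(t)U$ at $s=t$, and $\|\Phi^-(s,t)U\|_X\le Ke^{\kappa^-(s-t)}\|U\|_X$ for $t\le s\le s_1$; 2. $\Phi^+(\cdot,t)U$ is a weak solution on $(-\infty,t]$, the unique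 one with value $(I-P(t))U$ at $s=t$, and $\|\Phi^+(s,t)U\|_X\le Ke^{\kappa^+(s-t)}\|U\|_X$ for $s\le t$; 3. $\Phi^-(s,t)U\in\operatorname{Ran}P(s)$ for $t\le s\le s_1$, and $\Phi^+(s,t)U\in\ker P(s)$ for $s\le t$. **Theorem.** Let $-1<\kappa^s<\kappa^{cu}<0$ and $0<\kappa^{cs}<\kappa^u<1$. There exist an open neighbourhood $\mathcal U$ of $0$ in $\tilde{\mathcal R}$ and families of projections $P^s_-(s;\lambda,\tilde\rho)$, $P^{cs}_-(s;\lambda,\tilde\rho)$ and evolution operators $\Phi^s_-,\Phi^{cu}_-,\Phi^{cs}_-,\Phi^u_-(s,t;\lambda,\tilde\rho)$ in $\mathcal L(X)$ such that for every $\lambda\in\mathbb R$ and every $\tilde\rho\in\mathcal U$ the system has * an exponential dichotomy in $X$ on $J_-$ with some constant $K$, rates $\kappa^s<\kappa^{cu}$, projections $P^s_-(\cdot;\lambda,\tilde\rho)$ and evolution operators $\Phi^s_-(\cdot,\cdot;\lambda,\tilde\rho),\Phi^{cu}_-(\cdot,\cdot;\lambda,\tilde\rho)$, and * an exponential dichotomy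 in $X$ on $J_-$ with some constant $K$, rates $\kappa^{cs}<\kappa^u$, projections $P^{cs}_-(\cdot;\lambda,\tilde\rho)$ and evolution operators $\Phi^{cs}_-(\cdot,\cdot;\lambda,\tilde\rho),\Phi^u_-(\cdot,\cdot;\lambda,\tilde\rho)$. Moreover, the projections and evolution operators depend smoothly on $(\lambda,\tilde\rho)\in\mathbb R\times\mathcal U$: for all admissible fixed $s,t$ the maps $(\lambda,\tilde\rho)\mapsto P(s;\lambda,\tilde\rho)$ and $(\lambda,\tilde\rho)\mapsto\Phi(s,t;\lambda,\tilde\rho)$ are $C^\infty$ into $\mathcal L(X)$; and for fixed $t$ the map which sends $(\lambda,\tilde\rho)$ to the operator $U\mapsto e^{-\kappa(\cdot-t)}\Phi(\cdot,t;\lambda,\tilde\rho)U$ is $C^\infty$ into the bounded operators from $X$ to the bounded continuous $X$-valued functions on $[t,s_1]$ (for $\Phi=\Phi^s_-,\Phi^{cs}_-$), respectively on $(-\infty,t]$ (for $\Phi=\Phi^{cu}_-,\Phi^u_-$), with $\kappa$ the rate of $\Phi$. -/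

import Mathlib

open Set Filter Topology MeasureTheory
open scoped ContDiff

noncomputable section

namespace Bilaplace

/-! ### Sobolev spaces on the circle -/

/-- The weight `(1 + k²)^(σ/2)`. -/
def wt (σ : ℝ) (k : ℤ) : ℝ := (1 + (k : ℝ) ^ 2) ^ (σ / 2)

theorem wt_pos (σ : ℝ) (k : ℤ) : 0 < wt σ k := by
  unfold wt; positivity

theorem wt_mono {σ τ : ℝ} (h : τ ≤ σ) (k : ℤ) : wt τ k ≤ wt σ k := by
  unfold wt
  exact Real.rpow_le_rpow_of_exponent_le (by nlinarith [sq_nonneg (k : ℝ)]) (by linarith)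

theorem wt_add_two (τ : ℝ) (k : ℤ) : wt (τ + 2) k = (1 + (k : ℝ) ^ 2) * wt τ k := by
  unfold wt
  rw [show (τ + 2) / 2 = 1 + τ / 2 by ring, Real.rpow_add (by positivity), Real.rpow_one]

/-- The weighted sequences `(c_k)` with `∑ (1 + k²)^σ |c_k|² < ∞`. -/
def hsSub (σ : ℝ) : Submodule ℂ (ℤ → ℂ) where
  carrier := {c | Memℓp (fun k => (wt σ k : ℂ) * c k) 2}
  add_mem' {a b} ha hb := by
    have h := Memℓp.add ha hb
    have e : (fun k => (wt σ k : ℂ) * (a + b) k)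
        = (fun k => (wt σ k : ℂ) * a k) + fun k => (wt σ k : ℂ) * b k := by
      funext k; simp [mul_add]
    simpa only [mem_ofPred_eq, e] using h
  zero_mem' := by
    have e : (fun k : ℤ => (wt σ k : ℂ) * (0 : ℤ → ℂ) k) = 0 := by funext k; simp
    simpa only [mem_ofPred_eq, e] using (zero_memℓp (E := fun _ : ℤ => ℂ) (p := 2))
  smul_mem' z a ha := by
    have h := Memℓp.const_smul (𝕜 := ℂ) ha z
    have e : (fun k => (wt σ k : ℂ) * (z • a) k) = z • fun k => (wt σ k : ℂ) * a k := by
      funext k; simp; ring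
    simpa only [mem_ofPred_eq, e] using h

/-- The Sobolev space `H^σ(S¹)` of complex-valued functions on `S¹ = ℝ/2πℤ`. A function
`u = ∑ u_k e^{ikφ}` is given by its Fourier coefficients, and
`‖u‖² = ∑ (1 + k²)^σ |u_k|²` (see `HS.norm_sq`). -/
def HS (σ : ℝ) : Type := ↥(hsSub σ)

namespace HS

variable {σ τ : ℝ}

instance : AddCommGroup (HS σ) := inferInstanceAs (AddCommGroup ↥(hsSub σ))
instance : Module ℂ (HS σ) := inferInstanceAs (Module ℂ ↥(hsSub σ))

/-- The `k`-th Fourier coefficient. -/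
def coeff (u : HS σ) (k : ℤ) : ℂ := u.1 k

@[ext] theorem ext {u v : HS σ} (h : ∀ k, u.coeff k = v.coeff k) : u = v :=
  Subtype.ext (funext h)

@[simp] theorem coeff_add (u v : HS σ) (k : ℤ) : (u + v).coeff k = u.coeff k + v.coeff k := rfl
@[simp] theorem coeff_smul (z : ℂ) (u : HS σ) (k : ℤ) : (z • u).coeff k = z * u.coeff k := rfl

/-- The element with prescribed Fourier coefficients. -/
def mk (c : ℤ → ℂ) (h : Memℓp (fun k => (wt σ k : ℂ) * c k) 2) : HS σ := ⟨c, h⟩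

@[simp] theorem coeff_mk (c : ℤ → ℂ) (h : Memℓp (fun k => (wt σ k : ℂ) * c k) 2) (k : ℤ) :
    (mk c h).coeff k = c k := rfl

theorem mem (u : HS σ) : Memℓp (fun k => (wt σ k : ℂ) * u.coeff k) 2 := u.2

/-- Weighted Fourier coefficients, an isomorphism onto `ℓ²`. -/
def toL2 (σ : ℝ) : HS σ ≃ₗ[ℂ] lp (fun _ : ℤ => ℂ) 2 where
  toFun u := ⟨fun k => (wt σ k : ℂ) * u.coeff k, u.mem⟩
  map_add' u v := by
    ext k
    change (wt σ k : ℂ) * (u.coeff k + v.coeff k) = wt σ k * u.coeff k + wt σ k * v.coeff k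
    ring
  map_smul' z u := by
    ext k
    change (wt σ k : ℂ) * (z * u.coeff k) = z * (wt σ k * u.coeff k)
    ring
  invFun f := mk (fun k => (wt σ k : ℂ)⁻¹ * f k) (by
    have e : (fun k => (wt σ k : ℂ) * ((wt σ k : ℂ)⁻¹ * f k)) = f := by
      funext k
      have : (wt σ k : ℂ) ≠ 0 := by exact_mod_cast (wt_pos σ k).ne'
      field_simp
    rw [e]; exact f.2)
  left_inv u := by
    ext k
    have : (wt σ k : ℂ) ≠ 0 := by exact_mod_cast (wt_pos σ k).ne'
    change (wt σ k : ℂ)⁻¹ * (wt σ k * u.coeff k) = u.coeff k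
    field_simp
  right_inv f := by
    ext k
    have : (wt σ k : ℂ) ≠ 0 := by exact_mod_cast (wt_pos σ k).ne'
    change (wt σ k : ℂ) * ((wt σ k : ℂ)⁻¹ * f k) = f k
    field_simp

instance : NormedAddCommGroup (HS σ) :=
  NormedAddCommGroup.induced (HS σ) (lp (fun _ : ℤ => ℂ) 2) (toL2 σ).toLinearMap
    (toL2 σ).injective

instance : NormedSpace ℂ (HS σ) :=
  NormedSpace.induced ℂ (HS σ) (lp (fun _ : ℤ => ℂ) 2) (toL2 σ).toLinearMap

/-- `toL2` as an isometry. -/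
def toL2ₗᵢ (σ : ℝ) : HS σ ≃ₗᵢ[ℂ] lp (fun _ : ℤ => ℂ) 2 := ⟨toL2 σ, fun _ => rfl⟩

instance : CompleteSpace (HS σ) :=
  (toL2ₗᵢ σ).toIsometryEquiv.completeSpace

theorem norm_sq (u : HS σ) : ‖u‖ ^ 2 = ∑' k : ℤ, (1 + (k : ℝ) ^ 2) ^ σ * ‖u.coeff k‖ ^ 2 := by
  have h := lp.norm_rpow_eq_tsum (p := 2) (by norm_num) (toL2 σ u)
  have h' : ‖u‖ ^ 2 = ‖toL2 σ u‖ ^ (2 : ENNReal).toReal := by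
    simp; rfl
  rw [h', h]
  refine tsum_congr fun k => ?_
  change ‖(wt σ k : ℂ) * u.coeff k‖ ^ (2 : ENNReal).toReal = _
  have e : wt σ k ^ 2 = (1 + (k : ℝ) ^ 2) ^ σ := by
    unfold wt
    rw [← Real.rpow_natCast, ← Real.rpow_mul (by positivity)]
    norm_num
  rw [norm_mul, Complex.norm_real, Real.norm_of_nonneg (wt_pos σ k).le]
  simp [mul_pow, e]

/-- The inclusion `H^σ(S¹) ⊆ H^τ(S¹)` for `τ ≤ σ`. -/
def incl (h : τ ≤ σ) (u : HS σ) : HS τ :=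
  mk u.coeff (Memℓp.mono' u.mem fun k => by
    rw [norm_mul, norm_mul, Complex.norm_real, Complex.norm_real,
      Real.norm_of_nonneg (wt_pos _ k).le, Real.norm_of_nonneg (wt_pos _ k).le]
    exact mul_le_mul_of_nonneg_right (wt_mono h k) (norm_nonneg _))

@[simp] theorem coeff_incl (h : τ ≤ σ) (u : HS σ) (k : ℤ) :
    (incl h u).coeff k = u.coeff k := by
  unfold incl; rw [coeff_mk]

/-- The operator `-∂² = -d²/dφ²`, mapping `H^σ(S¹)` into `H^τ(S¹)` if `τ + 2 ≤ σ`; on Fourier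
coefficients it is multiplication by `k²`. -/
def negD2 (h : τ + 2 ≤ σ) (u : HS σ) : HS τ :=
  mk (fun k => (k : ℂ) ^ 2 * u.coeff k) (Memℓp.mono' u.mem fun k => by
    rw [norm_mul, norm_mul, norm_mul, Complex.norm_real, Complex.norm_real,
      Real.norm_of_nonneg (wt_pos _ k).le, Real.norm_of_nonneg (wt_pos _ k).le, ← mul_assoc]
    refine mul_le_mul_of_nonneg_right ?_ (norm_nonneg _)
    refine le_trans ?_ (wt_mono h k)
    rw [wt_add_two, mul_comm]
    refine mul_le_mul_of_nonneg_right ?_ (wt_pos _ k).le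
    simp)

@[simp] theorem coeff_negD2 (h : τ + 2 ≤ σ) (u : HS σ) (k : ℤ) :
    (negD2 h u).coeff k = (k : ℂ) ^ 2 * u.coeff k := by
  unfold negD2; rw [coeff_mk]

theorem wt_zero (k : ℤ) : wt 0 k = 1 := by simp [wt]

theorem summable_norm_coeff (u : HS 2) : Summable fun k => ‖u.coeff k‖ := by
  have h2 : Summable fun k : ℤ => (wt 2 k * ‖u.coeff k‖) ^ 2 := by
    have := (memℓp_gen_iff (p := 2) (by norm_num)).1 u.mem
    refine this.congr fun k => ?_
    simp [abs_of_pos (wt_pos 2 k)]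
  have h1 : Summable fun k : ℤ => ((1 + (k : ℝ) ^ 2)⁻¹) ^ 2 := by
    refine Summable.of_norm_bounded_eventually
      (Real.summable_one_div_int_pow.2 (by norm_num : 1 < 2)) ?_
    have : ({0} : Set ℤ)ᶜ ∈ cofinite := (finite_singleton 0).compl_mem_cofinite
    filter_upwards [this] with k hk
    have hk' : (k : ℝ) ≠ 0 := by exact_mod_cast hk
    have hp : 0 < (k : ℝ) ^ 2 := by positivity
    have h3 : (1 + (k : ℝ) ^ 2)⁻¹ ≤ 1 := inv_le_one_of_one_le₀ (by linarith)
    have h4 : (1 + (k : ℝ) ^ 2)⁻¹ ≤ ((k : ℝ) ^ 2)⁻¹ := inv_anti₀ hp (by linarith)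
    have h5 : 0 < (1 + (k : ℝ) ^ 2)⁻¹ := by positivity
    rw [Real.norm_of_nonneg (by positivity), one_div]
    nlinarith
  refine Summable.of_nonneg_of_le (fun _ => norm_nonneg _) (fun k => ?_) (h1.add h2)
  have hw : wt 2 k = 1 + (k : ℝ) ^ 2 := by
    simp [wt]
  rw [hw]
  have hp : 0 < 1 + (k : ℝ) ^ 2 := by positivity
  have e : (1 + (k : ℝ) ^ 2)⁻¹ * ((1 + (k : ℝ) ^ 2) * ‖u.coeff k‖) = ‖u.coeff k‖ := by
    field_simp
  nlinarith [sq_nonneg ((1 + (k : ℝ) ^ 2)⁻¹ - (1 + (k : ℝ) ^ 2) * ‖u.coeff k‖),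
    sq_nonneg ((1 + (k : ℝ) ^ 2)⁻¹), sq_nonneg ((1 + (k : ℝ) ^ 2) * ‖u.coeff k‖)]

/-- The convolution of an `ℓ¹` sequence with an `ℓ²` sequence is in `ℓ²`. -/
theorem memℓp_conv {a c : ℤ → ℂ} (ha : Summable fun j => ‖a j‖) (hc : Memℓp c 2) :
    Memℓp (fun k => ∑' j, a j * c (k - j)) 2 := by
  have hs : ∀ j : ℤ, Memℓp (fun k => c (k - j)) 2 := fun j => by
    rw [memℓp_gen_iff (by norm_num)] at hc ⊢
    exact (Equiv.subRight j).summable_iff.2 hc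
  let S : ℤ → lp (fun _ : ℤ => ℂ) 2 := fun j => ⟨fun k => c (k - j), hs j⟩
  have hS : ∀ j, ‖S j‖ = ‖S 0‖ := fun j => by
    rw [lp.norm_eq_tsum_rpow (by norm_num), lp.norm_eq_tsum_rpow (by norm_num)]
    congr 1
    change ∑' k, ‖c (k - j)‖ ^ _ = ∑' k, ‖c (k - 0)‖ ^ _
    simp only [sub_zero]
    exact (Equiv.subRight j).tsum_eq fun k => ‖c k‖ ^ (2 : ENNReal).toReal
  have hsum : Summable fun j => a j • S j := by
    refine Summable.of_norm ?_
    simp only [norm_smul, hS]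
    exact ha.mul_right _
  have e : (fun k => ∑' j, a j * c (k - j)) = ((∑' j, a j • S j : lp (fun _ : ℤ => ℂ) 2)) := by
    funext k
    have := (lp.evalCLM ℂ (fun _ : ℤ => ℂ) 2 k).map_tsum hsum
    exact this.symm
  rw [e]
  exact lp.memℓp _

/-- The pointwise product `ρ u` of `ρ ∈ H^{1/2}(S¹)` and `u ∈ H²(S¹)`, as an element of
`L²(S¹) = H⁰(S¹)`; its Fourier coefficients are `∑_j u_j ρ_{k-j}`. -/
def mul (ρ : HS (1 / 2)) (u : HS 2) : HS 0 :=
  mk (fun k => ∑' j, u.coeff j * ρ.coeff (k - j)) (by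
    have h : Memℓp ρ.coeff 2 := by
      simpa [wt_zero] using (incl (by norm_num : (0 : ℝ) ≤ 1 / 2) ρ).mem
    simpa only [wt_zero, Complex.ofReal_one, one_mul] using memℓp_conv (summable_norm_coeff u) h)

/-- The `L²(S¹)` inner product (normalised), conjugate linear in the second argument. -/
def pair (u v : HS σ) : ℂ := ∑' k, u.coeff k * (starRingEnd ℂ) (v.coeff k)

end HS

/-! ### The spatial-dynamics system for `s ≤ s₁` -/

/-- `X = H²(S¹) × H¹(S¹) × H¹(S¹) × L²(S¹)`. -/
abbrev XSp : Type := HS 2 × HS 1 × HS 1 × HS 0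

/-- `Y = H³(S¹) × H²(S¹) × H²(S¹) × H¹(S¹)`. -/
abbrev YSp : Type := HS 3 × HS 2 × HS 2 × HS 1

/-- The inclusion `Y ⊆ X`. -/
def toX (U : YSp) : XSp :=
  (HS.incl (by norm_num) U.1, HS.incl (by norm_num) U.2.1, HS.incl (by norm_num) U.2.2.1,
    HS.incl (by norm_num) U.2.2.2)

/-- The `L²(S¹)⁴` inner product on `X`. -/
def pairX (U V : XSp) : ℂ :=
  HS.pair U.1 V.1 + HS.pair U.2.1 V.2.1 + HS.pair U.2.2.1 V.2.2.1 + HS.pair U.2.2.2 V.2.2.2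

/-- The space `L²((-∞, s₁]; H^{1/2}(S¹), e^{2s} ds)`. -/
abbrev Pot (s₁ : ℝ) : Type :=
  Lp (HS (1 / 2)) 2
    ((volume.restrict (Iic s₁)).withDensity fun s => ENNReal.ofReal (Real.exp (2 * s)))

/-- The radial profile `s ↦ θ(r(s))`, `r(s) = e^s`, of a radial function `θ` on the plane. -/
def profile (θ : EuclideanSpace ℝ (Fin 2) → ℝ) (s : ℝ) : ℝ :=
  θ (EuclideanSpace.single 0 (Real.exp s))

/-- The right-hand side `A(s; λ, ρ) : Y → X`. For `s ≤ s₁` one has `r(s) = e^s`, so that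
`A(s; λ, ρ) U = (u₂, -∂²u₁ + e^{2s} u₃, u₄, (λ - θ(s) - ρ(s)) e^{2s} u₁ - ∂²u₃)`. -/
def rhs (θ : ℝ → ℝ) {s₁ : ℝ} (lam : ℝ) (ρ : Pot s₁) (s : ℝ) (U : YSp) : XSp :=
  (U.2.1,
   HS.negD2 (by norm_num) U.1 + (Real.exp (2 * s) : ℂ) • HS.incl (by norm_num) U.2.2.1,
   U.2.2.2,
   (Real.exp (2 * s) : ℂ) •
      (((lam - θ s : ℝ) : ℂ) • HS.incl (by norm_num) U.1
        - HS.mul (ρ s) (HS.incl (by norm_num) U.1))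
    + HS.negD2 (by norm_num) U.2.2.1)

/-! ### Weak solutions and exponential dichotomies -/

/-- `f ∈ L²_loc(O; E)`. -/
def LocL2 {E : Type*} [NormedAddCommGroup E] (f : ℝ → E) (O : Set ℝ) : Prop :=
  ∀ K ⊆ O, IsCompact K → MemLp f 2 (volume.restrict K)

/-- Smooth test functions with compact support in `O`. -/
def IsTest {E : Type*} [NormedAddCommGroup E] [NormedSpace ℝ E] (φ : ℝ → E) (O : Set ℝ) : Prop :=
  ContDiff ℝ ∞ φ ∧ HasCompactSupport φ ∧ tsupport φ ⊆ O

/-- `U ∈ H¹_loc(O; E)`. -/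
def LocH1 {E : Type*} [NormedAddCommGroup E] [NormedSpace ℝ E] (U : ℝ → E) (O : Set ℝ) : Prop :=
  LocL2 U O ∧ ∃ D : ℝ → E, LocL2 D O ∧
    ∀ φ : ℝ → ℝ, IsTest φ O → ∫ s in O, deriv φ s • U s = -∫ s in O, φ s • D s

/-- `U : J → X` is a weak solution of `U' = A(s) U` on the interval `J`: it is continuous on `J`
with values in `X`, belongs to `L²_loc(Y) ∩ H¹_loc(X)` on the interior of `J`, and satisfies the
equation there when tested against `X`-valued test functions in the `L²(S¹)⁴` inner product.
`W` is `U`, regarded as a function with values in `Y`. -/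
def IsWeakSolution (A : ℝ → YSp → XSp) (J : Set ℝ) (U : ℝ → XSp) : Prop :=
  ContinuousOn U J ∧ LocH1 U (interior J) ∧
  ∃ W : ℝ → YSp, LocL2 W (interior J) ∧
    (∀ᵐ s ∂volume.restrict (interior J), toX (W s) = U s) ∧
    ∀ V : ℝ → XSp, IsTest V (interior J) →
      -∫ s in interior J, pairX (U s) (deriv V s)
        = ∫ s in interior J, pairX (A s (W s)) (V s)

/-- `Φ(·, t) U₀` restricted to the interval `I ∋ t` is the unique weak solution on `I` which
equals `U₀` at time `t`. -/
def IsUniqueSolution (A : ℝ → YSp → XSp) (I : Set ℝ) (t : ℝ) (U₀ : XSp) (U : ℝ → XSp) : Prop :=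
  IsWeakSolution A I U ∧ U t = U₀ ∧
    ∀ V : ℝ → XSp, IsWeakSolution A I V → V t = U₀ → EqOn V U I

/-- `U' = A(s) U` has an exponential dichotomy in `X` on the interval `J` with constant `K` and
rates `κs < κu`, given by the projections `P(s)` and the evolution operators `Φs(s,t)` for
`s ≥ t` and `Φu(s,t)` for `s ≤ t`. -/
structure IsExpDichotomy (A : ℝ → YSp → XSp) (J : Set ℝ) (K κs κu : ℝ)
    (P : ℝ → XSp →L[ℂ] XSp) (Φs Φu : ℝ → ℝ → XSp →L[ℂ] XSp) : Prop where
  K_pos : 0 < K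
  rate_lt : κs < κu
  proj : ∀ s ∈ J, ∀ U, P s (P s U) = P s U
  cont : ∀ U, ContinuousOn (fun s => P s U) J
  stable_sol : ∀ t ∈ J, ∀ U, IsUniqueSolution A (J ∩ Ici t) t (P t U) fun s => Φs s t U
  stable_bound : ∀ t ∈ J, ∀ s ∈ J, t ≤ s → ∀ U,
    ‖Φs s t U‖ ≤ K * Real.exp (κs * (s - t)) * ‖U‖
  unstable_sol : ∀ t ∈ J, ∀ U, IsUniqueSolution A (J ∩ Iic t) t (U - P t U) fun s => Φu s t U
  unstable_bound : ∀ t ∈ J, ∀ s ∈ J, s ≤ t → ∀ U,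
    ‖Φu s t U‖ ≤ K * Real.exp (κu * (s - t)) * ‖U‖
  stable_range : ∀ t ∈ J, ∀ s ∈ J, t ≤ s → ∀ U, Φs s t U ∈ (P s).range
  unstable_ker : ∀ t ∈ J, ∀ s ∈ J, s ≤ t → ∀ U, Φu s t U ∈ (P s).ker

/-! ### Smooth dependence on parameters -/

section

variable {E : Type*} [NormedAddCommGroup E] [NormedSpace ℝ E]

/-- The curves `s ↦ Φ p s U`, `s ∈ I`, depend smoothly on `p ∈ D` in the weighted supremum norm
`sup_{s ∈ I} w s * ‖Φ p s U‖`, in operator norm with respect to `U ∈ X`. -/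
def SmoothCurves (D : Set E) (I : Set ℝ) (w : ℝ → ℝ) (Φ : E → ℝ → XSp →L[ℂ] XSp) : Prop :=
  ∃ F : E → XSp →L[ℂ] BoundedContinuousFunction I XSp,
    ContDiffOn ℝ ∞ F D ∧ ∀ p ∈ D, ∀ U, ∀ s : I, F p U s = (w s : ℂ) • Φ p s U

/-- Smooth dependence of the projections and evolution operators of a family of dichotomies on
the parameter `p ∈ D`: in the operator norm of `X` for fixed times, and, for the evolution
operators with fixed initial time `t`, uniformly in `s` in the exponentially weighted norm. -/
structure SmoothDichotomies (D : Set E) (J : Set ℝ) (κs κu : ℝ)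
    (P : E → ℝ → XSp →L[ℂ] XSp) (Φs Φu : E → ℝ → ℝ → XSp →L[ℂ] XSp) : Prop where
  proj : ∀ s ∈ J, ContDiffOn ℝ ∞ (fun p => P p s) D
  stable : ∀ t ∈ J, ∀ s ∈ J, t ≤ s → ContDiffOn ℝ ∞ (fun p => Φs p s t) D
  unstable : ∀ t ∈ J, ∀ s ∈ J, s ≤ t → ContDiffOn ℝ ∞ (fun p => Φu p s t) D
  stable_curves : ∀ t ∈ J,
    SmoothCurves D (J ∩ Ici t) (fun s => Real.exp (-κs * (s - t))) fun p s => Φs p s t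
  unstable_curves : ∀ t ∈ J,
    SmoothCurves D (J ∩ Iic t) (fun s => Real.exp (-κu * (s - t))) fun p s => Φu p s t

end

end Bilaplace

end

/-! On Fourier modes the leading part of the system splits into the blocks (u₁, u₂) and (u₃, u₄). At
frequency k ≠ 0 each block has the eigenvalues ±|k|; at k = 0 it is nilpotent, and rescaling one
component makes the nilpotent coupling as small as desired. In the coordinates `psi` the system
reads z' = ev z + C(s) z with integer eigenvalues. Here C(s) is ε times `jordan` plus an operator
whose norm is at most a constant times e^{2s}(1 + ‖λ - θ - ρ‖), a function that is integrable and
square-integrable on (-∞, s₁]. Weak solutions are exactly the mild solutions of this equation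
(`isWeakSolution_iff`). Passing from mild to weak uses an energy estimate in each mode with a
constant independent of the mode, so that a derivative is gained after summation.

The Cauchy problem is ill-posed in both time directions, so solutions are produced by a Green
operator of Lyapunov-Perron type and a fixed point. The integral equation is contracting for every
potential because three devices act together. Time is cut at S: on (-∞, S) the integral of the
perturbation is small. On [S, s₁] the finitely many modes of frequency at most n are all integrated
forward in a weight of very large exponential rate, which produces a kernel e^{-L(s-σ)} that is
small against a square-integrable function. The remaining growing modes are integrated backward from
s₁ and lose a factor Ω = e^{L(s₁-S)}; this is compensated by scaling the high modes of the two
blocks by different large factors. The coupling into high modes then becomes small, and since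
multiplication by a function needs only the Wiener norm of u₁, whose high-frequency tail is small,
the total bound does not deteriorate. The constants are chosen in `exists_localSol_coefC`, and the
contraction is `SmallBounds.norm_KOp_le`.

To obtain a dichotomy that does not depend on these auxiliary choices, it is characterised
intrinsically by `IsJump`. A vector v at time t is written as Wm(t) + Wp(t), where Wp is a solution
on (-∞, t] with growth rate κ at -∞ and Wm is a solution on [t, s₁] whose value at s₁ is orthogonal
to the space `EU` of end values of all solutions on (-∞, s₁] with growth rate κ. Uniqueness
(`IsJump.unique`) follows by gluing: the difference of two decompositions is a solution on (-∞, s₁]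
whose end value lies in `EU` and is orthogonal to it, hence vanishes, and backward uniqueness
finishes the argument. Existence (`Small.isJump`) subtracts from the Green solution a solution of
controlled growth, chosen by an orthogonal projection of the end value. This projection is smooth in
the parameters because the end value operator is bounded below modulo its fixed kernel.

Uniqueness has three consequences: P(t)v = Wm(t) is a projection compatible with the flow, the
backward part decays with the better rate κ' (the same construction with another weight yields the
same solution), and the families constructed near each parameter, with different cuts and scalings,
agree where they overlap. Smoothness is then local, coming from inversion of operators near an
invertible one. -/

set_option linter.unusedSectionVars false

noncomputable section

namespace Bilaplace

/-! ### Square-summable sequences and diagonal operators -/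

/-- Square-summable families of complex numbers. -/
abbrev L2seq (ι : Type) : Type := ↥(lp (fun _ : ι => ℂ) 2)

namespace L2seq

variable {ι : Type}

theorem memℓp_iff {f : ι → ℂ} : Memℓp f 2 ↔ Summable fun i => ‖f i‖ ^ 2 := by
  rw [memℓp_gen_iff (by norm_num)]
  simp

theorem summable_sq (v : L2seq ι) : Summable fun i => ‖v i‖ ^ 2 := memℓp_iff.1 v.2

theorem norm_sq (v : L2seq ι) : ‖v‖ ^ 2 = ∑' i, ‖v i‖ ^ 2 := by
  have h := lp.norm_rpow_eq_tsum (p := 2) (by norm_num) v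
  simpa using h

theorem norm_apply_le (v : L2seq ι) (i : ι) : ‖v i‖ ≤ ‖v‖ :=
  lp.norm_apply_le_norm (by norm_num) v i

theorem norm_le_of_forall {v w : L2seq ι} {c : ℝ} (hc : 0 ≤ c) (h : ∀ i, ‖w i‖ ≤ c * ‖v i‖) :
    ‖w‖ ≤ c * ‖v‖ := by
  refine le_of_sq_le_sq ?_ (by positivity)
  rw [mul_pow, norm_sq, norm_sq, ← tsum_mul_left]
  refine w.summable_sq.tsum_le_tsum (fun i => ?_) (v.summable_sq.mul_left _)
  rw [← mul_pow]
  exact pow_le_pow_left₀ (norm_nonneg _) (h i) 2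

@[simp] theorem add_apply (v w : L2seq ι) (i : ι) : (v + w) i = v i + w i := rfl
@[simp] theorem sub_apply (v w : L2seq ι) (i : ι) : (v - w) i = v i - w i := rfl
@[simp] theorem neg_apply (v : L2seq ι) (i : ι) : (-v) i = -v i := rfl
@[simp] theorem smul_apply (z : ℂ) (v : L2seq ι) (i : ι) : (z • v) i = z * v i := rfl
@[simp] theorem zero_apply (i : ι) : (0 : L2seq ι) i = 0 := rfl

theorem ext_apply {v w : L2seq ι} (h : ∀ i, v i = w i) : v = w := lp.ext (funext h)

theorem memℓp_mul {a : ι → ℝ} {c : ℝ} (h : ∀ i, |a i| ≤ c) (v : L2seq ι) :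
    Memℓp (fun i => (a i : ℂ) * v i) 2 := by
  rw [memℓp_iff]
  refine Summable.of_nonneg_of_le (fun _ => by positivity) (fun i => ?_)
    (v.summable_sq.mul_left (c ^ 2))
  rw [norm_mul, mul_pow, Complex.norm_real]
  exact mul_le_mul_of_nonneg_right (pow_le_pow_left₀ (norm_nonneg _) (h i) 2) (by positivity)

open Classical in
/-- The diagonal operator with entries `a i` (zero if they are unbounded). -/
def dmul (a : ι → ℝ) : L2seq ι →L[ℂ] L2seq ι :=
  if h : ∃ c, ∀ i, |a i| ≤ c then
    LinearMap.mkContinuous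
      { toFun := fun v => ⟨fun i => (a i : ℂ) * v i, memℓp_mul h.choose_spec v⟩
        map_add' := fun v w => ext_apply fun i => mul_add _ _ _
        map_smul' := fun z v => ext_apply fun i => mul_left_comm _ _ _ }
      |h.choose| (fun v => norm_le_of_forall (abs_nonneg _) fun i => by
        change ‖(a i : ℂ) * v i‖ ≤ _
        rw [norm_mul, Complex.norm_real]
        exact mul_le_mul_of_nonneg_right ((h.choose_spec i).trans (le_abs_self _))
          (norm_nonneg _))
  else 0

theorem dmul_apply {a : ι → ℝ} {c : ℝ} (h : ∀ i, |a i| ≤ c) (v : L2seq ι) (i : ι) :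
    dmul a v i = a i * v i := by
  have h' : ∃ c, ∀ i, |a i| ≤ c := ⟨c, h⟩
  rw [dmul, dif_pos h']
  rfl

theorem norm_dmul_apply_le {a : ι → ℝ} {c : ℝ} (hc : 0 ≤ c) (h : ∀ i, |a i| ≤ c) (v : L2seq ι) :
    ‖dmul a v‖ ≤ c * ‖v‖ :=
  norm_le_of_forall hc fun i => by
    rw [dmul_apply h, norm_mul, Complex.norm_real]
    exact mul_le_mul_of_nonneg_right (h i) (norm_nonneg _)

theorem norm_dmul_le {a : ι → ℝ} {c : ℝ} (hc : 0 ≤ c) (h : ∀ i, |a i| ≤ c) : ‖dmul a‖ ≤ c :=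
  ContinuousLinearMap.opNorm_le_bound _ hc (norm_dmul_apply_le hc h)

open Classical in
/-- The coordinate projection onto the coordinates in `s`. -/
def cproj (s : Set ι) : L2seq ι →L[ℂ] L2seq ι := dmul fun i => if i ∈ s then 1 else 0

open Classical in
theorem cproj_apply (s : Set ι) (v : L2seq ι) (i : ι) :
    cproj s v i = if i ∈ s then v i else 0 := by
  rw [cproj, dmul_apply (c := 1)]
  · split_ifs <;> simp
  · intro i; split_ifs <;> simp

theorem norm_cproj_apply_le (s : Set ι) (v : L2seq ι) : ‖cproj s v‖ ≤ ‖v‖ := by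
  have := norm_le_of_forall (v := v) (w := cproj s v) zero_le_one fun i => by
    classical
    rw [cproj_apply]; split_ifs <;> simp
  simpa using this

/-- A diagonal operator whose entries are at most `b` off `s` and at most `c` on `s`. -/
theorem norm_dmul_le_add {a : ι → ℝ} {b c : ℝ} (hb : 0 ≤ b) (hc : 0 ≤ c) (s : Set ι)
    (h₁ : ∀ i, i ∉ s → |a i| ≤ b) (h₂ : ∀ i, i ∈ s → |a i| ≤ c) (v : L2seq ι) :
    ‖dmul a v‖ ≤ b * ‖v‖ + c * ‖cproj s v‖ := by
  classical
  have hall : ∀ i, |a i| ≤ b + c := fun i => by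
    by_cases hi : i ∈ s
    · linarith [h₂ i hi]
    · linarith [h₁ i hi]
  have e : dmul a v = dmul a (cproj sᶜ v) + dmul a (cproj s v) := by
    rw [← map_add]
    congr 1
    refine ext_apply fun i => ?_
    simp only [add_apply, cproj_apply, mem_compl_iff]
    by_cases hi : i ∈ s <;> simp [hi]
  have h3 : ‖dmul a (cproj sᶜ v)‖ ≤ b * ‖v‖ := by
    refine norm_le_of_forall hb fun i => ?_
    rw [dmul_apply hall, cproj_apply, norm_mul, Complex.norm_real]
    by_cases hi : i ∈ s
    · simp only [mem_compl_iff, hi, not_true_eq_false, if_false, norm_zero, mul_zero]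
      positivity
    · simp only [mem_compl_iff, hi, not_false_eq_true, if_true]
      exact mul_le_mul_of_nonneg_right (h₁ i hi) (norm_nonneg _)
  have h4 : ‖dmul a (cproj s v)‖ ≤ c * ‖cproj s v‖ := by
    refine norm_le_of_forall hc fun i => ?_
    rw [dmul_apply hall, cproj_apply, norm_mul, Complex.norm_real]
    by_cases hi : i ∈ s
    · simp only [hi, if_true]
      exact mul_le_mul_of_nonneg_right (h₂ i hi) (norm_nonneg _)
    · simp [hi]
  rw [e]
  exact (norm_add_le _ _).trans (add_le_add h3 h4)

/-- Strong continuity of diagonal operators in their entries. -/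
theorem tendsto_dmul {α : Type*} {l : Filter α} {a : α → ι → ℝ} {b : ι → ℝ} {c : ℝ}
    (ha : ∀ᶠ x in l, ∀ i, |a x i| ≤ c) (hb : ∀ i, |b i| ≤ c)
    (h : ∀ i, Tendsto (fun x => a x i) l (𝓝 (b i))) (v : L2seq ι) :
    Tendsto (fun x => dmul (a x) v) l (𝓝 (dmul b v)) := by
  rw [tendsto_iff_norm_sub_tendsto_zero]
  have key : Tendsto (fun x => ∑' i, |a x i - b i| ^ 2 * ‖v i‖ ^ 2) l
      (𝓝 (∑' _ : ι, (0 : ℝ))) := by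
    refine tendsto_tsum_of_dominated_convergence
      (bound := fun i => (2 * c) ^ 2 * ‖v i‖ ^ 2) (v.summable_sq.mul_left _) (fun i => ?_) ?_
    · have : Tendsto (fun x => |a x i - b i| ^ 2 * ‖v i‖ ^ 2) l
          (𝓝 (|b i - b i| ^ 2 * ‖v i‖ ^ 2)) :=
        (((h i).sub_const _).abs.pow 2).mul_const _
      simpa using this
    · filter_upwards [ha] with x hx i
      rw [Real.norm_of_nonneg (by positivity)]
      refine mul_le_mul_of_nonneg_right (pow_le_pow_left₀ (abs_nonneg _) ?_ 2) (by positivity)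
      have := abs_sub (a x i) (b i)
      linarith [hx i, hb i]
  rw [tsum_zero] at key
  have key2 := key.sqrt
  rw [Real.sqrt_zero] at key2
  refine key2.congr' ?_
  filter_upwards [ha] with x hx
  have e : ‖dmul (a x) v - dmul b v‖ ^ 2 = ∑' i, |a x i - b i| ^ 2 * ‖v i‖ ^ 2 := by
    rw [norm_sq]
    refine tsum_congr fun i => ?_
    rw [sub_apply, dmul_apply hx, dmul_apply hb, ← sub_mul, norm_mul, mul_pow,
      ← Complex.ofReal_sub, Complex.norm_real, Real.norm_eq_abs]
  rw [← e, Real.sqrt_sq (norm_nonneg _)]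

/-- Finite partial sums over coordinates converge pointwise in ℓ² along the directed set of finite
subsets, which is countably generated for countable `ι`. -/
theorem measurable_of_apply [Countable ι] {α : Type*} [MeasurableSpace α] {m : Measure α}
    {f : α → L2seq ι} (h : ∀ i, AEStronglyMeasurable (fun x => f x i) m) :
    AEStronglyMeasurable f m := by
  classical
  refine aestronglyMeasurable_of_tendsto_ae (u := (atTop : Filter (Finset ι)))
    (f := fun s x => ∑ i ∈ s, lp.single 2 i (f x i)) (fun s => ?_) ?_
  · refine Finset.aestronglyMeasurable_fun_sum s fun i _ => ?_
    exact (lp.isometry_single (E := fun _ : ι => ℂ) (p := 2) i).continuous.comp_aestronglyMeasurable (h i)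
  · exact Eventually.of_forall fun x => lp.hasSum_single (by norm_num) (f x)

theorem apply_integral {α : Type*} [MeasurableSpace α] {m : Measure α} {f : α → L2seq ι}
    (hf : Integrable f m) (i : ι) : (∫ x, f x ∂m) i = ∫ x, f x i ∂m :=
  ((lp.evalCLM ℂ (fun _ : ι => ℂ) 2 i).integral_comp_comm hf).symm

theorem measurable_apply {α : Type*} [MeasurableSpace α] {m : Measure α} {f : α → L2seq ι}
    (hf : AEStronglyMeasurable f m) (i : ι) : AEStronglyMeasurable (fun x => f x i) m :=
  (lp.evalCLM ℂ (fun _ : ι => ℂ) 2 i).continuous.comp_aestronglyMeasurable hf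

theorem integrable_apply {α : Type*} [MeasurableSpace α] {m : Measure α} {f : α → L2seq ι}
    (hf : Integrable f m) (i : ι) : Integrable (fun x => f x i) m :=
  (lp.evalCLM ℂ (fun _ : ι => ℂ) 2 i).integrable_comp hf

theorem continuousOn_apply {s : Set ℝ} {f : ℝ → L2seq ι} (hf : ContinuousOn f s) (i : ι) :
    ContinuousOn (fun x => f x i) s :=
  (lp.evalCLM ℂ (fun _ : ι => ℂ) 2 i).continuous.comp_continuousOn hf

end L2seq

end Bilaplace

namespace Bilaplace

/-! ### The weighted Green kernel of a diagonal equation -/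

theorem integral_exp_neg_mul_abs_sub {δ : ℝ} (hδ : 0 < δ) (s : ℝ) :
    ∫ x : ℝ, Real.exp (-δ * |s - x|) = 2 / δ := by
  rw [integral_sub_left_eq_self (fun x => Real.exp (-δ * |x|)),
    integral_comp_abs (f := fun x => Real.exp (-δ * x)), integral_exp_mul_Ioi (by linarith)]
  simp
  field_simp

/-- The integral computed above is nonzero, whereas a non-integrable function has integral 0 by
convention. -/
theorem integrable_exp_neg_mul_abs_sub {δ : ℝ} (hδ : 0 < δ) (s : ℝ) :
    Integrable fun x : ℝ => Real.exp (-δ * |s - x|) := by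
  by_contra h
  have h1 := integral_exp_neg_mul_abs_sub hδ s
  rw [integral_undef h] at h1
  have : 0 < 2 / δ := by positivity
  linarith

/-- A diagonal equation `U' = μ U` on `(-∞, s₁]` together with a splitting of its modes: modes in
`F` are solved forward from `-∞`, the other modes in `M` from time `S`, and the remaining modes
backward from `s₁`. Growth is measured against a weight of exponential rate `κ` for `s ≤ S` and
`ν` for `s ≥ S`. The modes in `O` have a gap `δ` to these rates; they contain the range of a
constant operator `N`. -/
structure Splitting (ι : Type) where
  μ : ι → ℝ
  F : Set ι
  M : Set ι
  O : Set ι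
  S : ℝ
  s₁ : ℝ
  κ : ℝ
  ν : ℝ
  L : ℝ
  δ : ℝ
  S_le : S ≤ s₁
  L_nonneg : 0 ≤ L
  δ_pos : 0 < δ
  ν_nonneg : 0 ≤ ν
  κ_le : κ + L ≤ ν
  fwd : ∀ i ∈ F, μ i ≤ κ
  mid_lower : ∀ i ∈ M, i ∉ F → κ ≤ μ i
  mid_upper : ∀ i ∈ M, i ∉ F → μ i + L ≤ ν
  bwd : ∀ i, i ∉ F → i ∉ M → ν ≤ μ i + L
  bwd_gap : ∀ i, i ∉ F → i ∉ M → κ + δ ≤ μ i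
  nonneg : ∀ i, i ∉ F → 0 ≤ μ i
  gap : ∀ i ∈ O, μ i + δ ≤ ν ∧ (i ∈ F ∧ μ i + δ ≤ κ ∨ i ∉ F ∧ i ∈ M ∧ κ + δ ≤ μ i)
  N : L2seq ι →L[ℂ] L2seq ι
  N_supp : ∀ v, ∀ i ∉ O, N v i = 0

namespace Splitting

variable {ι : Type} (D : Splitting ι)

/-- The logarithm of the weight. -/
def lw (s : ℝ) : ℝ := D.κ * min (s - D.S) 0 + D.ν * max (s - D.S) 0

/-- The modes solved backward from `s₁`. -/
def B : Set ι := {i | i ∉ D.F ∧ i ∉ D.M}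

/-- A bound for the weighted kernel. -/
def Ω : ℝ := Real.exp (D.L * (D.s₁ - D.S))

open Classical in
/-- Whether at time `σ` the mode `i` is solved backward. -/
def un (i : ι) (σ : ℝ) : ℝ :=
  if i ∈ D.F then 0 else if i ∈ D.M then (if σ < D.S then 1 else 0) else 1

/-- The entries of the weighted Green kernel. -/
def gk (s σ : ℝ) (i : ι) : ℝ :=
  Real.exp (D.μ i * (s - σ) + D.lw σ - D.lw s) * ((if σ ≤ s then 1 else 0) - D.un i σ)

/-- The weighted Green kernel. -/
def Gam (s σ : ℝ) : L2seq ι →L[ℂ] L2seq ι := L2seq.dmul (D.gk s σ)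

/-- A bound for the entries in the modes which are not solved backward. -/
def kl (s σ : ℝ) : ℝ :=
  if σ < D.S then 1 else if σ ≤ s then Real.exp (-D.L * (s - σ)) else 0

theorem one_le_Ω : 1 ≤ D.Ω :=
  Real.one_le_exp (mul_nonneg D.L_nonneg (by linarith [D.S_le]))

theorem kl_nonneg (s σ : ℝ) : 0 ≤ D.kl s σ := by
  unfold kl; split_ifs <;> positivity

theorem kl_le_one (s σ : ℝ) : D.kl s σ ≤ 1 := by
  unfold kl
  split_ifs with h1 h2
  · exact le_rfl
  · exact Real.exp_le_one_iff.2 (by nlinarith [D.L_nonneg])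
  · exact zero_le_one

theorem continuous_lw : Continuous D.lw := by unfold lw; fun_prop

theorem κ_le_ν : D.κ ≤ D.ν := by linarith [D.κ_le, D.L_nonneg]

theorem lw_of_le {s : ℝ} (h : s ≤ D.S) : D.lw s = D.κ * (s - D.S) := by
  rw [lw, min_eq_left (by linarith), max_eq_right (by linarith)]; ring

theorem lw_of_ge {s : ℝ} (h : D.S ≤ s) : D.lw s = D.ν * (s - D.S) := by
  rw [lw, min_eq_right (by linarith), max_eq_left (by linarith)]; ring

theorem lw_eq (s : ℝ) : D.lw s = D.κ * (s - D.S) + (D.ν - D.κ) * max (s - D.S) 0 := by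
  rcases le_total s D.S with h | h
  · rw [D.lw_of_le h, max_eq_right (by linarith)]; ring
  · rw [D.lw_of_ge h, max_eq_left (by linarith)]; ring

/-- The logarithmic weight is piecewise linear with slopes κ and ν, both at least κ. -/
theorem lw_sub_ge {s σ : ℝ} (h : σ ≤ s) : D.κ * (s - σ) ≤ D.lw s - D.lw σ := by
  have h1 : max (σ - D.S) 0 ≤ max (s - D.S) 0 := max_le_max (by linarith) le_rfl
  rw [lw_eq, lw_eq]
  nlinarith [mul_nonneg (sub_nonneg.2 D.κ_le_ν) (sub_nonneg.2 h1)]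

/-- Before S the slope κ is at most ν - L. After S the slope ν exceeds ν - L by L, which costs at
most L(s₁ - S), the logarithm of Ω. -/
theorem lw_sub_le {s σ : ℝ} (h : s ≤ σ) (h' : σ ≤ D.s₁) :
    D.lw σ - D.lw s ≤ (D.ν - D.L) * (σ - s) + D.L * (D.s₁ - D.S) := by
  have hL := D.L_nonneg
  have hS := D.S_le
  rcases le_total σ D.S with h1 | h1
  · rw [D.lw_of_le h1, D.lw_of_le (h.trans h1)]
    nlinarith [mul_nonneg (sub_nonneg.2 D.κ_le) (sub_nonneg.2 h),
      mul_nonneg hL (sub_nonneg.2 hS)]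
  rcases le_total s D.S with h2 | h2
  · rw [D.lw_of_ge h1, D.lw_of_le h2]
    nlinarith [mul_nonneg (sub_nonneg.2 D.κ_le) (sub_nonneg.2 h2),
      mul_nonneg hL (sub_nonneg.2 h')]
  · rw [D.lw_of_ge h1, D.lw_of_ge h2]
    nlinarith [mul_nonneg hL (sub_nonneg.2 h'), mul_nonneg hL (sub_nonneg.2 h2)]

/-- Relative to the weight, modes of `F` do not grow before S and contract at rate L after S, since
μ ≤ κ ≤ ν - L. The other modes of `M` satisfy κ ≤ μ ≤ ν - L. They do not grow backward while the
weight has rate κ, and contract forward at rate L while it has rate ν; this is why their direction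
of integration switches at S. -/
theorem abs_gk_le_kl {s σ : ℝ} {i : ι} (hi : i ∉ D.B) : |D.gk s σ i| ≤ D.kl s σ := by
  by_cases hF : i ∈ D.F
  · have hμ := D.fwd i hF
    have hκ := D.κ_le
    by_cases hs : σ ≤ s
    · have e : D.gk s σ i = Real.exp (D.μ i * (s - σ) + D.lw σ - D.lw s) := by
        simp [gk, un, hF, hs]
      rw [e, abs_of_pos (Real.exp_pos _), kl]
      split_ifs with h1
      · refine Real.exp_le_one_iff.2 ?_
        have := D.lw_sub_ge hs
        nlinarith
      · push Not at h1
        refine Real.exp_le_exp.2 ?_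
        rw [D.lw_of_ge h1, D.lw_of_ge (h1.trans hs)]
        nlinarith
    · have e : D.gk s σ i = 0 := by simp [gk, un, hF, hs]
      rw [e, abs_zero]
      exact D.kl_nonneg s σ
  · have hM : i ∈ D.M := by
      by_contra h; exact hi ⟨hF, h⟩
    have hμ := D.mid_lower i hM hF
    have hμ' := D.mid_upper i hM hF
    by_cases h1 : σ < D.S
    · by_cases hs : σ ≤ s
      · have e : D.gk s σ i = 0 := by simp [gk, un, hF, hM, hs, h1]
        rw [e, abs_zero]
        exact D.kl_nonneg s σ
      · have e : D.gk s σ i = -Real.exp (D.μ i * (s - σ) + D.lw σ - D.lw s) := by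
          simp [gk, un, hF, hM, hs, h1]
        rw [e, abs_neg, abs_of_pos (Real.exp_pos _), kl, if_pos h1]
        refine Real.exp_le_one_iff.2 ?_
        push Not at hs
        rw [D.lw_of_le h1.le, D.lw_of_le (hs.trans h1).le]
        nlinarith
    · by_cases hs : σ ≤ s
      · have e : D.gk s σ i = Real.exp (D.μ i * (s - σ) + D.lw σ - D.lw s) := by
          simp [gk, un, hF, hM, hs, h1]
        rw [e, abs_of_pos (Real.exp_pos _), kl, if_neg h1, if_pos hs]
        push Not at h1
        refine Real.exp_le_exp.2 ?_
        rw [D.lw_of_ge h1, D.lw_of_ge (h1.trans hs)]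
        nlinarith
      · have e : D.gk s σ i = 0 := by simp [gk, un, hF, hM, hs, h1]
        rw [e, abs_zero]
        exact D.kl_nonneg s σ

/-- Only modes integrated backward from s₁ can exceed 1. For these ν - L ≤ μ, so against a weight of
rate ν the backward flow grows at rate at most L over a time at most s₁ - S. -/
theorem abs_gk_le_Ω {s σ : ℝ} (hσ : σ ≤ D.s₁) (i : ι) : |D.gk s σ i| ≤ D.Ω := by
  by_cases hi : i ∈ D.B
  · have hμ := D.bwd i hi.1 hi.2
    by_cases hs : σ ≤ s
    · have e : D.gk s σ i = 0 := by simp [gk, un, hi.1, hi.2, hs]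
      rw [e, abs_zero]
      exact zero_le_one.trans D.one_le_Ω
    · have e : D.gk s σ i = -Real.exp (D.μ i * (s - σ) + D.lw σ - D.lw s) := by
        simp [gk, un, hi.1, hi.2, hs]
      rw [e, abs_neg, abs_of_pos (Real.exp_pos _)]
      refine Real.exp_le_exp.2 ?_
      push Not at hs
      have := D.lw_sub_le hs.le hσ
      nlinarith
  · exact ((D.abs_gk_le_kl hi).trans (D.kl_le_one s σ)).trans D.one_le_Ω

/-- The constant operator `N` is not integrable in time, so a bounded kernel would not suffice for
it. On its range a distance δ to the weight rates makes the kernel decay exponentially, with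
integral at most 2/δ. -/
theorem abs_gk_le_gap {s σ : ℝ} {i : ι} (hi : i ∈ D.O) :
    |D.gk s σ i| ≤ Real.exp (-D.δ * |s - σ|) := by
  obtain ⟨hν, ⟨hF, hμ⟩ | ⟨hF, hM, hμ⟩⟩ := D.gap i hi
  · by_cases hs : σ ≤ s
    · have e : D.gk s σ i = Real.exp (D.μ i * (s - σ) + D.lw σ - D.lw s) := by
        simp [gk, un, hF, hs]
      rw [e, abs_of_pos (Real.exp_pos _), abs_of_nonneg (by linarith)]
      refine Real.exp_le_exp.2 ?_
      have := D.lw_sub_ge hs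
      nlinarith
    · have e : D.gk s σ i = 0 := by simp [gk, un, hF, hs]
      rw [e, abs_zero]
      positivity
  · by_cases h1 : σ < D.S
    · by_cases hs : σ ≤ s
      · have e : D.gk s σ i = 0 := by simp [gk, un, hF, hM, hs, h1]
        rw [e, abs_zero]
        positivity
      · have e : D.gk s σ i = -Real.exp (D.μ i * (s - σ) + D.lw σ - D.lw s) := by
          simp [gk, un, hF, hM, hs, h1]
        push Not at hs
        rw [e, abs_neg, abs_of_pos (Real.exp_pos _), abs_of_neg (by linarith)]
        refine Real.exp_le_exp.2 ?_
        rw [D.lw_of_le h1.le, D.lw_of_le (hs.trans h1).le]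
        nlinarith
    · by_cases hs : σ ≤ s
      · have e : D.gk s σ i = Real.exp (D.μ i * (s - σ) + D.lw σ - D.lw s) := by
          simp [gk, un, hF, hM, hs, h1]
        push Not at h1
        rw [e, abs_of_pos (Real.exp_pos _), abs_of_nonneg (by linarith)]
        refine Real.exp_le_exp.2 ?_
        rw [D.lw_of_ge h1, D.lw_of_ge (h1.trans hs)]
        nlinarith
      · have e : D.gk s σ i = 0 := by simp [gk, un, hF, hM, hs, h1]
        rw [e, abs_zero]
        positivity

theorem Gam_apply {s σ : ℝ} (hσ : σ ≤ D.s₁) (v : L2seq ι) (i : ι) :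
    D.Gam s σ v i = D.gk s σ i * v i :=
  L2seq.dmul_apply (D.abs_gk_le_Ω hσ) v i

theorem norm_Gam_le {s σ : ℝ} (hσ : σ ≤ D.s₁) : ‖D.Gam s σ‖ ≤ D.Ω :=
  L2seq.norm_dmul_le (zero_le_one.trans D.one_le_Ω) (D.abs_gk_le_Ω hσ)

/-- Only the component in the modes solved backward from s₁ is charged with the large factor Ω;
everything else sees the small kernel `kl`. -/
theorem norm_Gam_apply_le {s σ : ℝ} (hσ : σ ≤ D.s₁) (v : L2seq ι) :
    ‖D.Gam s σ v‖ ≤ D.kl s σ * ‖v‖ + D.Ω * ‖L2seq.cproj D.B v‖ :=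
  L2seq.norm_dmul_le_add (D.kl_nonneg s σ) (zero_le_one.trans D.one_le_Ω) _
    (fun _ hi => D.abs_gk_le_kl hi) (fun i _ => D.abs_gk_le_Ω hσ i) v

theorem norm_Gam_gap_le {s σ : ℝ} (hσ : σ ≤ D.s₁) {v : L2seq ι} (hv : ∀ i ∉ D.O, v i = 0) :
    ‖D.Gam s σ v‖ ≤ Real.exp (-D.δ * |s - σ|) * ‖v‖ := by
  refine L2seq.norm_le_of_forall (Real.exp_pos _).le fun i => ?_
  rw [D.Gam_apply hσ, norm_mul, Complex.norm_real]
  by_cases hi : i ∈ D.O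
  · exact mul_le_mul_of_nonneg_right (D.abs_gk_le_gap hi) (norm_nonneg _)
  · rw [hv i hi]; simp

theorem continuousAt_gk {s σ : ℝ} (h : σ ≠ s) (i : ι) :
    ContinuousAt (fun x => D.gk x σ i) s := by
  have h1 : ContinuousAt (fun x : ℝ => (if σ ≤ x then (1 : ℝ) else 0)) s := by
    rcases lt_or_gt_of_ne h with h | h
    · refine (continuousAt_const (y := (1 : ℝ))).congr ?_
      filter_upwards [Ioi_mem_nhds h] with x hx
      rw [if_pos (le_of_lt hx)]
    · refine (continuousAt_const (y := (0 : ℝ))).congr ?_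
      filter_upwards [Iio_mem_nhds h] with x hx
      rw [if_neg (not_le.2 hx)]
  have := D.continuous_lw
  exact ContinuousAt.mul (Continuous.continuousAt (by fun_prop)) (h1.sub continuousAt_const)

theorem continuousAt_Gam {s σ : ℝ} (h : σ ≠ s) (hσ : σ ≤ D.s₁) (v : L2seq ι) :
    ContinuousAt (fun x => D.Gam x σ v) s :=
  L2seq.tendsto_dmul (Eventually.of_forall fun _ => D.abs_gk_le_Ω hσ) (D.abs_gk_le_Ω hσ)
    (fun i => D.continuousAt_gk h i) v

theorem measurable_gk (s : ℝ) (i : ι) : Measurable fun σ => D.gk s σ i := by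
  have h1 : Measurable fun σ : ℝ => (if σ ≤ s then (1 : ℝ) else 0) :=
    Measurable.ite measurableSet_Iic measurable_const measurable_const
  have h2 : Measurable (D.un i) := by
    unfold un
    split_ifs
    · exact measurable_const
    · exact Measurable.ite measurableSet_Iio measurable_const measurable_const
    · exact measurable_const
  have := D.continuous_lw.measurable
  exact Measurable.mul (by fun_prop) (h1.sub h2)

theorem measurable_gk_left (σ : ℝ) (i : ι) : Measurable fun s => D.gk s σ i := by
  have h1 : Measurable fun s : ℝ => (if σ ≤ s then (1 : ℝ) else 0) :=
    Measurable.ite measurableSet_Ici measurable_const measurable_const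
  have := D.continuous_lw.measurable
  exact Measurable.mul (by fun_prop) (h1.sub_const _)

/-- The time interval `(-∞, s₁]`. -/
abbrev vol : Measure ℝ := volume.restrict (Iic D.s₁)

theorem ae_le : ∀ᵐ σ ∂D.vol, σ ≤ D.s₁ := ae_restrict_mem measurableSet_Iic

theorem measurable_Gam [Countable ι] (s : ℝ) {f : ℝ → L2seq ι}
    (hf : AEStronglyMeasurable f D.vol) :
    AEStronglyMeasurable (fun σ => D.Gam s σ (f σ)) D.vol := by
  refine L2seq.measurable_of_apply fun i => ?_
  have h1 : AEStronglyMeasurable (fun σ => (D.gk s σ i : ℂ) * f σ i) D.vol :=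
    ((Complex.measurable_ofReal.comp (D.measurable_gk s i)).aestronglyMeasurable).mul
      (L2seq.measurable_apply hf i)
  refine h1.congr ?_
  filter_upwards [D.ae_le] with σ hσ
  rw [D.Gam_apply hσ]

theorem measurable_Gam_left [Countable ι] {t : ℝ} (ht : t ≤ D.s₁) (v : L2seq ι) {m : Measure ℝ} :
    AEStronglyMeasurable (fun σ => D.Gam σ t v) m := by
  refine L2seq.measurable_of_apply fun i => ?_
  have h1 : AEStronglyMeasurable (fun σ => (D.gk σ t i : ℂ) * v i) m :=
    ((Complex.measurable_ofReal.comp (D.measurable_gk_left t i)).aestronglyMeasurable).mul_const _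
  refine h1.congr (Eventually.of_forall fun σ => ?_)
  simp only [D.Gam_apply ht]

end Splitting

end Bilaplace

namespace Bilaplace

/-! ### Integral operators with the weighted Green kernel -/

/-- Perturbations: a multiple of a fixed constant operator plus an integrable operator-valued
function on `(-∞, s₁]`. -/
abbrev Pert (ι : Type) (s₁ : ℝ) : Type :=
  ℂ × Lp (L2seq ι →L[ℂ] L2seq ι) 1 (volume.restrict (Iic s₁))

/-- The operator at time `σ` of a perturbation. -/
def pert {ι : Type} {s₁ : ℝ} (N : L2seq ι →L[ℂ] L2seq ι) (q : Pert ι s₁) (σ : ℝ) :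
    L2seq ι →L[ℂ] L2seq ι :=
  q.1 • N + (q.2 : ℝ → L2seq ι →L[ℂ] L2seq ι) σ

theorem measurable_pert {ι : Type} {s₁ : ℝ} (N : L2seq ι →L[ℂ] L2seq ι) (q : Pert ι s₁) :
    AEStronglyMeasurable (pert N q) (volume.restrict (Iic s₁)) :=
  aestronglyMeasurable_const.add (Lp.aestronglyMeasurable q.2)

theorem measurable_pert_apply {ι : Type} {s₁ : ℝ} (N : L2seq ι →L[ℂ] L2seq ι) (q : Pert ι s₁)
    {f : ℝ → L2seq ι} {m : Measure ℝ} (hm : m ≤ volume.restrict (Iic s₁))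
    (hf : AEStronglyMeasurable f m) :
    AEStronglyMeasurable (fun σ => pert N q σ (f σ)) m :=
  (ContinuousLinearMap.id ℂ (L2seq ι →L[ℂ] L2seq ι)).aestronglyMeasurable_comp₂
    ((measurable_pert N q).mono_measure hm) hf

namespace Splitting

variable {ι : Type} [Countable ι] (D : Splitting ι)

/-- A bounded linear family of bounded measurable curves on `(-∞, s₁]`. -/
structure CurveFam (G : Type) [NormedAddCommGroup G] [NormedSpace ℂ G] where
  val : ℝ → G →L[ℂ] L2seq ι
  c : ℝ
  c_nonneg : 0 ≤ c
  meas : ∀ g, AEStronglyMeasurable (fun σ => val σ g) D.vol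
  bound : ∀ σ ≤ D.s₁, ‖val σ‖ ≤ c

variable {D} {G : Type} [NormedAddCommGroup G] [NormedSpace ℂ G] (Λ : CurveFam D G)

/-- The integrand of the Green operator. -/
def kint (q : Pert ι D.s₁) (g : G) (s σ : ℝ) : L2seq ι :=
  D.Gam s σ (pert D.N q σ (Λ.val σ g))

/-- The constant part of the perturbation is integrated against the exponentially decaying kernel on
its gapped modes; the integrable part only needs a bounded kernel. -/
theorem norm_kint_le (q : Pert ι D.s₁) (g : G) {s σ : ℝ} (hσ : σ ≤ D.s₁) :
    ‖kint Λ q g s σ‖ ≤ (‖q.1‖ * ‖D.N‖ * Real.exp (-D.δ * |s - σ|) + D.Ω * ‖q.2 σ‖)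
      * (Λ.c * ‖g‖) := by
  have hv : ‖Λ.val σ g‖ ≤ Λ.c * ‖g‖ :=
    (Λ.val σ).le_of_opNorm_le (Λ.bound σ hσ) g
  have e : kint Λ q g s σ = q.1 • D.Gam s σ (D.N (Λ.val σ g)) + D.Gam s σ (q.2 σ (Λ.val σ g)) := by
    simp [kint, pert]
  have h1 : ‖q.1 • D.Gam s σ (D.N (Λ.val σ g))‖ ≤
      ‖q.1‖ * ‖D.N‖ * Real.exp (-D.δ * |s - σ|) * (Λ.c * ‖g‖) := by
    rw [norm_smul]
    have h2 := D.norm_Gam_gap_le (s := s) hσ (D.N_supp (Λ.val σ g))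
    have h3 := (D.N.le_opNorm (Λ.val σ g)).trans (mul_le_mul_of_nonneg_left hv (norm_nonneg _))
    calc ‖q.1‖ * ‖D.Gam s σ (D.N (Λ.val σ g))‖
        ≤ ‖q.1‖ * (Real.exp (-D.δ * |s - σ|) * (‖D.N‖ * (Λ.c * ‖g‖))) := by
          gcongr
          exact h2.trans (mul_le_mul_of_nonneg_left h3 (Real.exp_pos _).le)
      _ = _ := by ring
  have h4 : ‖D.Gam s σ (q.2 σ (Λ.val σ g))‖ ≤ D.Ω * ‖q.2 σ‖ * (Λ.c * ‖g‖) := by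
    have h5 := (D.Gam s σ).le_of_opNorm_le (D.norm_Gam_le hσ) (q.2 σ (Λ.val σ g))
    have h6 := ((q.2 σ).le_opNorm (Λ.val σ g)).trans
      (mul_le_mul_of_nonneg_left hv (norm_nonneg _))
    have := zero_le_one.trans D.one_le_Ω
    calc _ ≤ D.Ω * (‖q.2 σ‖ * (Λ.c * ‖g‖)) := h5.trans (mul_le_mul_of_nonneg_left h6 this)
      _ = _ := by ring
  rw [e, add_mul]
  exact (norm_add_le _ _).trans (add_le_add h1 h4)

theorem measurable_kint (q : Pert ι D.s₁) (g : G) (s : ℝ) :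
    AEStronglyMeasurable (kint Λ q g s) D.vol :=
  D.measurable_Gam s (measurable_pert_apply D.N q le_rfl (Λ.meas g))

theorem integrable_kbound (q : Pert ι D.s₁) (s c : ℝ) :
    Integrable (fun σ => (‖q.1‖ * ‖D.N‖ * Real.exp (-D.δ * |s - σ|) + D.Ω * ‖q.2 σ‖) * c)
      D.vol :=
  ((((integrable_exp_neg_mul_abs_sub D.δ_pos s).restrict).const_mul _).add
    ((L1.integrable_coeFn q.2).norm.const_mul _)).mul_const _

theorem integrable_kint (q : Pert ι D.s₁) (g : G) (s : ℝ) : Integrable (kint Λ q g s) D.vol := by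
  refine (integrable_kbound q s (Λ.c * ‖g‖)).mono' (measurable_kint Λ q g s) ?_
  filter_upwards [D.ae_le] with σ hσ using norm_kint_le Λ q g hσ

theorem continuous_integral_kint (q : Pert ι D.s₁) (g : G) :
    Continuous fun s => ∫ σ, kint Λ q g s σ ∂D.vol := by
  refine continuous_iff_continuousAt.2 fun s₀ => ?_
  -- For |s - s₀| < 1 the decaying kernel centred at s is at most e^δ times the one centred at s₀,
  -- which gives an integrable majorant independent of s. The kernel is continuous at s₀ except at σ
  -- = s₀, a null set.
  refine continuousAt_of_dominated
    (bound := fun σ => (‖q.1‖ * ‖D.N‖ * Real.exp D.δ * Real.exp (-D.δ * |s₀ - σ|)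
      + D.Ω * ‖q.2 σ‖) * (Λ.c * ‖g‖))
    (Eventually.of_forall fun s => measurable_kint Λ q g s) ?_ ?_ ?_
  · filter_upwards [Metric.ball_mem_nhds s₀ one_pos] with s hs
    filter_upwards [D.ae_le] with σ hσ
    refine (norm_kint_le Λ q g hσ).trans ?_
    have hc := Λ.c_nonneg
    refine mul_le_mul_of_nonneg_right ?_ (by positivity)
    rw [mul_assoc (‖q.1‖ * ‖D.N‖), ← Real.exp_add]
    have hδ := D.δ_pos
    gcongr
    have h1 : |s₀ - σ| ≤ |s₀ - s| + |s - σ| := abs_sub_le _ _ _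
    have h2 : |s₀ - s| < 1 := by
      rw [Metric.mem_ball, Real.dist_eq, abs_sub_comm] at hs; exact hs
    nlinarith
  · exact ((((integrable_exp_neg_mul_abs_sub D.δ_pos s₀).restrict).const_mul _).add
      ((L1.integrable_coeFn q.2).norm.const_mul _)).mul_const _
  · have : ∀ᵐ σ ∂D.vol, σ ≠ s₀ := by
      refine ae_restrict_of_ae ?_
      simp [ae_iff]
    filter_upwards [D.ae_le, this] with σ hσ hne
    exact D.continuousAt_Gam hne hσ _

theorem norm_integral_kint_le (q : Pert ι D.s₁) (g : G) (s : ℝ) :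
    ‖∫ σ, kint Λ q g s σ ∂D.vol‖ ≤ ((‖D.N‖ * (2 / D.δ) + D.Ω) * Λ.c) * ‖q‖ * ‖g‖ := by
  have hc := Λ.c_nonneg
  have hΩ := zero_le_one.trans D.one_le_Ω
  have hδ := D.δ_pos
  have h1 : ‖∫ σ, kint Λ q g s σ ∂D.vol‖ ≤
      ∫ σ, (‖q.1‖ * ‖D.N‖ * Real.exp (-D.δ * |s - σ|) + D.Ω * ‖q.2 σ‖) * (Λ.c * ‖g‖) ∂D.vol := by
    refine norm_integral_le_of_norm_le (integrable_kbound q s _) ?_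
    filter_upwards [D.ae_le] with σ hσ using norm_kint_le Λ q g hσ
  have h2 : ∫ σ, Real.exp (-D.δ * |s - σ|) ∂D.vol ≤ 2 / D.δ := by
    rw [← integral_exp_neg_mul_abs_sub D.δ_pos s]
    exact setIntegral_le_integral (integrable_exp_neg_mul_abs_sub D.δ_pos s)
      (Eventually.of_forall fun _ => (Real.exp_pos _).le)
  have h3 : ∫ σ, ‖q.2 σ‖ ∂D.vol = ‖q.2‖ := (L1.norm_eq_integral_norm q.2).symm
  refine h1.trans ?_
  rw [integral_mul_const, integral_add (((integrable_exp_neg_mul_abs_sub D.δ_pos s).restrict).const_mul _)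
    ((L1.integrable_coeFn q.2).norm.const_mul _), integral_const_mul, integral_const_mul, h3]
  have h4 : ‖q.1‖ ≤ ‖q‖ := norm_fst_le q
  have h5 : ‖q.2‖ ≤ ‖q‖ := norm_snd_le q
  calc _ ≤ (‖q‖ * ‖D.N‖ * (2 / D.δ) + D.Ω * ‖q‖) * (Λ.c * ‖g‖) := by gcongr
    _ = _ := by ring

/-- The Green operator `(q, g) ↦ ∫ Γ(s, σ) C_q(σ) (Λ g)(σ) dσ`. -/
def KOp : Pert ι D.s₁ →L[ℂ] G →L[ℂ] BoundedContinuousFunction ℝ (L2seq ι) :=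
  LinearMap.mkContinuous₂
    (LinearMap.mk₂ ℂ
      (fun q g => BoundedContinuousFunction.ofNormedAddCommGroup
        (fun s => ∫ σ, kint Λ q g s σ ∂D.vol) (continuous_integral_kint Λ q g) _
        (norm_integral_kint_le Λ q g))
      (fun q q' g => by
        ext1 s
        change ∫ σ, kint Λ (q + q') g s σ ∂D.vol
          = ∫ σ, kint Λ q g s σ ∂D.vol + ∫ σ, kint Λ q' g s σ ∂D.vol
        rw [← integral_add (integrable_kint Λ q g s) (integrable_kint Λ q' g s)]
        refine integral_congr_ae ?_
        filter_upwards [Lp.coeFn_add q.2 q'.2] with σ h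
        simp only [kint, pert, Prod.fst_add, Prod.snd_add, h, Pi.add_apply,
          add_apply, add_smul, map_add]
        abel)
      (fun z q g => by
        ext1 s
        change ∫ σ, kint Λ (z • q) g s σ ∂D.vol = z • ∫ σ, kint Λ q g s σ ∂D.vol
        rw [← integral_smul]
        refine integral_congr_ae ?_
        filter_upwards [Lp.coeFn_smul z q.2] with σ h
        simp only [kint, pert, Prod.smul_fst, Prod.smul_snd, h, Pi.smul_apply,
          add_apply, smul_apply, map_add, map_smul,
          smul_add, smul_assoc])
      (fun q g g' => by
        ext1 s
        change ∫ σ, kint Λ q (g + g') s σ ∂D.vol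
          = ∫ σ, kint Λ q g s σ ∂D.vol + ∫ σ, kint Λ q g' s σ ∂D.vol
        rw [← integral_add (integrable_kint Λ q g s) (integrable_kint Λ q g' s)]
        simp only [kint, map_add])
      (fun z q g => by
        ext1 s
        change ∫ σ, kint Λ q (z • g) s σ ∂D.vol = z • ∫ σ, kint Λ q g s σ ∂D.vol
        rw [← integral_smul]
        simp only [kint, map_smul]))
    ((‖D.N‖ * (2 / D.δ) + D.Ω) * Λ.c)
    (fun q g => by
      have hc := Λ.c_nonneg
      have hΩ := zero_le_one.trans D.one_le_Ω
      have hδ := D.δ_pos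
      exact (BoundedContinuousFunction.norm_le (by positivity)).2 (norm_integral_kint_le Λ q g))

theorem KOp_apply (q : Pert ι D.s₁) (g : G) (s : ℝ) :
    KOp Λ q g s = ∫ σ, D.Gam s σ (pert D.N q σ (Λ.val σ g)) ∂D.vol := rfl

theorem KOp_eq (q : Pert ι D.s₁) (g : G) (s : ℝ) :
    KOp Λ q g s = ∫ σ, kint Λ q g s σ ∂D.vol := rfl

theorem norm_KOp_apply_le (q : Pert ι D.s₁) :
    ‖KOp Λ q‖ ≤ ((‖D.N‖ * (2 / D.δ) + D.Ω) * Λ.c) * ‖q‖ := by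
  have hc := Λ.c_nonneg
  have hΩ := zero_le_one.trans D.one_le_Ω
  have hδ := D.δ_pos
  refine ContinuousLinearMap.opNorm_le_bound _ (by positivity) fun g => ?_
  exact (BoundedContinuousFunction.norm_le (by positivity)).2 (norm_integral_kint_le Λ q g)

/-- Bounded continuous functions as a family of curves. -/
def bcfFam : CurveFam D (BoundedContinuousFunction ℝ (L2seq ι)) where
  val σ := BoundedContinuousFunction.evalCLM ℂ σ
  c := 1
  c_nonneg := zero_le_one
  meas g := g.continuous.aestronglyMeasurable
  bound σ _ := ContinuousLinearMap.opNorm_le_bound _ zero_le_one fun g => by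
    rw [one_mul]; exact g.norm_coe_le_norm σ

/-- The solutions of the unperturbed equation with a prescribed jump at time `t`. -/
def jumpFam {t : ℝ} (ht : t ≤ D.s₁) : CurveFam D (L2seq ι) where
  val σ := D.Gam σ t
  c := D.Ω
  c_nonneg := zero_le_one.trans D.one_le_Ω
  meas v := D.measurable_Gam_left ht v
  bound _ _ := D.norm_Gam_le ht

/-- Bounds for a perturbation which make the Green operator a contraction. -/
structure SmallBounds (D : Splitting ι) (q : Pert ι D.s₁) : Prop where
  nil : ‖q.1‖ * ‖D.N‖ * (2 / D.δ) ≤ 1 / 8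
  exists_bounds : ∃ b h : ℝ → ℝ, Integrable b D.vol ∧ Integrable h D.vol ∧ (∀ σ, 0 ≤ b σ) ∧
    (∀ σ, 0 ≤ h σ) ∧
    (∀ᵐ σ ∂D.vol, ∀ v, ‖q.2 σ v‖ ≤ b σ * ‖v‖) ∧
    (∀ᵐ σ ∂D.vol, ∀ v, ‖L2seq.cproj D.B (q.2 σ v)‖ ≤ h σ * ‖v‖) ∧
    (∀ s, ∫ σ, D.kl s σ * b σ ∂D.vol ≤ 1 / 4) ∧ D.Ω * ∫ σ, h σ ∂D.vol ≤ 1 / 8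

theorem measurable_kl (s : ℝ) : Measurable (D.kl s) := by
  unfold kl
  refine Measurable.ite measurableSet_Iio measurable_const ?_
  exact Measurable.ite measurableSet_Iic (by fun_prop) measurable_const

/-- The constant part contributes 1/8, the integrable part 1/4 through `kl`, and its component in
the backward modes 1/8 after the loss of Ω. -/
theorem SmallBounds.norm_KOp_le {q : Pert ι D.s₁} (hq : D.SmallBounds q) :
    ‖KOp (bcfFam (D := D)) q‖ ≤ 1 / 2 := by
  obtain ⟨b, h, hb, hh, hb0, hh0, hbb, hhb, hkb, hΩh⟩ := hq.exists_bounds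
  have hΩ := zero_le_one.trans D.one_le_Ω
  refine ContinuousLinearMap.opNorm_le_bound _ (by norm_num) fun g => ?_
  refine (BoundedContinuousFunction.norm_le (by positivity)).2 fun s => ?_
  rw [KOp_apply]
  have hkbi : Integrable (fun σ => D.kl s σ * b σ) D.vol := by
    refine hb.mono' ((measurable_kl s).aestronglyMeasurable.mul hb.aestronglyMeasurable)
      (Eventually.of_forall fun σ => ?_)
    rw [Real.norm_of_nonneg (mul_nonneg (D.kl_nonneg _ _) (hb0 σ))]
    exact mul_le_of_le_one_left (hb0 σ) (D.kl_le_one _ _)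
  have hei := ((integrable_exp_neg_mul_abs_sub D.δ_pos s).restrict (s := Iic D.s₁)).const_mul
    (‖q.1‖ * ‖D.N‖)
  have key : ‖∫ σ, D.Gam s σ (pert D.N q σ ((bcfFam (D := D)).val σ g)) ∂D.vol‖ ≤
      ∫ σ, (‖q.1‖ * ‖D.N‖ * Real.exp (-D.δ * |s - σ|) + D.kl s σ * b σ + D.Ω * h σ) * ‖g‖
        ∂D.vol := by
    refine norm_integral_le_of_norm_le
      (((hei.add hkbi).add (hh.const_mul _)).mul_const _) ?_
    filter_upwards [D.ae_le, hbb, hhb] with σ hσ h1 h2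
    have hv : ‖(bcfFam (D := D)).val σ g‖ ≤ ‖g‖ := g.norm_coe_le_norm σ
    set v := (bcfFam (D := D)).val σ g
    have e : D.Gam s σ (pert D.N q σ v) = q.1 • D.Gam s σ (D.N v) + D.Gam s σ (q.2 σ v) := by
      simp [pert]
    rw [e]
    refine (norm_add_le _ _).trans ?_
    have h3 : ‖q.1 • D.Gam s σ (D.N v)‖ ≤
        ‖q.1‖ * ‖D.N‖ * Real.exp (-D.δ * |s - σ|) * ‖g‖ := by
      rw [norm_smul]
      calc _ ≤ ‖q.1‖ * (Real.exp (-D.δ * |s - σ|) * (‖D.N‖ * ‖g‖)) := by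
            gcongr
            exact (D.norm_Gam_gap_le hσ (D.N_supp v)).trans (mul_le_mul_of_nonneg_left
              ((D.N.le_opNorm v).trans (mul_le_mul_of_nonneg_left hv (norm_nonneg _)))
              (Real.exp_pos _).le)
        _ = _ := by ring
    have h4 : ‖D.Gam s σ (q.2 σ v)‖ ≤ (D.kl s σ * b σ + D.Ω * h σ) * ‖g‖ := by
      refine (D.norm_Gam_apply_le hσ _).trans ?_
      have hk := D.kl_nonneg s σ
      have h5 : ‖q.2 σ v‖ ≤ b σ * ‖g‖ := (h1 v).trans (mul_le_mul_of_nonneg_left hv (hb0 σ))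
      have h6 : ‖L2seq.cproj D.B (q.2 σ v)‖ ≤ h σ * ‖g‖ :=
        (h2 v).trans (mul_le_mul_of_nonneg_left hv (hh0 σ))
      calc _ ≤ D.kl s σ * (b σ * ‖g‖) + D.Ω * (h σ * ‖g‖) := by gcongr
        _ = _ := by ring
    calc _ ≤ _ := add_le_add h3 h4
      _ = _ := by ring
  refine key.trans ?_
  rw [integral_mul_const]
  refine mul_le_mul_of_nonneg_right ?_ (norm_nonneg _)
  have hei2 : Integrable (fun σ => ‖q.1‖ * ‖D.N‖ * Real.exp (-D.δ * |s - σ|) + D.kl s σ * b σ)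
      D.vol := hei.add hkbi
  rw [integral_add hei2 (hh.const_mul _), integral_add hei hkbi, integral_const_mul,
    integral_const_mul]
  have h2 : ∫ σ, Real.exp (-D.δ * |s - σ|) ∂D.vol ≤ 2 / D.δ := by
    rw [← integral_exp_neg_mul_abs_sub D.δ_pos s]
    exact setIntegral_le_integral (integrable_exp_neg_mul_abs_sub D.δ_pos s)
      (Eventually.of_forall fun _ => (Real.exp_pos _).le)
  have h3 : ‖q.1‖ * ‖D.N‖ * ∫ σ, Real.exp (-D.δ * |s - σ|) ∂D.vol ≤ 1 / 8 :=
    (mul_le_mul_of_nonneg_left h2 (by positivity)).trans hq.nil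
  linarith [hkb s]

end Splitting

end Bilaplace

namespace Bilaplace

/-! ### Mild solutions of perturbed diagonal equations -/

variable {ι : Type}

/-- `U` solves `U' = μ U + C(s) U` on `I` in the sense of the variation of constants formula. -/
def IsMild (μ : ι → ℝ) (C : ℝ → L2seq ι →L[ℂ] L2seq ι) (I : Set ℝ) (U : ℝ → L2seq ι) : Prop :=
  ContinuousOn U I ∧ ∀ a ∈ I, ∀ b ∈ I, a ≤ b → ∀ i,
    U b i = (Real.exp (μ i * (b - a)) : ℂ) * U a i
      + ∫ σ in a..b, (Real.exp (μ i * (b - σ)) : ℂ) * C σ (U σ) i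

namespace IsMild

variable {μ : ι → ℝ} {C : ℝ → L2seq ι →L[ℂ] L2seq ι} {I J : Set ℝ} {U V : ℝ → L2seq ι}

theorem mono (h : IsMild μ C I U) (hJ : J ⊆ I) : IsMild μ C J U :=
  ⟨h.1.mono hJ, fun a ha b hb => h.2 a (hJ ha) b (hJ hb)⟩

theorem congr [I.OrdConnected] (h : IsMild μ C I U) (hUV : EqOn V U I) : IsMild μ C I V := by
  refine ⟨h.1.congr hUV, fun a ha b hb hab i => ?_⟩
  rw [hUV ha, hUV hb, h.2 a ha b hb hab i]
  congr 1
  refine intervalIntegral.integral_congr fun σ hσ => ?_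
  rw [uIcc_of_le hab] at hσ
  have hσI : σ ∈ I := (‹I.OrdConnected›.out ha hb) hσ
  beta_reduce
  rw [hUV hσI]

theorem measurable (h : IsMild μ C I U) {a b : ℝ} (hI : Icc a b ⊆ I)
    (hC : IntegrableOn C (Icc a b)) :
    AEStronglyMeasurable (fun σ => C σ (U σ)) (volume.restrict (Icc a b)) :=
  (ContinuousLinearMap.id ℂ (L2seq ι →L[ℂ] L2seq ι)).aestronglyMeasurable_comp₂
    hC.aestronglyMeasurable ((h.1.mono hI).aestronglyMeasurable measurableSet_Icc)

theorem integrable (h : IsMild μ C I U) {a b : ℝ} (hI : Icc a b ⊆ I)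
    (hC : IntegrableOn C (Icc a b)) : IntegrableOn (fun σ => C σ (U σ)) (Icc a b) := by
  obtain ⟨c, hc⟩ := isCompact_Icc.exists_bound_of_continuousOn (h.1.mono hI)
  refine (hC.norm.mul_const c).mono' (h.measurable hI hC) ?_
  filter_upwards [ae_restrict_mem measurableSet_Icc] with σ hσ
  exact ((C σ).le_opNorm _).trans (mul_le_mul_of_nonneg_left (hc σ hσ) (norm_nonneg _))

theorem intervalIntegrable (h : IsMild μ C I U) {a b : ℝ} (hab : a ≤ b) (hI : Icc a b ⊆ I)
    (hC : IntegrableOn C (Icc a b)) (i : ι) (c : ℝ) :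
    IntervalIntegrable (fun σ => (Real.exp (μ i * (c - σ)) : ℂ) * C σ (U σ) i) volume a b := by
  rw [intervalIntegrable_iff_integrableOn_Icc_of_le hab]
  refine IntegrableOn.continuousOn_mul ?_ (L2seq.integrable_apply (h.integrable hI hC) i)
    isCompact_Icc
  fun_prop

theorem backward (h : IsMild μ C I U) {a b : ℝ} (ha : a ∈ I) (hb : b ∈ I) (hab : a ≤ b) (i : ι) :
    U a i = (Real.exp (μ i * (a - b)) : ℂ) * U b i
      - ∫ σ in a..b, (Real.exp (μ i * (a - σ)) : ℂ) * C σ (U σ) i := by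
  rw [h.2 a ha b hb hab i, mul_add, ← mul_assoc, ← Complex.ofReal_mul, ← Real.exp_add,
    ← intervalIntegral.integral_const_mul]
  have e : ∀ σ, (Real.exp (μ i * (a - b)) : ℂ) *
      ((Real.exp (μ i * (b - σ)) : ℂ) * C σ (U σ) i)
      = (Real.exp (μ i * (a - σ)) : ℂ) * C σ (U σ) i := fun σ => by
    rw [← mul_assoc, ← Complex.ofReal_mul, ← Real.exp_add]
    congr 3; ring_nf
  simp only [e]
  rw [show μ i * (a - b) + μ i * (b - a) = 0 by ring]
  simp

theorem sub (h : IsMild μ C I U) (h' : IsMild μ C I V) [I.OrdConnected]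
    (hC : ∀ a ∈ I, ∀ b ∈ I, IntegrableOn C (Icc a b)) : IsMild μ C I (U - V) := by
  refine ⟨h.1.sub h'.1, fun a ha b hb hab i => ?_⟩
  have hI : Icc a b ⊆ I := ‹I.OrdConnected›.out ha hb
  have e : ∀ σ, (Real.exp (μ i * (b - σ)) : ℂ) * C σ ((U - V) σ) i
      = (Real.exp (μ i * (b - σ)) : ℂ) * C σ (U σ) i
        - (Real.exp (μ i * (b - σ)) : ℂ) * C σ (V σ) i := fun σ => by
    rw [Pi.sub_apply, map_sub, L2seq.sub_apply, mul_sub]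
  simp only [e]
  rw [intervalIntegral.integral_sub (h.intervalIntegrable hab hI (hC a ha b hb) i b)
    (h'.intervalIntegrable hab hI (hC a ha b hb) i b), Pi.sub_apply, Pi.sub_apply,
    L2seq.sub_apply, L2seq.sub_apply, h.2 a ha b hb hab i, h'.2 a ha b hb hab i]
  ring

theorem zero : IsMild μ C I 0 :=
  ⟨continuousOn_const, fun a _ b _ _ i => by simp⟩

theorem smul (h : IsMild μ C I U) (z : ℂ) : IsMild μ C I (z • U) := by
  refine ⟨h.1.const_smul z, fun a ha b hb hab i => ?_⟩
  simp only [Pi.smul_apply, map_smul, L2seq.smul_apply, mul_left_comm _ z,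
    intervalIntegral.integral_const_mul]
  rw [h.2 a ha b hb hab i]
  ring

/-- Solutions on both sides of `t` which agree at `t` form one solution. -/
theorem glue {s₁ t : ℝ} (ht : t ≤ s₁) (h₁ : IsMild μ C (Iic t) U) (h₂ : IsMild μ C (Icc t s₁) V)
    (hUV : U t = V t) (hC : ∀ a, IntegrableOn C (Icc a s₁)) :
    IsMild μ C (Iic s₁) (fun s => if s ≤ t then U s else V s) := by
  set W : ℝ → L2seq ι := fun s => if s ≤ t then U s else V s
  have e₁ : EqOn W U (Iic t) := fun s hs => if_pos hs
  have e₂ : EqOn W V (Icc t s₁) := fun s hs => by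
    rcases hs.1.eq_or_lt with h | h
    · rw [← h]; exact (if_pos le_rfl).trans hUV
    · exact if_neg (not_le.2 h)
  have g₁ := h₁.congr e₁
  have g₂ := h₂.congr e₂
  refine ⟨?_, fun a ha b hb hab i => ?_⟩
  · have : Iic s₁ = Iic t ∪ Icc t s₁ := (Iic_union_Icc_eq_Iic ht).symm
    rw [this]
    exact g₁.1.union_of_isClosed g₂.1 isClosed_Iic isClosed_Icc
  · rcases le_total b t with hbt | hbt
    · exact g₁.2 a (hab.trans hbt) b hbt hab i
    rcases le_total t a with hat | hat
    · exact g₂.2 a ⟨hat, ha⟩ b ⟨hbt, hb⟩ hab i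
    have hCab : IntegrableOn C (Icc a t) := (hC a).mono_set (Icc_subset_Icc_right ht)
    have hCtb : IntegrableOn C (Icc t b) := (hC t).mono_set (Icc_subset_Icc_right hb)
    have i₁ := g₁.intervalIntegrable hat (fun x hx => hx.2) hCab i b
    have i₂ := g₂.intervalIntegrable hbt (fun x hx => ⟨hx.1, hx.2.trans hb⟩) hCtb i b
    rw [g₂.2 t ⟨le_rfl, ht⟩ b ⟨hbt, hb⟩ hbt i, g₁.2 a hat t self_mem_Iic hat i, mul_add,
      ← intervalIntegral.integral_const_mul, add_assoc,
      ← intervalIntegral.integral_add_adjacent_intervals i₁ i₂, ← mul_assoc,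
      ← Complex.ofReal_mul, ← Real.exp_add]
    have e : ∀ σ, (Real.exp (μ i * (b - t)) : ℂ) *
        ((Real.exp (μ i * (t - σ)) : ℂ) * C σ (W σ) i)
        = (Real.exp (μ i * (b - σ)) : ℂ) * C σ (W σ) i := fun σ => by
      rw [← mul_assoc, ← Complex.ofReal_mul, ← Real.exp_add]
      congr 3; ring_nf
    simp only [e]
    rw [show μ i * (b - t) + μ i * (t - a) = μ i * (b - a) by ring]

/-- Negating all eigenvalues costs nothing because no sign condition is imposed on them, so forward
and backward statements are equivalent under time reversal. -/
theorem reflect (h : IsMild μ C I U) :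
    IsMild (-μ) (fun s => -C (-s)) (Neg.neg ⁻¹' I) fun s => U (-s) := by
  refine ⟨h.1.comp continuous_neg.continuousOn fun _ hx => hx, fun a ha b hb hab i => ?_⟩
  have h1 := h.backward hb ha (neg_le_neg hab) i
  beta_reduce
  rw [h1, sub_eq_add_neg, ← intervalIntegral.integral_neg,
    ← intervalIntegral.integral_comp_neg fun σ =>
      -((Real.exp (μ i * (-b - σ)) : ℂ) * C σ (U σ) i)]
  congr 1
  · congr 3; simp only [Pi.neg_apply]; ring_nf
  · refine intervalIntegral.integral_congr fun σ _ => ?_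
    simp only [Pi.neg_apply, neg_apply, L2seq.neg_apply, mul_neg]
    congr 4; ring_nf

/-! ### Uniqueness for the Cauchy problem in both time directions -/

section Uniqueness

variable [Countable ι]

open Classical in
/-- The basic estimate for the Cauchy problem: in a weight of rate `τ`, modes below `τ` are
integrated forward and modes above `τ` backward. -/
theorem norm_le_of_eq_zero (h : IsMild μ C I U) {a T : ℝ} (hI : Icc a T ⊆ I)
    (hC : IntegrableOn C (Icc a T)) (h0 : U a = 0) (τ : ℝ) {s : ℝ} (hs : s ∈ Icc a T) :
    ‖U s‖ ≤ Real.exp (τ * (s - T)) * ‖U T‖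
      + ∫ σ in Icc a T, Real.exp (τ * (s - σ)) * ‖C σ (U σ)‖ := by
  have hF := h.integrable hI hC
  have haT : a ≤ T := hs.1.trans hs.2
  -- Modes with μ ≤ τ start from U a = 0 and therefore contribute no boundary term; the others start
  -- from U T and are integrated backward.
  let p : ι → ℝ := fun i => if μ i ≤ τ then 0 else Real.exp (μ i * (s - T))
  let g : ℝ → ι → ℝ := fun σ i => if μ i ≤ τ then (if σ ≤ s then Real.exp (μ i * (s - σ)) else 0)
    else (if σ ≤ s then 0 else -Real.exp (μ i * (s - σ)))
  have hp : ∀ i, |p i| ≤ Real.exp (τ * (s - T)) := fun i => by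
    simp only [p]
    split_ifs with h1
    · simp [Real.exp_nonneg]
    · rw [abs_of_pos (Real.exp_pos _)]
      refine Real.exp_le_exp.2 ?_
      push Not at h1
      nlinarith [hs.2]
  have hg : ∀ σ i, |g σ i| ≤ Real.exp (τ * (s - σ)) := fun σ i => by
    simp only [g]
    split_ifs with h1 h2 h2
    · rw [abs_of_pos (Real.exp_pos _)]
      refine Real.exp_le_exp.2 ?_
      nlinarith
    · simp [Real.exp_nonneg]
    · simp [Real.exp_nonneg]
    · rw [abs_neg, abs_of_pos (Real.exp_pos _)]
      refine Real.exp_le_exp.2 ?_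
      push Not at h1 h2
      nlinarith
  have hgm : ∀ i, Measurable fun σ => g σ i := fun i => by
    simp only [g]
    split_ifs
    · exact Measurable.ite measurableSet_Iic (by fun_prop) measurable_const
    · exact Measurable.ite measurableSet_Iic measurable_const (by fun_prop)
  have hGb : ∀ σ, ‖L2seq.dmul (g σ) (C σ (U σ))‖ ≤ Real.exp (τ * (s - σ)) * ‖C σ (U σ)‖ :=
    fun σ => L2seq.norm_dmul_apply_le (Real.exp_pos _).le (hg σ) _
  have hGm : AEStronglyMeasurable (fun σ => L2seq.dmul (g σ) (C σ (U σ)))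
      (volume.restrict (Icc a T)) := by
    refine L2seq.measurable_of_apply fun i => ?_
    simp only [L2seq.dmul_apply (hg _)]
    exact ((Complex.measurable_ofReal.comp (hgm i)).aestronglyMeasurable).mul
      (L2seq.measurable_apply hF.aestronglyMeasurable i)
  have hbi : IntegrableOn (fun σ => Real.exp (τ * (s - σ)) * ‖C σ (U σ)‖) (Icc a T) :=
    IntegrableOn.continuousOn_mul (by fun_prop) hF.norm isCompact_Icc
  have hGi : IntegrableOn (fun σ => L2seq.dmul (g σ) (C σ (U σ))) (Icc a T) :=
    hbi.mono' hGm (Eventually.of_forall hGb)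
  have key : U s = L2seq.dmul p (U T) + ∫ σ in Icc a T, L2seq.dmul (g σ) (C σ (U σ)) := by
    refine L2seq.ext_apply fun i => ?_
    rw [L2seq.add_apply, L2seq.dmul_apply hp, L2seq.apply_integral hGi]
    simp only [L2seq.dmul_apply (hg _)]
    by_cases h1 : μ i ≤ τ
    · have e : ∀ σ, (g σ i : ℂ) * C σ (U σ) i
          = (Iic s).indicator (fun σ => (Real.exp (μ i * (s - σ)) : ℂ) * C σ (U σ) i) σ := fun σ => by
        by_cases h2 : σ ≤ s <;> simp [g, h1, h2]
      simp only [e, p, if_pos h1, Complex.ofReal_zero, zero_mul, zero_add]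
      rw [setIntegral_indicator measurableSet_Iic,
        show Icc a T ∩ Iic s = Icc a s by ext x; simp; grind [hs.2],
        h.2 a (hI ⟨le_rfl, haT⟩) s (hI hs) hs.1 i, h0, intervalIntegral.integral_of_le hs.1,
        integral_Icc_eq_integral_Ioc]
      simp
    · have e : ∀ σ, (g σ i : ℂ) * C σ (U σ) i
          = (Ioi s).indicator (fun σ => -((Real.exp (μ i * (s - σ)) : ℂ) * C σ (U σ) i)) σ :=
        fun σ => by
        by_cases h2 : σ ≤ s
        · simp [g, h1, h2]
        · simp [g, h1, h2, not_le.1 h2]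
      simp only [e, p, if_neg h1]
      rw [setIntegral_indicator measurableSet_Ioi,
        show Icc a T ∩ Ioi s = Ioc s T by ext x; simp; grind [hs.1],
        h.backward (hI hs) (hI ⟨haT, le_rfl⟩) hs.2 i, intervalIntegral.integral_of_le hs.2,
        integral_neg]
      rfl
  rw [key]
  refine (norm_add_le _ _).trans (add_le_add
    (L2seq.norm_dmul_apply_le (Real.exp_pos _).le hp _)
    (norm_integral_le_of_norm_le hbi (Eventually.of_forall hGb)))

/-- This is a Carleman-type argument. Let m be the maximum of e^{-τs}‖U s‖. The basic estimate and
the smallness of ∫‖C‖ give m ≤ e^{-τT}‖U T‖ + m/2, hence ‖U s‖ ≤ 2 e^{-τ(T-s)}‖U T‖. The rate τ is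
arbitrary because the estimate makes no reference to the spectrum, and letting τ → ∞ gives zero for
s < T. -/
theorem eq_zero_of_small (h : IsMild μ C I U) {a T : ℝ} (hI : Icc a T ⊆ I)
    (hC : IntegrableOn C (Icc a T)) (h0 : U a = 0) (hsmall : ∫ σ in Icc a T, ‖C σ‖ ≤ 1 / 2)
    {s : ℝ} (hs : s ∈ Ico a T) : U s = 0 := by
  have hF := h.integrable hI hC
  have haT : a ≤ T := hs.1.trans hs.2.le
  have key : ∀ τ : ℝ, ‖U s‖ ≤ 2 * Real.exp (-(τ * (T - s))) * ‖U T‖ := fun τ => by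
    have hcont : ContinuousOn (fun s => Real.exp (-(τ * s)) * ‖U s‖) (Icc a T) :=
      ContinuousOn.mul (by fun_prop) (h.1.mono hI).norm
    obtain ⟨x, hx, hmax⟩ := isCompact_Icc.exists_isMaxOn ⟨a, le_rfl, haT⟩ hcont
    set m := Real.exp (-(τ * x)) * ‖U x‖
    have hm : ∀ y ∈ Icc a T, Real.exp (-(τ * y)) * ‖U y‖ ≤ m := fun y hy => hmax hy
    have h1 := h.norm_le_of_eq_zero hI hC h0 τ hx
    have h2 : ∫ σ in Icc a T, Real.exp (τ * (x - σ)) * ‖C σ (U σ)‖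
        ≤ Real.exp (τ * x) * (m * (1 / 2)) := by
      have h3 : ∫ σ in Icc a T, Real.exp (τ * (x - σ)) * ‖C σ (U σ)‖
          ≤ ∫ σ in Icc a T, Real.exp (τ * x) * m * ‖C σ‖ := by
        refine setIntegral_mono_on
          (IntegrableOn.continuousOn_mul (by fun_prop) hF.norm isCompact_Icc)
          (hC.norm.const_mul _) measurableSet_Icc fun y hy => ?_
        have h4 := (C y).le_opNorm (U y)
        calc _ ≤ Real.exp (τ * (x - y)) * (‖C y‖ * ‖U y‖) := by gcongr
          _ = Real.exp (τ * x) * (Real.exp (-(τ * y)) * ‖U y‖) * ‖C y‖ := by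
            rw [show τ * (x - y) = τ * x + -(τ * y) by ring, Real.exp_add]; ring
          _ ≤ _ := by
            gcongr
            exact hm y hy
      refine h3.trans ?_
      rw [integral_const_mul, mul_assoc]
      have : 0 ≤ m := by positivity
      gcongr
    have h5 : m ≤ 2 * Real.exp (-(τ * T)) * ‖U T‖ := by
      have h6 : m ≤ Real.exp (-(τ * x)) * (Real.exp (τ * (x - T)) * ‖U T‖
          + Real.exp (τ * x) * (m * (1 / 2))) :=
        mul_le_mul_of_nonneg_left (h1.trans (by gcongr)) (Real.exp_pos _).le
      have e1 : Real.exp (-(τ * x)) * Real.exp (τ * x) = 1 := by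
        rw [← Real.exp_add]; simp
      have e2 : Real.exp (-(τ * x)) * Real.exp (τ * (x - T)) = Real.exp (-(τ * T)) := by
        rw [← Real.exp_add]; congr 1; ring
      rw [mul_add, ← mul_assoc, ← mul_assoc, e1, e2] at h6
      linarith
    have h7 := (hm s ⟨hs.1, hs.2.le⟩).trans h5
    have e3 : Real.exp (τ * s) * Real.exp (-(τ * s)) = 1 := by
      rw [← Real.exp_add]; simp
    calc ‖U s‖ = Real.exp (τ * s) * (Real.exp (-(τ * s)) * ‖U s‖) := by
          rw [← mul_assoc, e3, one_mul]
      _ ≤ Real.exp (τ * s) * (2 * Real.exp (-(τ * T)) * ‖U T‖) := by gcongr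
      _ = _ := by
        rw [show -(τ * (T - s)) = τ * s + -(τ * T) by ring, Real.exp_add]; ring
  have hlim : Tendsto (fun τ : ℝ => 2 * Real.exp (-(τ * (T - s))) * ‖U T‖) atTop
      (𝓝 (2 * 0 * ‖U T‖)) := by
    refine Tendsto.mul_const _ (Tendsto.const_mul _ ?_)
    refine Real.tendsto_exp_neg_atTop_nhds_zero.comp ?_
    exact tendsto_id.atTop_mul_const (sub_pos.2 hs.2)
  have := ge_of_tendsto' hlim key
  exact norm_le_zero_iff.1 (by simpa using this)

/-- Uniqueness for the (ill-posed) forward Cauchy problem. -/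
theorem eq_zero_forward {a b : ℝ} (h : IsMild μ C (Icc a b) U) (hC : IntegrableOn C (Icc a b))
    (h0 : U a = 0) : EqOn U 0 (Icc a b) := by
  rcases lt_or_ge b a with hab | hab
  · rw [Icc_eq_empty (not_le.2 hab)]; exact eqOn_empty _ _
  suffices Icc a b ⊆ {x | x ∈ Icc a b ∧ U x = 0} from fun x hx => (this hx).2
  -- The times where U vanishes form a closed set. From such a time x one can move to the right,
  -- because ∫‖C‖ over [x, T] is less than 1/2 for T close to x.
  refine IsClosed.Icc_subset_of_forall_exists_gt ?_ ⟨⟨le_rfl, hab⟩, h0⟩ ?_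
  · have := h.1.preimage_isClosed_of_isClosed isClosed_Icc (isClosed_singleton (x := (0 : L2seq ι)))
    convert this using 1
    ext x; simp; tauto
  · rintro x ⟨⟨hx, hx0⟩, hxa, hxb⟩ y hy
    have hcont := intervalIntegral.continuousOn_primitive_Icc
      (f := fun σ => ‖C σ‖) (a := x) (b := b) (μ := volume)
      ((hC.mono_set (Icc_subset_Icc_left hxa)).norm)
    have h1 : ∀ᶠ T in 𝓝[Icc x b] x, ∫ σ in Icc x T, ‖C σ‖ < 1 / 2 := by
      have h2 := hcont x ⟨le_rfl, hxb.le⟩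
      refine h2.eventually_lt tendsto_const_nhds ?_
      simp
    have h3 : ∀ᶠ T in 𝓝[>] x, ∫ σ in Icc x T, ‖C σ‖ < 1 / 2 := by
      have h4 : 𝓝[>] x ≤ 𝓝[Icc x b] x := by
        rw [← nhdsWithin_Ioc_eq_nhdsGT hxb]
        exact nhdsWithin_mono _ Ioc_subset_Icc_self
      exact h4 h1
    obtain ⟨T, hT, hTx, hTb⟩ := (h3.and (Ioc_mem_nhdsGT (lt_min hxb hy))).exists
    have hTb' := hTb.trans (min_le_left _ _)
    have hTy := hTb.trans (min_le_right _ _)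
    -- The previous lemma gives vanishing strictly before T only, so the midpoint is taken.
    refine ⟨(x + T) / 2, ⟨⟨?_, ?_⟩, ?_⟩, ?_, ?_⟩
    · linarith
    · linarith
    · have hsub : Icc x T ⊆ Icc a b := Icc_subset_Icc hxa hTb'
      exact h.eq_zero_of_small hsub (hC.mono_set hsub) hx0 hT.le ⟨by linarith, by linarith⟩
    · linarith
    · linarith

theorem eq_zero_backward {a b : ℝ} (h : IsMild μ C (Icc a b) U) (hC : IntegrableOn C (Icc a b))
    (h0 : U b = 0) : EqOn U 0 (Icc a b) := by
  have h1 := h.reflect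
  have e : Neg.neg ⁻¹' Icc a b = Icc (-b) (-a) := by
    ext x; simp only [mem_preimage, mem_Icc]; constructor <;> rintro ⟨h, h'⟩ <;> constructor <;> linarith
  rw [e] at h1
  have h2 : IntegrableOn (fun s => -C (-s)) (Icc (-b) (-a)) := by
    refine Integrable.neg ?_
    have := (Measure.measurePreserving_neg (volume : Measure ℝ)).integrableOn_comp_preimage
      (Homeomorph.neg ℝ).measurableEmbedding (f := C) (s := Icc a b)
    rw [e] at this
    exact this.2 hC
  have h3 := h1.eq_zero_forward h2 (by simpa using h0)
  intro x hx
  have := h3 (x := -x) ⟨by linarith [hx.2], by linarith [hx.1]⟩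
  simpa using this

end Uniqueness

end IsMild

end Bilaplace

namespace Bilaplace

theorem integrableOn_pert {ι : Type} {s₁ : ℝ} (N : L2seq ι →L[ℂ] L2seq ι) (q : Pert ι s₁)
    (a : ℝ) : IntegrableOn (pert N q) (Icc a s₁) := by
  have h1 : Integrable (fun _ : ℝ => q.1 • N) (volume.restrict (Icc a s₁)) := 
    continuousOn_const.integrableOn_Icc
  have h2 : Integrable (q.2 : ℝ → L2seq ι →L[ℂ] L2seq ι) (volume.restrict (Icc a s₁)) :=
    IntegrableOn.mono_set (L1.integrable_coeFn q.2) Icc_subset_Iic_self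
  exact Integrable.add (ε' := L2seq ι →L[ℂ] L2seq ι) h1 h2

/-! ### Solutions with prescribed jumps -/

/-- The values at `s₁` of the solutions on `(-∞, s₁]` of growth rate `κ` at `-∞`. -/
def EU {ι : Type} (μ : ι → ℝ) (C : ℝ → L2seq ι →L[ℂ] L2seq ι) (s₁ κ : ℝ) : Set (L2seq ι) :=
  {x | ∃ Y, IsMild μ C (Iic s₁) Y ∧ (∃ c, ∀ s ≤ s₁, ‖Y s‖ ≤ c * Real.exp (κ * s)) ∧ Y s₁ = x}

/-- A solution `Wm` for times after `t` and a solution `Wp` of growth rate `κ` for times before `t`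
which add up to `v` at time `t`; the former ends in the orthogonal complement of `EU` for the
inner product `⟪g x, g y⟫`. -/
structure IsJump {ι : Type} (μ : ι → ℝ) (C : ℝ → L2seq ι →L[ℂ] L2seq ι) (s₁ κ : ℝ)
    (g : L2seq ι →L[ℂ] L2seq ι) (t : ℝ) (v : L2seq ι) (Wm Wp : ℝ → L2seq ι) : Prop where
  mild_m : IsMild μ C (Icc t s₁) Wm
  mild_p : IsMild μ C (Iic t) Wp
  growth : ∃ c, ∀ s ≤ t, ‖Wp s‖ ≤ c * Real.exp (κ * s)
  jump : Wm t + Wp t = v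
  orth : ∀ x ∈ EU μ C s₁ κ, inner ℂ (g x) (g (Wm s₁)) = 0

theorem IsMild.eq_zero_of_end {ι : Type} [Countable ι] {μ : ι → ℝ}
    {C : ℝ → L2seq ι →L[ℂ] L2seq ι} {s₁ : ℝ} {Y : ℝ → L2seq ι} (h : IsMild μ C (Iic s₁) Y)
    (hC : ∀ a, IntegrableOn C (Icc a s₁)) (h0 : Y s₁ = 0) : EqOn Y 0 (Iic s₁) := fun s hs =>
  (h.mono (fun _ hx => hx.2 : Icc s s₁ ⊆ Iic s₁)).eq_zero_backward (hC s) h0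
    ⟨le_rfl, hs⟩

theorem growth_of_le {ι : Type} {Y : ℝ → L2seq ι} {κ t s₁ : ℝ} (hY : ContinuousOn Y (Icc t s₁))
    (h : ∃ c, ∀ s ≤ t, ‖Y s‖ ≤ c * Real.exp (κ * s)) :
    ∃ c, ∀ s ≤ s₁, ‖Y s‖ ≤ c * Real.exp (κ * s) := by
  obtain ⟨c, hc⟩ := h
  have h1 : ContinuousOn (fun s => ‖Y s‖ * Real.exp (-(κ * s))) (Icc t s₁) :=
    hY.norm.mul (by fun_prop)
  obtain ⟨d, hd⟩ := isCompact_Icc.exists_bound_of_continuousOn h1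
  refine ⟨max c d, fun s hs => ?_⟩
  rcases le_total s t with h | h
  · exact (hc s h).trans (mul_le_mul_of_nonneg_right (le_max_left _ _) (Real.exp_pos _).le)
  · have h2 := hd s ⟨h, hs⟩
    rw [Real.norm_of_nonneg (by positivity)] at h2
    have e : Real.exp (-(κ * s)) * Real.exp (κ * s) = 1 := by rw [← Real.exp_add]; simp
    calc ‖Y s‖ = ‖Y s‖ * Real.exp (-(κ * s)) * Real.exp (κ * s) := by rw [mul_assoc, e, mul_one]
      _ ≤ max c d * Real.exp (κ * s) := by
        gcongr
        exact h2.trans (le_max_right _ _)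

/-- The differences of the two decompositions agree at t and glue to one solution Y on all of (-∞,
s₁] with growth rate κ. Its end value lies in `EU` and, being also a difference of two values `Wm
s₁`, is orthogonal to `EU`. Hence it is orthogonal to itself, so it vanishes as `g` is injective,
and backward uniqueness gives Y = 0. -/
theorem IsJump.unique {ι : Type} [Countable ι] {μ : ι → ℝ} {C : ℝ → L2seq ι →L[ℂ] L2seq ι}
    {s₁ κ : ℝ} {g : L2seq ι →L[ℂ] L2seq ι} (hg : ∀ x, g x = 0 → x = 0)
    (hC : ∀ a, IntegrableOn C (Icc a s₁)) {t : ℝ} (ht : t ≤ s₁) {v : L2seq ι}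
    {Wm Wp Wm' Wp' : ℝ → L2seq ι} (h : IsJump μ C s₁ κ g t v Wm Wp)
    (h' : IsJump μ C s₁ κ g t v Wm' Wp') : EqOn Wm Wm' (Icc t s₁) ∧ EqOn Wp Wp' (Iic t) := by
  have hCt : ∀ a b, b ≤ s₁ → IntegrableOn C (Icc a b) := fun a b hb =>
    (hC a).mono_set (Icc_subset_Icc_right hb)
  have hm := h.mild_m.sub h'.mild_m fun a _ b hb => hCt a b hb.2
  have hp := h'.mild_p.sub h.mild_p fun a _ b hb => hCt a b (le_trans hb ht)
  have hj : (Wp' - Wp) t = (Wm - Wm') t := by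
    have := h.jump.trans h'.jump.symm
    simp only [Pi.sub_apply]
    rw [sub_eq_sub_iff_add_eq_add, add_comm, ← this, add_comm]
  have hY := hp.glue ht hm hj hC
  set Y : ℝ → L2seq ι := fun s => if s ≤ t then (Wp' - Wp) s else (Wm - Wm') s
  have e₁ : ∀ s ≤ t, Y s = (Wp' - Wp) s := fun s hs => if_pos hs
  have e₂ : ∀ s, t ≤ s → Y s = (Wm - Wm') s := fun s hs => by
    rcases hs.eq_or_lt with h | h
    · rw [← h]; exact (if_pos le_rfl).trans hj
    · exact if_neg (not_le.2 h)
  have hgr : ∃ c, ∀ s ≤ s₁, ‖Y s‖ ≤ c * Real.exp (κ * s) := by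
    refine growth_of_le (hY.1.mono fun _ hx => hx.2) (t := t) ?_
    obtain ⟨c, hc⟩ := h.growth
    obtain ⟨c', hc'⟩ := h'.growth
    refine ⟨c' + c, fun s hs => ?_⟩
    rw [e₁ s hs, add_mul]
    exact (norm_sub_le _ _).trans (add_le_add (hc' s hs) (hc s hs))
  have hmem : Y s₁ ∈ EU μ C s₁ κ := ⟨Y, hY, hgr, rfl⟩
  have h0 : Y s₁ = 0 := by
    refine hg _ ?_
    rw [← inner_self_eq_zero (𝕜 := ℂ)]
    nth_rw 2 [e₂ s₁ ht]
    rw [Pi.sub_apply, map_sub, inner_sub_right, h.orth _ hmem, h'.orth _ hmem, sub_zero]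
  have hz := hY.eq_zero_of_end hC h0
  constructor
  · intro s hs
    have := hz (x := s) hs.2
    rw [e₂ s hs.1] at this
    exact sub_eq_zero.1 this
  · intro s hs
    have := hz (x := s) (le_trans hs ht)
    rw [e₁ s hs] at this
    exact (sub_eq_zero.1 this).symm

namespace Splitting

variable {ι : Type} [Countable ι] {D : Splitting ι}
  {G : Type} [NormedAddCommGroup G] [NormedSpace ℂ G]
  {G' : Type} [NormedAddCommGroup G'] [NormedSpace ℂ G']

/-- The sum of two families of curves. -/
def CurveFam.sum (Λ : CurveFam D G) (Λ' : CurveFam D G') : CurveFam D (G × G') where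
  val σ := (Λ.val σ).comp (ContinuousLinearMap.fst ℂ G G')
    + (Λ'.val σ).comp (ContinuousLinearMap.snd ℂ G G')
  c := Λ.c + Λ'.c
  c_nonneg := add_nonneg Λ.c_nonneg Λ'.c_nonneg
  meas g := (Λ.meas g.1).add (Λ'.meas g.2)
  bound σ hσ := by
    refine ContinuousLinearMap.opNorm_le_bound _ (add_nonneg Λ.c_nonneg Λ'.c_nonneg) fun g => ?_
    rw [add_mul]
    refine (norm_add_le _ _).trans (add_le_add ?_ ?_)
    · exact ((Λ.val σ).le_of_opNorm_le (Λ.bound σ hσ) g.1).trans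
        (mul_le_mul_of_nonneg_left (norm_fst_le g) Λ.c_nonneg)
    · exact ((Λ'.val σ).le_of_opNorm_le (Λ'.bound σ hσ) g.2).trans
        (mul_le_mul_of_nonneg_left (norm_snd_le g) Λ'.c_nonneg)

theorem KOp_sum (Λ : CurveFam D G) (Λ' : CurveFam D G') (q : Pert ι D.s₁) (g : G) (g' : G') :
    KOp (Λ.sum Λ') q (g, g') = KOp Λ q g + KOp Λ' q g' := by
  ext1 s
  rw [BoundedContinuousFunction.add_apply, KOp_eq, KOp_eq, KOp_eq,
    ← integral_add (integrable_kint Λ q g s) (integrable_kint Λ' q g' s)]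
  refine integral_congr_ae (Eventually.of_forall fun σ => ?_)
  simp [kint, CurveFam.sum]

/-- Without the weights, both kernels are the same exponential times a step function. The switch
`un` depends on σ alone and cancels in the difference, so only the jump at σ = s survives, as an
indicator of (a, b]. This is the variation of constants formula on the level of kernels. -/
theorem exp_gk_sub {a b σ : ℝ} (hab : a ≤ b) (i : ι) :
    Real.exp (D.lw b) * D.gk b σ i - Real.exp (D.μ i * (b - a)) * (Real.exp (D.lw a) * D.gk a σ i)
      = (Ioc a b).indicator (fun σ => Real.exp (D.μ i * (b - σ)) * Real.exp (D.lw σ)) σ := by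
  have e₁ : Real.exp (D.lw b) * Real.exp (D.μ i * (b - σ) + D.lw σ - D.lw b)
      = Real.exp (D.μ i * (b - σ)) * Real.exp (D.lw σ) := by
    rw [← Real.exp_add, ← Real.exp_add]; congr 1; ring
  have e₂ : Real.exp (D.μ i * (b - a)) *
      (Real.exp (D.lw a) * Real.exp (D.μ i * (a - σ) + D.lw σ - D.lw a))
      = Real.exp (D.μ i * (b - σ)) * Real.exp (D.lw σ) := by
    rw [← Real.exp_add, ← Real.exp_add, ← Real.exp_add]; congr 1; ring
  unfold gk
  rw [← mul_assoc, e₁, ← mul_assoc (Real.exp (D.lw a)), ← mul_assoc, e₂, ← mul_sub]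
  by_cases h1 : σ ≤ a
  · have h2 : σ ∉ Ioc a b := fun h => not_lt.2 h1 h.1
    rw [indicator_of_notMem h2, if_pos h1, if_pos (h1.trans hab)]; ring
  · by_cases h2 : σ ≤ b
    · have h3 : σ ∈ Ioc a b := ⟨not_le.1 h1, h2⟩
      rw [indicator_of_mem h3, if_neg h1, if_pos h2]; ring
    · have h3 : σ ∉ Ioc a b := fun h => h2 h.2
      rw [indicator_of_notMem h3, if_neg h1, if_neg h2]; ring

theorem KOp_variation (Λ : CurveFam D G) (q : Pert ι D.s₁) (g : G) {a b : ℝ} (hab : a ≤ b)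
    (hb : b ≤ D.s₁) (i : ι) :
    (Real.exp (D.lw b) : ℂ) * KOp Λ q g b i
      = (Real.exp (D.μ i * (b - a)) : ℂ) * ((Real.exp (D.lw a) : ℂ) * KOp Λ q g a i)
        + ∫ σ in a..b, (Real.exp (D.μ i * (b - σ)) : ℂ) *
            pert D.N q σ ((Real.exp (D.lw σ) : ℂ) • Λ.val σ g) i := by
  rw [← sub_eq_iff_eq_add', KOp_eq, KOp_eq,
    L2seq.apply_integral (integrable_kint Λ q g b), L2seq.apply_integral (integrable_kint Λ q g a),
    ← integral_const_mul, ← integral_const_mul, ← integral_const_mul,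
    ← integral_sub ((L2seq.integrable_apply (integrable_kint Λ q g b) i).const_mul _)
      (((L2seq.integrable_apply (integrable_kint Λ q g a) i).const_mul _).const_mul _),
    intervalIntegral.integral_of_le hab]
  have e : ∀ᵐ σ ∂D.vol, (Real.exp (D.lw b) : ℂ) * kint Λ q g b σ i
      - (Real.exp (D.μ i * (b - a)) : ℂ) * ((Real.exp (D.lw a) : ℂ) * kint Λ q g a σ i)
      = (Ioc a b).indicator (fun σ => (Real.exp (D.μ i * (b - σ)) : ℂ) *
            pert D.N q σ ((Real.exp (D.lw σ) : ℂ) • Λ.val σ g) i) σ := by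
    filter_upwards [D.ae_le] with σ hσ
    rw [kint, kint, D.Gam_apply hσ, D.Gam_apply hσ]
    have h1 := congrArg (fun x : ℝ => (x : ℂ)) (exp_gk_sub (D := D) (σ := σ) hab i)
    simp only [Complex.ofReal_sub, Complex.ofReal_mul] at h1
    have h2 : ((Ioc a b).indicator (fun σ => (Real.exp (D.μ i * (b - σ)) : ℂ) *
            pert D.N q σ ((Real.exp (D.lw σ) : ℂ) • Λ.val σ g) i) σ)
        = (((Ioc a b).indicator (fun σ => Real.exp (D.μ i * (b - σ)) * Real.exp (D.lw σ)) σ : ℝ) : ℂ)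
          * pert D.N q σ (Λ.val σ g) i := by
      by_cases h : σ ∈ Ioc a b
      · simp only [indicator_of_mem h, map_smul, L2seq.smul_apply, Complex.ofReal_mul]; ring
      · simp [indicator_of_notMem h]
    rw [h2, ← h1]
    ring
  rw [integral_congr_ae e, setIntegral_indicator measurableSet_Ioc,
    show Iic D.s₁ ∩ Ioc a b = Ioc a b from inter_eq_right.2 fun x hx => hx.2.trans hb]

/-- A solution of the unperturbed equation plus a Green operator is a mild solution, if the
argument of the Green operator is this sum. -/
theorem isMild_of_free (Λ : CurveFam D G) (q : Pert ι D.s₁) (g : G) {I : Set ℝ} [I.OrdConnected]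
    (hI : I ⊆ Iic D.s₁) {f : ℝ → L2seq ι} (hf : ContinuousOn f I)
    (hfree : ∀ a ∈ I, ∀ b ∈ I, a ≤ b → ∀ i, (Real.exp (D.lw b) : ℂ) * f b i
      = (Real.exp (D.μ i * (b - a)) : ℂ) * ((Real.exp (D.lw a) : ℂ) * f a i))
    (hval : ∀ᵐ σ : ℝ, σ ∈ I → Λ.val σ g = f σ + KOp Λ q g σ) :
    IsMild D.μ (pert D.N q) I fun s => (Real.exp (D.lw s) : ℂ) • (f s + KOp Λ q g s) := by
  have hlw := D.continuous_lw
  have hexp : Continuous fun s => (Real.exp (D.lw s) : ℂ) := by fun_prop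
  refine ⟨hexp.continuousOn.smul (hf.add (KOp Λ q g).continuous.continuousOn),
    fun a ha b hb hab i => ?_⟩
  have h1 := KOp_variation Λ q g hab (hI hb) i
  have h2 : ∫ σ in a..b, (Real.exp (D.μ i * (b - σ)) : ℂ) *
      pert D.N q σ ((Real.exp (D.lw σ) : ℂ) • (f σ + KOp Λ q g σ)) i
      = ∫ σ in a..b, (Real.exp (D.μ i * (b - σ)) : ℂ) *
            pert D.N q σ ((Real.exp (D.lw σ) : ℂ) • Λ.val σ g) i := by
    refine intervalIntegral.integral_congr_ae ?_
    filter_upwards [hval] with σ hσ hσI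
    rw [uIoc_of_le hab] at hσI
    rw [hσ ((‹I.OrdConnected›.out ha hb) ⟨hσI.1.le, hσI.2⟩)]
  rw [h2]
  simp only [L2seq.smul_apply, L2seq.add_apply, mul_add]
  rw [h1, hfree a ha b hb hab i]
  ring

end Splitting

end Bilaplace

/-! ### Fixed points of the Green operator and the end values of solutions controlled at -∞ -/

namespace Bilaplace

/-- A bounded continuous family of diagonal operators. -/
def dmulBCF {ι : Type} (φ : ℝ → ι → ℝ) (c : ℝ) (hc : 0 ≤ c) (hφ : ∀ s i, |φ s i| ≤ c)
    (hcont : ∀ i, Continuous fun s => φ s i) :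
    L2seq ι →L[ℂ] BoundedContinuousFunction ℝ (L2seq ι) :=
  LinearMap.mkContinuous
    { toFun := fun v => BoundedContinuousFunction.ofNormedAddCommGroup
        (fun s => L2seq.dmul (φ s) v)
        (continuous_iff_continuousAt.2 fun s => L2seq.tendsto_dmul
          (Eventually.of_forall fun x => hφ x) (hφ s) (fun i => (hcont i).continuousAt) v)
        (c * ‖v‖) (fun s => L2seq.norm_dmul_apply_le hc (hφ s) v)
      map_add' := fun v w => by ext1 s; exact map_add (L2seq.dmul (φ s)) v w
      map_smul' := fun z v => by ext1 s; exact map_smul (L2seq.dmul (φ s)) z v }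
    c (fun v => (BoundedContinuousFunction.norm_le (by positivity)).2 fun s =>
      L2seq.norm_dmul_apply_le hc (hφ s) v)

theorem dmulBCF_apply {ι : Type} (φ : ℝ → ι → ℝ) (c : ℝ) (hc : 0 ≤ c) (hφ : ∀ s i, |φ s i| ≤ c)
    (hcont : ∀ i, Continuous fun s => φ s i) (v : L2seq ι) (s : ℝ) :
    dmulBCF φ c hc hφ hcont v s = L2seq.dmul (φ s) v := rfl

theorem norm_dmulBCF_le {ι : Type} (φ : ℝ → ι → ℝ) (c : ℝ) (hc : 0 ≤ c) (hφ : ∀ s i, |φ s i| ≤ c)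
    (hcont : ∀ i, Continuous fun s => φ s i) : ‖dmulBCF φ c hc hφ hcont‖ ≤ c :=
  LinearMap.mkContinuous_norm_le _ hc _

namespace Splitting

variable {ι : Type} [Countable ι] {D : Splitting ι}

/-- The Green operator on bounded continuous curves. -/
abbrev K (q : Pert ι D.s₁) :
    BoundedContinuousFunction ℝ (L2seq ι) →L[ℂ] BoundedContinuousFunction ℝ (L2seq ι) :=
  KOp (bcfFam (D := D)) q

/-- The resolvent `(1 - K)⁻¹`. -/
def Res (q : Pert ι D.s₁) :
    BoundedContinuousFunction ℝ (L2seq ι) →L[ℂ] BoundedContinuousFunction ℝ (L2seq ι) :=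
  Ring.inverse (1 - K q)

/-- A perturbation which is small enough for the splitting. -/
def Small (D : Splitting ι) (q : Pert ι D.s₁) : Prop := ‖KOp (bcfFam (D := D)) q‖ < 1

theorem SmallBounds.small {q : Pert ι D.s₁} (hq : D.SmallBounds q) : D.Small q :=
  hq.norm_KOp_le.trans_lt (by norm_num)

theorem isOpen_small (D : Splitting ι) : IsOpen {q | D.Small q} :=
  isOpen_lt (KOp (bcfFam (D := D))).continuous.norm continuous_const

theorem Small.isUnit {q : Pert ι D.s₁} (hq : D.Small q) : IsUnit (1 - K q) :=
  (Units.oneSub (K q) hq).isUnit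

theorem Small.res_eq {q : Pert ι D.s₁} (hq : D.Small q)
    (f : BoundedContinuousFunction ℝ (L2seq ι)) : Res q f = f + K q (Res q f) := by
  have h := congrArg (fun A => A f) (Ring.mul_inverse_cancel _ hq.isUnit)
  change (1 - K q) (Res q f) = f at h
  rw [sub_apply] at h
  exact sub_eq_iff_eq_add.1 h

theorem Small.eq_res {q : Pert ι D.s₁} (hq : D.Small q)
    {f y : BoundedContinuousFunction ℝ (L2seq ι)} (h : y = f + K q y) : y = Res q f := by
  have h1 := congrArg (fun A => A y) (Ring.inverse_mul_cancel _ hq.isUnit)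
  change Res q ((1 - K q) y) = y at h1
  have h2 : (1 - K q) y = f := by
    rw [sub_apply]
    exact sub_eq_iff_eq_add.2 h
  rw [← h1, h2]

theorem Small.norm_res_le {q : Pert ι D.s₁} (hq : D.Small q)
    (f : BoundedContinuousFunction ℝ (L2seq ι)) : ‖Res q f‖ ≤ (1 - ‖K q‖)⁻¹ * ‖f‖ := by
  have h1 : ‖Res q f‖ ≤ ‖f‖ + ‖K q (Res q f)‖ := by
    conv_lhs => rw [hq.res_eq f]
    exact norm_add_le _ _
  have h2 := (K q).le_opNorm (Res q f)
  rw [le_inv_mul_iff₀ (sub_pos.2 hq)]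
  linarith

/-! #### Solutions of controlled growth at `-∞` -/

open Classical in
/-- The entries of the unperturbed solutions with prescribed value at `s₁`. -/
def freeEntry (D : Splitting ι) (s : ℝ) (i : ι) : ℝ :=
  if i ∈ D.F then 0 else Real.exp (D.μ i * (min s D.s₁ - D.s₁) - D.lw s)

theorem κ_le_of_notMem {i : ι} (hi : i ∉ D.F) : D.κ ≤ D.μ i := by
  by_cases hM : i ∈ D.M
  · exact D.mid_lower i hM hi
  · linarith [D.bwd i hi hM, D.κ_le]

/-- Before S the weight has rate κ ≤ μ. After S the weight is at least 1 because ν ≥ 0, and the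
backward flow from s₁ does not grow because μ ≥ 0. -/
theorem abs_freeEntry_le (s : ℝ) (i : ι) : |D.freeEntry s i| ≤ 1 := by
  unfold freeEntry
  split_ifs with hi
  · simp
  · rw [abs_of_pos (Real.exp_pos _), Real.exp_le_one_iff]
    have h1 := D.nonneg i hi
    have h2 := κ_le_of_notMem hi
    have h3 := D.S_le
    rcases le_total s D.S with h | h
    · rw [D.lw_of_le h, min_eq_left (h.trans h3)]
      nlinarith
    · rw [D.lw_of_ge h]
      have h4 := D.ν_nonneg
      have h5 : min s D.s₁ - D.s₁ ≤ 0 := by linarith [min_le_right s D.s₁]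
      nlinarith

theorem continuous_freeEntry (i : ι) : Continuous fun s => D.freeEntry s i := by
  have := D.continuous_lw
  unfold freeEntry
  split_ifs <;> fun_prop

/-- The unperturbed solutions with prescribed value at `s₁`. -/
def freeOp (D : Splitting ι) : L2seq ι →L[ℂ] BoundedContinuousFunction ℝ (L2seq ι) :=
  dmulBCF D.freeEntry 1 zero_le_one abs_freeEntry_le continuous_freeEntry

theorem freeOp_apply (a : L2seq ι) (s : ℝ) (i : ι) :
    D.freeOp a s i = D.freeEntry s i * a i := by
  rw [freeOp, dmulBCF_apply, L2seq.dmul_apply (abs_freeEntry_le s)]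

theorem free_freeOp (a : L2seq ι) {s r : ℝ} (hr : r ≤ D.s₁) (hs : s ≤ r) (i : ι) :
    (Real.exp (D.lw r) : ℂ) * D.freeOp a r i
      = (Real.exp (D.μ i * (r - s)) : ℂ) * ((Real.exp (D.lw s) : ℂ) * D.freeOp a s i) := by
  simp only [freeOp_apply, freeEntry]
  split_ifs
  · simp
  · simp only [← mul_assoc, ← Complex.ofReal_mul, ← Real.exp_add]
    rw [min_eq_left hr, min_eq_left (hs.trans hr)]
    congr 3; ring

/-- The weighted solutions of controlled growth at `-∞`, in terms of data for the modes which are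
not solved forward. -/
def Yop (q : Pert ι D.s₁) : L2seq ι →L[ℂ] BoundedContinuousFunction ℝ (L2seq ι) :=
  (Res q).comp D.freeOp

/-- The values at `s₁` of the solutions of controlled growth. -/
def endOp (q : Pert ι D.s₁) : L2seq ι →L[ℂ] L2seq ι :=
  (Real.exp (D.lw D.s₁) : ℂ) • (BoundedContinuousFunction.evalCLM ℂ D.s₁).comp (Yop q)

theorem endOp_apply (q : Pert ι D.s₁) (a : L2seq ι) :
    endOp q a = (Real.exp (D.lw D.s₁) : ℂ) • Yop q a D.s₁ := rfl

theorem Small.Yop_eq {q : Pert ι D.s₁} (hq : D.Small q) (a : L2seq ι) :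
    Yop q a = D.freeOp a + K q (Yop q a) := hq.res_eq _

theorem Small.isMild_Yop {q : Pert ι D.s₁} (hq : D.Small q) (a : L2seq ι) :
    IsMild D.μ (pert D.N q) (Iic D.s₁) fun s => (Real.exp (D.lw s) : ℂ) • Yop q a s := by
  have h := isMild_of_free (bcfFam (D := D)) q (Yop q a) (I := Iic D.s₁) Subset.rfl
    (f := D.freeOp a) (D.freeOp a).continuous.continuousOn
    (fun s _ r hr hs i => free_freeOp a hr hs i)
    (Eventually.of_forall fun σ _ => congrArg (fun y => y σ) (hq.Yop_eq a))
  refine h.congr fun s _ => ?_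
  have h1 := congrArg (fun y => y s) (hq.Yop_eq a)
  beta_reduce at h1
  rw [h1]; rfl

theorem lw_le {s : ℝ} (hs : s ≤ D.s₁) : D.lw s ≤ D.κ * (s - D.S) + (D.ν - D.κ) * (D.s₁ - D.S) := by
  rw [lw_eq]
  have h1 : max (s - D.S) 0 ≤ D.s₁ - D.S := max_le (by linarith) (by linarith [D.S_le])
  have := mul_le_mul_of_nonneg_left h1 (sub_nonneg.2 D.κ_le_ν)
  linarith

theorem lw_ge (s : ℝ) : D.κ * (s - D.S) ≤ D.lw s := by
  rw [lw_eq]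
  have := mul_nonneg (sub_nonneg.2 D.κ_le_ν) (le_max_right (s - D.S) 0)
  linarith

theorem growth_weighted (y : BoundedContinuousFunction ℝ (L2seq ι)) :
    ∃ c, ∀ s ≤ D.s₁, ‖(Real.exp (D.lw s) : ℂ) • y s‖ ≤ c * Real.exp (D.κ * s) := by
  refine ⟨Real.exp (-(D.κ * D.S) + (D.ν - D.κ) * (D.s₁ - D.S)) * ‖y‖, fun s hs => ?_⟩
  rw [norm_smul, Complex.norm_real, Real.norm_of_nonneg (Real.exp_pos _).le]
  have h1 := lw_le hs
  have h2 := y.norm_coe_le_norm s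
  calc _ ≤ Real.exp (D.κ * (s - D.S) + (D.ν - D.κ) * (D.s₁ - D.S)) * ‖y‖ := by gcongr
    _ = _ := by
      rw [show D.κ * (s - D.S) + (D.ν - D.κ) * (D.s₁ - D.S)
        = -(D.κ * D.S) + (D.ν - D.κ) * (D.s₁ - D.S) + D.κ * s by ring, Real.exp_add]
      ring

theorem K_congr (q : Pert ι D.s₁) {y z : BoundedContinuousFunction ℝ (L2seq ι)}
    (h : ∀ s ≤ D.s₁, y s = z s) : K q y = K q z := by
  ext1 s
  rw [KOp_apply, KOp_apply]
  refine integral_congr_ae ?_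
  filter_upwards [D.ae_le] with σ hσ
  have : (bcfFam (D := D)).val σ y = (bcfFam (D := D)).val σ z := h σ hσ
  rw [this]

/-- Subtracting the Green operator from a solution of controlled growth leaves a solution of the
unperturbed equation with the same growth. Its modes in `F` must vanish, as they would grow too fast
at -∞. It is therefore a free solution determined by its value at s₁, and the weighted solution is
the corresponding fixed point. -/
theorem EU_subset_range {q : Pert ι D.s₁} (hq : D.Small q) (hF : ∀ i ∈ D.F, D.μ i < D.κ) :
    EU D.μ (pert D.N q) D.s₁ D.κ ⊆ range (endOp q) := by
  rintro x ⟨Y, hY, ⟨c, hc⟩, rfl⟩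
  have hlw := D.continuous_lw
  have hYc : Continuous fun s => Y (min s D.s₁) :=
    hY.1.comp_continuous (by fun_prop) fun s => mem_Iic.2 (min_le_right s D.s₁)
  have hc0 : 0 ≤ c := by
    have h1 := (norm_nonneg _).trans (hc D.s₁ le_rfl)
    exact nonneg_of_mul_nonneg_left h1 (Real.exp_pos _)
  let y : BoundedContinuousFunction ℝ (L2seq ι) :=
    BoundedContinuousFunction.ofNormedAddCommGroup
      (fun s => (Real.exp (-D.lw (min s D.s₁)) : ℂ) • Y (min s D.s₁))
      (by
        have : Continuous fun s => (Real.exp (-D.lw (min s D.s₁)) : ℂ) := by fun_prop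
        exact this.smul hYc) (c * Real.exp (D.κ * D.S)) (fun s => by
        rw [norm_smul, Complex.norm_real, Real.norm_of_nonneg (Real.exp_pos _).le]
        have h1 := hc (min s D.s₁) (min_le_right _ _)
        have h2 := D.lw_ge (min s D.s₁)
        calc _ ≤ Real.exp (-(D.κ * (min s D.s₁ - D.S))) * (c * Real.exp (D.κ * min s D.s₁)) := by
              gcongr
          _ = _ := by
            rw [mul_left_comm, ← Real.exp_add]; congr 2; ring)
  have hy : ∀ s ≤ D.s₁, Y s = (Real.exp (D.lw s) : ℂ) • y s := fun s hs => by
    change _ = _ • ((Real.exp (-D.lw (min s D.s₁)) : ℂ) • Y (min s D.s₁))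
    rw [min_eq_left hs, smul_smul, ← Complex.ofReal_mul, ← Real.exp_add]
    simp
  -- The unweighted difference between the solution and its Green operator solves the unperturbed
  -- equation, by comparing the two variation of constants formulas.
  let E : ℝ → L2seq ι := fun s => (Real.exp (D.lw s) : ℂ) • (y s - K q y s)
  have hE : ∀ a b, a ≤ b → b ≤ D.s₁ → ∀ i,
      E b i = (Real.exp (D.μ i * (b - a)) : ℂ) * E a i := fun a b hab hb i => by
    have h1 := hY.2 a (hab.trans hb) b hb hab i
    have h2 := KOp_variation (bcfFam (D := D)) q y hab hb i
    have h3 : ∫ σ in a..b, (Real.exp (D.μ i * (b - σ)) : ℂ) *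
          pert D.N q σ ((Real.exp (D.lw σ) : ℂ) • (bcfFam (D := D)).val σ y) i
        = ∫ σ in a..b, (Real.exp (D.μ i * (b - σ)) : ℂ) * pert D.N q σ (Y σ) i := by
      refine intervalIntegral.integral_congr fun σ hσ => ?_
      rw [uIcc_of_le hab] at hσ
      beta_reduce
      rw [hy σ (hσ.2.trans hb)]
      rfl
    rw [h3] at h2
    rw [hy b hb, hy a (hab.trans hb)] at h1
    simp only [E, L2seq.smul_apply, L2seq.sub_apply, mul_sub] at h1 h2 ⊢
    rw [h1, h2]
    ring
  have hEF : ∀ b ≤ D.s₁, ∀ i ∈ D.F, E b i = 0 := fun b hb i hi => by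
    obtain ⟨d, hd⟩ := growth_weighted (D := D) (y - K q y)
    have h1 : ∀ a ≤ b, ‖E b i‖ ≤ Real.exp (D.μ i * b) * d * Real.exp ((D.κ - D.μ i) * a) :=
      fun a hab => by
        rw [hE a b hab hb i, norm_mul, Complex.norm_real, Real.norm_of_nonneg (Real.exp_pos _).le]
        calc _ ≤ Real.exp (D.μ i * (b - a)) * (d * Real.exp (D.κ * a)) := by
              gcongr
              exact (L2seq.norm_apply_le _ i).trans (hd a (hab.trans hb))
          _ = _ := by
            rw [show D.μ i * (b - a) = D.μ i * b + -(D.μ i * a) by ring,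
              show (D.κ - D.μ i) * a = D.κ * a + -(D.μ i * a) by ring, Real.exp_add, Real.exp_add]
            ring
    -- Here the strict inequality μ < κ on `F` is essential: the bound for the value at b tends to 0
    -- as the starting time a goes to -∞.
    have h2 : Tendsto (fun a : ℝ => Real.exp (D.μ i * b) * d * Real.exp ((D.κ - D.μ i) * a)) atBot
        (𝓝 (Real.exp (D.μ i * b) * d * 0)) := by
      refine Tendsto.const_mul _ (Real.tendsto_exp_atBot.comp ?_)
      exact tendsto_id.const_mul_atBot (sub_pos.2 (hF i hi))
    have h3 : ‖E b i‖ ≤ Real.exp (D.μ i * b) * d * 0 := by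
      refine ge_of_tendsto h2 ?_
      filter_upwards [Iic_mem_atBot b] with a ha using h1 a ha
    exact norm_le_zero_iff.1 (by simpa using h3)
  let a : L2seq ι := E D.s₁
  have hfree : ∀ s ≤ D.s₁, y s = (D.freeOp a + K q y) s := fun s hs => by
    rw [BoundedContinuousFunction.add_apply, ← sub_eq_iff_eq_add]
    refine L2seq.ext_apply fun i => ?_
    rw [freeOp_apply, freeEntry, min_eq_left hs]
    have h0 : (y s - K q y s) i = (Real.exp (-D.lw s) : ℂ) * E s i := by
      simp only [E, L2seq.smul_apply]
      rw [← mul_assoc, ← Complex.ofReal_mul, ← Real.exp_add]; simp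
    rw [h0]
    split_ifs with hi
    · rw [hEF s hs i hi]; simp
    · have h1 : a i = (Real.exp (D.μ i * (D.s₁ - s)) : ℂ) * E s i := hE s D.s₁ hs le_rfl i
      rw [h1, ← mul_assoc, ← Complex.ofReal_mul, ← Real.exp_add]
      congr 3; ring
  -- The fixed point equation for y holds only up to time s₁. Replacing y by the right-hand side
  -- makes it hold on all of ℝ, and the Green operator does not see the change.
  let z := D.freeOp a + K q y
  have hz : z = D.freeOp a + K q z := by
    have := K_congr q (y := y) (z := z) hfree
    rw [← this]
  have hz' : z = Yop q a := hq.eq_res hz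
  refine ⟨a, ?_⟩
  rw [endOp_apply, ← hz', hy D.s₁ le_rfl, hfree D.s₁ le_rfl]

/-- The modes in `B` are integrated from s₁ backward, so the Green operator has no component there
at time s₁. -/
theorem endOp_apply_bwd {q : Pert ι D.s₁} (hq : D.Small q) (a : L2seq ι) {i : ι}
    (hi : i ∈ D.B) : endOp q a i = a i := by
  have h1 : K q (Yop q a) D.s₁ i = 0 := by
    rw [KOp_eq, L2seq.apply_integral (integrable_kint _ _ _ _)]
    refine integral_eq_zero_of_ae ?_
    filter_upwards [D.ae_le] with σ hσ
    rw [kint, D.Gam_apply hσ]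
    simp [gk, un, hi.1, hi.2, hσ]
  rw [endOp_apply, hq.Yop_eq a, BoundedContinuousFunction.add_apply, L2seq.smul_apply,
    L2seq.add_apply, h1, freeOp_apply, freeEntry, if_neg hi.1, add_zero, ← mul_assoc,
    ← Complex.ofReal_mul, ← Real.exp_add]
  simp

theorem endOp_fwd (q : Pert ι D.s₁) {a : L2seq ι} (ha : ∀ i ∉ D.F, a i = 0) : endOp q a = 0 := by
  have : D.freeOp a = 0 := by
    ext1 s
    refine L2seq.ext_apply fun i => ?_
    rw [freeOp_apply, freeEntry]
    split_ifs with hi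
    · simp
    · rw [ha i hi]; simp
  rw [endOp_apply, Yop, ContinuousLinearMap.comp_apply, this, map_zero]
  simp

/-- Together with `endOp_fwd` this identifies the kernel with the modes of `F`, whatever the
perturbation. A vanishing end value forces the solution to vanish by backward uniqueness, and then
its free part vanishes too. -/
theorem endOp_injective {q : Pert ι D.s₁} (hq : D.Small q) {a : L2seq ι}
    (h : endOp q a = 0) : ∀ i ∉ D.F, a i = 0 := by
  have h1 := (hq.isMild_Yop a).eq_zero_of_end (integrableOn_pert D.N q) h
  have h2 : ∀ s ≤ D.s₁, Yop q a s = (0 : BoundedContinuousFunction ℝ (L2seq ι)) s := fun s hs => by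
    have := h1 (x := s) hs
    simpa [Real.exp_ne_zero] using this
  have h3 := K_congr q h2
  rw [map_zero] at h3
  intro i hi
  have h4 := h2 D.s₁ le_rfl
  rw [hq.Yop_eq a, h3, add_zero] at h4
  have h5 : D.freeOp a D.s₁ i = 0 := by rw [h4]; rfl
  rw [freeOp_apply, freeEntry, if_neg hi] at h5
  simpa [Real.exp_ne_zero] using h5

end Splitting

end Bilaplace

namespace Bilaplace

/-! ### Orthogonal projections onto ranges -/

section Range

variable {H : Type} [NormedAddCommGroup H] [InnerProductSpace ℂ H] [CompleteSpace H]

/-- The operator `T* T + P* P`. -/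
def gram (T P : H →L[ℂ] H) : H →L[ℂ] H :=
  (ContinuousLinearMap.adjoint T).comp T + (ContinuousLinearMap.adjoint P).comp P

/-- The coefficient operator of the orthogonal projection onto the range of `T`. -/
def coef (T P : H →L[ℂ] H) : H →L[ℂ] H :=
  (Ring.inverse (gram T P)).comp (ContinuousLinearMap.adjoint T)

theorem inner_gram (T P : H →L[ℂ] H) (x y : H) :
    inner ℂ (gram T P x) y = inner ℂ (T x) (T y) + inner ℂ (P x) (P y) := by
  simp [gram, ContinuousLinearMap.adjoint_inner_left]

/-- Splitting x into x - P x and P x, the first part is controlled by ‖T x‖ and the second by ‖P x‖,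
so the form ‖T x‖² + ‖P x‖² is coercive. Adding P*P makes T*T invertible although T has the kernel
Ran P, and this fixed correction keeps the projection onto Ran T smooth in T. -/
theorem isUnit_gram {T P : H →L[ℂ] H} (hTP : ∀ x, T (P x) = 0) (hPP : ∀ x, P (P x) = P x)
    {c : ℝ} (hc : 0 < c) (h : ∀ x, P x = 0 → c * ‖x‖ ≤ ‖T x‖) : IsUnit (gram T P) := by
  have hk : 0 < (2 / c ^ 2 + 2)⁻¹ := by positivity
  refine ContinuousLinearMap.isUnit_of_forall_le_norm_inner_map _
    (c := ⟨(2 / c ^ 2 + 2)⁻¹, hk.le⟩) hk fun x => ?_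
  have e : inner ℂ (gram T P x) x = ((‖T x‖ ^ 2 + ‖P x‖ ^ 2 : ℝ) : ℂ) := by
    rw [inner_gram, inner_self_eq_norm_sq_to_K, inner_self_eq_norm_sq_to_K]
    push_cast; rfl
  rw [e, Complex.norm_real, Real.norm_of_nonneg (by positivity)]
  have h1 := h (x - P x) (by rw [map_sub, hPP, sub_self])
  rw [map_sub, hTP, sub_zero] at h1
  have h2 : ‖x‖ ≤ ‖x - P x‖ + ‖P x‖ := by
    simpa using norm_add_le (x - P x) (P x)
  have h3 : ‖x‖ ^ 2 ≤ 2 * ‖x - P x‖ ^ 2 + 2 * ‖P x‖ ^ 2 := by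
    nlinarith [norm_nonneg x, sq_nonneg (‖x - P x‖ - ‖P x‖)]
  have h4 : ‖x - P x‖ ^ 2 ≤ ‖T x‖ ^ 2 / c ^ 2 := by
    rw [le_div_iff₀ (by positivity), ← mul_pow, mul_comm]
    exact pow_le_pow_left₀ (by positivity) h1 2
  change ‖x‖ ^ 2 * (2 / c ^ 2 + 2)⁻¹ ≤ _
  rw [← div_eq_mul_inv, div_le_iff₀ (by positivity)]
  have h5 : 0 ≤ ‖P x‖ ^ 2 / c ^ 2 := by positivity
  have h6 : (‖T x‖ ^ 2 + ‖P x‖ ^ 2) * (2 / c ^ 2 + 2)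
      = 2 * (‖T x‖ ^ 2 / c ^ 2) + 2 * (‖P x‖ ^ 2 / c ^ 2) + 2 * ‖T x‖ ^ 2 + 2 * ‖P x‖ ^ 2 := by ring
  rw [h6]
  nlinarith [sq_nonneg ‖T x‖]

/-- With z the coefficient vector, the equation gram z = T*y tested against P z gives P z = 0, since
T annihilates P z. What remains is the normal equation T*T z = T*y. -/
theorem inner_sub_coef {T P : H →L[ℂ] H} (hTP : ∀ x, T (P x) = 0) (hPP : ∀ x, P (P x) = P x)
    (hG : IsUnit (gram T P)) (x y : H) : inner ℂ (T x) (y - T (coef T P y)) = 0 := by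
  set z := coef T P y
  have hz : gram T P z = ContinuousLinearMap.adjoint T y := by
    have := congrArg (fun A => A (ContinuousLinearMap.adjoint T y))
      (Ring.mul_inverse_cancel _ hG)
    exact this
  have hP : P z = 0 := by
    have h1 := inner_gram T P z (P z)
    rw [hTP, inner_zero_right, zero_add, hPP, hz, ContinuousLinearMap.adjoint_inner_left, hTP,
      inner_zero_right] at h1
    exact inner_self_eq_zero.1 h1.symm
  have h2 := inner_gram T P z x
  rw [hP, inner_zero_left, add_zero, hz, ContinuousLinearMap.adjoint_inner_left] at h2
  rw [inner_sub_right, ← inner_conj_symm (T x) y, h2, inner_conj_symm, sub_self]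

end Range

/-! ### Smoothness of operator-valued expressions -/

section Smooth

variable {X E F G : Type} [NormedAddCommGroup X] [NormedSpace ℝ X]
  [NormedAddCommGroup E] [NormedSpace ℂ E] [NormedAddCommGroup F] [NormedSpace ℂ F]
  [NormedAddCommGroup G] [NormedSpace ℂ G]

theorem contDiffAt_comp {f : X → F →L[ℂ] G} {g : X → E →L[ℂ] F} {x : X}
    (hf : ContDiffAt ℝ ∞ f x) (hg : ContDiffAt ℝ ∞ g x) :
    ContDiffAt ℝ ∞ (fun y => (f y).comp (g y)) x := by
  have h : ContDiff ℂ ∞ fun p : (F →L[ℂ] G) × (E →L[ℂ] F) => p.1.comp p.2 :=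
    isBoundedBilinearMap_comp.contDiff
  exact (h.restrict_scalars ℝ).contDiffAt.comp x (hf.prodMk hg)

theorem contDiffAt_clm {A : F →L[ℂ] G} {f : X → F} {x : X} (hf : ContDiffAt ℝ ∞ f x) :
    ContDiffAt ℝ ∞ (fun y => A (f y)) x :=
  ((A.contDiff (n := ∞)).restrict_scalars ℝ).contDiffAt.comp x hf

theorem contDiffAt_inverse [CompleteSpace E] {f : X → E →L[ℂ] E} {x : X}
    (hf : ContDiffAt ℝ ∞ f x) (hu : IsUnit (f x)) :
    ContDiffAt ℝ ∞ (fun y => Ring.inverse (f y)) x := by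
  obtain ⟨u, hu⟩ := hu
  have h : ContDiffAt ℂ ∞ Ring.inverse (f x) := hu ▸ contDiffAt_ringInverse ℂ u
  exact (h.restrict_scalars ℝ).comp x hf

/-- The adjoint is conjugate linear, so it is smooth over ℝ only; for this reason all parameter
dependence is differentiated over ℝ. -/
theorem contDiffAt_adjoint {H : Type} [NormedAddCommGroup H] [InnerProductSpace ℂ H]
    [CompleteSpace H] {f : X → H →L[ℂ] H} {x : X} (hf : ContDiffAt ℝ ∞ f x) :
    ContDiffAt ℝ ∞ (fun y => ContinuousLinearMap.adjoint (f y)) x := by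
  have h : IsBoundedLinearMap ℝ (fun A : H →L[ℂ] H => ContinuousLinearMap.adjoint A) :=
    { map_add := fun A B => map_add _ A B
      map_smul := fun r A => by
        have := map_smulₛₗ (ContinuousLinearMap.adjoint (𝕜 := ℂ) (E := H) (F := H)) (r : ℂ) A
        simpa using this
      bound := ⟨1, one_pos, fun A => by simp⟩ }
  exact h.contDiff.contDiffAt.comp x hf

theorem contDiffAt_coef {H : Type} [NormedAddCommGroup H] [InnerProductSpace ℂ H]
    [CompleteSpace H] {T : X → H →L[ℂ] H} {P : H →L[ℂ] H} {x : X} (hT : ContDiffAt ℝ ∞ T x)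
    (hG : IsUnit (gram (T x) P)) : ContDiffAt ℝ ∞ (fun y => coef (T y) P) x := by
  have h1 : ContDiffAt ℝ ∞ (fun y => gram (T y) P) x :=
    (contDiffAt_comp (contDiffAt_adjoint hT) hT).add contDiffAt_const
  exact contDiffAt_comp (contDiffAt_inverse h1 hG) (contDiffAt_adjoint hT)

end Smooth

namespace Splitting

variable {ι : Type} [Countable ι] {D : Splitting ι}

/-! ### Change of the rate -/

/-- The same splitting with another rate. -/
def withRate (D : Splitting ι) (κ' : ℝ) (h₁ : κ' + D.L ≤ D.ν) (h₂ : ∀ i ∈ D.F, D.μ i ≤ κ')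
    (h₃ : ∀ i ∉ D.F, κ' + D.δ ≤ D.μ i) (h₄ : ∀ i ∈ D.O, i ∈ D.F → D.μ i + D.δ ≤ κ') :
    Splitting ι :=
  { D with
    κ := κ'
    κ_le := h₁
    fwd := h₂
    mid_lower := fun i _ hi => by linarith [h₃ i hi, D.δ_pos]
    bwd_gap := fun i hi _ => h₃ i hi
    gap := fun i hi => ⟨(D.gap i hi).1, (D.gap i hi).2.imp (fun h => ⟨h.1, h₄ i hi h.1⟩)
      fun h => ⟨h.1, h.2.1, h₃ i h.1⟩⟩ }

/-- The quotient of the two weights is at most 1 since κ ≤ κ', and it conjugates one Green kernel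
into the other. The fixed point for κ', multiplied by this quotient, is thus a bounded fixed point
for κ, and the two are identified by uniqueness. The weights agree at s₁, so the end values are the
same. In this way the faster decay κ' at -∞ becomes available without changing the space of end
values. -/
theorem endOp_withRate {κ' : ℝ} (h₁ : κ' + D.L ≤ D.ν) (h₂ : ∀ i ∈ D.F, D.μ i ≤ κ')
    (h₃ : ∀ i ∉ D.F, κ' + D.δ ≤ D.μ i) (h₄ : ∀ i ∈ D.O, i ∈ D.F → D.μ i + D.δ ≤ κ')
    (hκ : D.κ ≤ κ') {q : Pert ι D.s₁} (hq : D.Small q)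
    (hq' : (D.withRate κ' h₁ h₂ h₃ h₄).Small q) :
    endOp (D := D.withRate κ' h₁ h₂ h₃ h₄) q = endOp (D := D) q := by
  classical
  set D' := D.withRate κ' h₁ h₂ h₃ h₄ with hD'
  have hlw := D.continuous_lw
  have hlw' := D'.continuous_lw
  have hle : ∀ s, D'.lw s - D.lw s ≤ 0 := fun s => by
    change κ' * min (s - D.S) 0 + D.ν * max (s - D.S) 0
      - (D.κ * min (s - D.S) 0 + D.ν * max (s - D.S) 0) ≤ 0
    nlinarith [min_le_right (s - D.S) 0]
  have hgk : ∀ s σ i, D.gk s σ i * Real.exp (D'.lw σ - D.lw σ)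
      = Real.exp (D'.lw s - D.lw s) * D'.gk s σ i := fun s σ i => by
    have e : D'.gk s σ i = Real.exp (D.μ i * (s - σ) + D'.lw σ - D'.lw s) *
      ((if σ ≤ s then 1 else 0) - D.un i σ) := rfl
    rw [e, gk, mul_right_comm, ← Real.exp_add, ← mul_assoc, ← Real.exp_add]
    congr 2; ring
  ext a : 1
  let y' := Yop (D := D') q a
  let y : BoundedContinuousFunction ℝ (L2seq ι) :=
    BoundedContinuousFunction.ofNormedAddCommGroup
      (fun s => (Real.exp (D'.lw s - D.lw s) : ℂ) • y' s)
      (by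
        have : Continuous fun s => (Real.exp (D'.lw s - D.lw s) : ℂ) := by fun_prop
        exact this.smul y'.continuous) ‖y'‖ (fun s => by
        rw [norm_smul, Complex.norm_real, Real.norm_of_nonneg (Real.exp_pos _).le]
        exact (mul_le_of_le_one_left (norm_nonneg _) (Real.exp_le_one_iff.2 (hle s))).trans
          (y'.norm_coe_le_norm s))
  have hyv : ∀ s, y s = (Real.exp (D'.lw s - D.lw s) : ℂ) • y' s := fun _ => rfl
  have hy : y = D.freeOp a + K q y := by
    ext1 s
    rw [BoundedContinuousFunction.add_apply, hyv]
    have h1 : y' s = D'.freeOp a s + K (D := D') q y' s :=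
      congrArg (fun f => f s) (hq'.Yop_eq a)
    have h2 : (Real.exp (D'.lw s - D.lw s) : ℂ) • D'.freeOp a s = D.freeOp a s := by
      refine L2seq.ext_apply fun i => ?_
      rw [L2seq.smul_apply, freeOp_apply, freeOp_apply]
      change _ * (((if i ∈ D.F then 0 else Real.exp (D.μ i * (min s D.s₁ - D.s₁) - D'.lw s) : ℝ) : ℂ)
        * a i) = _
      rw [freeEntry]
      split_ifs
      · simp
      · rw [← mul_assoc, ← Complex.ofReal_mul, ← Real.exp_add]
        congr 3; ring
    have h3 : (Real.exp (D'.lw s - D.lw s) : ℂ) • K (D := D') q y' s = K (D := D) q y s := by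
      have e0 : K (D := D') q y' s = ∫ σ, D'.Gam s σ (pert D.N q σ (y' σ)) ∂D.vol := rfl
      rw [e0, KOp_apply, ← integral_smul]
      refine integral_congr_ae ?_
      filter_upwards [D.ae_le] with σ hσ
      refine L2seq.ext_apply fun i => ?_
      have e1 : (bcfFam (D := D)).val σ y = (Real.exp (D'.lw σ - D.lw σ) : ℂ) • y' σ := rfl
      rw [e1, map_smul, L2seq.smul_apply, D'.Gam_apply hσ, D.Gam_apply hσ, L2seq.smul_apply,
        ← mul_assoc, ← mul_assoc, ← Complex.ofReal_mul, ← Complex.ofReal_mul, ← hgk]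
    rw [h1, smul_add, h2, h3]
  have hyY : y = Yop q a := hq.eq_res hy
  have e4 : endOp (D := D') q a = (Real.exp (D'.lw D'.s₁) : ℂ) • y' D.s₁ := rfl
  rw [e4, endOp_apply, ← hyY, hyv, smul_smul, ← Complex.ofReal_mul, ← Real.exp_add]
  have e2 : D'.lw D'.s₁ = D.lw D.s₁ := by
    rw [D'.lw_of_ge D'.S_le, D.lw_of_ge D.S_le]; rfl
  have e3 : D.lw D.s₁ + (D'.lw D.s₁ - D.lw D.s₁) = D'.lw D'.s₁ := by
    have : D'.s₁ = D.s₁ := rfl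
    rw [this]; ring
  rw [e3]

/-! ### A lower bound for the end values -/

/-- The components in `B` are read off exactly from the end value. The modes left over, in `M` but
not in `F`, are finitely many, and on a finite-dimensional space injectivity gives a lower bound.
The two estimates combine by subtracting the `B` part. -/
theorem exists_endOp_lower (hM : D.M.Finite) {q : Pert ι D.s₁} (hq : D.Small q) :
    ∃ c > 0, ∀ a, L2seq.cproj D.F a = 0 → c * ‖a‖ ≤ ‖endOp q a‖ := by
  classical
  let Ms : Set ι := {i | i ∈ D.M ∧ i ∉ D.F}
  have hMs : Ms.Finite := hM.subset fun i hi => hi.1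
  have : Fintype Ms := hMs.fintype
  let emb : (Ms → ℂ) →ₗ[ℂ] L2seq ι := ∑ i : Ms, (lp.lsingle (𝕜 := ℂ) (E := fun _ : ι => ℂ) 2 i.1) ∘ₗ
    (LinearMap.proj i : (Ms → ℂ) →ₗ[ℂ] ℂ)
  have hemb : ∀ x i, emb x i = if h : i ∈ Ms then x ⟨i, h⟩ else 0 := fun x i => by
    have e1 : emb x = ∑ j : Ms, lp.single 2 j.1 (x j) := by
      simp [emb, LinearMap.sum_apply]
    have e2 : emb x i = ∑ j : Ms, (lp.single (E := fun _ : ι => ℂ) 2 j.1 (x j)) i := by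
      rw [e1]
      exact map_sum (lp.evalCLM ℂ (fun _ : ι => ℂ) 2 i) _ _
    rw [e2]
    split_ifs with h
    · rw [Finset.sum_eq_single ⟨i, h⟩]
      · exact lp.single_apply_self 2 i _
      · intro j _ hj
        refine lp.single_apply_ne 2 _ _ fun h' => hj (Subtype.ext h'.symm)
      · simp
    · refine Finset.sum_eq_zero fun j _ => lp.single_apply_ne 2 _ _ fun h' => h (h' ▸ j.2)
  have hinj : LinearMap.ker ((endOp q).toLinearMap ∘ₗ emb) = ⊥ := by
    rw [LinearMap.ker_eq_bot']
    intro x hx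
    have h1 := endOp_injective hq hx
    funext j
    have h2 := h1 j.1 j.2.2
    rw [hemb, dif_pos j.2] at h2
    exact h2
  obtain ⟨A, hA, hanti⟩ := LinearMap.exists_antilipschitzWith _ hinj
  have hemb_cont : ∃ n : ℝ, 0 ≤ n ∧ ∀ x, ‖emb x‖ ≤ n * ‖x‖ :=
    ⟨‖LinearMap.toContinuousLinearMap emb‖, norm_nonneg _,
      fun x => (LinearMap.toContinuousLinearMap emb).le_opNorm x⟩
  obtain ⟨n, hn0, hn⟩ := hemb_cont
  refine ⟨(1 + n * (A * (1 + ‖endOp q‖)))⁻¹, by positivity, fun a ha => ?_⟩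
  have haF : ∀ i ∈ D.F, a i = 0 := fun i hi => by
    have := congrArg (fun v : L2seq ι => v i) ha
    simpa [L2seq.cproj_apply, hi] using this
  let x : Ms → ℂ := fun j => a j.1
  have hsplit : a = L2seq.cproj D.B a + emb x := by
    refine L2seq.ext_apply fun i => ?_
    rw [L2seq.add_apply, L2seq.cproj_apply, hemb]
    by_cases hF : i ∈ D.F
    · have h1 : i ∉ D.B := fun h => h.1 hF
      have h2 : i ∉ Ms := fun h => h.2 hF
      rw [haF i hF, if_neg h1, dif_neg h2, add_zero]
    · by_cases hMi : i ∈ D.M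
      · have h1 : i ∉ D.B := fun h => h.2 hMi
        have h2 : i ∈ Ms := ⟨hMi, hF⟩
        rw [if_neg h1, dif_pos h2, zero_add]
      · have h1 : i ∈ D.B := ⟨hF, hMi⟩
        have h2 : i ∉ Ms := fun h => hMi h.1
        rw [if_pos h1, dif_neg h2, add_zero]
  have hB : ‖L2seq.cproj D.B a‖ ≤ ‖endOp q a‖ := by
    have : L2seq.cproj D.B a = L2seq.cproj D.B (endOp q a) := by
      refine L2seq.ext_apply fun i => ?_
      rw [L2seq.cproj_apply, L2seq.cproj_apply]
      split_ifs with h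
      · exact (endOp_apply_bwd hq a h).symm
      · rfl
    rw [this]
    exact L2seq.norm_cproj_apply_le _ _
  have hx : ‖x‖ ≤ A * ‖endOp q (emb x)‖ := by
    have := hanti.le_mul_norm_sub x 0
    simpa using this
  have hTx : ‖endOp q (emb x)‖ ≤ (1 + ‖endOp q‖) * ‖endOp q a‖ := by
    have e : endOp q (emb x) = endOp q a - endOp q (L2seq.cproj D.B a) := by
      rw [← map_sub]
      congr 1
      exact eq_sub_of_add_eq' hsplit.symm
    rw [e, add_mul, one_mul]
    refine (norm_sub_le _ _).trans (add_le_add le_rfl ?_)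
    exact ((endOp q).le_opNorm _).trans (mul_le_mul_of_nonneg_left hB (norm_nonneg _))
  rw [inv_mul_le_iff₀ (by positivity)]
  calc ‖a‖ ≤ ‖L2seq.cproj D.B a‖ + ‖emb x‖ := by
        conv_lhs => rw [hsplit]
        exact norm_add_le _ _
    _ ≤ ‖endOp q a‖ + n * (A * ((1 + ‖endOp q‖) * ‖endOp q a‖)) := by
        gcongr
        exact (hn x).trans (by gcongr; exact hx.trans (by gcongr))
    _ = _ := by ring

end Splitting

end Bilaplace

namespace Bilaplace

namespace Splitting

variable {ι : Type} [Countable ι] {D : Splitting ι}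

/-! ### Construction of solutions with prescribed jumps -/

/-- The kernel is discontinuous in s at t. Freezing the time at max(s, t) extends its branch after t
to a continuous curve on ℝ, so that both branches lie in the space on which the Green operator acts.
-/
theorem continuous_gk_max (t : ℝ) (i : ι) : Continuous fun s => D.gk (max s t) t i := by
  have := D.continuous_lw
  simp only [gk, le_max_right, if_true]
  fun_prop

/-- The weighted unperturbed solution with a jump at `t`, for times after `t`. -/
def jumpP {t : ℝ} (ht : t ≤ D.s₁) : L2seq ι →L[ℂ] BoundedContinuousFunction ℝ (L2seq ι) :=
  dmulBCF (fun s i => D.gk (max s t) t i) D.Ω (zero_le_one.trans D.one_le_Ω)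
    (fun _ i => D.abs_gk_le_Ω ht i) (continuous_gk_max t)

/-- The entries of the unperturbed solution for times before `t`. -/
def gkMin (D : Splitting ι) (t s : ℝ) (i : ι) : ℝ :=
  -(Real.exp (D.μ i * (min s t - t) + D.lw t - D.lw (min s t)) * D.un i t)

theorem gkMin_of_lt {t s : ℝ} (h : s < t) (i : ι) : D.gkMin t s i = D.gk s t i := by
  rw [gkMin, gk, min_eq_left h.le, if_neg (not_le.2 h)]; ring

theorem gkMin_of_ge {t s : ℝ} (h : t ≤ s) (i : ι) : D.gkMin t s i = -D.un i t := by
  rw [gkMin, min_eq_right h]; simp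

theorem abs_un_le (i : ι) (t : ℝ) : |D.un i t| ≤ 1 := by
  unfold un; split_ifs <;> simp

theorem abs_gkMin_le {t : ℝ} (ht : t ≤ D.s₁) (s : ℝ) (i : ι) : |D.gkMin t s i| ≤ D.Ω := by
  rcases lt_or_ge s t with h | h
  · rw [gkMin_of_lt h]; exact D.abs_gk_le_Ω ht i
  · rw [gkMin_of_ge h, abs_neg]; exact (abs_un_le i t).trans D.one_le_Ω

theorem continuous_gkMin (t : ℝ) (i : ι) : Continuous fun s => D.gkMin t s i := by
  have := D.continuous_lw
  unfold gkMin
  fun_prop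

/-- The weighted unperturbed solution with a jump at `t`, for times before `t`. -/
def jumpM {t : ℝ} (ht : t ≤ D.s₁) : L2seq ι →L[ℂ] BoundedContinuousFunction ℝ (L2seq ι) :=
  dmulBCF (D.gkMin t) D.Ω (zero_le_one.trans D.one_le_Ω) (abs_gkMin_le ht) (continuous_gkMin t)

theorem jumpP_apply {t : ℝ} (ht : t ≤ D.s₁) (v : L2seq ι) (s : ℝ) (i : ι) :
    jumpP ht v s i = D.gk (max s t) t i * v i := by
  rw [jumpP, dmulBCF_apply, L2seq.dmul_apply (fun i => D.abs_gk_le_Ω ht i)]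

theorem jumpM_apply {t : ℝ} (ht : t ≤ D.s₁) (v : L2seq ι) (s : ℝ) (i : ι) :
    jumpM ht v s i = D.gkMin t s i * v i := by
  rw [jumpM, dmulBCF_apply, L2seq.dmul_apply (abs_gkMin_le ht s)]

theorem jumpP_of_ge {t : ℝ} (ht : t ≤ D.s₁) (v : L2seq ι) {s : ℝ} (hs : t ≤ s) :
    jumpP ht v s = D.Gam s t v :=
  L2seq.ext_apply fun i => by rw [jumpP_apply, D.Gam_apply ht, max_eq_left hs]

theorem jumpM_of_lt {t : ℝ} (ht : t ≤ D.s₁) (v : L2seq ι) {s : ℝ} (hs : s < t) :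
    jumpM ht v s = D.Gam s t v :=
  L2seq.ext_apply fun i => by rw [jumpM_apply, D.Gam_apply ht, gkMin_of_lt hs]

theorem jumpP_sub_jumpM {t : ℝ} (ht : t ≤ D.s₁) (v : L2seq ι) :
    jumpP ht v t - jumpM ht v t = v :=
  L2seq.ext_apply fun i => by
    rw [L2seq.sub_apply, jumpP_apply, jumpM_apply, gkMin_of_ge le_rfl, max_self, gk, if_pos le_rfl]
    simp; ring

/-- The perturbation part of the weighted solution with a jump at `t`. -/
def Zop {t : ℝ} (ht : t ≤ D.s₁) (q : Pert ι D.s₁) :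
    L2seq ι →L[ℂ] BoundedContinuousFunction ℝ (L2seq ι) :=
  (Res q).comp (KOp (jumpFam ht) q)

theorem Small.Zop_eq {q : Pert ι D.s₁} (hq : D.Small q) {t : ℝ} (ht : t ≤ D.s₁) (v : L2seq ι) :
    Zop ht q v = KOp ((bcfFam (D := D)).sum (jumpFam ht)) q (Zop ht q v, v) := by
  rw [KOp_sum]
  exact (hq.res_eq _).trans (add_comm _ _)

/-- The correction by a solution of controlled growth which makes the end value orthogonal. -/
def corr {t : ℝ} (ht : t ≤ D.s₁) (g : L2seq ι →L[ℂ] L2seq ι) (q : Pert ι D.s₁) :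
    L2seq ι →L[ℂ] BoundedContinuousFunction ℝ (L2seq ι) :=
  (Yop q).comp ((coef (g.comp (endOp q)) (L2seq.cproj D.F)).comp (g.comp
    ((Real.exp (D.lw D.s₁) : ℂ) • (BoundedContinuousFunction.evalCLM ℂ D.s₁).comp
      (jumpP ht + Zop ht q))))

/-- The weighted solutions for times after `t`. -/
def FM {t : ℝ} (ht : t ≤ D.s₁) (g : L2seq ι →L[ℂ] L2seq ι) (q : Pert ι D.s₁) :
    L2seq ι →L[ℂ] BoundedContinuousFunction ℝ (L2seq ι) :=
  jumpP ht + Zop ht q - corr ht g q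

/-- The weighted solutions for times before `t`. -/
def FP {t : ℝ} (ht : t ≤ D.s₁) (g : L2seq ι →L[ℂ] L2seq ι) (q : Pert ι D.s₁) :
    L2seq ι →L[ℂ] BoundedContinuousFunction ℝ (L2seq ι) :=
  corr ht g q - (jumpM ht + Zop ht q)

/-- The value at time `s` of a weighted curve started at time `t`. -/
def sol (D : Splitting ι) (t s : ℝ)
    (F : L2seq ι →L[ℂ] BoundedContinuousFunction ℝ (L2seq ι)) : L2seq ι →L[ℂ] L2seq ι :=
  (Real.exp (D.lw s - D.lw t) : ℂ) • (BoundedContinuousFunction.evalCLM ℂ s).comp F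

theorem sol_apply (t s : ℝ) (F : L2seq ι →L[ℂ] BoundedContinuousFunction ℝ (L2seq ι))
    (v : L2seq ι) : D.sol t s F v = (Real.exp (D.lw s - D.lw t) : ℂ) • F v s := rfl

/-- On [t, s₁] the free part coincides with Γ(·, t)v, so `Zop` plus the free part is exactly the
curve fed into the Green operator. The same holds before t with the other branch of the kernel. -/
theorem Small.isMild_m {q : Pert ι D.s₁} (hq : D.Small q) {t : ℝ} (ht : t ≤ D.s₁)
    (v : L2seq ι) : IsMild D.μ (pert D.N q) (Icc t D.s₁)
      fun s => (Real.exp (D.lw s) : ℂ) • (jumpP ht + Zop ht q) v s := by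
  have h := isMild_of_free ((bcfFam (D := D)).sum (jumpFam ht)) q (Zop ht q v, v)
    (I := Icc t D.s₁) (fun x hx => hx.2) (f := jumpP ht v) (jumpP ht v).continuous.continuousOn
    (fun a ha b hb _ i => by
      rw [jumpP_of_ge ht v ha.1, jumpP_of_ge ht v hb.1, D.Gam_apply ht, D.Gam_apply ht, gk, gk,
        if_pos ha.1, if_pos hb.1]
      simp only [← mul_assoc, ← Complex.ofReal_mul, ← Real.exp_add]
      congr 4; ring)
    (Eventually.of_forall fun σ hσ => by
      rw [← hq.Zop_eq ht v, jumpP_of_ge ht v hσ.1, add_comm]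
      rfl)
  refine h.congr fun s _ => ?_
  rw [← hq.Zop_eq ht v]
  rfl

theorem Small.isMild_p {q : Pert ι D.s₁} (hq : D.Small q) {t : ℝ} (ht : t ≤ D.s₁)
    (v : L2seq ι) : IsMild D.μ (pert D.N q) (Iic t)
      fun s => (Real.exp (D.lw s) : ℂ) • (jumpM ht + Zop ht q) v s := by
  have h := isMild_of_free ((bcfFam (D := D)).sum (jumpFam ht)) q (Zop ht q v, v)
    (I := Iic t) (fun x hx => le_trans hx ht) (f := jumpM ht v) (jumpM ht v).continuous.continuousOn
    (fun a ha b hb _ i => by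
      rw [jumpM_apply, jumpM_apply, gkMin, gkMin, min_eq_left (mem_Iic.1 ha),
        min_eq_left (mem_Iic.1 hb)]
      simp only [neg_mul, mul_neg, Complex.ofReal_neg, ← mul_assoc, ← Complex.ofReal_mul,
        ← Real.exp_add]
      congr 5; ring)
    (by
      -- At σ = t the kernel takes the value of its right branch while `jumpM` takes the left limit;
      -- the single point does not affect the integral.
      have : ∀ᵐ σ : ℝ, σ ≠ t := by simp [ae_iff]
      filter_upwards [this] with σ hne hσ
      rw [← hq.Zop_eq ht v, jumpM_of_lt ht v (lt_of_le_of_ne hσ hne), add_comm]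
      rfl)
  refine h.congr fun s _ => ?_
  rw [← hq.Zop_eq ht v]
  rfl

theorem isUnit_gram_endOp (hM : D.M.Finite) {g : L2seq ι →L[ℂ] L2seq ι} {cg : ℝ} (hcg : 0 < cg)
    (hg : ∀ x, cg * ‖x‖ ≤ ‖g x‖) {q : Pert ι D.s₁} (hq : D.Small q) :
    IsUnit (gram (g.comp (endOp q)) (L2seq.cproj D.F)) := by
  obtain ⟨c, hc, h⟩ := exists_endOp_lower hM hq
  refine isUnit_gram (c := cg * c) (fun x => ?_) (fun x => ?_) (by positivity) fun x hx => ?_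
  · rw [ContinuousLinearMap.comp_apply, endOp_fwd, map_zero]
    intro i hi
    rw [L2seq.cproj_apply, if_neg hi]
  · refine L2seq.ext_apply fun i => ?_
    rw [L2seq.cproj_apply, L2seq.cproj_apply]
    split_ifs <;> rfl
  · rw [mul_assoc]
    exact (mul_le_mul_of_nonneg_left (h x hx) hcg.le).trans (hg _)

/-- The jump at t is that of the free kernel, because the perturbation part and the correction
cancel in the sum. The correction removes from the end value its projection onto the range of
`endOp` in the inner product ⟪g x, g y⟫, and this range contains `EU`. The rate κ₀ is allowed to be
smaller than the rate of the splitting, so that splittings with different weights solve one and the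
same jump problem. -/
theorem Small.isJump {q : Pert ι D.s₁} (hq : D.Small q) (hM : D.M.Finite)
    {g : L2seq ι →L[ℂ] L2seq ι} {cg : ℝ} (hcg : 0 < cg) (hg : ∀ x, cg * ‖x‖ ≤ ‖g x‖) {κ₀ : ℝ}
    (hκ₀ : κ₀ ≤ D.κ) (hEU : EU D.μ (pert D.N q) D.s₁ κ₀ ⊆ range (endOp q)) {t : ℝ}
    (ht : t ≤ D.s₁) (v : L2seq ι) :
    IsJump D.μ (pert D.N q) D.s₁ κ₀ g t v (fun s => D.sol t s (FM ht g q) v)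
      (fun s => D.sol t s (FP ht g q) v) := by
  have hC := integrableOn_pert D.N q
  have hCt : ∀ a b, b ≤ D.s₁ → IntegrableOn (pert D.N q) (Icc a b) := fun a b hb =>
    (hC a).mono_set (Icc_subset_Icc_right hb)
  set b := coef (g.comp (endOp q)) (L2seq.cproj D.F)
    (g ((Real.exp (D.lw D.s₁) : ℂ) • (jumpP ht + Zop ht q) v D.s₁)) with hb
  have hcorr : corr ht g q v = Yop q b := rfl
  have hY := hq.isMild_Yop b
  have e : ∀ s, Real.exp (D.lw s - D.lw t) = Real.exp (-D.lw t) * Real.exp (D.lw s) := fun s => by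
    rw [← Real.exp_add]; congr 1; ring
  refine ⟨?_, ?_, ?_, ?_, ?_⟩
  · have h := ((hq.isMild_m ht v).sub (hY.mono fun x hx => hx.2)
      fun a _ b hb => hCt a b hb.2).smul (Real.exp (-D.lw t) : ℂ)
    refine h.congr fun s _ => ?_
    rw [sol_apply, FM, sub_apply, hcorr, e, Complex.ofReal_mul, mul_smul]
    simp only [Pi.smul_apply, Pi.sub_apply, ← smul_sub]
    rfl
  · have h := ((hY.mono (Iic_subset_Iic.2 ht)).sub (hq.isMild_p ht v)
      fun a _ b hb => hCt a b (le_trans hb ht)).smul (Real.exp (-D.lw t) : ℂ)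
    refine h.congr fun s _ => ?_
    rw [sol_apply, FP, sub_apply, hcorr, e, Complex.ofReal_mul, mul_smul]
    simp only [Pi.smul_apply, Pi.sub_apply, ← smul_sub]
    rfl
  · obtain ⟨c, hc⟩ := growth_weighted (D := D) (FP ht g q v)
    -- For s ≤ s₁ growth at the larger rate implies growth at rate κ₀, at the cost of the factor
    -- e^{(κ - κ₀)s₁}.
    refine ⟨Real.exp (-D.lw t) * |c| * Real.exp ((D.κ - κ₀) * D.s₁), fun s hs => ?_⟩
    rw [sol_apply, e, Complex.ofReal_mul, mul_smul, norm_smul, Complex.norm_real,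
      Real.norm_of_nonneg (Real.exp_pos _).le, mul_assoc, mul_assoc, ← Real.exp_add]
    refine mul_le_mul_of_nonneg_left ((hc s (hs.trans ht)).trans ?_) (Real.exp_pos _).le
    have : D.κ * s ≤ (D.κ - κ₀) * D.s₁ + κ₀ * s := by nlinarith [hs.trans ht]
    exact mul_le_mul (le_abs_self c) (Real.exp_le_exp.2 this) (Real.exp_pos _).le (abs_nonneg _)
  · rw [sol_apply, sol_apply, sub_self, Real.exp_zero, Complex.ofReal_one, one_smul, one_smul,
      FM, FP]
    have h1 := jumpP_sub_jumpM ht v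
    change (jumpP ht v t + Zop ht q v t - corr ht g q v t)
      + (corr ht g q v t - (jumpM ht v t + Zop ht q v t)) = v
    conv_rhs => rw [← h1]
    abel
  · intro x hx
    obtain ⟨a, rfl⟩ := hEU hx
    have h1 := inner_sub_coef (T := g.comp (endOp q)) (P := L2seq.cproj D.F)
      (fun x => by
        rw [ContinuousLinearMap.comp_apply, endOp_fwd, map_zero]
        intro i hi
        rw [L2seq.cproj_apply, if_neg hi])
      (fun x => by
        refine L2seq.ext_apply fun i => ?_
        rw [L2seq.cproj_apply, L2seq.cproj_apply]
        split_ifs <;> rfl)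
      (isUnit_gram_endOp hM hcg hg hq) a
      (g ((Real.exp (D.lw D.s₁) : ℂ) • (jumpP ht + Zop ht q) v D.s₁))
    rw [← hb, ContinuousLinearMap.comp_apply, ContinuousLinearMap.comp_apply, ← map_sub,
      endOp_apply q b, ← smul_sub] at h1
    have h2 : D.sol t D.s₁ (FM ht g q) v = (Real.exp (-D.lw t) : ℂ) •
        ((Real.exp (D.lw D.s₁) : ℂ) • ((jumpP ht + Zop ht q) v D.s₁ - Yop q b D.s₁)) := by
      rw [sol_apply, FM, sub_apply, hcorr, e, Complex.ofReal_mul, mul_smul]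
      rfl
    rw [h2, map_smul, inner_smul_right, h1, mul_zero]

/-! #### Bounds -/

theorem norm_evalCLM_le (s : ℝ) :
    ‖(BoundedContinuousFunction.evalCLM ℂ s :
      BoundedContinuousFunction ℝ (L2seq ι) →L[ℂ] L2seq ι)‖ ≤ 1 :=
  ContinuousLinearMap.opNorm_le_bound _ zero_le_one fun f => by
    rw [one_mul]; exact f.norm_coe_le_norm s

theorem Small.norm_Zop_le {q : Pert ι D.s₁} (hq : D.Small q) {t : ℝ} (ht : t ≤ D.s₁) :
    ‖Zop ht q‖ ≤ (1 - ‖K q‖)⁻¹ * (((‖D.N‖ * (2 / D.δ) + D.Ω) * D.Ω) * ‖q‖) := by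
  have h1 := norm_KOp_apply_le (jumpFam ht) q
  have hΩ := zero_le_one.trans D.one_le_Ω
  have hδ := D.δ_pos
  have h2 : 0 ≤ (1 - ‖K q‖)⁻¹ := inv_nonneg.2 (sub_nonneg.2 hq.le)
  refine ContinuousLinearMap.opNorm_le_bound _ (by positivity) fun v => ?_
  refine (hq.norm_res_le _).trans ?_
  rw [mul_assoc]
  exact mul_le_mul_of_nonneg_left ((KOp (jumpFam ht) q).le_of_opNorm_le h1 v)
    h2

/-- The constant does not depend on t, because the free solutions with a jump are bounded by Ω in
the weighted norm for every jump time. -/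
theorem Small.exists_bound {q : Pert ι D.s₁} (hq : D.Small q) (g : L2seq ι →L[ℂ] L2seq ι) :
    ∃ c, 0 ≤ c ∧ ∀ t (ht : t ≤ D.s₁), ‖FM ht g q‖ ≤ c ∧ ‖FP ht g q‖ ≤ c := by
  have hΩ := zero_le_one.trans D.one_le_Ω
  have hδ := D.δ_pos
  set z := (1 - ‖K q‖)⁻¹ * (((‖D.N‖ * (2 / D.δ) + D.Ω) * D.Ω) * ‖q‖) with hz
  have hz0 : 0 ≤ z := (norm_nonneg _).trans (hq.norm_Zop_le D.S_le)
  set R := Yop q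
  set G := coef (g.comp (endOp q)) (L2seq.cproj D.F)
  set e := Real.exp (D.lw D.s₁)
  have he : 0 < e := Real.exp_pos _
  have hc : ∀ t (ht : t ≤ D.s₁), ‖corr ht g q‖ ≤ ‖R‖ * (‖G‖ * (‖g‖ * (e * (1 * (D.Ω + z))))) :=
    fun t ht => by
    have h0 : ‖jumpP ht + Zop ht q‖ ≤ D.Ω + z :=
      (norm_add_le _ _).trans (add_le_add (norm_dmulBCF_le _ _ _ _ _) (hq.norm_Zop_le ht))
    refine (ContinuousLinearMap.opNorm_comp_le _ _).trans ?_
    gcongr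
    refine (ContinuousLinearMap.opNorm_comp_le _ _).trans ?_
    gcongr
    refine (ContinuousLinearMap.opNorm_comp_le _ _).trans ?_
    gcongr
    rw [norm_smul, Complex.norm_real, Real.norm_of_nonneg he.le]
    gcongr
    refine (ContinuousLinearMap.opNorm_comp_le _ _).trans ?_
    gcongr
    exact norm_evalCLM_le _
  refine ⟨(D.Ω + z) + ‖R‖ * (‖G‖ * (‖g‖ * (e * (1 * (D.Ω + z))))), by positivity,
    fun t ht => ⟨?_, ?_⟩⟩
  · refine (norm_sub_le _ _).trans (add_le_add ((norm_add_le _ _).trans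
      (add_le_add (norm_dmulBCF_le _ _ _ _ _) (hq.norm_Zop_le ht))) (hc t ht))
  · rw [add_comm (D.Ω + z)]
    refine (norm_sub_le _ _).trans (add_le_add (hc t ht) ((norm_add_le _ _).trans
      (add_le_add (norm_dmulBCF_le _ _ _ _ _) (hq.norm_Zop_le ht))))

/-- The weighted curves, measured in the rate `κ`. -/
theorem norm_sol_forward_le {t s : ℝ} (hs : s ≤ D.s₁)
    {F : L2seq ι →L[ℂ] BoundedContinuousFunction ℝ (L2seq ι)} {c : ℝ} (hF : ‖F‖ ≤ c)
    (v : L2seq ι) : ‖D.sol t s F v‖ ≤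
      Real.exp ((D.ν - D.κ) * (D.s₁ - D.S)) * c * Real.exp (D.κ * (s - t)) * ‖v‖ := by
  rw [sol_apply, norm_smul, Complex.norm_real, Real.norm_of_nonneg (Real.exp_pos _).le]
  have h1 : ‖F v s‖ ≤ c * ‖v‖ := ((F v).norm_coe_le_norm s).trans (F.le_of_opNorm_le hF v)
  have h2 : D.lw s - D.lw t ≤ (D.ν - D.κ) * (D.s₁ - D.S) + D.κ * (s - t) := by
    have := lw_le hs
    have := D.lw_ge t
    linarith
  have h3 : 0 ≤ c * ‖v‖ := mul_nonneg ((norm_nonneg _).trans hF) (norm_nonneg _)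
  calc _ ≤ Real.exp ((D.ν - D.κ) * (D.s₁ - D.S) + D.κ * (s - t)) * (c * ‖v‖) := by gcongr
    _ = _ := by rw [Real.exp_add]; ring

theorem norm_sol_backward_le {t s : ℝ} (hst : s ≤ t)
    {F : L2seq ι →L[ℂ] BoundedContinuousFunction ℝ (L2seq ι)} {c : ℝ} (hF : ‖F‖ ≤ c)
    (v : L2seq ι) : ‖D.sol t s F v‖ ≤ c * Real.exp (D.κ * (s - t)) * ‖v‖ := by
  rw [sol_apply, norm_smul, Complex.norm_real, Real.norm_of_nonneg (Real.exp_pos _).le]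
  have h1 : ‖F v s‖ ≤ c * ‖v‖ := ((F v).norm_coe_le_norm s).trans (F.le_of_opNorm_le hF v)
  have h2 : D.lw s - D.lw t ≤ D.κ * (s - t) := by
    have := D.lw_sub_ge hst
    linarith
  have h3 : 0 ≤ c * ‖v‖ := mul_nonneg ((norm_nonneg _).trans hF) (norm_nonneg _)
  calc _ ≤ Real.exp (D.κ * (s - t)) * (c * ‖v‖) := by gcongr
    _ = _ := by ring

/-! #### Smooth dependence on the perturbation -/

section Smooth

variable {X : Type} [NormedAddCommGroup X] [NormedSpace ℝ X] {f : X → Pert ι D.s₁} {x : X}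
  {G : Type} [NormedAddCommGroup G] [NormedSpace ℂ G]

theorem contDiffAt_KOp (Λ : CurveFam D G) (hf : ContDiffAt ℝ ∞ f x) :
    ContDiffAt ℝ ∞ (fun y => KOp Λ (f y)) x := contDiffAt_clm hf

theorem contDiffAt_Res (hf : ContDiffAt ℝ ∞ f x) (hx : D.Small (f x)) :
    ContDiffAt ℝ ∞ (fun y => Res (f y)) x :=
  contDiffAt_inverse (contDiffAt_const.sub (contDiffAt_KOp _ hf)) hx.isUnit

theorem contDiffAt_Zop {t : ℝ} (ht : t ≤ D.s₁) (hf : ContDiffAt ℝ ∞ f x) (hx : D.Small (f x)) :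
    ContDiffAt ℝ ∞ (fun y => Zop ht (f y)) x :=
  contDiffAt_comp (contDiffAt_Res hf hx) (contDiffAt_KOp _ hf)

theorem contDiffAt_Yop (hf : ContDiffAt ℝ ∞ f x) (hx : D.Small (f x)) :
    ContDiffAt ℝ ∞ (fun y => Yop (f y)) x :=
  contDiffAt_comp (contDiffAt_Res hf hx) contDiffAt_const

theorem contDiffAt_endOp (hf : ContDiffAt ℝ ∞ f x) (hx : D.Small (f x)) :
    ContDiffAt ℝ ∞ (fun y => endOp (f y)) x :=
  (contDiffAt_comp contDiffAt_const (contDiffAt_Yop hf hx)).const_smul _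

theorem contDiffAt_corr (hM : D.M.Finite) {g : L2seq ι →L[ℂ] L2seq ι} {cg : ℝ} (hcg : 0 < cg)
    (hg : ∀ x, cg * ‖x‖ ≤ ‖g x‖) {t : ℝ} (ht : t ≤ D.s₁) (hf : ContDiffAt ℝ ∞ f x)
    (hx : D.Small (f x)) : ContDiffAt ℝ ∞ (fun y => corr ht g (f y)) x := by
  refine contDiffAt_comp (contDiffAt_Yop hf hx) (contDiffAt_comp (contDiffAt_coef
    (contDiffAt_comp contDiffAt_const (contDiffAt_endOp hf hx))
    (isUnit_gram_endOp hM hcg hg hx)) (contDiffAt_comp contDiffAt_const ?_))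
  exact (contDiffAt_comp contDiffAt_const
    (contDiffAt_const.add (contDiffAt_Zop ht hf hx))).const_smul _

theorem contDiffAt_FM (hM : D.M.Finite) {g : L2seq ι →L[ℂ] L2seq ι} {cg : ℝ} (hcg : 0 < cg)
    (hg : ∀ x, cg * ‖x‖ ≤ ‖g x‖) {t : ℝ} (ht : t ≤ D.s₁) (hf : ContDiffAt ℝ ∞ f x)
    (hx : D.Small (f x)) : ContDiffAt ℝ ∞ (fun y => FM ht g (f y)) x :=
  (contDiffAt_const.add (contDiffAt_Zop ht hf hx)).sub (contDiffAt_corr hM hcg hg ht hf hx)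

theorem contDiffAt_FP (hM : D.M.Finite) {g : L2seq ι →L[ℂ] L2seq ι} {cg : ℝ} (hcg : 0 < cg)
    (hg : ∀ x, cg * ‖x‖ ≤ ‖g x‖) {t : ℝ} (ht : t ≤ D.s₁) (hf : ContDiffAt ℝ ∞ f x)
    (hx : D.Small (f x)) : ContDiffAt ℝ ∞ (fun y => FP ht g (f y)) x :=
  (contDiffAt_corr hM hcg hg ht hf hx).sub (contDiffAt_const.add (contDiffAt_Zop ht hf hx))

end Smooth

/-! #### Continuity in the initial time -/

/-- This supplies a majorant in σ independent of the jump time t ≥ S. For σ ≥ S the times form a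
bounded set and the bound Ω is enough. For σ < S ≤ t only the modes in `B` are present, and their
gap δ above κ gives exponential decay. -/
theorem abs_gk_le_exp {σ t : ℝ} (hσ : σ ≤ D.s₁) (ht : t ≤ D.s₁) (hS : D.S ≤ t) (i : ι) :
    |D.gk σ t i| ≤ D.Ω * Real.exp (D.δ * (D.s₁ - D.S)) * Real.exp (-D.δ * |D.s₁ - σ|) := by
  have hδ := D.δ_pos
  rw [abs_of_nonneg (sub_nonneg.2 hσ), mul_assoc, ← Real.exp_add]
  rcases le_or_gt D.S σ with h | h
  · refine (D.abs_gk_le_Ω ht i).trans (le_mul_of_one_le_right (Real.exp_pos _).le ?_)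
    exact Real.one_le_exp (by nlinarith)
  · have h1 : ¬ t ≤ σ := not_le.2 (h.trans_le hS)
    by_cases hi : i ∈ D.B
    · have hb := D.bwd i hi.1 hi.2
      have hb' := D.bwd_gap i hi.1 hi.2
      have e : D.gk σ t i = -Real.exp (D.μ i * (σ - t) + D.lw t - D.lw σ) := by
        simp [gk, un, hi.1, hi.2, h1]
      rw [e, abs_neg, abs_of_pos (Real.exp_pos _), Ω, ← Real.exp_add]
      refine Real.exp_le_exp.2 ?_
      have h2 := D.lw_sub_le hS ht
      have h3 : D.lw σ = D.lw D.S + D.κ * (σ - D.S) := by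
        rw [D.lw_of_le h.le, D.lw_of_le le_rfl]; ring
      rw [h3]
      nlinarith [mul_nonneg (sub_nonneg.2 hb') (sub_nonneg.2 h.le),
        mul_nonneg (sub_nonneg.2 hb) (sub_nonneg.2 hS)]
    · have e : D.gk σ t i = 0 := by
        have h4 : ¬ t < D.S := not_lt.2 hS
        by_cases hF : i ∈ D.F
        · simp [gk, un, hF, h1]
        · have hM : i ∈ D.M := by
            by_contra h; exact hi ⟨hF, h⟩
          simp [gk, un, hF, hM, h4, h1]
      rw [e, abs_zero]
      exact mul_nonneg (zero_le_one.trans D.one_le_Ω) (Real.exp_pos _).le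

/-- The switch of the direction of integration is discontinuous at S. Continuity in the initial time
is therefore obtained only for t > S, and S is later placed below the time in question. -/
theorem continuousAt_un {t : ℝ} (ht : D.S < t) (i : ι) : ContinuousAt (D.un i) t := by
  have h : D.un i =ᶠ[𝓝 t] fun _ => D.un i t := by
    filter_upwards [Ioi_mem_nhds ht] with x hx
    simp [un, not_lt.2 (le_of_lt ht), not_lt.2 (le_of_lt (mem_Ioi.1 hx))]
  exact continuousAt_const.congr h.symm

theorem continuousAt_gk_right {s t : ℝ} (h : t ≠ s) (ht : D.S < t) (i : ι) :
    ContinuousAt (fun x => D.gk s x i) t := by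
  have h1 : ContinuousAt (fun x : ℝ => (if x ≤ s then (1 : ℝ) else 0)) t := by
    rcases lt_or_gt_of_ne h with h | h
    · refine (continuousAt_const (y := (1 : ℝ))).congr ?_
      filter_upwards [Iio_mem_nhds h] with x hx
      rw [if_pos (le_of_lt hx)]
    · refine (continuousAt_const (y := (0 : ℝ))).congr ?_
      filter_upwards [Ioi_mem_nhds h] with x hx
      rw [if_neg (not_le.2 hx)]
  have := D.continuous_lw
  exact ContinuousAt.mul (Continuous.continuousAt (by fun_prop)) (h1.sub (continuousAt_un ht i))

theorem norm_Gam_apply_le_exp {σ t : ℝ} (hσ : σ ≤ D.s₁) (ht : t ≤ D.s₁) (hS : D.S ≤ t)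
    (v : L2seq ι) : ‖D.Gam σ t v‖ ≤
      D.Ω * Real.exp (D.δ * (D.s₁ - D.S)) * Real.exp (-D.δ * |D.s₁ - σ|) * ‖v‖ :=
  L2seq.norm_dmul_apply_le (by have := zero_le_one.trans D.one_le_Ω; positivity)
    (abs_gk_le_exp hσ ht hS) v

/-- Since the kernel is bounded by Ω, the difference of the two curves is at most Ω times the
integral of ‖C(σ)(Γ(σ, t)v - Γ(σ, t₀)v)‖, uniformly in s. This integral tends to 0 by dominated
convergence. -/
theorem tendsto_KOp_jumpFam (q : Pert ι D.s₁) (v : L2seq ι) {t₀ : ℝ} (h₀ : t₀ ≤ D.s₁)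
    (hS : D.S < t₀) : Tendsto (fun t : Iic D.s₁ => KOp (jumpFam (D := D) t.2) q v)
      (𝓝 ⟨t₀, h₀⟩) (𝓝 (KOp (jumpFam (D := D) h₀) q v)) := by
  have hΩ := zero_le_one.trans D.one_le_Ω
  let H : Iic D.s₁ → ℝ → ℝ := fun t σ => ‖pert D.N q σ (D.Gam σ t v - D.Gam σ t₀ v)‖
  let e : ℝ → ℝ := fun σ => D.Ω * Real.exp (D.δ * (D.s₁ - D.S)) * Real.exp (-D.δ * |D.s₁ - σ|) * ‖v‖
  have he0 : ∀ σ, 0 ≤ e σ := fun σ => by positivity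
  -- The constant operator requires the exponentially decaying majorant; for the integrable part a
  -- uniform bound of the kernel suffices.
  let bd : ℝ → ℝ := fun σ => (‖q.1‖ * ‖D.N‖) * (2 * e σ) + ‖q.2 σ‖ * (2 * (D.Ω * ‖v‖))
  have hbd : Integrable bd D.vol := by
    have h1 := (integrable_exp_neg_mul_abs_sub D.δ_pos D.s₁).restrict (s := Iic D.s₁)
    exact ((((h1.const_mul _).mul_const _).const_mul _).const_mul _).add
      ((L1.integrable_coeFn q.2).norm.mul_const _)
  have hHm : ∀ t, AEStronglyMeasurable (H t) D.vol := fun t =>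
    (measurable_pert_apply D.N q le_rfl
      ((D.measurable_Gam_left t.2 v).sub (D.measurable_Gam_left h₀ v))).norm
  have hHb : ∀ t : Iic D.s₁, D.S ≤ t → ∀ᵐ σ ∂D.vol, ‖H t σ‖ ≤ bd σ := fun t ht => by
    filter_upwards [D.ae_le] with σ hσ
    rw [norm_norm, pert, add_apply, smul_apply]
    have h1 : ‖D.Gam σ t v - D.Gam σ t₀ v‖ ≤ 2 * e σ := by
      have a1 := norm_Gam_apply_le_exp hσ t.2 ht v
      have a2 := norm_Gam_apply_le_exp hσ h₀ hS.le v
      have := norm_sub_le (D.Gam σ t v) (D.Gam σ t₀ v)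
      simp only [e]
      linarith
    have h2 : ‖D.Gam σ t v - D.Gam σ t₀ v‖ ≤ 2 * (D.Ω * ‖v‖) := by
      have a1 := (D.Gam σ t).le_of_opNorm_le (D.norm_Gam_le t.2) v
      have a2 := (D.Gam σ t₀).le_of_opNorm_le (D.norm_Gam_le h₀) v
      have := norm_sub_le (D.Gam σ t v) (D.Gam σ t₀ v)
      linarith
    refine (norm_add_le _ _).trans (add_le_add ?_ ?_)
    · rw [norm_smul, mul_assoc]
      gcongr
      exact (D.N.le_opNorm _).trans (by gcongr)
    · exact ((q.2 σ).le_opNorm _).trans (by gcongr)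
  have hlim : Tendsto (fun t => D.Ω * ∫ σ, H t σ ∂D.vol) (𝓝 ⟨t₀, h₀⟩) (𝓝 0) := by
    have h3 : Tendsto (fun t => ∫ σ, H t σ ∂D.vol) (𝓝 ⟨t₀, h₀⟩) (𝓝 (∫ _, (0 : ℝ) ∂D.vol)) := by
      refine tendsto_integral_filter_of_dominated_convergence bd (Eventually.of_forall hHm) ?_ hbd ?_
      · have : ∀ᶠ t : Iic D.s₁ in 𝓝 ⟨t₀, h₀⟩, D.S < t :=
          continuous_subtype_val.continuousAt.eventually (lt_mem_nhds hS)
        filter_upwards [this] with t ht using hHb t ht.le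
      · have : ∀ᵐ σ ∂D.vol, σ ≠ t₀ := ae_restrict_of_ae (by simp [ae_iff])
        filter_upwards [this, D.ae_le] with σ hne hσ
        have h4 : Tendsto (fun t : Iic D.s₁ => D.Gam σ t v) (𝓝 ⟨t₀, h₀⟩) (𝓝 (D.Gam σ t₀ v)) :=
          L2seq.tendsto_dmul (Eventually.of_forall fun t => D.abs_gk_le_Ω t.2) (D.abs_gk_le_Ω h₀)
            (fun i => (continuousAt_gk_right hne.symm hS i).tendsto.comp
              (continuous_subtype_val.tendsto' (⟨t₀, h₀⟩ : Iic D.s₁) t₀ rfl)) v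
        have h5 := ((pert D.N q σ).continuous.tendsto _).comp (h4.sub_const (D.Gam σ t₀ v))
        simpa [H] using h5.norm
    simpa using h3.const_mul D.Ω
  rw [tendsto_iff_norm_sub_tendsto_zero]
  refine squeeze_zero' (Eventually.of_forall fun _ => norm_nonneg _) ?_ hlim
  have : ∀ᶠ t : Iic D.s₁ in 𝓝 ⟨t₀, h₀⟩, D.S < t :=
    continuous_subtype_val.continuousAt.eventually (lt_mem_nhds hS)
  filter_upwards [this] with t ht
  have hHi : Integrable (H t) D.vol := hbd.mono' (hHm t) (hHb t ht.le)
  refine (BoundedContinuousFunction.norm_le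
    (mul_nonneg hΩ (integral_nonneg fun _ => norm_nonneg _))).2 fun s => ?_
  rw [BoundedContinuousFunction.sub_apply, KOp_eq, KOp_eq,
    ← integral_sub (integrable_kint _ q v s) (integrable_kint _ q v s), ← integral_const_mul]
  refine norm_integral_le_of_norm_le (hHi.const_mul _) ?_
  filter_upwards [D.ae_le] with σ hσ
  have e1 : kint (jumpFam (D := D) t.2) q v s σ - kint (jumpFam (D := D) h₀) q v s σ
      = D.Gam s σ (pert D.N q σ (D.Gam σ t v - D.Gam σ t₀ v)) := by
    simp [kint, jumpFam]
  rw [e1]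
  exact (D.Gam s σ).le_of_opNorm_le (D.norm_Gam_le hσ) _

theorem tendsto_FM_self (g : L2seq ι →L[ℂ] L2seq ι) (q : Pert ι D.s₁) (v : L2seq ι) {t₀ : ℝ}
    (h₀ : t₀ ≤ D.s₁) (hS : D.S < t₀) :
    Tendsto (fun t : Iic D.s₁ => FM (D := D) t.2 g q v t) (𝓝 ⟨t₀, h₀⟩)
      (𝓝 (FM (D := D) h₀ g q v t₀)) := by
  have hval : Tendsto (fun t : Iic D.s₁ => (t : ℝ)) (𝓝 ⟨t₀, h₀⟩) (𝓝 t₀) :=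
    continuous_subtype_val.tendsto' (⟨t₀, h₀⟩ : Iic D.s₁) t₀ rfl
  have hZ : Tendsto (fun t : Iic D.s₁ => Zop (D := D) t.2 q v) (𝓝 ⟨t₀, h₀⟩)
      (𝓝 (Zop (D := D) h₀ q v)) :=
    ((Res q).continuous.tendsto _).comp (tendsto_KOp_jumpFam q v h₀ hS)
  have heval : ∀ {F : Iic D.s₁ → BoundedContinuousFunction ℝ (L2seq ι)}
      {F₀ : BoundedContinuousFunction ℝ (L2seq ι)} {r : Iic D.s₁ → ℝ} {r₀ : ℝ},
      Tendsto F (𝓝 ⟨t₀, h₀⟩) (𝓝 F₀) → Tendsto r (𝓝 ⟨t₀, h₀⟩) (𝓝 r₀) →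
      Tendsto (fun t => F t (r t)) (𝓝 ⟨t₀, h₀⟩) (𝓝 (F₀ r₀)) := fun hF hr =>
    ((continuous_eval (F := BoundedContinuousFunction ℝ (L2seq ι))).tendsto _).comp
      (hF.prodMk_nhds hr)
  -- Two evaluations are needed: at the moving time t for the value itself, and at s₁ for the end
  -- value that enters the correction.
  have hJ : ∀ (a : ℝ → ℝ), (∀ t, a t = t) ∨ (∀ t, a t = D.s₁) →
      Tendsto (fun t : Iic D.s₁ => jumpP (D := D) t.2 v (a t)) (𝓝 ⟨t₀, h₀⟩)
        (𝓝 (jumpP (D := D) h₀ v (a t₀))) := fun a ha => by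
    have hlw := D.continuous_lw
    have hac : Continuous a := by
      rcases ha with ha | ha
      · rw [funext ha]; exact continuous_id
      · rw [funext ha]; exact continuous_const
    refine L2seq.tendsto_dmul (Eventually.of_forall fun t i => D.abs_gk_le_Ω t.2 i)
      (fun i => D.abs_gk_le_Ω h₀ i) (fun i => ?_) v
    simp only [gk, le_max_right, if_true]
    have h1 : ContinuousAt (fun t : ℝ => Real.exp (D.μ i * (max (a t) t - t) + D.lw t
        - D.lw (max (a t) t)) * (1 - D.un i t)) t₀ :=
      ContinuousAt.mul (Continuous.continuousAt (by fun_prop))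
        (continuousAt_const.sub (continuousAt_un hS i))
    exact h1.tendsto.comp hval
  have h1 := hJ (fun t => t) (Or.inl fun _ => rfl)
  have h2 := hJ (fun _ => D.s₁) (Or.inr fun _ => rfl)
  have h3 := heval hZ (tendsto_const_nhds (x := D.s₁))
  have h4 : Tendsto (fun t : Iic D.s₁ => corr (D := D) t.2 g q v) (𝓝 ⟨t₀, h₀⟩)
      (𝓝 (corr (D := D) h₀ g q v)) := by
    have h5 := (h2.add h3).const_smul (Real.exp (D.lw D.s₁) : ℂ)
    exact (((Yop q).comp ((coef (g.comp (endOp q)) (L2seq.cproj D.F)).comp g)).continuous.tendsto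
      _).comp h5
  exact (h1.add (heval hZ hval)).sub (heval h4 hval)

end Splitting

end Bilaplace

namespace Bilaplace

/-! ### Families of solutions with prescribed jumps -/

section Conj

variable {ι : Type} {μ : ι → ℝ} {C C' : ℝ → L2seq ι →L[ℂ] L2seq ι}

theorem IsMild.map {I : Set ℝ} [I.OrdConnected] {U : ℝ → L2seq ι} (h : IsMild μ C I U)
    {g : L2seq ι →L[ℂ] L2seq ι} {a : ι → ℂ} (hg : ∀ v i, g v i = a i * v i)
    (hC : ∀ᵐ σ : ℝ, σ ∈ I → ∀ v, g (C σ v) = C' σ (g v)) : IsMild μ C' I fun s => g (U s) := by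
  refine ⟨g.continuous.comp_continuousOn h.1, fun s hs r hr hsr i => ?_⟩
  have e : ∫ σ in s..r, (Real.exp (μ i * (r - σ)) : ℂ) * C' σ (g (U σ)) i
      = ∫ σ in s..r, a i * ((Real.exp (μ i * (r - σ)) : ℂ) * C σ (U σ) i) := by
    refine intervalIntegral.integral_congr_ae ?_
    filter_upwards [hC] with σ hσ hσI
    rw [uIoc_of_le hsr] at hσI
    rw [← hσ ((‹I.OrdConnected›.out hs hr) ⟨hσI.1.le, hσI.2⟩), hg]
    ring
  rw [e, intervalIntegral.integral_const_mul, hg, hg, h.2 s hs r hr hsr i]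
  ring

/-- A diagonal scaling commutes with the free evolution, hence maps mild solutions to mild solutions
and preserves growth rates. The inner product ⟪g x, g y⟫ in scaled coordinates is the standard one
in the original coordinates. The resulting jump problem therefore does not depend on the scaling. -/
theorem IsJump.conj {s₁ κ : ℝ} {g g' : L2seq ι →L[ℂ] L2seq ι} {a a' : ι → ℂ}
    (hg : ∀ v i, g v i = a i * v i) (hg' : ∀ v i, g' v i = a' i * v i) (h₁ : ∀ v, g (g' v) = v)
    (hC : ∀ᵐ σ ∂volume.restrict (Iic s₁), ∀ v, C' σ v = g' (C σ (g v))) {t : ℝ} (ht : t ≤ s₁)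
    {v : L2seq ι} {Wm Wp : ℝ → L2seq ι} (h : IsJump μ C' s₁ κ g t (g' v) Wm Wp) :
    IsJump μ C s₁ κ (ContinuousLinearMap.id ℂ _) t v (fun s => g (Wm s)) fun s => g (Wp s) := by
  rw [ae_restrict_iff' measurableSet_Iic] at hC
  have hC₁ : ∀ᵐ σ : ℝ, σ ∈ Iic s₁ → ∀ v, g (C' σ v) = C σ (g v) := by
    filter_upwards [hC] with σ hσ hs v
    rw [hσ hs, h₁]
  have hC₂ : ∀ᵐ σ : ℝ, σ ∈ Iic s₁ → ∀ v, g' (C σ v) = C' σ (g' v) := by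
    filter_upwards [hC] with σ hσ hs v
    rw [hσ hs, h₁]
  refine ⟨h.mild_m.map hg (hC₁.mono fun σ hσ hs => hσ hs.2),
    h.mild_p.map hg (hC₁.mono fun σ hσ hs => hσ (le_trans hs ht)), ?_, ?_, ?_⟩
  · obtain ⟨c, hc⟩ := h.growth
    refine ⟨‖g‖ * c, fun s hs => (g.le_opNorm _).trans ?_⟩
    rw [mul_assoc]
    exact mul_le_mul_of_nonneg_left (hc s hs) (norm_nonneg _)
  · rw [← map_add, h.jump, h₁]
  · rintro x ⟨Y, hY, ⟨c, hc⟩, rfl⟩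
    have h2 := h.orth (g' (Y s₁)) ⟨fun s => g' (Y s), hY.map hg' hC₂,
      ⟨‖g'‖ * c, fun s hs => (g'.le_opNorm _).trans (by
        rw [mul_assoc]
        exact mul_le_mul_of_nonneg_left (hc s hs) (norm_nonneg _))⟩, rfl⟩
    rw [h₁] at h2
    exact h2

end Conj

/-- Restriction of bounded continuous curves to `I`, with a weight. -/
def restr {H : Type} [NormedAddCommGroup H] [NormedSpace ℂ H] (I : Set ℝ) (a : ℝ → ℝ)
    (ha : Continuous a) (c : ℝ) (hc : ∀ s ∈ I, |a s| ≤ c) :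
    BoundedContinuousFunction ℝ H →L[ℂ] BoundedContinuousFunction I H :=
  LinearMap.mkContinuous
    { toFun := fun f => BoundedContinuousFunction.ofNormedAddCommGroup
        (fun s : I => (a s : ℂ) • f s)
        (by
          have : Continuous fun s : I => (a s : ℂ) := by fun_prop
          exact this.smul (f.continuous.comp continuous_subtype_val))
        (|c| * ‖f‖) (fun s => by
          rw [norm_smul, Complex.norm_real, Real.norm_eq_abs]
          exact mul_le_mul ((hc s s.2).trans (le_abs_self c)) (f.norm_coe_le_norm s)
            (norm_nonneg _) (abs_nonneg c))
      map_add' := fun f g => by ext1 s; exact smul_add _ _ _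
      map_smul' := fun z f => by ext1 s; exact smul_comm _ _ _ }
    |c| (fun f => (BoundedContinuousFunction.norm_le (by positivity)).2 fun s => by
      change ‖(a s : ℂ) • f s‖ ≤ _
      rw [norm_smul, Complex.norm_real, Real.norm_eq_abs]
      exact mul_le_mul ((hc s s.2).trans (le_abs_self c)) (f.norm_coe_le_norm s)
        (norm_nonneg _) (abs_nonneg c))

/-! ### Families of jump solutions, first near one parameter, then for all parameters -/

section Families

variable {ι E : Type} [Countable ι] [NormedAddCommGroup E] [NormedSpace ℝ E]

/-- `Φm`, `Φp` are the families of solutions with prescribed jumps for the parameters in `O`,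
with estimates at `p₀` and smooth dependence at `p₀`. -/
structure LocalSol (μ : ι → ℝ) (C : E → ℝ → L2seq ι →L[ℂ] L2seq ι) (s₁ κ κ' : ℝ) (p₀ : E)
    (S₀ : ℝ) (O : Set E) (Φm Φp : E → ℝ → ℝ → L2seq ι →L[ℂ] L2seq ι) : Prop where
  mem : O ∈ 𝓝 p₀
  jump : ∀ p ∈ O, ∀ t ≤ s₁, ∀ v, IsJump μ (C p) s₁ κ (ContinuousLinearMap.id ℂ _) t v
    (fun s => Φm p s t v) fun s => Φp p s t v
  bound : ∃ K > 0, ∀ t ≤ s₁,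
    (∀ s, t ≤ s → s ≤ s₁ → ∀ v, ‖Φm p₀ s t v‖ ≤ K * Real.exp (κ * (s - t)) * ‖v‖) ∧
    (∀ s, s ≤ t → ∀ v, ‖Φp p₀ s t v‖ ≤ K * Real.exp (κ' * (s - t)) * ‖v‖)
  cont : ∀ t₀, S₀ < t₀ → t₀ ≤ s₁ → ∀ v,
    ContinuousWithinAt (fun t => Φm p₀ t t v) (Iic s₁) t₀
  smooth_m : ∀ t ≤ s₁, ∃ F : E → L2seq ι →L[ℂ]
      BoundedContinuousFunction ↥(Iic s₁ ∩ Ici t) (L2seq ι), ContDiffAt ℝ ∞ F p₀ ∧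
    ∀ p ∈ O, ∀ v, ∀ s : ↥(Iic s₁ ∩ Ici t), F p v s = (Real.exp (-κ * (s - t)) : ℂ) • Φm p s t v
  smooth_p : ∀ t ≤ s₁, ∃ F : E → L2seq ι →L[ℂ]
      BoundedContinuousFunction ↥(Iic s₁ ∩ Iic t) (L2seq ι), ContDiffAt ℝ ∞ F p₀ ∧
    ∀ p ∈ O, ∀ v, ∀ s : ↥(Iic s₁ ∩ Iic t), F p v s = (Real.exp (-κ' * (s - t)) : ℂ) • Φp p s t v

/-- A splitting with a scaling of the modes, for which a family of perturbations is small. -/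
theorem Splitting.exists_localSol (D : Splitting ι) (hM : D.M.Finite)
    (hF : ∀ i ∈ D.F, D.μ i < D.κ) {κ' : ℝ}
    (h₁ : κ' + D.L ≤ D.ν) (h₂ : ∀ i ∈ D.F, D.μ i ≤ κ') (h₃ : ∀ i ∉ D.F, κ' + D.δ ≤ D.μ i)
    (h₄ : ∀ i ∈ D.O, i ∈ D.F → D.μ i + D.δ ≤ κ') (hκ : D.κ ≤ κ')
    {g g' : L2seq ι →L[ℂ] L2seq ι} {a a' : ι → ℂ} (hg : ∀ v i, g v i = a i * v i)
    (hg' : ∀ v i, g' v i = a' i * v i) (hgg : ∀ v, g (g' v) = v) (hgg' : ∀ v, g' (g v) = v)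
    {C : E → ℝ → L2seq ι →L[ℂ] L2seq ι} (hCi : ∀ p a, IntegrableOn (C p) (Icc a D.s₁))
    {q : E → Pert ι D.s₁} (hq : ContDiff ℝ ∞ q)
    (hC : ∀ p, ∀ᵐ σ ∂volume.restrict (Iic D.s₁), ∀ v, pert D.N (q p) σ v = g' (C p σ (g v)))
    {p₀ : E} (hs : D.Small (q p₀)) (hs' : (D.withRate κ' h₁ h₂ h₃ h₄).Small (q p₀)) :
    ∃ O Φm Φp, LocalSol D.μ C D.s₁ D.κ κ' p₀ D.S O Φm Φp := by
  classical
  set D' := D.withRate κ' h₁ h₂ h₃ h₄ with hD'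
  obtain ⟨cg, hcg, hgl⟩ : ∃ cg > 0, ∀ x, cg * ‖x‖ ≤ ‖g x‖ := by
    refine ⟨(1 + ‖g'‖)⁻¹, by positivity, fun x => ?_⟩
    rw [inv_mul_le_iff₀ (by positivity)]
    conv_lhs => rw [← hgg' x]
    refine (g'.le_opNorm _).trans (mul_le_mul_of_nonneg_right ?_ (norm_nonneg _))
    linarith
  let O : Set E := {p | D.Small (q p)} ∩ {p | D'.Small (q p)}
  have hO : IsOpen O := ((D.isOpen_small).preimage hq.continuous).inter
    ((D'.isOpen_small).preimage hq.continuous)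
  let Φm : E → ℝ → ℝ → L2seq ι →L[ℂ] L2seq ι := fun p s t => if ht : t ≤ D.s₁ then
    g.comp ((D.sol t s (Splitting.FM (D := D) ht g (q p))).comp g') else 0
  let Φp : E → ℝ → ℝ → L2seq ι →L[ℂ] L2seq ι := fun p s t => if ht : t ≤ D.s₁ then
    g.comp ((D'.sol t s (Splitting.FP (D := D') ht g (q p))).comp g') else 0
  have em : ∀ p s t (ht : t ≤ D.s₁) v, Φm p s t v
      = g (D.sol t s (Splitting.FM (D := D) ht g (q p)) (g' v)) := fun p s t ht v => by
    simp only [Φm, dif_pos ht]; rfl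
  have ep : ∀ p s t (ht : t ≤ D.s₁) v, Φp p s t v
      = g (D'.sol t s (Splitting.FP (D := D') ht g (q p)) (g' v)) := fun p s t ht v => by
    simp only [Φp, dif_pos ht]; rfl
  have hgz : ∀ x : L2seq ι, ContinuousLinearMap.id ℂ (L2seq ι) x = 0 → x = 0 := fun x hx => hx
  refine ⟨O, Φm, Φp, hO.mem_nhds ⟨hs, hs'⟩, fun p hp t ht v => ?_, ?_, ?_, ?_, ?_⟩
  · have hE := Splitting.EU_subset_range hp.1 hF
    have hE' : EU D'.μ (pert D'.N (q p)) D'.s₁ D.κ ⊆ range (Splitting.endOp (D := D') (q p)) := by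
      rw [Splitting.endOp_withRate h₁ h₂ h₃ h₄ hκ hp.1 hp.2]; exact hE
    have j₁ := (hp.1.isJump hM hcg hgl le_rfl hE ht (g' v)).conj hg hg' hgg (hC p) ht
    have j₂ := (hp.2.isJump (D := D') hM hcg hgl hκ hE' ht (g' v)).conj hg hg' hgg (hC p) ht
    -- The part after t is taken from the splitting with rate κ and the part before t from the one
    -- with rate κ'. Both splittings solve the same jump problem, so by uniqueness the two halves
    -- fit together.
    have hu := (j₁.unique hgz (hCi p) ht j₂).1 (⟨le_rfl, ht⟩ : t ∈ Icc t D.s₁)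
    simp only [em p _ t ht, ep p _ t ht]
    refine ⟨j₁.mild_m, j₂.mild_p, j₂.growth, ?_, j₁.orth⟩
    exact (congrArg (· + _) hu).trans j₂.jump
  · obtain ⟨c, hc0, hc⟩ := Splitting.Small.exists_bound hs g
    obtain ⟨c', hc0', hc'⟩ := Splitting.Small.exists_bound hs' g
    set e := Real.exp ((D.ν - D.κ) * (D.s₁ - D.S))
    have he : 0 < e := Real.exp_pos _
    have hle1 : ‖g‖ * (e * c * ‖g'‖) ≤ ‖g‖ * ((e * c + c') * ‖g'‖) + 1 := by
      have h5 : 0 ≤ ‖g‖ * (c' * ‖g'‖) := by positivity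
      nlinarith
    have hle2 : ‖g‖ * (c' * ‖g'‖) ≤ ‖g‖ * ((e * c + c') * ‖g'‖) + 1 := by
      have h5 : 0 ≤ ‖g‖ * (e * c * ‖g'‖) := by positivity
      nlinarith
    refine ⟨‖g‖ * ((e * c + c') * ‖g'‖) + 1, by positivity, fun t ht => ⟨fun s hts hss v => ?_,
      fun s hst v => ?_⟩⟩
    · rw [em p₀ s t ht]
      have h5 := Splitting.norm_sol_forward_le (t := t) hss (hc t ht).1 (g' v)
      have h6 := g'.le_opNorm v
      calc _ ≤ ‖g‖ * (e * c * Real.exp (D.κ * (s - t)) * (‖g'‖ * ‖v‖)) := by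
            refine (g.le_opNorm _).trans (mul_le_mul_of_nonneg_left (h5.trans ?_) (norm_nonneg _))
            gcongr
        _ = ‖g‖ * (e * c * ‖g'‖) * Real.exp (D.κ * (s - t)) * ‖v‖ := by ring
        _ ≤ _ := by gcongr
    · rw [ep p₀ s t ht]
      have h5 : ‖D'.sol t s (Splitting.FP (D := D') ht g (q p₀)) (g' v)‖
          ≤ c' * Real.exp (κ' * (s - t)) * ‖g' v‖ :=
        Splitting.norm_sol_backward_le (D := D') hst (hc' t ht).2 (g' v)
      have h6 := g'.le_opNorm v
      calc _ ≤ ‖g‖ * (c' * Real.exp (κ' * (s - t)) * (‖g'‖ * ‖v‖)) := by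
            refine (g.le_opNorm _).trans (mul_le_mul_of_nonneg_left (h5.trans ?_) (norm_nonneg _))
            gcongr
        _ = ‖g‖ * (c' * ‖g'‖) * Real.exp (κ' * (s - t)) * ‖v‖ := by ring
        _ ≤ _ := by gcongr
  · intro t₀ hS h₀ v
    have h5 := Splitting.tendsto_FM_self (D := D) g (q p₀) (g' v) h₀ hS
    have h6 : Tendsto (fun t : Iic D.s₁ => Φm p₀ t t v) (𝓝 ⟨t₀, h₀⟩) (𝓝 (Φm p₀ t₀ t₀ v)) := by
      have e1 : ∀ t (ht : t ≤ D.s₁), Φm p₀ t t v = g (Splitting.FM (D := D) ht g (q p₀) (g' v) t) :=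
        fun t ht => by
        rw [em p₀ t t ht, Splitting.sol_apply]; simp
      rw [e1 t₀ h₀]
      refine ((g.continuous.tendsto _).comp h5).congr fun t => (e1 t t.2).symm
    exact (continuousWithinAt_iff_continuousAt_domRestrict (fun t => Φm p₀ t t v)
      (s := Iic D.s₁) (mem_Iic.2 h₀)).2 h6
  · intro t ht
    have hlw := D.continuous_lw
    let w : ℝ → ℝ := fun s => Real.exp (-D.κ * (s - t)) * Real.exp (D.lw s - D.lw t)
    have hw : Continuous w := by fun_prop
    have hwb : ∀ s ∈ Iic D.s₁ ∩ Ici t, |w s| ≤ Real.exp ((D.ν - D.κ) * (D.s₁ - D.S)) := by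
      intro s hs
      have h5 := Splitting.lw_le hs.1
      have h6 := D.lw_ge t
      rw [abs_of_pos (by positivity)]
      simp only [w]
      rw [← Real.exp_add]
      exact Real.exp_le_exp.2 (by linarith)
    let R := restr (H := L2seq ι) (Iic D.s₁ ∩ Ici t) w hw _ hwb
    let G : BoundedContinuousFunction ℝ (L2seq ι) →L[ℂ] BoundedContinuousFunction ℝ (L2seq ι) :=
      g.compLeftContinuousBounded ℝ
    refine ⟨fun p => R.comp (G.comp ((Splitting.FM (D := D) ht g (q p)).comp g')), ?_, ?_⟩
    · exact contDiffAt_comp contDiffAt_const (contDiffAt_comp contDiffAt_const (contDiffAt_comp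
        (Splitting.contDiffAt_FM hM hcg hgl ht hq.contDiffAt hs) contDiffAt_const))
    · intro p _ v s
      rw [em p s t ht, Splitting.sol_apply, map_smul, smul_smul, ← Complex.ofReal_mul]
      rfl
  · intro t ht
    have hlw := D'.continuous_lw
    let w : ℝ → ℝ := fun s => Real.exp (-κ' * (s - t)) * Real.exp (D'.lw s - D'.lw t)
    have hw : Continuous w := by fun_prop
    have hwb : ∀ s ∈ Iic D.s₁ ∩ Iic t, |w s| ≤ 1 := by
      intro s hs
      have h5 : κ' * (t - s) ≤ D'.lw t - D'.lw s := D'.lw_sub_ge hs.2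
      rw [abs_of_pos (by positivity)]
      simp only [w]
      rw [← Real.exp_add]
      exact Real.exp_le_one_iff.2 (by linarith)
    let R := restr (H := L2seq ι) (Iic D.s₁ ∩ Iic t) w hw _ hwb
    let G : BoundedContinuousFunction ℝ (L2seq ι) →L[ℂ] BoundedContinuousFunction ℝ (L2seq ι) :=
      g.compLeftContinuousBounded ℝ
    refine ⟨fun p => R.comp (G.comp ((Splitting.FP (D := D') ht g (q p)).comp g')), ?_, ?_⟩
    · exact contDiffAt_comp contDiffAt_const (contDiffAt_comp contDiffAt_const (contDiffAt_comp
        (Splitting.contDiffAt_FP (D := D') hM hcg hgl ht hq.contDiffAt hs') contDiffAt_const))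
    · intro p _ v s
      rw [ep p s t ht, Splitting.sol_apply, map_smul, smul_smul, ← Complex.ofReal_mul]
      rfl

/-- The families of solutions with prescribed jumps for all parameters, with estimates and smooth
dependence. -/
structure GlobalSol (μ : ι → ℝ) (C : E → ℝ → L2seq ι →L[ℂ] L2seq ι) (s₁ κ κ' : ℝ)
    (Φm Φp : E → ℝ → ℝ → L2seq ι →L[ℂ] L2seq ι) : Prop where
  jump : ∀ p, ∀ t ≤ s₁, ∀ v, IsJump μ (C p) s₁ κ (ContinuousLinearMap.id ℂ _) t v
    (fun s => Φm p s t v) fun s => Φp p s t v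
  bound : ∀ p, ∃ K > 0, ∀ t ≤ s₁,
    (∀ s, t ≤ s → s ≤ s₁ → ∀ v, ‖Φm p s t v‖ ≤ K * Real.exp (κ * (s - t)) * ‖v‖) ∧
    (∀ s, s ≤ t → ∀ v, ‖Φp p s t v‖ ≤ K * Real.exp (κ' * (s - t)) * ‖v‖)
  cont : ∀ p v, ContinuousOn (fun t => Φm p t t v) (Iic s₁)
  smooth_m : ∀ t ≤ s₁, ∃ F : E → L2seq ι →L[ℂ]
      BoundedContinuousFunction ↥(Iic s₁ ∩ Ici t) (L2seq ι), ContDiff ℝ ∞ F ∧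
    ∀ p v, ∀ s : ↥(Iic s₁ ∩ Ici t), F p v s = (Real.exp (-κ * (s - t)) : ℂ) • Φm p s t v
  smooth_p : ∀ t ≤ s₁, ∃ F : E → L2seq ι →L[ℂ]
      BoundedContinuousFunction ↥(Iic s₁ ∩ Iic t) (L2seq ι), ContDiff ℝ ∞ F ∧
    ∀ p v, ∀ s : ↥(Iic s₁ ∩ Iic t), F p v s = (Real.exp (-κ' * (s - t)) : ℂ) • Φp p s t v

/-- The jump problem mentions neither the splitting nor the scaling, so the local families agree on
common parameters. Each property is local in the parameter or in the initial time and can be read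
off from a suitable local family. -/
theorem exists_globalSol {μ : ι → ℝ} {C : E → ℝ → L2seq ι →L[ℂ] L2seq ι} {s₁ κ κ' : ℝ}
    (hCi : ∀ p a, IntegrableOn (C p) (Icc a s₁))
    (h : ∀ p₀, ∀ S₀ < s₁, ∃ O Φm Φp, LocalSol μ C s₁ κ κ' p₀ S₀ O Φm Φp) :
    ∃ Φm Φp, GlobalSol μ C s₁ κ κ' Φm Φp := by
  choose! O Φm Φp hL using fun p₀ => h p₀
  have hgz : ∀ x : L2seq ι, ContinuousLinearMap.id ℂ (L2seq ι) x = 0 → x = 0 := fun x hx => hx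
  -- One admissible cut is fixed to define the global family; its value is irrelevant by uniqueness.
  have hS : s₁ - 1 < s₁ := by linarith
  have hL' := fun p => hL p (s₁ - 1) hS
  have hmem : ∀ p S, S < s₁ → p ∈ O p S := fun p S hS => mem_of_mem_nhds (hL p S hS).mem
  have hu : ∀ p₀ S, S < s₁ → ∀ p ∈ O p₀ S, ∀ t ≤ s₁, ∀ v,
      EqOn (fun s => Φm p (s₁ - 1) p s t v) (fun s => Φm p₀ S p s t v) (Icc t s₁) ∧
      EqOn (fun s => Φp p (s₁ - 1) p s t v) (fun s => Φp p₀ S p s t v) (Iic t) :=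
    fun p₀ S hS' p hp t ht v => ((hL' p).jump p (hmem p _ hS) t ht v).unique hgz (hCi p) ht
      ((hL p₀ S hS').jump p hp t ht v)
  refine ⟨fun p => Φm p (s₁ - 1) p, fun p => Φp p (s₁ - 1) p,
    fun p => (hL' p).jump p (hmem p _ hS), fun p => (hL' p).bound, ?_, ?_, ?_⟩
  · intro p v t₀ ht₀
    -- For continuity at t₀ the family is replaced by one whose cut lies below t₀.
    have hS' : t₀ - 1 < s₁ := by linarith [mem_Iic.1 ht₀]
    refine ((hL p (t₀ - 1) hS').cont t₀ (by linarith) ht₀ v).congr (fun t ht => ?_) ?_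
    · exact (hu p (t₀ - 1) hS' p (hmem p _ hS') t ht v).1 ⟨le_rfl, ht⟩
    · exact (hu p (t₀ - 1) hS' p (hmem p _ hS') t₀ ht₀ v).1 ⟨le_rfl, ht₀⟩
  · intro t ht
    choose F hF hFe using fun p => (hL' p).smooth_m t ht
    refine ⟨fun p => F p p, contDiff_iff_contDiffAt.2 fun p₀ => (hF p₀).congr_of_eventuallyEq ?_,
      fun p v s => hFe p p (hmem p _ hS) v s⟩
    filter_upwards [(hL' p₀).mem] with p hp
    ext v : 1
    ext1 s
    rw [hFe p p (hmem p _ hS), hFe p₀ p hp]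
    congr 1
    exact (hu p₀ _ hS p hp t ht v).1 ⟨s.2.2, s.2.1⟩
  · intro t ht
    choose F hF hFe using fun p => (hL' p).smooth_p t ht
    refine ⟨fun p => F p p, contDiff_iff_contDiffAt.2 fun p₀ => (hF p₀).congr_of_eventuallyEq ?_,
      fun p v s => hFe p p (hmem p _ hS) v s⟩
    filter_upwards [(hL' p₀).mem] with p hp
    ext v : 1
    ext1 s
    rw [hFe p p (hmem p _ hS), hFe p₀ p hp]
    congr 1
    exact (hu p₀ _ hS p hp t ht v).2 s.2.2

end Families

end Bilaplace

namespace Bilaplace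

/-! ### Diagonal coordinates -/

/-- The modes: a frequency, a block (`true` for `(u₁, u₂)`, `false` for `(u₃, u₄)`) and a sign. -/
abbrev Mode : Type := ℤ × Bool × Bool

/-- The value `±1` of a sign. -/
def sg (b : Bool) : ℝ := if b then 1 else -1

theorem abs_sg (b : Bool) : |sg b| = 1 := by cases b <;> simp [sg]

/-- The eigenvalue of a mode. -/
def ev (i : Mode) : ℝ := sg i.2.2 * |(i.1 : ℝ)|

theorem wt_one_sq (k : ℤ) : wt 1 k ^ 2 = 1 + (k : ℝ) ^ 2 := by
  unfold wt
  rw [← Real.rpow_natCast, ← Real.rpow_mul (by positivity)]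
  norm_num

theorem wt_two (k : ℤ) : wt 2 k = wt 1 k ^ 2 := by
  rw [wt_one_sq]; simp [wt]

theorem wt_three (k : ℤ) : wt 3 k = wt 1 k ^ 3 := by
  have := wt_add_two 1 k
  rw [show (3 : ℝ) = 1 + 2 by norm_num, this, ← wt_one_sq]; ring

theorem one_le_wt_one (k : ℤ) : 1 ≤ wt 1 k := by
  have h1 := wt_one_sq k
  have h2 := wt_pos 1 k
  nlinarith [sq_nonneg (k : ℝ)]

theorem abs_le_wt_one (k : ℤ) : |(k : ℝ)| ≤ wt 1 k :=
  abs_le_of_sq_le_sq (by rw [wt_one_sq]; linarith) (wt_pos 1 k).le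

theorem wt_one_le (k : ℤ) : wt 1 k ≤ 1 + |(k : ℝ)| := by
  refine le_of_sq_le_sq ?_ (by positivity)
  rw [wt_one_sq, ← sq_abs (k : ℝ)]
  nlinarith [abs_nonneg (k : ℝ)]

theorem HS.norm_eq (σ : ℝ) (u : HS σ) : ‖u‖ = ‖(HS.toL2 σ u : L2seq ℤ)‖ := rfl

theorem HS.norm_sq' {σ : ℝ} (u : HS σ) : ‖u‖ ^ 2 = ∑' k, (wt σ k * ‖u.coeff k‖) ^ 2 := by
  rw [HS.norm_eq, L2seq.norm_sq]
  refine tsum_congr fun k => ?_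
  change ‖(wt σ k : ℂ) * u.coeff k‖ ^ 2 = _
  rw [norm_mul, Complex.norm_real, Real.norm_of_nonneg (wt_pos σ k).le]

theorem HS.summable_sq {σ : ℝ} (u : HS σ) : Summable fun k => (wt σ k * ‖u.coeff k‖) ^ 2 := by
  refine (L2seq.summable_sq (HS.toL2 σ u)).congr fun k => ?_
  change ‖(wt σ k : ℂ) * u.coeff k‖ ^ 2 = _
  rw [norm_mul, Complex.norm_real, Real.norm_of_nonneg (wt_pos σ k).le]

theorem hasSum_mode {f : ℤ → ℝ} (hf : Summable f) (h0 : ∀ k, 0 ≤ f k) :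
    Summable (fun i : Mode => f i.1) ∧ ∑' i : Mode, f i.1 = 4 * ∑' k, f k := by
  have h1 : Summable fun _ : Bool × Bool => (1 : ℝ) := Summable.of_finite
  have h2 : Summable fun i : Mode => f i.1 * 1 :=
    hf.mul_of_nonneg h1 h0 fun _ => zero_le_one
  have h3 := hf.tsum_mul_tsum h1 h2
  refine ⟨by simpa using h2, ?_⟩
  have h4 : ∑' _ : Bool × Bool, (1 : ℝ) = 4 := by simp
  rw [h4] at h3
  rw [mul_comm, h3]
  simp

/-- The map from a Sobolev space to the modes which multiplies Fourier coefficients. -/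
def fromHS (σ : ℝ) (a : Mode → ℝ) (c : ℝ) (h : ∀ i, |a i| ≤ c * wt σ i.1) :
    HS σ →L[ℂ] L2seq Mode :=
  have hle : ∀ (u : HS σ) (i : Mode), ‖(a i : ℂ) * u.coeff i.1‖ ^ 2
      ≤ c ^ 2 * (wt σ i.1 * ‖u.coeff i.1‖) ^ 2 := fun u i => by
    rw [← mul_pow, norm_mul, Complex.norm_real, Real.norm_eq_abs, ← mul_assoc]
    exact pow_le_pow_left₀ (by positivity)
      (mul_le_mul_of_nonneg_right (h i) (norm_nonneg _)) 2
  have hs := fun u : HS σ => hasSum_mode (HS.summable_sq u) fun _ => sq_nonneg _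
  have hmem : ∀ u : HS σ, Memℓp (fun i : Mode => (a i : ℂ) * u.coeff i.1) 2 := fun u =>
    L2seq.memℓp_iff.2 (Summable.of_nonneg_of_le (fun _ => sq_nonneg _) (hle u)
      ((hs u).1.mul_left _))
  LinearMap.mkContinuous
    { toFun := fun u => ⟨fun i => (a i : ℂ) * u.coeff i.1, hmem u⟩
      map_add' := fun u v => L2seq.ext_apply fun i => mul_add _ _ _
      map_smul' := fun z u => L2seq.ext_apply fun i => mul_left_comm _ _ _ }
    -- Each frequency carries four modes, so squared norms gain a factor 4.
    (2 * |c|) (fun u => by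
      refine le_of_sq_le_sq ?_ (by positivity)
      rw [L2seq.norm_sq]
      refine ((L2seq.memℓp_iff.1 (hmem u)).tsum_le_tsum (hle u) ((hs u).1.mul_left _)).trans ?_
      rw [tsum_mul_left, (hs u).2, ← HS.norm_sq', mul_pow, mul_pow, sq_abs]
      linarith)

@[simp] theorem fromHS_apply (σ : ℝ) (a : Mode → ℝ) (c : ℝ) (h : ∀ i, |a i| ≤ c * wt σ i.1)
    (u : HS σ) (i : Mode) : fromHS σ a c h u i = a i * u.coeff i.1 := rfl

/-- The map from the modes of a given block and sign to a Sobolev space which multiplies the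
coordinates. -/
def toHS (σ : ℝ) (b : Bool × Bool) (a : ℤ → ℝ) (c : ℝ) (h : ∀ k, wt σ k * |a k| ≤ c) :
    L2seq Mode →L[ℂ] HS σ :=
  have hinj : Function.Injective fun k : ℤ => ((k, b) : Mode) := fun k l h => congrArg Prod.fst h
  have hle : ∀ (v : L2seq Mode) (k : ℤ), (wt σ k * ‖(a k : ℂ) * v (k, b)‖) ^ 2
      ≤ c ^ 2 * ‖v (k, b)‖ ^ 2 := fun v k => by
    have := wt_pos σ k
    rw [← mul_pow, norm_mul, Complex.norm_real, Real.norm_eq_abs, ← mul_assoc]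
    exact pow_le_pow_left₀ (by positivity) (mul_le_mul_of_nonneg_right (h k) (norm_nonneg _)) 2
  have hs : ∀ v : L2seq Mode, Summable fun k : ℤ => ‖v (k, b)‖ ^ 2 := fun v =>
    (L2seq.summable_sq v).comp_injective hinj
  have hmem : ∀ v : L2seq Mode, Memℓp (fun k : ℤ => (wt σ k : ℂ) * ((a k : ℂ) * v (k, b))) 2 :=
    fun v => L2seq.memℓp_iff.2 (Summable.of_nonneg_of_le (fun _ => sq_nonneg _) (fun k => by
      rw [norm_mul, Complex.norm_real, Real.norm_of_nonneg (wt_pos σ k).le]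
      exact hle v k) ((hs v).mul_left _))
  LinearMap.mkContinuous
    { toFun := fun v => HS.mk (fun k => (a k : ℂ) * v (k, b)) (hmem v)
      map_add' := fun u v => HS.ext fun k => mul_add _ _ _
      map_smul' := fun z u => HS.ext fun k => mul_left_comm _ _ _ }
    |c| (fun v => by
      refine le_of_sq_le_sq ?_ (by positivity)
      rw [HS.norm_sq', mul_pow, sq_abs, L2seq.norm_sq]
      calc _ ≤ ∑' k, c ^ 2 * ‖v (k, b)‖ ^ 2 :=
            (HS.summable_sq (HS.mk _ (hmem v))).tsum_le_tsum (hle v) ((hs v).mul_left _)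
        _ = c ^ 2 * ∑' k, ‖v (k, b)‖ ^ 2 := tsum_mul_left
        _ ≤ _ := mul_le_mul_of_nonneg_left (tsum_comp_le_tsum_of_inj (L2seq.summable_sq v)
            (fun _ => sq_nonneg _) hinj) (sq_nonneg c))

@[simp] theorem coeff_toHS (σ : ℝ) (b : Bool × Bool) (a : ℤ → ℝ) (c : ℝ)
    (h : ∀ k, wt σ k * |a k| ≤ c) (v : L2seq Mode) (k : ℤ) :
    (toHS σ b a c h v).coeff k = a k * v (k, b) := rfl

@[simp] theorem HS.coeff_sub {σ : ℝ} (u v : HS σ) (k : ℤ) :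
    (u - v).coeff k = u.coeff k - v.coeff k := rfl

/-! ### Coordinates in which the leading part is diagonal up to a small nilpotent term -/

section Psi

/-- The frequency, with `0` replaced by `ε`. -/
def dd (ε : ℝ) (k : ℤ) : ℝ := if k = 0 then ε else |(k : ℝ)|

variable {ε : ℝ}

theorem dd_pos (hε : 0 < ε) (k : ℤ) : 0 < dd ε k := by
  unfold dd
  split_ifs with h
  · exact hε
  · have : (k : ℝ) ≠ 0 := by exact_mod_cast h
    positivity

theorem dd_le (hε : 0 < ε) (k : ℤ) : dd ε k ≤ (1 + ε) * wt 1 k := by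
  have h1 := one_le_wt_one k
  have h2 := abs_le_wt_one k
  unfold dd
  split_ifs with h <;> nlinarith

theorem wt_le_dd (hε : 0 < ε) (k : ℤ) : wt 1 k ≤ (2 + 1 / ε) * dd ε k := by
  have h0 : (1 / ε) * ε = 1 := by field_simp
  have h3 : 0 < 1 / ε := by positivity
  unfold dd
  split_ifs with h
  · subst h
    have : wt 1 0 = 1 := by simp [wt]
    rw [this]; nlinarith
  · have h1 := wt_one_le k
    have h2 : (1 : ℝ) ≤ |(k : ℝ)| := by exact_mod_cast Int.one_le_abs h
    nlinarith

/-- The coordinates of `u₁`. -/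
def in₁ (hε : 0 < ε) : HS 2 →L[ℂ] L2seq Mode :=
  fromHS 2 (fun i => if i.2.1 then wt 1 i.1 * dd ε i.1 / 2 else 0) (1 + ε) fun i => by
    have h1 := wt_pos 1 i.1
    have h2 := dd_pos hε i.1
    have h3 := dd_le hε i.1
    rw [wt_two]
    split_ifs
    · rw [abs_of_pos (by positivity)]; nlinarith [mul_pos h1 h2]
    · rw [abs_zero]; positivity

/-- The coordinates of `u₂`. -/
def in₂ : HS 1 →L[ℂ] L2seq Mode :=
  fromHS 1 (fun i => if i.2.1 then sg i.2.2 * wt 1 i.1 / 2 else 0) 1 fun i => by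
    have h1 := wt_pos 1 i.1
    split_ifs
    · rw [abs_div, abs_mul, abs_sg, abs_of_pos h1, abs_two]; linarith
    · rw [abs_zero]; positivity

/-- The coordinates of `u₃`. -/
def in₃ (hε : 0 < ε) : HS 1 →L[ℂ] L2seq Mode :=
  fromHS 1 (fun i => if i.2.1 then 0 else dd ε i.1 / 2) (1 + ε) fun i => by
    have h1 := wt_pos 1 i.1
    have h2 := dd_pos hε i.1
    have h3 := dd_le hε i.1
    split_ifs
    · rw [abs_zero]; positivity
    · rw [abs_of_pos (by positivity)]; linarith

/-- The coordinates of `u₄`. -/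
def in₄ : HS 0 →L[ℂ] L2seq Mode :=
  fromHS 0 (fun i => if i.2.1 then 0 else sg i.2.2 / 2) 1 fun i => by
    rw [HS.wt_zero]
    split_ifs
    · rw [abs_zero]; norm_num
    · rw [abs_div, abs_sg, abs_two]; norm_num

theorem wt_mul_inv_dd_le (hε : 0 < ε) (k : ℤ) : wt 1 k * (dd ε k)⁻¹ ≤ 2 + 1 / ε := by
  rw [← div_eq_mul_inv, div_le_iff₀ (dd_pos hε k)]
  exact wt_le_dd hε k

/-- The function `u₁` in coordinates. -/
def out₁ (hε : 0 < ε) : L2seq Mode →L[ℂ] HS 2 :=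
  have h : ∀ k, wt 2 k * |(wt 1 k * dd ε k)⁻¹| ≤ 2 + 1 / ε := fun k => by
    have h1 := wt_pos 1 k
    have h2 := dd_pos hε k
    rw [wt_two, abs_of_pos (by positivity)]
    refine le_trans (le_of_eq ?_) (wt_mul_inv_dd_le hε k)
    field_simp
  toHS 2 (true, true) _ _ h + toHS 2 (true, false) _ _ h

/-- The function `u₂` in coordinates. -/
def out₂ : L2seq Mode →L[ℂ] HS 1 :=
  have h : ∀ k, wt 1 k * |(wt 1 k)⁻¹| ≤ 1 := fun k => by
    have h1 := wt_pos 1 k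
    rw [abs_of_pos (by positivity), mul_inv_cancel₀ h1.ne']
  toHS 1 (true, true) _ _ h - toHS 1 (true, false) _ _ h

/-- The function `u₃` in coordinates. -/
def out₃ (hε : 0 < ε) : L2seq Mode →L[ℂ] HS 1 :=
  have h : ∀ k, wt 1 k * |(dd ε k)⁻¹| ≤ 2 + 1 / ε := fun k => by
    have h2 := dd_pos hε k
    rw [abs_of_pos (by positivity)]
    exact wt_mul_inv_dd_le hε k
  toHS 1 (false, true) _ _ h + toHS 1 (false, false) _ _ h

/-- The function `u₄` in coordinates. -/
def out₄ : L2seq Mode →L[ℂ] HS 0 :=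
  have h : ∀ k, wt 0 k * |(1 : ℝ)| ≤ 1 := fun k => by rw [HS.wt_zero]; simp
  toHS 0 (false, true) _ _ h - toHS 0 (false, false) _ _ h

theorem coeff_out₁ (hε : 0 < ε) (v : L2seq Mode) (k : ℤ) : (out₁ hε v).coeff k
    = ((wt 1 k * dd ε k)⁻¹ : ℝ) * (v (k, true, true) + v (k, true, false)) := by
  simp [out₁, mul_add]

theorem coeff_out₂ (v : L2seq Mode) (k : ℤ) : (out₂ v).coeff k
    = ((wt 1 k)⁻¹ : ℝ) * (v (k, true, true) - v (k, true, false)) := by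
  simp [out₂, mul_sub]

theorem coeff_out₃ (hε : 0 < ε) (v : L2seq Mode) (k : ℤ) : (out₃ hε v).coeff k
    = ((dd ε k)⁻¹ : ℝ) * (v (k, false, true) + v (k, false, false)) := by
  simp [out₃, mul_add]

theorem coeff_out₄ (v : L2seq Mode) (k : ℤ) : (out₄ v).coeff k
    = v (k, false, true) - v (k, false, false) := by
  simp [out₄]

theorem in₁_apply (hε : 0 < ε) (u : HS 2) (k : ℤ) (b s : Bool) : in₁ hε u (k, b, s)
    = if b then (wt 1 k * dd ε k / 2 : ℝ) * u.coeff k else 0 := by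
  simp only [in₁, fromHS_apply]
  split_ifs <;> simp

theorem in₂_apply (u : HS 1) (k : ℤ) (b s : Bool) : in₂ u (k, b, s)
    = if b then (sg s * wt 1 k / 2 : ℝ) * u.coeff k else 0 := by
  simp only [in₂, fromHS_apply]
  split_ifs <;> simp

theorem in₃_apply (hε : 0 < ε) (u : HS 1) (k : ℤ) (b s : Bool) : in₃ hε u (k, b, s)
    = if b then 0 else (dd ε k / 2 : ℝ) * u.coeff k := by
  simp only [in₃, fromHS_apply]
  split_ifs <;> simp

theorem in₄_apply (u : HS 0) (k : ℤ) (b s : Bool) : in₄ u (k, b, s)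
    = if b then 0 else (sg s / 2 : ℝ) * u.coeff k := by
  simp only [in₄, fromHS_apply]
  split_ifs <;> simp

/-- The diagonal coordinates of the leading part of the system. -/
def psi (hε : 0 < ε) : XSp ≃L[ℂ] L2seq Mode :=
  ContinuousLinearEquiv.equivOfInverse
    ((in₁ hε).comp (ContinuousLinearMap.fst ℂ _ _) + (in₂.comp (ContinuousLinearMap.fst ℂ _ _)
      + ((in₃ hε).comp (ContinuousLinearMap.fst ℂ _ _) + in₄.comp (ContinuousLinearMap.snd ℂ _ _)).comp
        (ContinuousLinearMap.snd ℂ _ _)).comp (ContinuousLinearMap.snd ℂ _ _))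
    ((out₁ hε).prod (out₂.prod ((out₃ hε).prod out₄)))
    (fun U => by
      obtain ⟨u₁, u₂, u₃, u₄⟩ := U
      have h1 : ∀ k, (wt 1 k : ℂ) ≠ 0 := fun k => by exact_mod_cast (wt_pos 1 k).ne'
      have h2 : ∀ k, (dd ε k : ℂ) ≠ 0 := fun k => by exact_mod_cast (dd_pos hε k).ne'
      refine Prod.ext (HS.ext fun k => ?_) (Prod.ext (HS.ext fun k => ?_)
        (Prod.ext (HS.ext fun k => ?_) (HS.ext fun k => ?_)))
      · change (out₁ hε _).coeff k = _
        have := h1 k; have := h2 k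
        simp [coeff_out₁, in₁_apply, in₂_apply, in₃_apply, in₄_apply, sg]
        field_simp; ring
      · change (out₂ _).coeff k = _
        have := h1 k
        simp [coeff_out₂, in₁_apply, in₂_apply, in₃_apply, in₄_apply, sg]
        field_simp; ring
      · change (out₃ hε _).coeff k = _
        have := h2 k
        simp [coeff_out₃, in₁_apply, in₂_apply, in₃_apply, in₄_apply, sg]
        field_simp; ring
      · change (out₄ _).coeff k = _
        simp [coeff_out₄, in₁_apply, in₂_apply, in₃_apply, in₄_apply, sg]
        ring)
    (fun v => by
      refine L2seq.ext_apply fun i => ?_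
      obtain ⟨k, b, s⟩ := i
      have h1 : (wt 1 k : ℂ) ≠ 0 := by exact_mod_cast (wt_pos 1 k).ne'
      have h2 : (dd ε k : ℂ) ≠ 0 := by exact_mod_cast (dd_pos hε k).ne'
      change in₁ hε (out₁ hε v) (k, b, s) + (in₂ (out₂ v) (k, b, s)
        + (in₃ hε (out₃ hε v) (k, b, s) + in₄ (out₄ v) (k, b, s))) = v (k, b, s)
      cases b <;> cases s <;>
        simp [coeff_out₁, coeff_out₂, coeff_out₃, coeff_out₄, in₁_apply, in₂_apply, in₃_apply,
          in₄_apply, sg] <;> field_simp <;> ring)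

theorem psi_apply (hε : 0 < ε) (U : XSp) :
    psi hε U = in₁ hε U.1 + (in₂ U.2.1 + (in₃ hε U.2.2.1 + in₄ U.2.2.2)) := rfl

theorem psi_symm_apply (hε : 0 < ε) (v : L2seq Mode) :
    (psi hε).symm v = (out₁ hε v, out₂ v, out₃ hε v, out₄ v) := rfl

end Psi

/-! ### Multiplication by functions -/

/-- The product of `ρ ∈ H^{1/2}` and `u ∈ H²` is controlled by the Wiener norm of `u`. -/
theorem HS.norm_mul_le (ρ : HS (1 / 2)) (u : HS 2) : ‖HS.mul ρ u‖ ≤ ‖ρ‖ * ∑' j, ‖u.coeff j‖ := by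
  have hsu := HS.summable_norm_coeff u
  let ρ₀ : L2seq ℤ := HS.toL2 0 (HS.incl (by norm_num) ρ)
  have hρ₀ : ∀ k, ρ₀ k = ρ.coeff k := fun k => by
    change (wt 0 k : ℂ) * (HS.incl _ ρ).coeff k = _
    rw [HS.wt_zero, HS.coeff_incl]; simp
  have hρn : ‖ρ₀‖ ≤ ‖ρ‖ := by
    rw [HS.norm_eq]
    have := L2seq.norm_le_of_forall (v := (HS.toL2 (1 / 2) ρ : L2seq ℤ)) (w := ρ₀) zero_le_one
      fun k => by
        rw [hρ₀, one_mul]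
        change _ ≤ ‖(wt (1 / 2) k : ℂ) * ρ.coeff k‖
        rw [norm_mul, Complex.norm_real, Real.norm_of_nonneg (wt_pos _ k).le]
        refine le_mul_of_one_le_left (norm_nonneg _) ?_
        exact (HS.wt_zero k).symm.le.trans (wt_mono (by norm_num) k)
    rwa [one_mul] at this
  have hs : ∀ j : ℤ, Memℓp (fun k => ρ₀ (k - j)) 2 := fun j =>
    L2seq.memℓp_iff.2 ((Equiv.subRight j).summable_iff.2 (L2seq.summable_sq ρ₀))
  let S : ℤ → L2seq ℤ := fun j => ⟨fun k => ρ₀ (k - j), hs j⟩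
  have hS : ∀ j, ‖S j‖ = ‖ρ₀‖ := fun j => by
    have : ‖S j‖ ^ 2 = ‖ρ₀‖ ^ 2 := by
      rw [L2seq.norm_sq, L2seq.norm_sq]
      exact (Equiv.subRight j).tsum_eq fun k => ‖ρ₀ k‖ ^ 2
    exact (pow_left_inj₀ (norm_nonneg _) (norm_nonneg _) two_ne_zero).1 this
  have hn : ∀ j, ‖u.coeff j • S j‖ = ‖u.coeff j‖ * ‖ρ₀‖ := fun j => by rw [norm_smul, hS]
  have hsn : Summable fun j => ‖u.coeff j • S j‖ := by
    simp only [hn]; exact hsu.mul_right _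
  have e : (HS.toL2 0 (HS.mul ρ u) : L2seq ℤ) = ∑' j, u.coeff j • S j := by
    refine L2seq.ext_apply fun k => ?_
    have h1 := (lp.evalCLM ℂ (fun _ : ℤ => ℂ) 2 k).map_tsum hsn.of_norm
    refine Eq.trans ?_ h1.symm
    change (wt 0 k : ℂ) * ∑' j, u.coeff j * ρ.coeff (k - j) = _
    rw [HS.wt_zero, Complex.ofReal_one, one_mul]
    refine tsum_congr fun j => ?_
    rw [← hρ₀]; rfl
  rw [HS.norm_eq, e]
  refine (norm_tsum_le_tsum_norm hsn).trans ?_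
  simp only [hn]
  rw [tsum_mul_right, mul_comm]
  exact mul_le_mul_of_nonneg_right hρn (tsum_nonneg fun _ => norm_nonneg _)

theorem L2seq.tsum_mul_le {ι : Type} (x y : L2seq ι) :
    Summable (fun i => ‖x i‖ * ‖y i‖) ∧ ∑' i, ‖x i‖ * ‖y i‖ ≤ ‖x‖ * ‖y‖ := by
  have h := Real.inner_le_Lp_mul_Lq_tsum_of_nonneg (p := 2) (q := 2) (f := fun i => ‖x i‖)
    (g := fun i => ‖y i‖) (by constructor <;> norm_num) (fun _ => norm_nonneg _)
    (fun _ => norm_nonneg _) (by simpa using L2seq.summable_sq x) (by simpa using L2seq.summable_sq y)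
  refine ⟨Real.summable_mul_of_Lp_Lq_of_nonneg (p := 2) (q := 2) (by constructor <;> norm_num)
    (fun _ => norm_nonneg _) (fun _ => norm_nonneg _) (by simpa using L2seq.summable_sq x)
    (by simpa using L2seq.summable_sq y), h.trans (le_of_eq ?_)⟩
  have e : ∀ z : L2seq ι, (∑' i, ‖z i‖ ^ (2 : ℝ)) ^ (1 / 2 : ℝ) = ‖z‖ := fun z => by
    simp only [Real.rpow_two]
    rw [← L2seq.norm_sq, ← Real.sqrt_eq_rpow, Real.sqrt_sq (norm_nonneg _)]
  rw [e, e]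

theorem summable_inv_wt_one : Summable fun k : ℤ => ((wt 2 k)⁻¹) ^ 2 := by
  refine Summable.of_norm_bounded_eventually
    (Real.summable_one_div_int_pow.2 (by norm_num : 1 < 2)) ?_
  have : ({0} : Set ℤ)ᶜ ∈ cofinite := (finite_singleton 0).compl_mem_cofinite
  filter_upwards [this] with k hk
  have hk' : (k : ℝ) ≠ 0 := by exact_mod_cast hk
  have hp : 0 < (k : ℝ) ^ 2 := by positivity
  have h0 := wt_pos 2 k
  have h1 : 1 + (k : ℝ) ^ 2 = wt 2 k := by rw [wt_two, wt_one_sq]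
  rw [Real.norm_of_nonneg (by positivity), one_div]
  have h3 : (wt 2 k)⁻¹ ≤ 1 := inv_le_one_of_one_le₀ (by linarith)
  have h4 : (wt 2 k)⁻¹ ≤ ((k : ℝ) ^ 2)⁻¹ := inv_anti₀ hp (by linarith)
  have h5 : 0 < (wt 2 k)⁻¹ := by positivity
  nlinarith

/-- By the Cauchy-Schwarz inequality with the square-summable weight (1 + k²)⁻¹, H² embeds into the
Wiener algebra. -/
theorem HS.tsum_coeff_le : ∃ c, 0 ≤ c ∧ ∀ u : HS 2, ∑' j, ‖u.coeff j‖ ≤ c * ‖u‖ := by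
  let w : L2seq ℤ := ⟨fun k => ((wt 2 k)⁻¹ : ℝ), L2seq.memℓp_iff.2 (summable_inv_wt_one.congr
    fun k => by rw [Complex.norm_real, Real.norm_of_nonneg (inv_nonneg.2 (wt_pos 2 k).le)])⟩
  refine ⟨‖w‖, norm_nonneg _, fun u => ?_⟩
  have h := (L2seq.tsum_mul_le w (HS.toL2 2 u)).2
  rw [HS.norm_eq]
  refine le_trans (le_of_eq (tsum_congr fun k => ?_)) h
  change _ = ‖(((wt 2 k)⁻¹ : ℝ) : ℂ)‖ * ‖(wt 2 k : ℂ) * u.coeff k‖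
  have h0 := wt_pos 2 k
  rw [norm_mul, Complex.norm_real, Complex.norm_real, Real.norm_of_nonneg (inv_nonneg.2 h0.le),
    Real.norm_of_nonneg h0.le, ← mul_assoc, inv_mul_cancel₀ h0.ne', one_mul]

theorem HS.summable_mul (ρ : HS (1 / 2)) (u : HS 2) (k : ℤ) :
    Summable fun j => u.coeff j * ρ.coeff (k - j) := by
  have h1 : ∀ j, ‖ρ.coeff j‖ ≤ ‖ρ‖ := fun j => by
    rw [HS.norm_eq]
    refine le_trans ?_ (L2seq.norm_apply_le _ j)
    change _ ≤ ‖(wt (1 / 2) j : ℂ) * ρ.coeff j‖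
    rw [norm_mul, Complex.norm_real, Real.norm_of_nonneg (wt_pos _ j).le]
    refine le_mul_of_one_le_left (norm_nonneg _) ?_
    exact (HS.wt_zero j).symm.le.trans (wt_mono (by norm_num) j)
  refine Summable.of_norm_bounded ((HS.summable_norm_coeff u).mul_right ‖ρ‖) fun j => ?_
  rw [norm_mul]
  exact mul_le_mul_of_nonneg_left (h1 _) (norm_nonneg _)

theorem HS.coeff_mul (ρ : HS (1 / 2)) (u : HS 2) (k : ℤ) :
    (HS.mul ρ u).coeff k = ∑' j, u.coeff j * ρ.coeff (k - j) := rfl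

/-- Multiplication of functions as a bounded bilinear map. -/
def mulCLM : HS (1 / 2) →L[ℂ] HS 2 →L[ℂ] HS 0 :=
  LinearMap.mkContinuous₂
    (LinearMap.mk₂ ℂ HS.mul
      (fun ρ ρ' u => HS.ext fun k => by
        rw [HS.coeff_add, HS.coeff_mul, HS.coeff_mul, HS.coeff_mul,
          ← (HS.summable_mul ρ u k).tsum_add (HS.summable_mul ρ' u k)]
        simp only [HS.coeff_add, mul_add])
      (fun z ρ u => HS.ext fun k => by
        rw [HS.coeff_smul, HS.coeff_mul, HS.coeff_mul, ← tsum_mul_left]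
        simp only [HS.coeff_smul, mul_left_comm])
      (fun ρ u u' => HS.ext fun k => by
        rw [HS.coeff_add, HS.coeff_mul, HS.coeff_mul, HS.coeff_mul,
          ← (HS.summable_mul ρ u k).tsum_add (HS.summable_mul ρ u' k)]
        simp only [HS.coeff_add, add_mul])
      (fun z ρ u => HS.ext fun k => by
        rw [HS.coeff_smul, HS.coeff_mul, HS.coeff_mul, ← tsum_mul_left]
        simp only [HS.coeff_smul, mul_assoc]))
    HS.tsum_coeff_le.choose
    (fun ρ u => by
      have h := HS.tsum_coeff_le.choose_spec.2 u
      calc _ ≤ ‖ρ‖ * ∑' j, ‖u.coeff j‖ := HS.norm_mul_le ρ u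
        _ ≤ ‖ρ‖ * (HS.tsum_coeff_le.choose * ‖u‖) := by gcongr
        _ = _ := by ring)

theorem mulCLM_apply (ρ : HS (1 / 2)) (u : HS 2) : mulCLM ρ u = HS.mul ρ u := rfl

/-- The constant function `1`. -/
def HS.one (σ : ℝ) : HS σ :=
  HS.mk (fun k => if k = 0 then 1 else 0) (L2seq.memℓp_iff.2 (summable_of_hasFiniteSupport
    ((finite_singleton (0 : ℤ)).subset fun k hk => by
      by_contra h
      exact hk (by simp [show k ≠ 0 from h]))))

theorem HS.mul_one' (u : HS 2) : HS.mul (HS.one (1 / 2)) u = HS.incl (by norm_num) u :=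
  HS.ext fun k => by
    rw [HS.coeff_mul, HS.coeff_incl, tsum_eq_single k]
    · simp [HS.one]
    · intro j hj
      have : k - j ≠ 0 := sub_ne_zero.2 (Ne.symm hj)
      simp [HS.one, this]

end Bilaplace

namespace Bilaplace

/-! ### The system in diagonal coordinates -/

/-- The nilpotent coupling of the modes of frequency `0`. -/
def jordan : L2seq Mode →L[ℂ] L2seq Mode :=
  have h₁ : ∀ (b : Bool) (i : Mode), |(if i.1 = 0 ∧ i.2.1 = b then 1 / 2 else 0 : ℝ)|
      ≤ 1 * wt 0 i.1 := fun b i => by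
    rw [HS.wt_zero]; split_ifs <;> norm_num
  have h₂ : ∀ k, wt 0 k * |(1 : ℝ)| ≤ 1 := fun k => by rw [HS.wt_zero]; simp
  (fromHS 0 _ _ (h₁ true)).comp (toHS 0 (true, true) _ _ h₂ - toHS 0 (true, false) _ _ h₂)
    + (fromHS 0 _ _ (h₁ false)).comp (toHS 0 (false, true) _ _ h₂ - toHS 0 (false, false) _ _ h₂)

theorem jordan_apply (v : L2seq Mode) (k : ℤ) (b s : Bool) : jordan v (k, b, s)
    = if k = 0 then (v (k, b, true) - v (k, b, false)) / 2 else 0 := by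
  simp only [jordan, add_apply, ContinuousLinearMap.comp_apply, L2seq.add_apply, fromHS_apply,
    sub_apply, HS.coeff_sub, coeff_toHS]
  by_cases h : k = 0 <;> cases b <;> simp [h] <;> ring

/-- The coupling of `u₃` to `u₂`. -/
def opE {ε : ℝ} (hε : 0 < ε) : L2seq Mode →L[ℂ] L2seq Mode := in₂.comp (out₃ hε)

/-- The coupling of `u₁` to `u₄` by multiplication with a function. -/
def opA {ε : ℝ} (hε : 0 < ε) : HS (1 / 2) →L[ℂ] L2seq Mode →L[ℂ] L2seq Mode :=
  ((ContinuousLinearMap.compL ℂ (L2seq Mode) (HS 2) (L2seq Mode)).flip (out₁ hε)).comp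
    ((ContinuousLinearMap.compL ℂ (HS 2) (HS 0) (L2seq Mode) in₄).comp mulCLM)

theorem opA_apply {ε : ℝ} (hε : 0 < ε) (ρ : HS (1 / 2)) (v : L2seq Mode) :
    opA hε ρ v = in₄ (HS.mul ρ (out₁ hε v)) := rfl

variable {s₁ : ℝ}

/-- The function `λ - θ(s) - ρ(s)`. -/
def potential (th : ℝ → ℝ) (p : ℝ × Pot s₁) (s : ℝ) : HS (1 / 2) :=
  ((p.1 - th s : ℝ) : ℂ) • HS.one (1 / 2) - p.2 s

/-- The part of the system which is not diagonal and decays at `-∞`. -/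
def decay {ε : ℝ} (hε : 0 < ε) (th : ℝ → ℝ) (p : ℝ × Pot s₁) (s : ℝ) :
    L2seq Mode →L[ℂ] L2seq Mode :=
  (Real.exp (2 * s) : ℂ) • (opE hε + opA hε (potential th p s))

/-- The part of the system which is not diagonal. -/
def coefC {ε : ℝ} (hε : 0 < ε) (th : ℝ → ℝ) (p : ℝ × Pot s₁) (s : ℝ) :
    L2seq Mode →L[ℂ] L2seq Mode :=
  (ε : ℂ) • jordan + decay hε th p s

/-! #### Integrability -/

/-- The measure `e^{2s} ds` on `(-∞, s₁]`. -/
abbrev wvol (s₁ : ℝ) : Measure ℝ :=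
  (volume.restrict (Iic s₁)).withDensity fun s => ENNReal.ofReal (Real.exp (2 * s))

theorem measurable_weight : Measurable fun s : ℝ => ENNReal.ofReal (Real.exp (2 * s)) := by
  fun_prop

theorem integrable_weight (s₁ : ℝ) :
    Integrable (fun s => Real.exp (2 * s)) (volume.restrict (Iic s₁)) :=
  integrableOn_exp_mul_Iic two_pos s₁

instance (s₁ : ℝ) : IsFiniteMeasure (wvol s₁) :=
  isFiniteMeasure_withDensity_ofReal (integrable_weight s₁).2

theorem ac_wvol (s₁ : ℝ) : volume.restrict (Iic s₁) ≪ wvol s₁ :=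
  withDensity_absolutelyContinuous' measurable_weight.aemeasurable
    (Eventually.of_forall fun s => by simp [Real.exp_pos])

theorem integrable_wvol_iff {f : ℝ → ℝ} :
    Integrable f (wvol s₁) ↔ Integrable (fun s => Real.exp (2 * s) * f s)
      (volume.restrict (Iic s₁)) := by
  rw [integrable_withDensity_iff_integrable_smul' measurable_weight
    (Eventually.of_forall fun s => ENNReal.ofReal_lt_top)]
  simp [ENNReal.toReal_ofReal (Real.exp_pos _).le]

theorem integral_wvol (f : ℝ → ℝ) :
    ∫ s, f s ∂wvol s₁ = ∫ s in Iic s₁, Real.exp (2 * s) * f s := by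
  rw [integral_withDensity_eq_integral_toReal_smul measurable_weight
    (Eventually.of_forall fun s => ENNReal.ofReal_lt_top)]
  simp [ENNReal.toReal_ofReal (Real.exp_pos _).le]

/-- The measure e^{2s} ds is finite on (-∞, s₁], so L² embeds into L¹. -/
theorem exists_integral_norm_le (s₁ : ℝ) : ∃ c, 0 ≤ c ∧ ∀ ρ : Pot s₁,
    Integrable (fun s => Real.exp (2 * s) * ‖ρ s‖) (volume.restrict (Iic s₁)) ∧
    ∫ s in Iic s₁, Real.exp (2 * s) * ‖ρ s‖ ≤ c * ‖ρ‖ := by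
  refine ⟨(wvol s₁ univ ^ (1 / (1 : ENNReal).toReal - 1 / (2 : ENNReal).toReal)).toReal,
    ENNReal.toReal_nonneg, fun ρ => ⟨?_, ?_⟩⟩
  · exact integrable_wvol_iff.1 ((Lp.memLp ρ).integrable one_le_two).norm
  · have hm := (Lp.memLp ρ).aestronglyMeasurable
    have h1 := eLpNorm_le_eLpNorm_mul_rpow_measure_univ (p := 1) (q := 2) one_le_two hm
    rw [← integral_wvol, integral_norm_eq_lintegral_enorm hm, ← eLpNorm_one_eq_lintegral_enorm,
      Lp.norm_def, mul_comm, ← ENNReal.toReal_mul]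
    refine ENNReal.toReal_mono ?_ h1
    refine ENNReal.mul_ne_top (Lp.memLp ρ).2.ne (ENNReal.rpow_ne_top_of_nonneg (by norm_num) ?_)
    exact measure_ne_top _ _

/-! ### Integrability of the non-diagonal part and its dependence on the parameters -/

section Potential

variable {th : ℝ → ℝ} (hth : Continuous th) {Θ : ℝ} (hΘ : ∀ s, |th s| ≤ Θ) (p : ℝ × Pot s₁)

theorem memLp_potential (hth : Continuous th) (hΘ : ∀ s, |th s| ≤ Θ) (p : ℝ × Pot s₁) :
    MemLp (potential th p) 2 (wvol s₁) := by
  refine MemLp.sub ?_ (Lp.memLp p.2)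
  refine MemLp.of_bound (C := (|p.1| + Θ) * ‖HS.one (1 / 2)‖) ?_ (Eventually.of_forall fun s => ?_)
  · refine Continuous.aestronglyMeasurable ?_
    have : Continuous fun s => ((p.1 - th s : ℝ) : ℂ) := by fun_prop
    exact this.smul continuous_const
  · rw [norm_smul, Complex.norm_real, Real.norm_eq_abs]
    gcongr
    exact (abs_sub _ _).trans (by gcongr; exact hΘ s)

/-- A bound for the non-diagonal part. -/
def rr (th : ℝ → ℝ) (p : ℝ × Pot s₁) (s : ℝ) : ℝ := Real.exp (2 * s) * (1 + ‖potential th p s‖)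

theorem rr_nonneg (s : ℝ) : 0 ≤ rr th p s := by unfold rr; positivity

theorem integrable_rr (hth : Continuous th) (hΘ : ∀ s, |th s| ≤ Θ) (p : ℝ × Pot s₁) :
    Integrable (rr th p) (volume.restrict (Iic s₁)) :=
  integrable_wvol_iff.1 ((integrable_const 1).add
    ((memLp_potential hth hΘ p).integrable one_le_two).norm)

/-- One of the two factors e^{2s} is bounded on (-∞, s₁], and the other is the weight of the
potential space. Square integrability makes the convolution with e^{-L(s-σ)} small uniformly in s
for large L, and it also yields the regularity of mild solutions. -/
theorem integrable_rr_sq (hth : Continuous th) (hΘ : ∀ s, |th s| ≤ Θ) (p : ℝ × Pot s₁) :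
    Integrable (fun s => rr th p s ^ 2) (volume.restrict (Iic s₁)) := by
  have h0 : MemLp (fun _ : ℝ => (1 : ℝ)) 2 (wvol s₁) := memLp_const 1
  have h0' : MemLp (fun s => ‖potential th p s‖) 2 (wvol s₁) := (memLp_potential hth hΘ p).norm
  have h1 : MemLp (fun s => 1 + ‖potential th p s‖) 2 (wvol s₁) := h0.add h0'
  have h2 : Integrable (fun s => Real.exp (2 * s) * (1 + ‖potential th p s‖) ^ 2)
      (volume.restrict (Iic s₁)) := integrable_wvol_iff.1 h1.integrable_sq
  have h3 : AEStronglyMeasurable (fun s => rr th p s ^ 2) (volume.restrict (Iic s₁)) :=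
    (integrable_rr hth hΘ p).aestronglyMeasurable.pow 2
  refine (h2.const_mul (Real.exp (2 * s₁))).mono' h3 ?_
  filter_upwards [ae_restrict_mem measurableSet_Iic] with s hs
  rw [Real.norm_of_nonneg (sq_nonneg _), rr, mul_pow, sq (Real.exp (2 * s)), mul_assoc]
  have : Real.exp (2 * s) ≤ Real.exp (2 * s₁) := Real.exp_le_exp.2 (by linarith [mem_Iic.1 hs])
  exact mul_le_mul_of_nonneg_right this (by positivity)

theorem measurable_potential (hth : Continuous th) (hΘ : ∀ s, |th s| ≤ Θ) (p : ℝ × Pot s₁) :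
    AEStronglyMeasurable (potential th p) (volume.restrict (Iic s₁)) :=
  (memLp_potential hth hΘ p).aestronglyMeasurable.mono_ac (ac_wvol s₁)

variable {ε : ℝ} (hε : 0 < ε)

theorem norm_decay_le (s : ℝ) :
    ‖decay hε th p s‖ ≤ (‖opE hε‖ + ‖opA hε‖) * rr th p s := by
  rw [decay, rr, norm_smul, Complex.norm_real, Real.norm_of_nonneg (Real.exp_pos _).le,
    mul_left_comm]
  refine mul_le_mul_of_nonneg_left ((norm_add_le _ _).trans ?_) (Real.exp_pos _).le
  have := (opA hε).le_opNorm (potential th p s)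
  nlinarith [norm_nonneg (opE hε), norm_nonneg (opA hε), norm_nonneg (potential th p s),
    mul_nonneg (norm_nonneg (opE hε)) (norm_nonneg (potential th p s))]

theorem measurable_decay (hth : Continuous th) (hΘ : ∀ s, |th s| ≤ Θ) (p : ℝ × Pot s₁) :
    AEStronglyMeasurable (decay hε th p) (volume.restrict (Iic s₁)) := by
  have h1 : Continuous fun s : ℝ => (Real.exp (2 * s) : ℂ) := by fun_prop
  exact h1.aestronglyMeasurable.smul (aestronglyMeasurable_const.add
    ((opA hε).continuous.comp_aestronglyMeasurable (measurable_potential hth hΘ p)))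

theorem integrable_decay (hth : Continuous th) (hΘ : ∀ s, |th s| ≤ Θ) (p : ℝ × Pot s₁) :
    Integrable (decay hε th p) (volume.restrict (Iic s₁)) :=
  ((integrable_rr hth hΘ p).const_mul _).mono' (measurable_decay hε hth hΘ p)
    (Eventually.of_forall fun s => norm_decay_le p hε s)

theorem integrableOn_coefC (hth : Continuous th) (hΘ : ∀ s, |th s| ≤ Θ) (p : ℝ × Pot s₁)
    (a : ℝ) : IntegrableOn (coefC hε th p) (Icc a s₁) := by
  have h1 : IntegrableOn (fun _ : ℝ => (ε : ℂ) • jordan) (Icc a s₁) :=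
    continuousOn_const.integrableOn_Icc
  have h2 : IntegrableOn (decay hε th p) (Icc a s₁) :=
    IntegrableOn.mono_set (integrable_decay hε hth hΘ p) Icc_subset_Iic_self
  exact Integrable.add (ε' := L2seq Mode →L[ℂ] L2seq Mode) h1 h2

/-- The operator of multiplication by `ρ` in coordinates, as an integrable function of time. -/
theorem integrable_opA (ρ : Pot s₁) : Integrable
    (fun s => (Real.exp (2 * s) : ℂ) • opA hε (ρ s)) (volume.restrict (Iic s₁)) := by
  obtain ⟨c, -, hc⟩ := exists_integral_norm_le s₁
  have h1 : Continuous fun s : ℝ => (Real.exp (2 * s) : ℂ) := by fun_prop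
  refine ((hc ρ).1.const_mul ‖opA hε‖).mono' (h1.aestronglyMeasurable.smul
    ((opA hε).continuous.comp_aestronglyMeasurable
      ((Lp.memLp ρ).aestronglyMeasurable.mono_ac (ac_wvol s₁)))) (Eventually.of_forall fun s => ?_)
  rw [norm_smul, Complex.norm_real, Real.norm_of_nonneg (Real.exp_pos _).le, mul_left_comm]
  exact mul_le_mul_of_nonneg_left ((opA hε).le_opNorm _) (Real.exp_pos _).le

theorem real_smul_op (r : ℝ) (X : L2seq Mode →L[ℂ] L2seq Mode) : r • X = (r : ℂ) • X := rfl

/-- The operator of multiplication by `ρ` in coordinates, as a bounded linear map of `ρ`. -/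
def opM : Pot s₁ →L[ℝ] Lp (L2seq Mode →L[ℂ] L2seq Mode) 1 (volume.restrict (Iic s₁)) :=
  LinearMap.mkContinuous
    { toFun := fun ρ => (integrable_opA hε ρ).toL1 _
      map_add' := fun ρ ρ' => by
        rw [← Integrable.toL1_add]
        refine (Integrable.toL1_eq_toL1_iff _ _ _ _).2 ?_
        filter_upwards [ac_wvol s₁ (Lp.coeFn_add ρ ρ')] with s hs
        rw [hs]
        simp
      map_smul' := fun r ρ => by
        rw [RingHom.id_apply, ← Integrable.toL1_smul]
        refine (Integrable.toL1_eq_toL1_iff _ _ _ _).2 ?_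
        filter_upwards [ac_wvol s₁ (Lp.coeFn_smul r ρ)] with s hs
        rw [hs, Pi.smul_apply, ← Complex.coe_smul r (ρ s), map_smul, smul_comm]
        exact (real_smul_op _ _).symm }
    (‖opA hε‖ * (exists_integral_norm_le s₁).choose)
    (fun ρ => by
      obtain ⟨-, hc⟩ := (exists_integral_norm_le s₁).choose_spec
      change ‖(integrable_opA hε ρ).toL1 _‖ ≤ _
      rw [L1.norm_of_fun_eq_integral_norm, mul_assoc]
      refine le_trans ?_ (mul_le_mul_of_nonneg_left (hc ρ).2 (norm_nonneg (opA hε)))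
      rw [← integral_const_mul]
      refine integral_mono (integrable_opA hε ρ).norm ((hc ρ).1.const_mul _) fun s => ?_
      beta_reduce
      rw [norm_smul, Complex.norm_real, Real.norm_of_nonneg (Real.exp_pos _).le, mul_left_comm]
      exact mul_le_mul_of_nonneg_left ((opA hε).le_opNorm _) (Real.exp_pos _).le)

/-- The decaying part as an integrable operator-valued function. -/
def decayL1 (hth : Continuous th) (hΘ : ∀ s, |th s| ≤ Θ) (p : ℝ × Pot s₁) :
    Lp (L2seq Mode →L[ℂ] L2seq Mode) 1 (volume.restrict (Iic s₁)) :=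
  (integrable_decay hε hth hΘ p).toL1 _

/-- The perturbation is an affine function of (λ, ρ) with values in L¹ and continuous linear part.
Its value at 0 carries θ and the coupling of u₃ to u₂. -/
theorem contDiff_decayL1 (hth : Continuous th) (hΘ : ∀ s, |th s| ≤ Θ) :
    ContDiff ℝ ∞ (decayL1 (s₁ := s₁) hε hth hΘ) := by
  have h1 : Integrable (fun s => (Real.exp (2 * s) : ℂ) • opA hε (HS.one (1 / 2)))
      (volume.restrict (Iic s₁)) :=
    (integrable_weight s₁).ofReal.smul_const _
  have e : decayL1 (s₁ := s₁) hε hth hΘ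
      = fun p => decayL1 hε hth hΘ 0 + p.1 • h1.toL1 _ - opM hε p.2 := by
    funext p
    have e1 : opM hε p.2 = (integrable_opA hε p.2).toL1 _ := rfl
    rw [e1, decayL1, decayL1, ← Integrable.toL1_smul, ← Integrable.toL1_add,
      ← Integrable.toL1_sub]
    refine (Integrable.toL1_eq_toL1_iff _ _ _ _).2 ?_
    filter_upwards [ac_wvol s₁ (Lp.coeFn_zero (HS (1 / 2)) 2 (wvol s₁))] with s hs
    have hs' : ((0 : ℝ × Pot s₁).2 : ℝ → HS (1 / 2)) s = 0 := hs
    simp only [Pi.add_apply, Pi.sub_apply]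
    simp only [decay, potential, hs', Prod.fst_zero, map_sub, map_smul, sub_zero, zero_sub]
    push_cast
    module
  rw [e]
  have h2 : ContDiff ℝ ∞ fun p : ℝ × Pot s₁ => p.1 • h1.toL1 _ := contDiff_fst.smul contDiff_const
  exact (contDiff_const.add h2).sub ((opM hε).contDiff.comp contDiff_snd)

end Potential

end Bilaplace

namespace Bilaplace

/-! ### Smallness of the perturbation in scaled coordinates -/

theorem exists_setIntegral_Iic_le {r : ℝ → ℝ} {s₁ : ℝ}
    (h1 : Integrable r (volume.restrict (Iic s₁))) (S₀ : ℝ) {η : ℝ} (hη : 0 < η) :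
    ∃ S ≤ S₀, S ≤ s₁ ∧ ∫ σ in Iic S, r σ ≤ η := by
  have h := intervalIntegral_tendsto_integral_Iic (f := r) (μ := volume) s₁ h1 tendsto_id
  have h2 : ∀ᶠ S in atBot, ∫ σ in Iic s₁, r σ < (∫ σ in S..s₁, r σ) + η := by
    filter_upwards [h.eventually_const_lt (sub_lt_self _ hη)] with S hS
    exact sub_lt_iff_lt_add.1 hS
  obtain ⟨S, hS1, hS2, hS3⟩ := (h2.and ((eventually_le_atBot S₀).and (eventually_le_atBot s₁))).exists
  refine ⟨S, hS2, hS3, ?_⟩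
  have := intervalIntegral.integral_Iic_sub_Iic
    (IntegrableOn.mono_set (f := r) h1 (Iic_subset_Iic.2 hS3)) h1
  linarith

/-- Before S the integral of r itself is small. After S the product of r with e^{-L(s-σ)} is split
by Young's inequality into a small multiple of r² and a multiple of e^{-2L(s-σ)}, whose integral is
of order 1/L uniformly in s. The cut may be placed below any S₀. -/
theorem exists_small_kernel {r : ℝ → ℝ} {s₁ : ℝ} (h0 : ∀ σ, 0 ≤ r σ)
    (h1 : Integrable r (volume.restrict (Iic s₁)))
    (h2 : Integrable (fun σ => r σ ^ 2) (volume.restrict (Iic s₁))) (S₀ : ℝ) :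
    ∃ S ≤ S₀, S ≤ s₁ ∧ ∃ L, 0 ≤ L ∧ ∀ s, ∫ σ in Iic s₁,
      (if σ < S then 1 else if σ ≤ s then Real.exp (-L * (s - σ)) else 0) * r σ ≤ 1 / 4 := by
  obtain ⟨S, hS₀, hS₁, hS⟩ := exists_setIntegral_Iic_le h1 S₀ (η := 1 / 8) (by norm_num)
  set Q := ∫ σ in Iic s₁, r σ ^ 2 with hQ
  have hQ0 : 0 ≤ Q := integral_nonneg fun σ => sq_nonneg _
  -- With L = 8/η the three contributions are 1/8 from the times before S, ηQ/2 ≤ 1/16 from r², and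
  -- 1/16 from the exponential.
  set η := 1 / (8 * (Q + 1)) with hη
  have hη0 : 0 < η := by positivity
  have hηQ : η * Q ≤ 1 / 8 := by
    rw [hη, div_mul_eq_mul_div, div_le_iff₀ (by positivity)]; linarith
  have hL : 0 < 8 / η := by positivity
  refine ⟨S, hS₀, hS₁, 8 / η, hL.le, fun s => ?_⟩
  have hi1 : Integrable ((Iic S).indicator r) (volume.restrict (Iic s₁)) :=
    h1.indicator measurableSet_Iic
  have hi2 := h2.const_mul (η / 2)
  have hi3 : Integrable (fun σ => 1 / (2 * η) * Real.exp (-(2 * (8 / η)) * |s - σ|))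
      (volume.restrict (Iic s₁)) :=
    ((integrable_exp_neg_mul_abs_sub (by positivity) s).const_mul _).restrict
  have hle : ∫ σ in Iic s₁,
      (if σ < S then 1 else if σ ≤ s then Real.exp (-(8 / η) * (s - σ)) else 0) * r σ
      ≤ ∫ σ in Iic s₁, ((Iic S).indicator r σ + η / 2 * r σ ^ 2
        + 1 / (2 * η) * Real.exp (-(2 * (8 / η)) * |s - σ|)) := by
    refine integral_mono_of_nonneg (Eventually.of_forall fun σ => ?_) ((hi1.add hi2).add hi3)
      (Eventually.of_forall fun σ => ?_)
    · have : (0 : ℝ) ≤ if σ < S then 1 else if σ ≤ s then Real.exp (-(8 / η) * (s - σ)) else 0 := by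
        split_ifs <;> positivity
      exact mul_nonneg this (h0 σ)
    · have hind : 0 ≤ (Iic S).indicator r σ := indicator_nonneg (fun σ _ => h0 σ) σ
      have hp2 : 0 ≤ η / 2 * r σ ^ 2 := by positivity
      have hp3 : 0 ≤ 1 / (2 * η) * Real.exp (-(2 * (8 / η)) * |s - σ|) := by positivity
      beta_reduce
      split_ifs with hc hc'
      · rw [indicator_of_mem (show σ ∈ Iic S from hc.le) r]; linarith
      · have e : Real.exp (-(2 * (8 / η)) * |s - σ|) = Real.exp (-(8 / η) * (s - σ)) ^ 2 := by
          rw [← Real.exp_nat_mul, abs_of_nonneg (by linarith)]; congr 1; push_cast; ring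
        rw [e]
        set x := Real.exp (-(8 / η) * (s - σ))
        have : x * r σ ≤ η / 2 * r σ ^ 2 + 1 / (2 * η) * x ^ 2 := by
          have h := sq_nonneg (η * r σ - x)
          have e2 : η / 2 * r σ ^ 2 + 1 / (2 * η) * x ^ 2 - x * r σ
              = (η * r σ - x) ^ 2 / (2 * η) := by field_simp; ring
          have h3 : 0 ≤ (η * r σ - x) ^ 2 / (2 * η) := by positivity
          linarith
        linarith
      · linarith
  refine hle.trans ?_
  rw [integral_add (by exact hi1.add hi2) hi3, integral_add hi1 hi2, integral_const_mul,
    integral_const_mul, setIntegral_indicator measurableSet_Iic,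
    inter_eq_self_of_subset_right (Iic_subset_Iic.2 hS₁), ← hQ]
  have h4 : ∫ σ in Iic s₁, Real.exp (-(2 * (8 / η)) * |s - σ|) ≤ 2 / (2 * (8 / η)) := by
    rw [← integral_exp_neg_mul_abs_sub (by positivity : 0 < 2 * (8 / η)) s]
    exact setIntegral_le_integral (integrable_exp_neg_mul_abs_sub (by positivity) s)
      (Eventually.of_forall fun σ => (Real.exp_pos _).le)
  have h5 : 1 / (2 * η) * ∫ σ in Iic s₁, Real.exp (-(2 * (8 / η)) * |s - σ|) ≤ 1 / 16 := by
    refine (mul_le_mul_of_nonneg_left h4 (by positivity)).trans (le_of_eq ?_)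
    field_simp; norm_num
  linarith

/-! #### The scaling -/

/-- The scaling factors: `1` for frequencies up to `n`, and `g₁`, `g₂` for higher ones. -/
def scl (n : ℕ) (g₁ g₂ : ℝ) (i : Mode) : ℝ :=
  if |(i.1 : ℝ)| ≤ n then 1 else if i.2.1 then g₂ else g₁

section Scaling

variable {n : ℕ} {g₁ g₂ : ℝ}

theorem one_le_scl (hg₁ : 1 ≤ g₁) (hg₂ : g₁ ≤ g₂) (i : Mode) : 1 ≤ scl n g₁ g₂ i := by
  unfold scl; split_ifs <;> linarith

theorem scl_le (hg₁ : 1 ≤ g₁) (hg₂ : g₁ ≤ g₂) (i : Mode) : scl n g₁ g₂ i ≤ g₂ := by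
  unfold scl; split_ifs <;> linarith

theorem abs_scl_le (hg₁ : 1 ≤ g₁) (hg₂ : g₁ ≤ g₂) (i : Mode) : |scl n g₁ g₂ i| ≤ g₂ := by
  rw [abs_of_nonneg (by linarith [one_le_scl hg₁ hg₂ (n := n) i])]; exact scl_le hg₁ hg₂ i

theorem abs_inv_scl_le (hg₁ : 1 ≤ g₁) (hg₂ : g₁ ≤ g₂) (i : Mode) : |(scl n g₁ g₂ i)⁻¹| ≤ 1 := by
  have := one_le_scl hg₁ hg₂ (n := n) i
  rw [abs_of_nonneg (by positivity)]; exact inv_le_one_of_one_le₀ this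

theorem dmul_scl_apply (hg₁ : 1 ≤ g₁) (hg₂ : g₁ ≤ g₂) (v : L2seq Mode) (i : Mode) :
    L2seq.dmul (scl n g₁ g₂) v i = (scl n g₁ g₂ i : ℝ) * v i :=
  L2seq.dmul_apply (abs_scl_le hg₁ hg₂) v i

theorem dmul_inv_scl_apply (hg₁ : 1 ≤ g₁) (hg₂ : g₁ ≤ g₂) (v : L2seq Mode) (i : Mode) :
    L2seq.dmul (fun i => (scl n g₁ g₂ i)⁻¹) v i = ((scl n g₁ g₂ i)⁻¹ : ℝ) * v i :=
  L2seq.dmul_apply (abs_inv_scl_le hg₁ hg₂) v i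

theorem dmul_scl_inv (hg₁ : 1 ≤ g₁) (hg₂ : g₁ ≤ g₂) (v : L2seq Mode) :
    L2seq.dmul (scl n g₁ g₂) (L2seq.dmul (fun i => (scl n g₁ g₂ i)⁻¹) v) = v :=
  L2seq.ext_apply fun i => by
    have := one_le_scl hg₁ hg₂ (n := n) i
    have h0 : (scl n g₁ g₂ i : ℂ) ≠ 0 := by exact_mod_cast (by linarith : scl n g₁ g₂ i ≠ 0)
    rw [dmul_scl_apply hg₁ hg₂, dmul_inv_scl_apply hg₁ hg₂]
    push_cast
    field_simp

theorem dmul_inv_scl (hg₁ : 1 ≤ g₁) (hg₂ : g₁ ≤ g₂) (v : L2seq Mode) :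
    L2seq.dmul (fun i => (scl n g₁ g₂ i)⁻¹) (L2seq.dmul (scl n g₁ g₂) v) = v :=
  L2seq.ext_apply fun i => by
    have := one_le_scl hg₁ hg₂ (n := n) i
    have h0 : (scl n g₁ g₂ i : ℂ) ≠ 0 := by exact_mod_cast (by linarith : scl n g₁ g₂ i ≠ 0)
    rw [dmul_inv_scl_apply hg₁ hg₂, dmul_scl_apply hg₁ hg₂]
    push_cast
    field_simp

end Scaling
-- Bounds for the scaled couplings, in total and into the high modes
section ScaledBounds

variable {n : ℕ} {g₁ g₂ : ℝ} {ε : ℝ}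

theorem opE_apply (hε : 0 < ε) (v : L2seq Mode) (k : ℤ) (b s : Bool) : opE hε v (k, b, s)
    = if b then (sg s * wt 1 k / 2 : ℝ) *
      (((dd ε k)⁻¹ : ℝ) * (v (k, false, true) + v (k, false, false))) else 0 := by
  rw [opE, ContinuousLinearMap.comp_apply, in₂_apply, coeff_out₃]

/-- The coupling of u₃ to u₂ preserves the frequency and leads from the block scaled by g₁ to the
block scaled by g₂, so at high frequencies it gains g₁/g₂ and at low ones it is unchanged. -/
theorem scaled_opE_apply (hg₁ : 1 ≤ g₁) (hg₂ : g₁ ≤ g₂) (hε : 0 < ε) (v : L2seq Mode)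
    (i : Mode) :
    L2seq.dmul (fun i => (scl n g₁ g₂ i)⁻¹) (opE hε (L2seq.dmul (scl n g₁ g₂) v)) i
      = (if |(i.1 : ℝ)| ≤ n then 1 else g₁ / g₂ : ℝ) * opE hε v i := by
  obtain ⟨k, b, s⟩ := i
  rw [dmul_inv_scl_apply hg₁ hg₂, opE_apply, opE_apply, dmul_scl_apply hg₁ hg₂,
    dmul_scl_apply hg₁ hg₂]
  have h2 : (g₂ : ℂ) ≠ 0 := by exact_mod_cast (by linarith : g₂ ≠ 0)
  cases b
  · simp
  · by_cases hk : |(k : ℝ)| ≤ n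
    · simp [scl, hk]
    · simp only [scl, hk, if_true, if_false, Bool.false_eq_true]
      push_cast
      field_simp

theorem norm_scaled_opE_le (hg₁ : 1 ≤ g₁) (hg₂ : g₁ ≤ g₂) (hε : 0 < ε) (v : L2seq Mode) :
    ‖L2seq.dmul (fun i => (scl n g₁ g₂ i)⁻¹) (opE hε (L2seq.dmul (scl n g₁ g₂) v))‖
      ≤ ‖opE hε‖ * ‖v‖ := by
  refine le_trans ?_ ((opE hε).le_opNorm v)
  rw [← one_mul ‖opE hε v‖]
  refine L2seq.norm_le_of_forall zero_le_one fun i => ?_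
  rw [scaled_opE_apply hg₁ hg₂, norm_mul, Complex.norm_real]
  refine mul_le_mul_of_nonneg_right ?_ (norm_nonneg _)
  have h1 : 0 < g₁ := by linarith
  have h2 : 0 < g₂ := by linarith
  split_ifs
  · simp
  · rw [Real.norm_of_nonneg (by positivity)]; exact div_le_one_of_le₀ hg₂ h2.le

theorem norm_cproj_scaled_opE_le (hg₁ : 1 ≤ g₁) (hg₂ : g₁ ≤ g₂) (hε : 0 < ε)
    {B : Set Mode} (hB : ∀ i ∈ B, ¬ |(i.1 : ℝ)| ≤ n) (v : L2seq Mode) :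
    ‖L2seq.cproj B
      (L2seq.dmul (fun i => (scl n g₁ g₂ i)⁻¹) (opE hε (L2seq.dmul (scl n g₁ g₂) v)))‖
      ≤ g₁ / g₂ * ‖opE hε‖ * ‖v‖ := by
  have h1 : 0 < g₁ := by linarith
  have h2 : 0 < g₂ := by linarith
  rw [mul_assoc]
  refine le_trans ?_ (mul_le_mul_of_nonneg_left ((opE hε).le_opNorm v) (by positivity))
  refine L2seq.norm_le_of_forall (by positivity) fun i => ?_
  rw [L2seq.cproj_apply]
  split_ifs with hi
  · rw [scaled_opE_apply hg₁ hg₂, norm_mul, Complex.norm_real, if_neg (hB i hi),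
      Real.norm_of_nonneg (by positivity)]
  · rw [norm_zero]; positivity

theorem norm_scaled_in₄_le (hg₁ : 1 ≤ g₁) (hg₂ : g₁ ≤ g₂) (u : HS 0) :
    ‖L2seq.dmul (fun i => (scl n g₁ g₂ i)⁻¹) (in₄ u)‖ ≤ ‖in₄‖ * ‖u‖ := by
  refine le_trans ?_ (in₄.le_opNorm u)
  rw [← one_mul ‖in₄ u‖]
  exact L2seq.norm_dmul_apply_le zero_le_one (abs_inv_scl_le hg₁ hg₂) _

/-- The image of `in₄` lies in the block (u₃, u₄), where high modes are divided by g₁. The smallness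
into high modes thus comes from g₁ alone, and g₂ may be chosen afterwards. -/
theorem norm_cproj_scaled_in₄_le (hg₁ : 1 ≤ g₁) (hg₂ : g₁ ≤ g₂)
    {B : Set Mode} (hB : ∀ i ∈ B, ¬ |(i.1 : ℝ)| ≤ n) (u : HS 0) :
    ‖L2seq.cproj B (L2seq.dmul (fun i => (scl n g₁ g₂ i)⁻¹) (in₄ u))‖
      ≤ g₁⁻¹ * ‖in₄‖ * ‖u‖ := by
  have h1 : 0 < g₁ := by linarith
  rw [mul_assoc]
  refine le_trans ?_ (mul_le_mul_of_nonneg_left (in₄.le_opNorm u) (by positivity))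
  refine L2seq.norm_le_of_forall (by positivity) fun i => ?_
  rw [L2seq.cproj_apply]
  split_ifs with hi
  · rw [dmul_inv_scl_apply hg₁ hg₂, norm_mul, Complex.norm_real]
    obtain ⟨k, b, s⟩ := i
    rw [in₄_apply]
    have hk := hB _ hi
    cases b
    · simp only [scl, hk, if_false, Bool.false_eq_true]
      rw [Real.norm_of_nonneg (by positivity)]
    · simp
  · rw [norm_zero]; positivity

/-- The coefficients of `u₁` in coordinates are multiplied by this sequence. -/
def outSeq (hε : 0 < ε) : L2seq ℤ :=
  ⟨fun k => ((wt 1 k * dd ε k)⁻¹ : ℝ), L2seq.memℓp_iff.2 <| by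
    refine Summable.of_nonneg_of_le (fun k => sq_nonneg _) (fun k => ?_)
      (summable_inv_wt_one.mul_left ((2 + 1 / ε) ^ 2))
    have h1 := wt_pos 1 k
    have h2 := dd_pos hε k
    rw [Complex.norm_real, Real.norm_of_nonneg (by positivity), ← mul_pow, wt_two]
    refine pow_le_pow_left₀ (by positivity) ?_ 2
    have h3 := wt_mul_inv_dd_le hε k
    rw [mul_inv, sq, mul_inv]
    calc (wt 1 k)⁻¹ * (dd ε k)⁻¹ = wt 1 k * (dd ε k)⁻¹ * ((wt 1 k)⁻¹ * (wt 1 k)⁻¹) := by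
          field_simp
      _ ≤ _ := mul_le_mul_of_nonneg_right h3 (by positivity)⟩

theorem outSeq_apply (hε : 0 < ε) (k : ℤ) : outSeq hε k = ((wt 1 k * dd ε k)⁻¹ : ℝ) := rfl

theorem tsum_mode_le (x : L2seq ℤ) (b s : Bool) (v : L2seq Mode) :
    Summable (fun k => ‖x k‖ * ‖v (k, b, s)‖) ∧ ∑' k, ‖x k‖ * ‖v (k, b, s)‖ ≤ ‖x‖ * ‖v‖ := by
  have hinj : Function.Injective fun k : ℤ => ((k, b, s) : Mode) := fun k l h => congrArg Prod.fst h
  let w : L2seq ℤ := ⟨fun k => v (k, b, s), L2seq.memℓp_iff.2 (v.summable_sq.comp_injective hinj)⟩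
  have h := L2seq.tsum_mul_le x w
  refine ⟨h.1, h.2.trans (mul_le_mul_of_nonneg_left ?_ (norm_nonneg _))⟩
  refine le_of_sq_le_sq ?_ (norm_nonneg _)
  rw [L2seq.norm_sq, L2seq.norm_sq]
  exact tsum_comp_le_tsum_of_inj v.summable_sq (fun _ => sq_nonneg _) hinj

/-- The part of `outSeq` of frequencies larger than `n`. -/
def outTail (hε : 0 < ε) (n : ℕ) : L2seq ℤ :=
  L2seq.dmul (fun k : ℤ => if |(k : ℝ)| ≤ n then 0 else 1) (outSeq hε)

theorem outTail_apply (hε : 0 < ε) (k : ℤ) :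
    outTail hε n k = if |(k : ℝ)| ≤ n then 0 else outSeq hε k := by
  rw [outTail, L2seq.dmul_apply (c := 1)]
  · split_ifs <;> simp
  · intro i; split_ifs <;> simp

theorem tendsto_outTail (hε : 0 < ε) : Tendsto (fun n => ‖outTail hε n‖) atTop (𝓝 0) := by
  have h := L2seq.tendsto_dmul (l := atTop) (a := fun (n : ℕ) (k : ℤ) =>
    if |(k : ℝ)| ≤ n then (0 : ℝ) else 1) (b := fun _ => 0) (c := 1)
    (Eventually.of_forall fun n i => by split_ifs <;> simp) (by simp) (fun k => by
      refine tendsto_const_nhds.congr' ?_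
      obtain ⟨m, hm⟩ := exists_nat_ge |(k : ℝ)|
      filter_upwards [eventually_ge_atTop m] with n hn
      rw [if_pos (hm.trans (by exact_mod_cast hn))]) (outSeq hε)
  have e : L2seq.dmul (fun _ : ℤ => (0 : ℝ)) (outSeq hε) = 0 :=
    L2seq.ext_apply fun i => by
      rw [L2seq.dmul_apply (c := 0) (by simp)]; simp
  rw [e] at h
  simpa [outTail] using h.norm

/-- The large factor g₂ multiplies only frequencies above n, where the square-summable sequence of
coefficients of `out₁` has a small tail. For n chosen after g₂ the Wiener norm of u₁ is therefore
bounded independently of the scaling. -/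
theorem tsum_out₁_scl_le (hg₁ : 1 ≤ g₁) (hg₂ : g₁ ≤ g₂) (hε : 0 < ε) (v : L2seq Mode) :
    ∑' k, ‖(out₁ hε (L2seq.dmul (scl n g₁ g₂) v)).coeff k‖
      ≤ (2 * ‖outSeq hε‖ + g₂ * (2 * ‖outTail hε n‖)) * ‖v‖ := by
  have h1 := fun s => tsum_mode_le (outSeq hε) true s v
  have h2 := fun s => tsum_mode_le (outTail hε n) true s v
  have hs := fun s => (h1 s).1.add ((h2 s).1.mul_left g₂)
  have hle : ∀ s, ∑' k, (‖outSeq hε k‖ * ‖v (k, true, s)‖ + g₂ * (‖outTail hε n k‖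
      * ‖v (k, true, s)‖)) ≤ (‖outSeq hε‖ + g₂ * ‖outTail hε n‖) * ‖v‖ := fun s => by
    rw [(h1 s).1.tsum_add ((h2 s).1.mul_left g₂), tsum_mul_left, add_mul, mul_assoc]
    exact add_le_add (h1 s).2 (mul_le_mul_of_nonneg_left (h2 s).2 (by linarith))
  have hp : ∀ k s, ‖outSeq hε k‖ * ‖L2seq.dmul (scl n g₁ g₂) v (k, true, s)‖
      ≤ ‖outSeq hε k‖ * ‖v (k, true, s)‖ + g₂ * (‖outTail hε n k‖ * ‖v (k, true, s)‖) := by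
    intro k s
    rw [dmul_scl_apply hg₁ hg₂, outTail_apply, norm_mul, Complex.norm_real]
    have h3 := mul_nonneg (norm_nonneg (outSeq hε k)) (norm_nonneg (v (k, true, s)))
    by_cases hk : |(k : ℝ)| ≤ n
    · simp [scl, hk]
    · simp only [scl, hk, if_true, if_false]
      rw [Real.norm_of_nonneg (by linarith)]
      nlinarith
  refine (Summable.tsum_le_tsum (fun k => ?_) (HS.summable_norm_coeff _)
    ((hs true).add (hs false))).trans ?_
  · rw [coeff_out₁, ← outSeq_apply hε, norm_mul]
    refine (mul_le_mul_of_nonneg_left (norm_add_le _ _) (norm_nonneg _)).trans ?_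
    rw [mul_add]
    exact add_le_add (hp k true) (hp k false)
  · rw [(hs true).tsum_add (hs false)]
    have := hle true
    have := hle false
    linarith

end ScaledBounds

/-! #### The splitting of the modes -/

/-- A spectral gap of size `δ` around `[κ, κ']`. -/
structure Gap (κ κ' δ : ℝ) : Prop where
  lt : κ < κ'
  δ_pos : 0 < δ
  δ_le : δ ≤ 1
  gap : ∀ m : ℤ, (m : ℝ) + δ ≤ κ ∨ κ' + δ ≤ m
  lower : -1 < κ'
  upper : κ' < 1

theorem exists_ev_eq (i : Mode) : ∃ m : ℤ, ev i = m := by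
  obtain ⟨k, b, s⟩ := i
  cases s
  · exact ⟨-|k|, by simp [ev, sg]⟩
  · exact ⟨|k|, by simp [ev, sg]⟩

theorem ev_le (i : Mode) : ev i ≤ |(i.1 : ℝ)| := by
  refine (le_abs_self _).trans ?_
  rw [ev, abs_mul, abs_sg, one_mul, abs_abs]

theorem ev_eq_of_nonneg {i : Mode} (h : 0 ≤ ev i) (h0 : 0 < |(i.1 : ℝ)|) :
    ev i = |(i.1 : ℝ)| := by
  obtain ⟨k, b, s⟩ := i
  cases s
  · simp only [ev, sg, Bool.false_eq_true, if_false] at h h0 ⊢; linarith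
  · simp [ev, sg]

theorem Gap.ev_gap {κ κ' δ : ℝ} (G : Gap κ κ' δ) {i : Mode} (h : ¬ ev i + δ ≤ κ) :
    κ' + δ ≤ ev i := by
  obtain ⟨m, hm⟩ := exists_ev_eq i
  rw [hm] at h ⊢
  exact (G.gap m).resolve_left h

/-- Eigenvalues are integers, so one that exceeds -1 is nonnegative. This covers gaps in (-1, 0) and
in (0, 1) alike. -/
theorem Gap.ev_nonneg {κ κ' δ : ℝ} (G : Gap κ κ' δ) {i : Mode} (h : ¬ ev i + δ ≤ κ) :
    0 ≤ ev i := by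
  have h1 := G.ev_gap h
  obtain ⟨m, hm⟩ := exists_ev_eq i
  rw [hm] at h1 ⊢
  have h2 : (-1 : ℝ) < m := by linarith [G.lower, G.δ_pos]
  have h3 : (-1 : ℤ) < m := by exact_mod_cast h2
  exact_mod_cast (by omega : (0 : ℤ) ≤ m)

theorem jordan_supp (v : L2seq Mode) (i : Mode) (hi : i ∉ {i : Mode | i.1 = 0}) :
    jordan v i = 0 := by
  obtain ⟨k, b, s⟩ := i
  rw [jordan_apply]
  exact if_neg hi

/-- The splitting of the modes at a spectral gap. -/
def modeSplitting {κ κ' δ : ℝ} (G : Gap κ κ' δ) {s₁ S L : ℝ} {n : ℕ} (hn : 1 ≤ n) (hS : S ≤ s₁)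
    (hL : 0 ≤ L) : Splitting Mode where
  μ := ev
  F := {i | ev i + δ ≤ κ}
  M := {i | |(i.1 : ℝ)| ≤ n}
  O := {i | i.1 = 0}
  S := S
  s₁ := s₁
  κ := κ
  -- With this rate, modes of frequency at most n satisfy μ + L ≤ ν, and growing modes of higher
  -- frequency satisfy ν ≤ μ + L.
  ν := n + L
  L := L
  δ := δ
  S_le := hS
  L_nonneg := hL
  δ_pos := G.δ_pos
  ν_nonneg := by positivity
  κ_le := by
    have : (1 : ℝ) ≤ n := by exact_mod_cast hn
    linarith [G.lt, G.upper]
  fwd i hi := by linarith [G.δ_pos, mem_ofPred_eq ▸ hi]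
  mid_lower i _ hi := by linarith [G.ev_gap hi, G.lt, G.δ_pos]
  mid_upper i hi _ := by linarith [ev_le i, mem_ofPred_eq ▸ hi]
  bwd i hi hi' := by
    have h : (n : ℝ) < |(i.1 : ℝ)| := lt_of_not_ge hi'
    have h0 : (0 : ℝ) ≤ n := n.cast_nonneg
    rw [ev_eq_of_nonneg (G.ev_nonneg hi) (by linarith)]
    linarith
  bwd_gap i hi _ := by linarith [G.ev_gap hi, G.lt]
  nonneg i hi := G.ev_nonneg hi
  gap i hi := by
    have h0 : ev i = 0 := by simp [ev, show i.1 = 0 from hi]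
    have : (1 : ℝ) ≤ n := by exact_mod_cast hn
    refine ⟨by linarith [G.δ_le], ?_⟩
    by_cases h : ev i + δ ≤ κ
    · exact Or.inl ⟨h, h⟩
    · refine Or.inr ⟨h, ?_, by linarith [G.ev_gap h, G.lt]⟩
      simp [show i.1 = 0 from hi]
  N := jordan
  N_supp v i hi := jordan_supp v i hi

theorem finite_modes (n : ℕ) : {i : Mode | |(i.1 : ℝ)| ≤ n}.Finite := by
  have h : {i : Mode | |(i.1 : ℝ)| ≤ n} ⊆ (Icc (-(n : ℤ)) n) ×ˢ (univ : Set (Bool × Bool)) := by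
    intro i hi
    refine ⟨?_, mem_univ _⟩
    have hi' : |(i.1 : ℝ)| ≤ n := hi
    have h1 : |i.1| ≤ (n : ℤ) := by exact_mod_cast hi'
    exact abs_le.1 h1
  exact ((finite_Icc _ _).prod finite_univ).subset h

/-- Conjugation by a scaling. -/
def conjOp (g g' : L2seq Mode →L[ℂ] L2seq Mode) :
    (L2seq Mode →L[ℂ] L2seq Mode) →L[ℂ] (L2seq Mode →L[ℂ] L2seq Mode) :=
  (ContinuousLinearMap.compL ℂ (L2seq Mode) (L2seq Mode) (L2seq Mode) g').comp
    ((ContinuousLinearMap.compL ℂ (L2seq Mode) (L2seq Mode) (L2seq Mode)).flip g)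

theorem conjOp_apply (g g' X : L2seq Mode →L[ℂ] L2seq Mode) (v : L2seq Mode) :
    conjOp g g' X v = g' (X (g v)) := rfl

/-! ### Choice of the cut, the rates and the scaling for a given parameter -/

section Local

variable {κ κ' δ : ℝ} {s₁ ε : ℝ} {th : ℝ → ℝ} {Θ : ℝ}

/-- The parameters of the perturbation in scaled coordinates. -/
def scaledPert (hε : 0 < ε) (hth : Continuous th) (hΘ : ∀ s, |th s| ≤ Θ)
    (g g' : L2seq Mode →L[ℂ] L2seq Mode) (p : ℝ × Pot s₁) : Pert Mode s₁ :=
  ((ε : ℂ), (conjOp g g').compLpL 1 (volume.restrict (Iic s₁)) (decayL1 hε hth hΘ p))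

theorem contDiff_scaledPert (hε : 0 < ε) (hth : Continuous th) (hΘ : ∀ s, |th s| ≤ Θ)
    (g g' : L2seq Mode →L[ℂ] L2seq Mode) :
    ContDiff ℝ ∞ (scaledPert (s₁ := s₁) hε hth hΘ g g') := by
  refine contDiff_const.prodMk ?_
  exact (((conjOp g g').compLpL 1 (volume.restrict (Iic s₁))).restrictScalars ℝ).contDiff.comp
    (contDiff_decayL1 hε hth hΘ)

theorem scaledPert_apply (hε : 0 < ε) (hth : Continuous th) (hΘ : ∀ s, |th s| ≤ Θ)
    (g g' : L2seq Mode →L[ℂ] L2seq Mode) (p : ℝ × Pot s₁) :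
    ∀ᵐ σ ∂volume.restrict (Iic s₁), ∀ v,
      (scaledPert hε hth hΘ g g' p).2 σ v = g' (decay hε th p σ (g v)) := by
  filter_upwards [(conjOp g g').coeFn_compLpL (decayL1 hε hth hΘ p),
    (integrable_decay hε hth hΘ p).coeFn_toL1] with σ h1 h2 v
  rw [scaledPert, h1, decayL1, h2, conjOp_apply]

/-- The choices are made in the order S and L, then Ω, g₁, g₂, and finally n. There is no
circularity: the total bound c · `rr` holds for all scalings with g₂ times the tail controlled, and
the kernel `kl` and the constant Ω depend on S, L and s₁ but not on n or the scaling. -/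
theorem exists_localSol_coefC (G : Gap κ κ' δ) (hε : 0 < ε)
    (hεδ : ε * ‖jordan‖ * (2 / δ) ≤ 1 / 8) (hth : Continuous th) (hΘ : ∀ s, |th s| ≤ Θ)
    (p₀ : ℝ × Pot s₁) (S₀ : ℝ) :
    ∃ O Φm Φp, LocalSol ev (coefC hε th) s₁ κ κ' p₀ S₀ O Φm Φp := by
  set T := 2 * ‖outSeq hε‖ with hT
  have hT0 : 0 ≤ T := by positivity
  set e₀ := ‖opE hε‖ with he₀
  set i₀ := ‖in₄‖ with hi₀
  have he0 : 0 ≤ e₀ := norm_nonneg _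
  have hi0 : 0 ≤ i₀ := norm_nonneg _
  -- The summand 1 is reserved for the tail g₂ · 2‖outTail‖, which is made at most 1 by the choice
  -- of n below.
  set c := e₀ + i₀ * (T + 1) with hc
  have hc0 : 0 ≤ c := by positivity
  have hr0 : ∀ σ, 0 ≤ c * rr th p₀ σ := fun σ => mul_nonneg hc0 (rr_nonneg p₀ σ)
  obtain ⟨S, hSS, hS, L, hL, hker⟩ := exists_small_kernel (s₁ := s₁) hr0
    ((integrable_rr hth hΘ p₀).const_mul c)
    (by simpa only [mul_pow] using (integrable_rr_sq hth hΘ p₀).const_mul (c ^ 2)) S₀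
  set Ω := Real.exp (L * (s₁ - S))
  have hΩ : 0 < Ω := Real.exp_pos _
  set R := ∫ σ in Iic s₁, rr th p₀ σ with hR
  have hR0 : 0 ≤ R := integral_nonneg fun σ => rr_nonneg p₀ σ
  -- This is the size of the coupling into the backward modes for which the loss Ω still leaves at
  -- most 1/8.
  set ϑ := 1 / (8 * Ω * (R + 1)) with hϑ
  have hϑ0 : 0 < ϑ := by positivity
  -- The factor g₁ makes the multiplication term into high modes at most ϑ/2. The ratio g₂/g₁ below
  -- does the same for the coupling of u₃ to u₂.
  set g₁ := 1 + 2 * i₀ * (T + 1) / ϑ with hg₁'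
  have hg₁ : 1 ≤ g₁ := by
    have : 0 ≤ 2 * i₀ * (T + 1) / ϑ := by positivity
    linarith
  set g₂ := g₁ * (1 + 2 * e₀ / ϑ) with hg₂'
  have he2 : 0 ≤ 2 * e₀ / ϑ := by positivity
  have hg₂ : g₁ ≤ g₂ := by nlinarith
  have hg10 : 0 < g₁ := by linarith
  have hg20 : 0 < g₂ := by linarith
  have hϑ1 : g₁ / g₂ * e₀ + g₁⁻¹ * i₀ * (T + 1) ≤ ϑ := by
    have h1 : g₁ / g₂ * e₀ ≤ ϑ / 2 := by
      have : g₁ / g₂ = (1 + 2 * e₀ / ϑ)⁻¹ := by rw [hg₂']; field_simp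
      rw [this, inv_mul_le_iff₀ (by positivity)]
      have : (1 + 2 * e₀ / ϑ) * (ϑ / 2) = ϑ / 2 + e₀ := by field_simp
      linarith
    have h2 : g₁⁻¹ * i₀ * (T + 1) ≤ ϑ / 2 := by
      rw [mul_assoc, inv_mul_le_iff₀ hg10]
      have : g₁ * (ϑ / 2) = ϑ / 2 + i₀ * (T + 1) := by rw [hg₁']; field_simp
      linarith
    linarith
  obtain ⟨n, hn, hn1⟩ : ∃ n : ℕ, g₂ * (2 * ‖outTail hε n‖) ≤ 1 ∧ 1 ≤ n := by
    have h1 : Tendsto (fun n => g₂ * (2 * ‖outTail hε n‖)) atTop (𝓝 0) := by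
      simpa using ((tendsto_outTail hε).const_mul 2).const_mul g₂
    exact ((h1.eventually_le_const one_pos).and (eventually_ge_atTop 1)).exists
  set g := L2seq.dmul (scl n g₁ g₂) with hg
  set g' := L2seq.dmul (fun i => (scl n g₁ g₂ i)⁻¹) with hg'
  let D := modeSplitting G hn1 hS hL
  let q : ℝ × Pot s₁ → Pert Mode D.s₁ := scaledPert hε hth hΘ g g'
  have hB : ∀ i ∈ D.B, ¬ |(i.1 : ℝ)| ≤ n := fun i hi => hi.2
  have hsum : ∀ v, ∑' k, ‖(out₁ hε (g v)).coeff k‖ ≤ (T + 1) * ‖v‖ := fun v =>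
    (tsum_out₁_scl_le hg₁ hg₂ hε v).trans
      (mul_le_mul_of_nonneg_right (by linarith) (norm_nonneg _))
  have hmul : ∀ σ v, ‖HS.mul (potential th p₀ σ) (out₁ hε (g v))‖
      ≤ ‖potential th p₀ σ‖ * ((T + 1) * ‖v‖) := fun σ v =>
    (HS.norm_mul_le _ _).trans (mul_le_mul_of_nonneg_left (hsum v) (norm_nonneg _))
  have hexp : ∀ σ, ‖((Real.exp (2 * σ) : ℝ) : ℂ)‖ = Real.exp (2 * σ) := fun σ => by
    rw [Complex.norm_real, Real.norm_of_nonneg (Real.exp_pos _).le]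
  have hdec : ∀ σ v, g' (decay hε th p₀ σ (g v)) = (Real.exp (2 * σ) : ℂ) •
      (g' (opE hε (g v)) + g' (in₄ (HS.mul (potential th p₀ σ) (out₁ hε (g v))))) := by
    intro σ v
    rw [decay, smul_apply, add_apply, opA_apply, map_smul, map_add]
  have hcomb : ∀ (x y P w E : ℝ), 0 ≤ x → 0 ≤ y → 0 ≤ P → 0 ≤ w → 0 ≤ E →
      E * (x * w + y * (P * ((T + 1) * w))) ≤ (x + y * (T + 1)) * (E * (1 + P)) * w := by
    intro x y P w E hx hy hP hw hE
    have h1 : 0 ≤ E * w * (x * P + y * (T + 1)) := by positivity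
    nlinarith
  have hbd : ∀ σ v, ‖g' (decay hε th p₀ σ (g v))‖ ≤ c * rr th p₀ σ * ‖v‖ := by
    intro σ v
    rw [hdec, norm_smul, hexp]
    refine le_trans (mul_le_mul_of_nonneg_left ((norm_add_le _ _).trans (add_le_add
      (norm_scaled_opE_le hg₁ hg₂ hε v) ((norm_scaled_in₄_le hg₁ hg₂ _).trans
        (mul_le_mul_of_nonneg_left (hmul σ v) hi0)))) (Real.exp_pos _).le) ?_
    exact hcomb _ _ _ _ _ he0 hi0 (norm_nonneg _) (norm_nonneg _) (Real.exp_pos _).le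
  have hbdB : ∀ σ v, ‖L2seq.cproj D.B (g' (decay hε th p₀ σ (g v)))‖
      ≤ ϑ * rr th p₀ σ * ‖v‖ := by
    intro σ v
    rw [hdec, map_smul, map_add, norm_smul, hexp]
    refine le_trans (mul_le_mul_of_nonneg_left ((norm_add_le _ _).trans (add_le_add
      (norm_cproj_scaled_opE_le hg₁ hg₂ hε hB v) ((norm_cproj_scaled_in₄_le hg₁ hg₂ hB _).trans
        (mul_le_mul_of_nonneg_left (hmul σ v) (by positivity))))) (Real.exp_pos _).le) ?_
    refine (hcomb _ _ _ _ _ (by positivity) (by positivity) (norm_nonneg _) (norm_nonneg _)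
      (Real.exp_pos _).le).trans ?_
    exact mul_le_mul_of_nonneg_right (mul_le_mul_of_nonneg_right hϑ1 (rr_nonneg p₀ σ))
      (norm_nonneg _)
  have happ : ∀ p, ∀ᵐ σ ∂volume.restrict (Iic s₁), ∀ v,
      (q p).2 σ v = g' (decay hε th p σ (g v)) := fun p => scaledPert_apply hε hth hΘ g g' p
  have hnil : ‖(ε : ℂ)‖ * ‖jordan‖ * (2 / δ) ≤ 1 / 8 := by
    rwa [Complex.norm_real, Real.norm_of_nonneg hε.le]
  have hbounds : ∃ b h : ℝ → ℝ, Integrable b D.vol ∧ Integrable h D.vol ∧ (∀ σ, 0 ≤ b σ) ∧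
      (∀ σ, 0 ≤ h σ) ∧ (∀ᵐ σ ∂D.vol, ∀ v, ‖(q p₀).2 σ v‖ ≤ b σ * ‖v‖) ∧
      (∀ᵐ σ ∂D.vol, ∀ v, ‖L2seq.cproj D.B ((q p₀).2 σ v)‖ ≤ h σ * ‖v‖) ∧
      (∀ s, ∫ σ, D.kl s σ * b σ ∂D.vol ≤ 1 / 4) ∧ D.Ω * ∫ σ, h σ ∂D.vol ≤ 1 / 8 := by
    refine ⟨fun σ => c * rr th p₀ σ, fun σ => ϑ * rr th p₀ σ,
      (integrable_rr hth hΘ p₀).const_mul c, (integrable_rr hth hΘ p₀).const_mul ϑ, hr0,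
      fun σ => mul_nonneg hϑ0.le (rr_nonneg p₀ σ), ?_, ?_, hker, ?_⟩
    · filter_upwards [happ p₀] with σ hσ v
      rw [hσ]; exact hbd σ v
    · filter_upwards [happ p₀] with σ hσ v
      rw [hσ]; exact hbdB σ v
    · change Ω * ∫ σ in Iic s₁, ϑ * rr th p₀ σ ≤ 1 / 8
      rw [integral_const_mul, ← hR, hϑ]
      have : Ω * (1 / (8 * Ω * (R + 1)) * R) = R / (R + 1) / 8 := by field_simp
      rw [this]
      have : R / (R + 1) ≤ 1 := div_le_one_of_le₀ (by linarith) (by linarith)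
      linarith
  have hn1' : (1 : ℝ) ≤ n := by exact_mod_cast hn1
  have h₁ : κ' + D.L ≤ D.ν := by
    change κ' + L ≤ n + L
    linarith [G.upper]
  have h₂ : ∀ i ∈ D.F, D.μ i ≤ κ' := fun i hi => by
    have : ev i + δ ≤ κ := hi
    change ev i ≤ κ'
    linarith [G.δ_pos, G.lt]
  have h₃ : ∀ i ∉ D.F, κ' + D.δ ≤ D.μ i := fun i hi => G.ev_gap hi
  have h₄ : ∀ i ∈ D.O, i ∈ D.F → D.μ i + D.δ ≤ κ' := fun i _ hi =>
    le_trans (show ev i + δ ≤ κ from hi) G.lt.le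
  have hs : D.SmallBounds (q p₀) := ⟨hnil, hbounds⟩
  -- The quantities in these bounds do not involve the rate at -∞, so the same bounds serve both
  -- splittings.
  have hs' : (D.withRate κ' h₁ h₂ h₃ h₄).SmallBounds (q p₀) := ⟨hnil, hbounds⟩
  have hC : ∀ p, ∀ᵐ σ ∂volume.restrict (Iic s₁), ∀ v,
      pert jordan (q p) σ v = g' (coefC hε th p σ (g v)) := fun p => by
    filter_upwards [happ p] with σ hσ v
    -- The nilpotent coupling lives at frequency 0, where the scaling factor is 1.
    have hj : g' (jordan (g v)) = jordan v := L2seq.ext_apply fun i => by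
      obtain ⟨k, b, s⟩ := i
      rw [hg', dmul_inv_scl_apply hg₁ hg₂, jordan_apply, jordan_apply, hg, dmul_scl_apply hg₁ hg₂,
        dmul_scl_apply hg₁ hg₂]
      by_cases hk : k = 0
      · simp [scl, hk]
      · simp [hk]
    rw [pert, add_apply, smul_apply, hσ, coefC, add_apply, map_add, smul_apply, map_smul, hj]
    rfl
  obtain ⟨O, Φm, Φp, h⟩ := D.exists_localSol (E := ℝ × Pot s₁) (finite_modes n)
    (fun i hi => by
      have : ev i + δ ≤ κ := hi
      change ev i < κ
      linarith [G.δ_pos]) h₁ h₂ h₃ h₄ G.lt.le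
    (dmul_scl_apply hg₁ hg₂) (dmul_inv_scl_apply hg₁ hg₂) (dmul_scl_inv hg₁ hg₂)
    (dmul_inv_scl hg₁ hg₂) (C := coefC hε th) (fun p a => integrableOn_coefC hε hth hΘ p a)
    (contDiff_scaledPert hε hth hΘ g g') hC (p₀ := p₀) hs.small hs'.small
  exact ⟨O, Φm, Φp, { h with cont := fun t₀ h1 => h.cont t₀ (lt_of_le_of_lt hSS h1) }⟩

theorem exists_globalSol_coefC (G : Gap κ κ' δ) (hε : 0 < ε)
    (hεδ : ε * ‖jordan‖ * (2 / δ) ≤ 1 / 8) (hth : Continuous th) (hΘ : ∀ s, |th s| ≤ Θ) :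
    ∃ Φm Φp, GlobalSol ev (coefC (s₁ := s₁) hε th) s₁ κ κ' Φm Φp :=
  exists_globalSol (fun p a => integrableOn_coefC hε hth hΘ p a)
    fun p₀ S₀ _ => exists_localSol_coefC G hε hεδ hth hΘ p₀ S₀

end Local

end Bilaplace

namespace Bilaplace

/-! ### Primitives of integrable functions and integration by parts -/

section Prim

variable {E F G : Type*} [NormedAddCommGroup E] [NormedSpace ℝ E] [CompleteSpace E]
  [NormedAddCommGroup F] [NormedSpace ℝ F] [CompleteSpace F]
  [NormedAddCommGroup G] [NormedSpace ℝ G] [CompleteSpace G]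

/-- `U` is a primitive of the integrable function `D` on `[a, b]`. -/
structure IsPrim (D U : ℝ → E) (a b : ℝ) : Prop where
  integrable : IntegrableOn D (Icc a b)
  eq : ∀ s ∈ Icc a b, U s = U a + ∫ σ in a..s, D σ

theorem intervalIntegral_eq_Icc {f : ℝ → E} {a b : ℝ} (hab : a ≤ b) :
    ∫ σ in a..b, f σ = ∫ σ in Icc a b, f σ := by
  rw [intervalIntegral.integral_of_le hab, integral_Icc_eq_integral_Ioc]

namespace IsPrim

variable {D U : ℝ → E} {D' V : ℝ → F} {a b : ℝ}

theorem intervalIntegrable (h : IsPrim D U a b) {c d : ℝ} (hc : c ∈ Icc a b) (hd : d ∈ Icc a b) :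
    IntervalIntegrable D volume c d :=
  (h.integrable.mono_set (uIcc_subset_Icc hc hd)).intervalIntegrable

theorem sub_eq (h : IsPrim D U a b) {c d : ℝ} (hc : c ∈ Icc a b) (hd : d ∈ Icc a b) :
    ∫ σ in c..d, D σ = U d - U c := by
  have ha : a ∈ Icc a b := ⟨le_rfl, hc.1.trans hc.2⟩
  rw [h.eq c hc, h.eq d hd, ← intervalIntegral.integral_interval_sub_left
    (h.intervalIntegrable ha hd) (h.intervalIntegrable ha hc)]
  abel

theorem mono (h : IsPrim D U a b) {c d : ℝ} (hc : c ∈ Icc a b) (hd : d ∈ Icc a b) :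
    IsPrim D U c d :=
  ⟨h.integrable.mono_set (Icc_subset_Icc hc.1 hd.2), fun s hs => by
    rw [h.sub_eq hc ⟨hc.1.trans hs.1, hs.2.trans hd.2⟩]; abel⟩

theorem continuousOn (h : IsPrim D U a b) : ContinuousOn U (Icc a b) := by
  rcases lt_or_ge b a with hab | hab
  · rw [Icc_eq_empty (not_le.2 hab)]; exact continuousOn_empty _
  have h1 := intervalIntegral.continuousOn_primitive_interval (f := D) (μ := volume) (a := a)
    (b := b) (by rw [uIcc_of_le hab]; exact h.integrable)
  rw [uIcc_of_le hab] at h1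
  exact (continuousOn_const.add h1).congr h.eq

theorem of_hasDerivAt (hV : ∀ s, HasDerivAt V (D' s) s) (hD : Continuous D') :
    IsPrim D' V a b :=
  ⟨hD.integrableOn_Icc, fun s _ => by
    rw [intervalIntegral.integral_eq_sub_of_hasDerivAt (fun x _ => hV x)
      (hD.intervalIntegrable _ _)]
    abel⟩

/-- Integration by parts. -/
theorem by_parts (B : E →L[ℝ] F →L[ℝ] G) (hab : a ≤ b) (hU : IsPrim D U a b)
    (hV : IsPrim D' V a b) :
    IntegrableOn (fun s => B (U s) (D' s)) (Icc a b) ∧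
    IntegrableOn (fun s => B (D s) (V s)) (Icc a b) ∧
    (∫ s in a..b, B (U s) (D' s)) + (∫ s in a..b, B (D s) (V s))
      = B (U b) (V b) - B (U a) (V a) := by
  have ha : a ∈ Icc a b := ⟨le_rfl, hab⟩
  have hb : b ∈ Icc a b := ⟨hab, le_rfl⟩
  set μ := volume.restrict (Icc a b) with hμ
  have hD : Integrable D μ := hU.integrable
  have hD' : Integrable D' μ := hV.integrable
  have hBc : Continuous (fun p : E × F => B p.1 p.2) :=
    (B.continuous.comp continuous_fst).clm_apply continuous_snd
  have hk0 : Integrable (fun z : ℝ × ℝ => B (D z.2) (D' z.1)) (μ.prod μ) := by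
    have := Integrable.op_fst_snd (op := fun (x : F) (y : E) => B y x) (μ := μ) (ν := μ)
      (hBc.comp continuous_swap) ⟨‖B‖, fun x y => by
        rw [mul_assoc, mul_comm ‖x‖, ← mul_assoc]; exact B.le_opNorm₂ y x⟩ hD' hD
    exact this
  have hms : MeasurableSet {z : ℝ × ℝ | z.2 ≤ z.1} := measurableSet_le measurable_snd measurable_fst
  -- Integration by parts is Fubini's theorem for B(D σ, D' s) on the triangle σ ≤ s; no pointwise
  -- derivative is required.
  set k : ℝ → ℝ → G := fun s σ => {z : ℝ × ℝ | z.2 ≤ z.1}.indicator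
    (fun z : ℝ × ℝ => B (D z.2) (D' z.1)) (s, σ) with hk
  have hki : Integrable (Function.uncurry k) (μ.prod μ) := hk0.indicator hms
  have e1 : ∀ s ∈ Icc a b, ∫ σ, k s σ ∂μ = B (U s - U a) (D' s) := fun s hs => by
    have : ∀ σ, k s σ = (Iic s).indicator (fun σ => B (D σ) (D' s)) σ := fun σ => by
      simp only [hk, indicator_apply, mem_ofPred_eq, mem_Iic]
    simp only [this]
    rw [hμ, setIntegral_indicator measurableSet_Iic, ← Ici_inter_Iic, inter_assoc, Iic_inter_Iic,
      min_eq_right hs.2, Ici_inter_Iic, ← intervalIntegral_eq_Icc hs.1, ← hU.sub_eq ha hs]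
    exact ((ContinuousLinearMap.apply ℝ G (D' s)).comp B).intervalIntegral_comp_comm
      (hU.intervalIntegrable ha hs)
  have e2 : ∀ σ ∈ Icc a b, ∫ s, k s σ ∂μ = B (D σ) (V b - V σ) := fun σ hσ => by
    have : ∀ s, k s σ = (Ici σ).indicator (fun s => B (D σ) (D' s)) s := fun s => by
      simp only [hk, indicator_apply, mem_ofPred_eq, mem_Ici]
    simp only [this]
    rw [hμ, setIntegral_indicator measurableSet_Ici, ← Ici_inter_Iic, inter_comm, ← inter_assoc,
      Ici_inter_Ici, sup_eq_left.2 hσ.1, Ici_inter_Iic, ← intervalIntegral_eq_Icc hσ.2,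
      ← hV.sub_eq hσ hb]
    exact (B (D σ)).intervalIntegral_comp_comm (hV.intervalIntegrable hσ hb)
  have i1 : Integrable (fun s => B (U s - U a) (D' s)) μ :=
    hki.integral_prod_left.congr (by
      filter_upwards [ae_restrict_mem measurableSet_Icc] with s hs using e1 s hs)
  have i2 : Integrable (fun s => B (D s) (V b - V s)) μ :=
    hki.integral_prod_right.congr (by
      filter_upwards [ae_restrict_mem measurableSet_Icc] with s hs using e2 s hs)
  have i3 : Integrable (fun s => B (U a) (D' s)) μ := (B (U a)).integrable_comp hD'
  have i4 : Integrable (fun s => B (D s) (V b)) μ :=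
    ((ContinuousLinearMap.apply ℝ G (V b)).comp B).integrable_comp hD
  have i5 : Integrable (fun s => B (U s) (D' s)) μ :=
    (i1.add i3).congr (Eventually.of_forall fun s => by simp)
  have i6 : Integrable (fun s => B (D s) (V s)) μ :=
    (i4.sub i2).congr (Eventually.of_forall fun s => by simp)
  have hsw := integral_integral_swap hki
  rw [setIntegral_congr_fun measurableSet_Icc e1, setIntegral_congr_fun measurableSet_Icc e2] at hsw
  have j1 : ∫ s in Icc a b, B (U s - U a) (D' s)
      = (∫ s in Icc a b, B (U s) (D' s)) - B (U a) (V b - V a) := by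
    rw [← hV.sub_eq ha hb, ← (B (U a)).intervalIntegral_comp_comm (hV.intervalIntegrable ha hb),
      intervalIntegral_eq_Icc hab, ← integral_sub i5 i3]
    simp only [map_sub, sub_apply]
    rfl
  have j2 : ∫ s in Icc a b, B (D s) (V b - V s)
      = B (U b - U a) (V b) - ∫ s in Icc a b, B (D s) (V s) := by
    have : B (U b - U a) (V b) = ∫ s in Icc a b, B (D s) (V b) := by
      rw [← hU.sub_eq ha hb, ← intervalIntegral_eq_Icc hab]
      exact (((ContinuousLinearMap.apply ℝ G (V b)).comp B).intervalIntegral_comp_comm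
        (hU.intervalIntegrable ha hb)).symm
    rw [this, ← integral_sub i4 i6]
    simp only [map_sub]
    rfl
  refine ⟨i5, i6, ?_⟩
  rw [intervalIntegral_eq_Icc hab, intervalIntegral_eq_Icc hab]
  rw [j1, j2] at hsw
  have h3 := sub_eq_iff_eq_add.1 hsw
  rw [h3]
  simp only [map_sub, sub_apply]
  abel

theorem map (L : E →L[ℝ] F) (h : IsPrim D U a b) : IsPrim (fun s => L (D s)) (fun s => L (U s)) a b :=
  ⟨L.integrable_comp h.integrable, fun s hs => by
    have ha : a ∈ Icc a b := ⟨le_rfl, hs.1.trans hs.2⟩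
    rw [L.intervalIntegral_comp_comm (h.intervalIntegrable ha hs), ← map_add, ← h.eq s hs]⟩

/-- The product of two primitives. -/
theorem bilin (B : E →L[ℝ] F →L[ℝ] G) (hU : IsPrim D U a b) (hV : IsPrim D' V a b) :
    IsPrim (fun s => B (U s) (D' s) + B (D s) (V s)) (fun s => B (U s) (V s)) a b := by
  rcases lt_or_ge b a with hab | hab
  · have : Icc a b = ∅ := Icc_eq_empty (not_le.2 hab)
    exact ⟨by rw [this]; exact integrableOn_empty, by rw [this]; simp⟩
  obtain ⟨h1, h2, -⟩ := by_parts B hab hU hV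
  refine ⟨h1.add h2, fun s hs => ?_⟩
  have ha : a ∈ Icc a b := ⟨le_rfl, hab⟩
  obtain ⟨h1, h2, h3⟩ := by_parts B hs.1 (hU.mono ha hs) (hV.mono ha hs)
  rw [intervalIntegral.integral_add, h3]
  · abel
  · rw [intervalIntegrable_iff_integrableOn_Icc_of_le hs.1]; exact h1
  · rw [intervalIntegrable_iff_integrableOn_Icc_of_le hs.1]; exact h2

end IsPrim

/-! #### Test functions -/

theorem IsTest.hasDerivAt {φ : ℝ → E} {O : Set ℝ} (h : IsTest φ O) (s : ℝ) :
    HasDerivAt φ (deriv φ s) s :=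
  (h.1.differentiable (by simp) s).hasDerivAt

theorem IsTest.continuous_deriv {φ : ℝ → E} {O : Set ℝ} (h : IsTest φ O) :
    Continuous (deriv φ) := h.1.continuous_deriv (by norm_cast)

theorem IsTest.isPrim {φ : ℝ → E} {O : Set ℝ} (h : IsTest φ O) (a b : ℝ) :
    IsPrim (deriv φ) φ a b := .of_hasDerivAt h.hasDerivAt h.continuous_deriv

theorem IsTest.eq_zero {φ : ℝ → E} {O : Set ℝ} (h : IsTest φ O) {s : ℝ} (hs : s ∉ O) : φ s = 0 :=
  image_eq_zero_of_notMem_tsupport fun h' => hs (h.2.2 h')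

theorem IsTest.deriv_eq_zero {φ : ℝ → E} {O : Set ℝ} (h : IsTest φ O) {s : ℝ} (hs : s ∉ O) :
    deriv φ s = 0 :=
  image_eq_zero_of_notMem_tsupport fun h' =>
    hs (h.2.2 (tsupport_deriv_subset h'))

/-- A compact subset of an open interval lies in a compact interval. -/
theorem exists_Icc_of_isCompact {K O : Set ℝ} (hK : IsCompact K) (hKO : K ⊆ O) (hO : IsOpen O)
    (hc : O.OrdConnected) (hKn : K.Nonempty) : ∃ a b, a < b ∧ Icc a b ⊆ O ∧ K ⊆ Ioo a b := by
  obtain ⟨m, hm, hm'⟩ := hK.exists_isLeast hKn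
  obtain ⟨M, hM, hM'⟩ := hK.exists_isGreatest hKn
  obtain ⟨a, ha, ham⟩ : ∃ a ∈ O, a < m := by
    obtain ⟨ε, hε, hb⟩ := Metric.isOpen_iff.1 hO m (hKO hm)
    exact ⟨m - ε / 2, hb (by rw [Metric.mem_ball, Real.dist_eq, abs_lt]; constructor <;> linarith),
      by linarith⟩
  obtain ⟨b, hb, hbM⟩ : ∃ b ∈ O, M < b := by
    obtain ⟨ε, hε, hb⟩ := Metric.isOpen_iff.1 hO M (hKO hM)
    exact ⟨M + ε / 2, hb (by rw [Metric.mem_ball, Real.dist_eq, abs_lt]; constructor <;> linarith),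
      by linarith⟩
  exact ⟨a, b, ham.trans_le ((hm' hM).trans hbM.le), hc.out ha hb, fun y hy =>
    ⟨ham.trans_le (hm' hy), (hM' hy).trans_lt hbM⟩⟩

/-- The support of a test function lies in a compact interval. -/
theorem IsTest.exists_Icc {φ : ℝ → E} {O : Set ℝ} (h : IsTest φ O) (hO : IsOpen O)
    (hc : O.OrdConnected) (hne : O.Nonempty) :
    ∃ a b, a < b ∧ Icc a b ⊆ O ∧ IsTest φ (Ioo a b) := by
  obtain ⟨x, hx⟩ := hne
  obtain ⟨a, b, hab, h1, h2⟩ := exists_Icc_of_isCompact (IsCompact.insert h.2.1 x)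
    (insert_subset hx h.2.2) hO hc ⟨x, mem_insert _ _⟩
  exact ⟨a, b, hab, h1, h.1, h.2.1, (subset_insert _ _).trans h2⟩

theorem integral_eq_of_zero {f : ℝ → G} {O : Set ℝ} (hO : MeasurableSet O) {a b : ℝ} (hab : a ≤ b)
    (hsub : Ioo a b ⊆ O) (h0 : ∀ s ∉ Ioo a b, f s = 0) :
    ∫ s in O, f s = ∫ s in a..b, f s := by
  rw [intervalIntegral.integral_of_le hab, integral_Ioc_eq_integral_Ioo]
  exact setIntegral_eq_of_subset_of_forall_sdiff_eq_zero hO hsub fun x hx => h0 x hx.2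

/-- Integration by parts against a test function. -/
theorem IsPrim.integral_test (B : E →L[ℝ] F →L[ℝ] G) {D U : ℝ → E} {V : ℝ → F} {O : Set ℝ}
    (hO : IsOpen O) (hc : O.OrdConnected) (hU : ∀ a b, a < b → Icc a b ⊆ O → IsPrim D U a b)
    (hV : IsTest V O) : ∫ s in O, B (U s) (deriv V s) = -∫ s in O, B (D s) (V s) := by
  rcases O.eq_empty_or_nonempty with rfl | hne
  · simp
  obtain ⟨a, b, hab, hsub, hT⟩ := hV.exists_Icc hO hc hne
  have h := (IsPrim.by_parts B hab.le (hU a b hab hsub) (hV.isPrim a b)).2.2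
  rw [hT.eq_zero (show a ∉ Ioo a b from fun h => lt_irrefl _ h.1),
    hT.eq_zero (show b ∉ Ioo a b from fun h => lt_irrefl _ h.2), map_zero, map_zero, sub_zero] at h
  rw [integral_eq_of_zero hO.measurableSet hab.le (Ioo_subset_Icc_self.trans hsub)
    fun s hs => by rw [hT.deriv_eq_zero hs, map_zero],
    integral_eq_of_zero hO.measurableSet hab.le (Ioo_subset_Icc_self.trans hsub)
    fun s hs => by rw [hT.eq_zero hs, map_zero]]
  exact eq_neg_of_add_eq_zero_left h

/-- A continuous function with vanishing weak derivative is constant. -/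
theorem eq_of_integral_deriv_eq_zero {f : ℝ → E} {a b : ℝ} (hab : a < b)
    (hf : ContinuousOn f (Icc a b))
    (h : ∀ ψ : ℝ → ℝ, IsTest ψ (Ioo a b) → ∫ s in a..b, deriv ψ s • f s = 0) : f b = f a := by
  obtain ⟨c, hc⟩ : (Ioo a b).Nonempty := nonempty_Ioo.2 hab
  obtain ⟨χ, hχs, hχc, hχ, hχr, hχ1⟩ :=
    exists_contDiff_tsupport_subset (n := ⊤) (Ioo_mem_nhds hc.1 hc.2)
  have hχT : IsTest χ (Ioo a b) := ⟨hχ, hχc, hχs⟩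
  have hI : 0 < ∫ s in a..b, χ s := by
    refine intervalIntegral.integral_pos hab hχ.continuous.continuousOn
      (fun x _ => (hχr (mem_range_self x)).1) ⟨c, Ioo_subset_Icc_self hc, by rw [hχ1]; norm_num⟩
  set I := ∫ s in a..b, χ s
  have hint : ∀ φ : ℝ → ℝ, Continuous φ → IntervalIntegrable (fun s => φ s • f s) volume a b :=
    fun φ hφ => ContinuousOn.intervalIntegrable (by
      rw [uIcc_of_le hab.le]; exact hφ.continuousOn.smul hf)
  have key : ∀ φ : ℝ → ℝ, IsTest φ (Ioo a b) →
      ∫ s in a..b, φ s • (f s - I⁻¹ • ∫ x in a..b, χ x • f x) = 0 := by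
    intro φ hφ
    set J := ∫ s in a..b, φ s
    -- Subtracting a multiple of a fixed bump χ gives integral zero, so the primitive ψ has compact
    -- support in (a, b) and is an admissible test function. Testing with it shows that f minus its
    -- χ-average integrates to zero against every φ.
    set ρ : ℝ → ℝ := fun s => φ s - J * I⁻¹ * χ s with hρ
    have hρs : ContDiff ℝ ∞ ρ := hφ.1.sub (contDiff_const.mul hχ)
    have hρc := hρs.continuous
    set ψ : ℝ → ℝ := fun x => ∫ s in a..x, ρ s with hψ
    have hd : ∀ x, HasDerivAt ψ (ρ x) x := fun x =>
      intervalIntegral.integral_hasDerivAt_right (hρc.intervalIntegrable _ _)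
        hρc.stronglyMeasurable.stronglyMeasurableAtFilter hρc.continuousAt
    have hdψ : deriv ψ = ρ := funext fun x => (hd x).deriv
    have hψs : ContDiff ℝ ∞ ψ :=
      contDiff_infty_iff_deriv.2 ⟨fun x => (hd x).differentiableAt, by rw [hdψ]; exact hρs⟩
    have hρ0 : ∫ s in a..b, ρ s = 0 := by
      have i2 : IntervalIntegrable (fun s => J * I⁻¹ * χ s) volume a b :=
        (continuous_const.mul hχ.continuous).intervalIntegrable _ _
      rw [hρ, intervalIntegral.integral_sub (hφ.1.continuous.intervalIntegrable _ _) i2,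
        intervalIntegral.integral_const_mul]
      change J - J * I⁻¹ * I = 0
      field_simp
      ring
    set K := tsupport φ ∪ tsupport χ
    have hK : IsCompact K := IsCompact.union hφ.2.1 hχc
    have hKs : K ⊆ Ioo a b := union_subset hφ.2.2 hχs
    have hKn : K.Nonempty := ⟨c, Or.inr (subset_tsupport _ (by simp [hχ1]))⟩
    obtain ⟨m, hm, hm'⟩ := hK.exists_isLeast hKn
    obtain ⟨M, hM, hM'⟩ := hK.exists_isGreatest hKn
    have hout : ∀ s ∉ K, ρ s = 0 := fun s hs => by
      rw [hρ]; beta_reduce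
      rw [image_eq_zero_of_notMem_tsupport fun h' => hs (Or.inl h'),
        image_eq_zero_of_notMem_tsupport fun h' => hs (Or.inr h')]
      ring
    have hψT : IsTest ψ (Ioo a b) := by
      have hsupp : tsupport ψ ⊆ Icc m M := by
        refine closure_minimal (fun x hx => ?_) isClosed_Icc
        by_contra hxm
        refine hx ?_
        rw [mem_Icc, not_and_or, not_le, not_le] at hxm
        rcases hxm with hxm | hxm
        · refine intervalIntegral.integral_zero_ae (Eventually.of_forall fun s hs => ?_)
          refine hout s fun hsK => ?_
          have h1 := hm' hsK
          have h2 : s ≤ max a x := (mem_uIoc.1 hs).elim (fun h => h.2.trans (le_max_right _ _))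
            fun h => h.2.trans (le_max_left _ _)
          have h3 : a < m := (hKs hm).1
          rcases max_choice a x with h | h <;> rw [h] at h2 <;> linarith
        · change ∫ s in a..x, ρ s = 0
          have h4 : ∫ s in b..x, ρ s = 0 := by
            refine intervalIntegral.integral_zero_ae (Eventually.of_forall fun s hs => ?_)
            refine hout s fun hsK => ?_
            have h1 := hM' hsK
            have h2 : min b x < s := (mem_uIoc.1 hs).elim
              (fun h => (min_le_left _ _).trans_lt h.1) fun h => (min_le_right _ _).trans_lt h.1
            have h3 : M < b := (hKs hM).2
            rcases min_choice b x with h | h <;> rw [h] at h2 <;> linarith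
          rw [← intervalIntegral.integral_add_adjacent_intervals
            (hρc.intervalIntegrable a b) (hρc.intervalIntegrable b x), hρ0, h4, add_zero]
      exact ⟨hψs, isCompact_Icc.of_isClosed_subset (isClosed_tsupport _) hsupp, fun x hx =>
        ⟨(hKs hm).1.trans_le (hsupp hx).1, (hsupp hx).2.trans_lt (hKs hM).2⟩⟩
    have h1 := h ψ hψT
    rw [hdψ] at h1
    have e1 : ∀ s, ρ s • f s = φ s • f s - (J * I⁻¹) • (χ s • f s) := fun s => by
      rw [hρ]; simp only [sub_smul, mul_smul]
    have e2 : ∀ s, φ s • (f s - I⁻¹ • ∫ x in a..b, χ x • f x)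
        = φ s • f s - φ s • (I⁻¹ • ∫ x in a..b, χ x • f x) := fun s => smul_sub _ _ _
    simp only [e1] at h1
    have i1 : IntervalIntegrable (fun s => (J * I⁻¹) • (χ s • f s)) volume a b :=
      (hint χ hχ.continuous).smul _
    have i2 : IntervalIntegrable (fun s => φ s • (I⁻¹ • ∫ x in a..b, χ x • f x)) volume a b :=
      (hφ.1.continuous.smul continuous_const).intervalIntegrable _ _
    rw [intervalIntegral.integral_sub (hint φ hφ.1.continuous) i1,
      intervalIntegral.integral_smul] at h1
    simp only [e2]
    rw [intervalIntegral.integral_sub (hint φ hφ.1.continuous) i2,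
      intervalIntegral.integral_smul_const, ← mul_smul]
    exact h1
  set C := I⁻¹ • ∫ x in a..b, χ x • f x
  have hco : ContinuousOn (fun s => f s - C) (Icc a b) := hf.sub continuousOn_const
  have hae := isOpen_Ioo.ae_eq_zero_of_integral_contDiff_smul_eq_zero (μ := volume)
    (f := fun s => f s - C) (U := Ioo a b)
    ((hco.mono Ioo_subset_Icc_self).locallyIntegrableOn measurableSet_Ioo)
    (fun g hg hgc hgs => by
      have hT : IsTest g (Ioo a b) := ⟨hg, hgc, hgs⟩
      rw [← key g hT, ← integral_eq_of_zero (O := univ) MeasurableSet.univ hab.le (subset_univ _)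
        fun s hs => by rw [hT.eq_zero hs, zero_smul], setIntegral_univ])
  have h1 : EqOn (fun s => f s - C) (fun _ => 0) (Ioo a b) :=
    Measure.eqOn_open_of_ae_eq (μ := volume) ((ae_restrict_iff' measurableSet_Ioo).2 hae) isOpen_Ioo
      (hco.mono Ioo_subset_Icc_self) continuousOn_const
  have h2 := h1.of_subset_closure hco continuousOn_const Ioo_subset_Icc_self
    (by rw [closure_Ioo hab.ne])
  have ha := h2 (left_mem_Icc.2 hab.le)
  have hb := h2 (right_mem_Icc.2 hab.le)
  rw [sub_eq_zero.1 ha, sub_eq_zero.1 hb]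

/-- A continuous function with an integrable weak derivative is a primitive of it. -/
theorem sub_eq_integral_of_weak {f g : ℝ → E} {a b : ℝ} (hab : a < b)
    (hf : ContinuousOn f (Icc a b)) (hg : IntegrableOn g (Icc a b))
    (h : ∀ ψ : ℝ → ℝ, IsTest ψ (Ioo a b) →
      ∫ s in a..b, deriv ψ s • f s = -∫ s in a..b, ψ s • g s) :
    f b - f a = ∫ σ in a..b, g σ := by
  set P : ℝ → E := fun s => ∫ σ in a..s, g σ with hP
  have hPp : IsPrim g P a b := ⟨hg, fun s _ => by simp [hP]⟩
  have h1 : (fun s => f s - P s) b = (fun s => f s - P s) a := by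
    refine eq_of_integral_deriv_eq_zero hab (hf.sub hPp.continuousOn) fun ψ hψ => ?_
    have h2 := (IsPrim.by_parts (ContinuousLinearMap.lsmul ℝ ℝ).flip hab.le hPp
      (hψ.isPrim a b)).2.2
    simp only [ContinuousLinearMap.flip_apply, ContinuousLinearMap.lsmul_apply,
      hψ.eq_zero (show a ∉ Ioo a b from fun h => lt_irrefl _ h.1),
      hψ.eq_zero (show b ∉ Ioo a b from fun h => lt_irrefl _ h.2), zero_smul, sub_zero] at h2
    have hc := hψ.continuous_deriv
    have e : ∀ s, deriv ψ s • (f s - P s) = deriv ψ s • f s - deriv ψ s • P s :=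
      fun s => smul_sub _ _ _
    change ∫ s in a..b, deriv ψ s • (f s - P s) = 0
    simp only [e]
    rw [intervalIntegral.integral_sub, h ψ hψ, eq_neg_of_add_eq_zero_left h2, sub_self]
    · exact ContinuousOn.intervalIntegrable (by
        rw [uIcc_of_le hab.le]; exact hc.continuousOn.smul hf)
    · exact ContinuousOn.intervalIntegrable (by
        rw [uIcc_of_le hab.le]; exact hc.continuousOn.smul hPp.continuousOn)
  have h3 : P a = 0 := by simp [hP]
  simp only [h3, sub_zero] at h1
  rw [← h1]
  abel

end Prim

end Bilaplace

namespace Bilaplace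

/-! ### Mild solutions as primitives -/

section MildPrim

variable {ι : Type} {μ : ι → ℝ} {C : ℝ → L2seq ι →L[ℂ] L2seq ι} {I : Set ℝ} {U : ℝ → L2seq ι}

theorem integrableOn_clm_apply {a b : ℝ} (hU : ContinuousOn U (Icc a b))
    (hC : IntegrableOn C (Icc a b)) : IntegrableOn (fun σ => C σ (U σ)) (Icc a b) := by
  obtain ⟨c, hc⟩ := isCompact_Icc.exists_bound_of_continuousOn hU
  refine (hC.norm.mul_const c).mono' ((ContinuousLinearMap.id ℂ
    (L2seq ι →L[ℂ] L2seq ι)).aestronglyMeasurable_comp₂ hC.aestronglyMeasurable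
      (hU.aestronglyMeasurable measurableSet_Icc)) ?_
  filter_upwards [ae_restrict_mem measurableSet_Icc] with σ hσ
  exact ((C σ).le_opNorm _).trans (mul_le_mul_of_nonneg_left (hc σ hσ) (norm_nonneg _))

theorem IsPrim.congr {E : Type*} [NormedAddCommGroup E] [NormedSpace ℝ E] [CompleteSpace E]
    {D U D' U' : ℝ → E} {a b : ℝ} (h : IsPrim D U a b) (hD : EqOn D' D (Icc a b))
    (hU : EqOn U' U (Icc a b)) : IsPrim D' U' a b :=
  ⟨h.integrable.congr_fun hD.symm measurableSet_Icc, fun s hs => by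
    rw [hU hs, hU ⟨le_rfl, hs.1.trans hs.2⟩, h.eq s hs]
    congr 1
    refine intervalIntegral.integral_congr fun σ hσ => ?_
    rw [uIcc_of_le hs.1] at hσ
    exact (hD ⟨hσ.1, hσ.2.trans hs.2⟩).symm⟩

theorem isPrim_exp (m c : ℝ) (a b : ℝ) :
    IsPrim (fun s => ((m * Real.exp (m * (s - c)) : ℝ) : ℂ))
      (fun s => ((Real.exp (m * (s - c)) : ℝ) : ℂ)) a b := by
  refine IsPrim.of_hasDerivAt (fun s => ?_) (by fun_prop)
  refine HasDerivAt.ofReal_comp ?_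
  have h1 : HasDerivAt (fun s : ℝ => m * (s - c)) m s := by
    simpa using ((hasDerivAt_id s).sub_const c).const_mul m
  simpa [mul_comm] using h1.exp

/-- Multiplied by e^{-μ(s-a)}, the variation of constants formula exhibits a primitive; the product
rule for primitives with e^{μ(s-a)} restores the equation. The converse below multiplies by
e^{-μ(s-b)} and compares end points. -/
theorem IsMild.isPrim (h : IsMild μ C I U) (hc : I.OrdConnected) {a b : ℝ} (ha : a ∈ I)
    (hb : b ∈ I) (hC : IntegrableOn C (Icc a b)) (i : ι) :
    IsPrim (fun s => (μ i : ℂ) * U s i + C s (U s) i) (fun s => U s i) a b := by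
  have hI : Icc a b ⊆ I := hc.out ha hb
  have hG := L2seq.integrable_apply (h.integrable hI hC) i
  have h1 : IsPrim (fun s => (Real.exp (-μ i * (s - a)) : ℂ) * C s (U s) i)
      (fun s => (Real.exp (-μ i * (s - a)) : ℂ) * U s i) a b := by
    refine ⟨IntegrableOn.continuousOn_mul (by fun_prop) hG isCompact_Icc, fun s hs => ?_⟩
    rw [h.2 a ha s (hI hs) hs.1 i, mul_add, ← intervalIntegral.integral_const_mul, ← mul_assoc,
      ← Complex.ofReal_mul, ← Real.exp_add]
    have e : ∀ σ, (Real.exp (-μ i * (s - a)) : ℂ) * ((Real.exp (μ i * (s - σ)) : ℂ)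
        * C σ (U σ) i) = (Real.exp (-μ i * (σ - a)) : ℂ) * C σ (U σ) i := fun σ => by
      rw [← mul_assoc, ← Complex.ofReal_mul, ← Real.exp_add]
      congr 3; ring_nf
    simp only [e]
    rw [show -μ i * (s - a) + μ i * (s - a) = 0 by ring]
    simp
  refine (h1.bilin (ContinuousLinearMap.mul ℝ ℂ) (isPrim_exp (μ i) a a b)).congr
    (fun s _ => ?_) fun s _ => ?_
  · have e : (Real.exp (-μ i * (s - a)) : ℂ) * (Real.exp (μ i * (s - a)) : ℂ) = 1 := by
      rw [← Complex.ofReal_mul, ← Real.exp_add]; simp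
    simp only [ContinuousLinearMap.mul_apply']
    push_cast at e ⊢
    linear_combination (-(μ i : ℂ) * U s i - C s (U s) i) * e
  · have e : (Real.exp (-μ i * (s - a)) : ℂ) * (Real.exp (μ i * (s - a)) : ℂ) = 1 := by
      rw [← Complex.ofReal_mul, ← Real.exp_add]; simp
    simp only [ContinuousLinearMap.mul_apply']
    linear_combination (-U s i) * e

theorem isMild_of_isPrim (hU : ContinuousOn U I)
    (h : ∀ a ∈ I, ∀ b ∈ I, a ≤ b → ∀ i,
      IsPrim (fun s => (μ i : ℂ) * U s i + C s (U s) i) (fun s => U s i) a b) :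
    IsMild μ C I U := by
  refine ⟨hU, fun a ha b hb hab i => ?_⟩
  have h1 := (h a ha b hb hab i).bilin (ContinuousLinearMap.mul ℝ ℂ) (isPrim_exp (-μ i) b a b)
  have h2 := h1.sub_eq (left_mem_Icc.2 hab) (right_mem_Icc.2 hab)
  simp only [ContinuousLinearMap.mul_apply', sub_self, mul_zero, Real.exp_zero,
    Complex.ofReal_one, mul_one] at h2
  have e : ∀ s, U s i * ((-μ i * Real.exp (-μ i * (s - b)) : ℝ) : ℂ)
      + ((μ i : ℂ) * U s i + C s (U s) i) * (Real.exp (-μ i * (s - b)) : ℂ)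
      = (Real.exp (μ i * (b - s)) : ℂ) * C s (U s) i := fun s => by
    rw [show μ i * (b - s) = -μ i * (s - b) by ring]
    push_cast
    ring
  simp only [e] at h2
  rw [h2, show -μ i * (a - b) = μ i * (b - a) by ring]
  ring

end MildPrim

/-! ### The system in coordinates -/

section Coord

variable {s₁ ε : ℝ}

theorem out₁_psi (hε : 0 < ε) (U : XSp) : out₁ hε (psi hε U) = U.1 :=
  congrArg Prod.fst ((psi hε).symm_apply_apply U)

theorem out₃_psi (hε : 0 < ε) (U : XSp) : out₃ hε (psi hε U) = U.2.2.1 :=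
  congrArg (fun V : XSp => V.2.2.1) ((psi hε).symm_apply_apply U)

theorem mul_potential (th : ℝ → ℝ) (lam : ℝ) (ρ : Pot s₁) (s : ℝ) (u : HS 2) :
    HS.mul (potential th (lam, ρ) s) u
      = ((lam - th s : ℝ) : ℂ) • HS.incl (by norm_num) u - HS.mul (ρ s) u := by
  rw [← mulCLM_apply, potential, map_sub, map_smul, sub_apply, smul_apply, mulCLM_apply,
    mulCLM_apply, HS.mul_one']

theorem psi_coord (hε : 0 < ε) (U : XSp) (k : ℤ) (b s : Bool) : psi hε U (k, b, s)
    = if b then (wt 1 k * dd ε k / 2 : ℝ) * U.1.coeff k + (sg s * wt 1 k / 2 : ℝ) * U.2.1.coeff k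
      else (dd ε k / 2 : ℝ) * U.2.2.1.coeff k + (sg s / 2 : ℝ) * U.2.2.2.coeff k := by
  rw [psi_apply, L2seq.add_apply, L2seq.add_apply, L2seq.add_apply, in₁_apply, in₂_apply,
    in₃_apply, in₄_apply]
  cases b <;> simp

theorem coefC_psi (hε : 0 < ε) (th : ℝ → ℝ) (p : ℝ × Pot s₁) (s : ℝ) (U : XSp) :
    coefC hε th p s (psi hε U) = (ε : ℂ) • jordan (psi hε U) + (Real.exp (2 * s) : ℂ) •
      (in₂ U.2.2.1 + in₄ (HS.mul (potential th p s) U.1)) := by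
  rw [coefC, add_apply, smul_apply, decay, smul_apply, add_apply, opA_apply, opE,
    ContinuousLinearMap.comp_apply, out₁_psi, out₃_psi]

theorem coefC_psi_apply (hε : 0 < ε) (th : ℝ → ℝ) (p : ℝ × Pot s₁) (s : ℝ) (U : XSp) (k : ℤ)
    (b t : Bool) : coefC hε th p s (psi hε U) (k, b, t)
    = ε * (if k = 0 then (psi hε U (k, b, true) - psi hε U (k, b, false)) / 2 else 0)
      + Real.exp (2 * s) * (if b then (sg t * wt 1 k / 2 : ℝ) * U.2.2.1.coeff k
        else (sg t / 2 : ℝ) * (HS.mul (potential th p s) U.1).coeff k) := by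
  rw [coefC_psi, L2seq.add_apply, L2seq.smul_apply, L2seq.smul_apply, L2seq.add_apply,
    jordan_apply, in₂_apply, in₄_apply]
  cases b <;> simp

theorem sg_sq (t : Bool) : ((sg t : ℝ) : ℂ) ^ 2 = 1 := by cases t <;> simp [sg]

theorem psi_mk (hε : 0 < ε) (u₁ : HS 2) (u₂ u₃ : HS 1) (u₄ : HS 0) (k : ℤ) (b t : Bool) :
    psi hε (u₁, u₂, u₃, u₄) (k, b, t)
    = if b then (wt 1 k * dd ε k / 2 : ℝ) * u₁.coeff k + (sg t * wt 1 k / 2 : ℝ) * u₂.coeff k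
      else (dd ε k / 2 : ℝ) * u₃.coeff k + (sg t / 2 : ℝ) * u₄.coeff k :=
  psi_coord hε _ k b t

theorem coefC_psi_mk (hε : 0 < ε) (th : ℝ → ℝ) (p : ℝ × Pot s₁) (s : ℝ) (u₁ : HS 2)
    (u₂ u₃ : HS 1) (u₄ : HS 0) (k : ℤ) (b t : Bool) :
    coefC hε th p s (psi hε (u₁, u₂, u₃, u₄)) (k, b, t)
    = ε * (if k = 0 then (psi hε (u₁, u₂, u₃, u₄) (k, b, true)
        - psi hε (u₁, u₂, u₃, u₄) (k, b, false)) / 2 else 0)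
      + Real.exp (2 * s) * (if b then (sg t * wt 1 k / 2 : ℝ) * u₃.coeff k
        else (sg t / 2 : ℝ) * (HS.mul (potential th p s) u₁).coeff k) :=
  coefC_psi_apply hε th p s _ k b t

theorem rhs_mk (th : ℝ → ℝ) (lam : ℝ) (ρ : Pot s₁) (s : ℝ) (w₁ : HS 3) (w₂ w₃ : HS 2) (w₄ : HS 1) :
    rhs th lam ρ s (w₁, w₂, w₃, w₄) = (w₂, HS.negD2 (by norm_num) w₁
      + (Real.exp (2 * s) : ℂ) • HS.incl (by norm_num) w₃, w₄,
      (Real.exp (2 * s) : ℂ) • (((lam - th s : ℝ) : ℂ) • HS.incl (by norm_num) w₁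
        - HS.mul (ρ s) (HS.incl (by norm_num) w₁)) + HS.negD2 (by norm_num) w₃) := rfl

theorem toX_mk (w₁ : HS 3) (w₂ w₃ : HS 2) (w₄ : HS 1) :
    toX (w₁, w₂, w₃, w₄) = (HS.incl (by norm_num) w₁, HS.incl (by norm_num) w₂,
      HS.incl (by norm_num) w₃, HS.incl (by norm_num) w₄) := rfl

/-- The system is the sum of its diagonal part and of `coefC`. -/
theorem psi_rhs (hε : 0 < ε) (th : ℝ → ℝ) (lam : ℝ) (ρ : Pot s₁) (s : ℝ) (W : YSp) (i : Mode) :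
    psi hε (rhs th lam ρ s W) i
      = (ev i : ℂ) * psi hε (toX W) i + coefC hε th (lam, ρ) s (psi hε (toX W)) i := by
  obtain ⟨k, b, t⟩ := i
  obtain ⟨w₁, w₂, w₃, w₄⟩ := W
  have hk2 : ((|(k : ℝ)| : ℝ) : ℂ) ^ 2 = (k : ℂ) ^ 2 := by
    rw [← Complex.ofReal_pow, sq_abs]; push_cast; rfl
  have hsg := sg_sq t
  rw [rhs_mk, toX_mk, coefC_psi_mk, psi_mk, psi_mk, psi_mk, psi_mk]
  rw [HS.coeff_add, HS.coeff_add, HS.coeff_smul, HS.coeff_smul, mul_potential, HS.coeff_sub,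
    HS.coeff_sub, HS.coeff_smul, HS.coeff_smul]
  simp only [HS.coeff_incl, HS.coeff_negD2]
  generalize (HS.mul (ρ s) _).coeff k = m
  generalize w₁.coeff k = x
  generalize w₂.coeff k = y
  generalize w₃.coeff k = z
  generalize w₄.coeff k = v
  generalize Real.exp (2 * s) = e
  generalize wt 1 k = w
  have hev : ev (k, b, t) = sg t * |(k : ℝ)| := rfl
  rw [hev]
  -- At frequency 0 the eigenvalue vanishes, and u₁' = u₂, u₃' = u₄ appear through ε · `jordan`. At
  -- other frequencies the identities |k|² = k² and σ² = 1 suffice.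
  by_cases hk : k = 0
  · have hd : dd ε k = ε := by rw [dd, if_pos hk]
    have h1 : sg true = 1 := rfl
    have h2 : sg false = -1 := rfl
    have hk0 : (k : ℂ) = 0 := by rw [hk]; simp
    have hk0' : (k : ℝ) = 0 := by rw [hk]; simp
    rw [hd, h1, h2, hk0, hk0']
    cases b
    · simp only [Bool.false_eq_true, if_false, if_pos hk]
      push_cast [abs_zero]
      ring
    · simp only [if_true, if_pos hk]
      push_cast [abs_zero]
      ring
  · have hd : dd ε k = |(k : ℝ)| := by rw [dd, if_neg hk]
    rw [hd]
    generalize |(k : ℝ)| = a at hk2 ⊢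
    generalize sg t = σ at hsg ⊢
    cases b
    · simp only [Bool.false_eq_true, if_false, if_neg hk]
      push_cast
      linear_combination (-(σ : ℂ) / 2 * z) * hk2 + (-(a : ℂ) / 2 * v) * hsg
    · simp only [if_true, if_neg hk]
      push_cast
      linear_combination (-(σ : ℂ) * w / 2 * x) * hk2 + (-(a : ℂ) * w / 2 * y) * hsg

/-- The function `c e^{ikφ}`. -/
def HS.single (σ : ℝ) (k : ℤ) (c : ℂ) : HS σ :=
  HS.mk (fun j => if j = k then c else 0) (L2seq.memℓp_iff.2 (summable_of_hasFiniteSupport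
    ((finite_singleton k).subset fun j hj => by
      by_contra h
      exact hj (by simp [show j ≠ k from h]))))

theorem HS.pair_single {σ : ℝ} (u : HS σ) (k : ℤ) (c : ℝ) :
    HS.pair u (HS.single σ k c) = c * u.coeff k := by
  rw [HS.pair, tsum_eq_single k]
  · simp [HS.single, mul_comm]
  · intro j hj
    simp [HS.single, hj]

theorem HS.pair_zero {σ : ℝ} (u : HS σ) : HS.pair u 0 = 0 := by
  have : ∀ k, (0 : HS σ).coeff k = 0 := fun k => rfl
  simp [HS.pair, this]

/-- The functional `U ↦ psi U i` is represented by this element. -/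
def coordVec (ε : ℝ) (i : Mode) : XSp :=
  if i.2.1 then (HS.single 2 i.1 (wt 1 i.1 * dd ε i.1 / 2 : ℝ),
    HS.single 1 i.1 (sg i.2.2 * wt 1 i.1 / 2 : ℝ), 0, 0)
  else (0, 0, HS.single 1 i.1 (dd ε i.1 / 2 : ℝ), HS.single 0 i.1 (sg i.2.2 / 2 : ℝ))

theorem pairX_coordVec (hε : 0 < ε) (U : XSp) (i : Mode) :
    pairX U (coordVec ε i) = psi hε U i := by
  obtain ⟨k, b, s⟩ := i
  rw [psi_coord]
  cases b
  · simp only [pairX, coordVec, Bool.false_eq_true, if_false, HS.pair_single, HS.pair_zero]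
    ring
  · simp only [pairX, coordVec, if_true, HS.pair_single, HS.pair_zero]
    ring

theorem HS.pair_smul {σ : ℝ} (u v : HS σ) (r : ℝ) : HS.pair u ((r : ℂ) • v) = r * HS.pair u v := by
  rw [HS.pair, HS.pair, ← tsum_mul_left]
  refine tsum_congr fun k => ?_
  rw [HS.coeff_smul, map_mul, Complex.conj_ofReal]
  ring

theorem pairX_smul (U V : XSp) (r : ℝ) : pairX U (r • V) = r * pairX U V := by
  rw [← Complex.coe_smul r V]
  simp only [pairX, Prod.smul_fst, Prod.smul_snd, HS.pair_smul]
  ring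

end Coord

/-! ### Weak solutions are mild solutions -/

section Weak

variable {s₁ ε : ℝ} {th : ℝ → ℝ} {Θ : ℝ}

/-- Test functions ψ(s) · `coordVec` isolate a single coordinate, which then satisfies a scalar
equation in the weak sense. A continuous function with integrable weak derivative is a primitive,
and the variation of constants formula follows mode by mode. The regularity in Y serves only to
identify the right-hand side. -/
theorem isMild_of_isWeakSolution (hε : 0 < ε) (hth : Continuous th) (hΘ : ∀ s, |th s| ≤ Θ)
    {lam : ℝ} {ρ : Pot s₁} {J : Set ℝ} (hJ : J.OrdConnected) (hJs : J ⊆ Iic s₁) {U : ℝ → XSp}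
    (h : IsWeakSolution (rhs th lam ρ) J U) :
    IsMild ev (coefC hε th (lam, ρ)) J fun s => psi hε (U s) := by
  obtain ⟨hU, -, W, -, hWU, hw⟩ := h
  have hz : ContinuousOn (fun s => psi hε (U s)) J := (psi hε).continuous.comp_continuousOn hU
  have key : ∀ a ∈ J, ∀ b ∈ J, a ≤ b → ∀ i,
      IntegrableOn (fun s => (ev i : ℂ) * psi hε (U s) i
        + coefC hε th (lam, ρ) s (psi hε (U s)) i) (Icc a b) ∧
      psi hε (U b) i - psi hε (U a) i = ∫ s in a..b, ((ev i : ℂ) * psi hε (U s) i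
        + coefC hε th (lam, ρ) s (psi hε (U s)) i) := by
    intro a ha b hb hab i
    have hI : Icc a b ⊆ J := hJ.out ha hb
    have hC : IntegrableOn (coefC hε th (lam, ρ)) (Icc a b) :=
      (integrableOn_coefC hε hth hΘ (lam, ρ) a).mono_set (Icc_subset_Icc_right (hJs hb))
    have hf : ContinuousOn (fun s => psi hε (U s) i) (Icc a b) :=
      L2seq.continuousOn_apply (hz.mono hI) i
    have hg : IntegrableOn (fun s => (ev i : ℂ) * psi hε (U s) i
        + coefC hε th (lam, ρ) s (psi hε (U s)) i) (Icc a b) :=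
      (continuousOn_const.mul hf).integrableOn_Icc.add
        (L2seq.integrable_apply (integrableOn_clm_apply (hz.mono hI) hC) i)
    refine ⟨hg, ?_⟩
    rcases hab.eq_or_lt with rfl | hab
    · simp
    have hO : Ioo a b ⊆ interior J :=
      interior_maximal (Ioo_subset_Icc_self.trans hI) isOpen_Ioo
    refine sub_eq_integral_of_weak hab hf hg fun ψ hψ => ?_
    set V : ℝ → XSp := fun s => ψ s • coordVec ε i with hV
    have hVd : ∀ s, HasDerivAt V (deriv ψ s • coordVec ε i) s := fun s =>
      (hψ.hasDerivAt s).smul_const _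
    have hVT : IsTest V (interior J) := by
      have hss : tsupport V ⊆ tsupport ψ := by
        refine closure_mono fun s hs hs' => hs ?_
        change ψ s • coordVec ε i = 0
        rw [hs', zero_smul]
      exact ⟨hψ.1.smul contDiff_const,
        hψ.2.1.of_isClosed_subset (isClosed_tsupport _) hss, (hss.trans hψ.2.2).trans hO⟩
    have h1 := hw V hVT
    have e1 : ∀ s, pairX (U s) (deriv V s) = deriv ψ s • psi hε (U s) i := fun s => by
      rw [(hVd s).deriv, pairX_smul, pairX_coordVec hε, Complex.real_smul]
    have e2 : (fun s => pairX (rhs th lam ρ s (W s)) (V s)) =ᵐ[volume.restrict (interior J)]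
        fun s => ψ s • ((ev i : ℂ) * psi hε (U s) i
          + coefC hε th (lam, ρ) s (psi hε (U s)) i) := by
      filter_upwards [hWU] with s hs
      rw [hV]
      beta_reduce
      rw [pairX_smul, pairX_coordVec hε, psi_rhs, hs, Complex.real_smul]
    rw [integral_congr_ae e2] at h1
    simp only [e1] at h1
    rw [integral_eq_of_zero isOpen_interior.measurableSet hab.le hO
      fun s hs => by rw [hψ.deriv_eq_zero hs, zero_smul],
      integral_eq_of_zero isOpen_interior.measurableSet hab.le hO
      fun s hs => by rw [hψ.eq_zero hs, zero_smul]] at h1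
    rw [← h1, neg_neg]
  refine isMild_of_isPrim hz fun a ha b hb hab i => ⟨(key a ha b hb hab i).1, fun s hs => ?_⟩
  rw [← (key a ha s (hJ.out ha hb hs) hs.1 i).2]
  abel

end Weak

end Bilaplace

namespace Bilaplace

/-! ### Regularity of mild solutions -/

theorem IsPrim.reflect {E : Type*} [NormedAddCommGroup E] [NormedSpace ℝ E] [CompleteSpace E]
    {D U : ℝ → E} {a b : ℝ} (h : IsPrim D U a b) :
    IsPrim (fun s => -D (-s)) (fun s => U (-s)) (-b) (-a) := by
  have e : Neg.neg ⁻¹' Icc a b = Icc (-b) (-a) := by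
    ext x; simp only [mem_preimage, mem_Icc]
    constructor <;> rintro ⟨h, h'⟩ <;> constructor <;> linarith
  refine ⟨?_, fun s hs => ?_⟩
  · have := (Measure.measurePreserving_neg (volume : Measure ℝ)).integrableOn_comp_preimage
      (f := D) (s := Icc a b) (Homeomorph.neg ℝ).measurableEmbedding
    rw [← e]
    exact (this.2 h.integrable).neg
  · rw [neg_neg, intervalIntegral.integral_neg, intervalIntegral.integral_comp_neg, neg_neg,
      h.sub_eq (c := -s) (d := b) ⟨by linarith [hs.2], by linarith [hs.1]⟩
        ⟨by linarith [hs.1, hs.2], le_rfl⟩]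
    abel

/-! ### Energy estimates for one mode, uniform in the eigenvalue -/

section Energy

variable {m : ℝ} {z G : ℝ → ℂ}

/-- The derivative of |z|² is 2 Re⟨z, -m z + G⟩, and Young's inequality with parameter m absorbs
half of the dissipation. -/
theorem energy_le (hm : 0 < m) {a b : ℝ} (hab : a ≤ b)
    (h : IsPrim (fun s => ((-m : ℝ) : ℂ) * z s + G s) z a b)
    (hG : IntegrableOn (fun s => ‖G s‖ ^ 2) (Icc a b)) :
    m * ∫ s in a..b, ‖z s‖ ^ 2 ≤ ‖z a‖ ^ 2 + m⁻¹ * ∫ s in a..b, ‖G s‖ ^ 2 := by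
  obtain ⟨h1, h2, h3⟩ :
      IntegrableOn (fun s => inner ℝ (z s) (((-m : ℝ) : ℂ) * z s + G s)) (Icc a b) volume ∧
      IntegrableOn (fun s => inner ℝ (((-m : ℝ) : ℂ) * z s + G s) (z s)) (Icc a b) volume ∧
      (∫ s in a..b, inner ℝ (z s) (((-m : ℝ) : ℂ) * z s + G s))
        + (∫ s in a..b, inner ℝ (((-m : ℝ) : ℂ) * z s + G s) (z s))
        = inner ℝ (z b) (z b) - inner ℝ (z a) (z a) := IsPrim.by_parts (innerSL ℝ) hab h h
  have e : ∀ s, inner ℝ (((-m : ℝ) : ℂ) * z s + G s) (z s)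
      = inner ℝ (z s) (((-m : ℝ) : ℂ) * z s + G s) := fun s => real_inner_comm _ _
  simp only [e, real_inner_self_eq_norm_sq] at h3
  have hz : ContinuousOn (fun s => ‖z s‖ ^ 2) (Icc a b) := h.continuousOn.norm.pow 2
  have i1 : IntegrableOn (fun s => -(m / 2) * ‖z s‖ ^ 2 + m⁻¹ / 2 * ‖G s‖ ^ 2) (Icc a b) :=
    (hz.integrableOn_Icc.const_mul _).add (hG.const_mul _)
  have hle : ∫ s in a..b, inner ℝ (z s) (((-m : ℝ) : ℂ) * z s + G s)
      ≤ ∫ s in a..b, (-(m / 2) * ‖z s‖ ^ 2 + m⁻¹ / 2 * ‖G s‖ ^ 2) := by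
    rw [intervalIntegral_eq_Icc hab, intervalIntegral_eq_Icc hab]
    refine integral_mono h1 i1 fun s => ?_
    have e2 : inner ℝ (z s) (((-m : ℝ) : ℂ) * z s + G s)
        = -m * ‖z s‖ ^ 2 + inner ℝ (z s) (G s) := by
      rw [inner_add_right, ← Complex.real_smul, real_inner_smul_right, real_inner_self_eq_norm_sq]
    beta_reduce
    rw [e2]
    have e3 := real_inner_le_norm (z s) (G s)
    have e4 : m / 2 * ‖z s‖ ^ 2 + m⁻¹ / 2 * ‖G s‖ ^ 2 - ‖z s‖ * ‖G s‖
        = (m * ‖z s‖ - ‖G s‖) ^ 2 / (2 * m) := by field_simp; ring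
    have e5 : 0 ≤ (m * ‖z s‖ - ‖G s‖) ^ 2 / (2 * m) := by positivity
    linarith
  rw [intervalIntegral.integral_add, intervalIntegral.integral_const_mul,
    intervalIntegral.integral_const_mul] at hle
  · linarith [sq_nonneg ‖z b‖]
  · rw [intervalIntegrable_iff_integrableOn_Icc_of_le hab]
    exact hz.integrableOn_Icc.const_mul _
  · rw [intervalIntegrable_iff_integrableOn_Icc_of_le hab]
    exact hG.const_mul _

/-- A second factor m is gained by averaging over the starting time a' in [a - η, a]. The initial
term m|z(a')|² is thereby replaced by an integral, which the first-order energy estimate controls.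
-/
theorem energy_sq_le (hm : 1 ≤ m) {a b η : ℝ} (hη : 0 < η) (hab : a ≤ b)
    (h : IsPrim (fun s => ((-m : ℝ) : ℂ) * z s + G s) z (a - η) b)
    (hG : IntegrableOn (fun s => ‖G s‖ ^ 2) (Icc (a - η) b)) :
    η * (m ^ 2 * ∫ s in a..b, ‖z s‖ ^ 2)
      ≤ ‖z (a - η)‖ ^ 2 + (1 + η) * ∫ s in (a - η)..b, ‖G s‖ ^ 2 := by
  have hm0 : 0 < m := by linarith
  set Γ := ∫ s in (a - η)..b, ‖G s‖ ^ 2 with hΓ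
  have hz : ContinuousOn (fun s => ‖z s‖ ^ 2) (Icc (a - η) b) := h.continuousOn.norm.pow 2
  have ha : a - η ∈ Icc (a - η) b := ⟨le_rfl, by linarith⟩
  have hmono : ∀ f : ℝ → ℝ, (∀ s, 0 ≤ f s) → IntegrableOn f (Icc (a - η) b) →
      ∀ c d c' d' : ℝ, a - η ≤ c' → c' ≤ c → c ≤ d → d ≤ d' → d' ≤ b →
      ∫ s in c..d, f s ≤ ∫ s in c'..d', f s := by
    intro f hf hi c d c' d' h1 h2 h3 h4 h5
    rw [intervalIntegral_eq_Icc h3, intervalIntegral_eq_Icc (h2.trans (h3.trans h4))]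
    exact setIntegral_mono_set (hi.mono_set (Icc_subset_Icc h1 h5))
      (Eventually.of_forall fun s => hf s) (Eventually.of_forall (Icc_subset_Icc h2 h4))
  have h1 : ∀ a' ∈ Icc (a - η) a, m ^ 2 * ∫ s in a..b, ‖z s‖ ^ 2 ≤ m * ‖z a'‖ ^ 2 + Γ := by
    intro a' ha'
    have hmem : a' ∈ Icc (a - η) b := ⟨ha'.1, ha'.2.trans hab⟩
    have h2 := energy_le hm0 hmem.2 (h.mono hmem ⟨hmem.1.trans hmem.2, le_rfl⟩)
      (hG.mono_set (Icc_subset_Icc_left hmem.1))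
    have h3 := hmono (fun s => ‖z s‖ ^ 2) (fun s => sq_nonneg _) hz.integrableOn_Icc
      a b a' b ha'.1 ha'.2 hab le_rfl le_rfl
    have h4 := hmono (fun s => ‖G s‖ ^ 2) (fun s => sq_nonneg _) hG
      a' b (a - η) b le_rfl ha'.1 hmem.2 le_rfl le_rfl
    calc m ^ 2 * ∫ s in a..b, ‖z s‖ ^ 2 ≤ m * (m * ∫ s in a'..b, ‖z s‖ ^ 2) := by
          rw [sq, mul_assoc]
          exact mul_le_mul_of_nonneg_left (mul_le_mul_of_nonneg_left h3 hm0.le) hm0.le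
      _ ≤ m * (‖z a'‖ ^ 2 + m⁻¹ * ∫ s in a'..b, ‖G s‖ ^ 2) := mul_le_mul_of_nonneg_left h2 hm0.le
      _ = m * ‖z a'‖ ^ 2 + ∫ s in a'..b, ‖G s‖ ^ 2 := by field_simp
      _ ≤ _ := by linarith
  have hza : ContinuousOn (fun s => ‖z s‖ ^ 2) (Icc (a - η) a) := hz.mono (Icc_subset_Icc_right hab)
  have i1 : IntervalIntegrable (fun s => m * ‖z s‖ ^ 2) volume (a - η) a := by
    rw [intervalIntegrable_iff_integrableOn_Icc_of_le (by linarith)]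
    exact hza.integrableOn_Icc.const_mul m
  have h2 := intervalIntegral.integral_mono_on (by linarith : a - η ≤ a)
    (intervalIntegrable_const (μ := volume)) (i1.add (intervalIntegrable_const (c := Γ))) h1
  rw [intervalIntegral.integral_const, intervalIntegral.integral_add i1 intervalIntegrable_const,
    intervalIntegral.integral_const_mul, intervalIntegral.integral_const, smul_eq_mul,
    smul_eq_mul, sub_sub_cancel] at h2
  have hmem : a ∈ Icc (a - η) b := ⟨by linarith, hab⟩
  have h3 := energy_le hm0 hmem.1 (h.mono ha hmem) (hG.mono_set (Icc_subset_Icc_right hab))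
  have h4 := hmono (fun s => ‖G s‖ ^ 2) (fun s => sq_nonneg _) hG
      (a - η) a (a - η) b le_rfl le_rfl hmem.1 hab le_rfl
  have h5 : 0 ≤ ∫ s in (a - η)..a, ‖G s‖ ^ 2 :=
    intervalIntegral.integral_nonneg hmem.1 fun s _ => sq_nonneg _
  have h6 : m⁻¹ * ∫ s in (a - η)..a, ‖G s‖ ^ 2 ≤ ∫ s in (a - η)..a, ‖G s‖ ^ 2 :=
    mul_le_of_le_one_left h5 (inv_le_one_of_one_le₀ hm)
  linarith

/-- The `H¹` norm of a solution of `z' = μ z + G`, with a constant independent of `μ`. -/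
theorem frequency_sq_le {μ : ℝ} (hμ : 1 ≤ |μ|) {a b η : ℝ} (hη : 0 < η) (hab : a ≤ b)
    (h : IsPrim (fun s => (μ : ℂ) * z s + G s) z (a - η) (b + η))
    (hG : IntegrableOn (fun s => ‖G s‖ ^ 2) (Icc (a - η) (b + η))) :
    η * (μ ^ 2 * ∫ s in a..b, ‖z s‖ ^ 2) ≤ ‖z (a - η)‖ ^ 2 + ‖z (b + η)‖ ^ 2
      + (1 + η) * ∫ s in (a - η)..(b + η), ‖G s‖ ^ 2 := by
  have hmono : ∀ c d : ℝ, a - η ≤ c → c ≤ d → d ≤ b + η →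
      ∫ s in c..d, ‖G s‖ ^ 2 ≤ ∫ s in (a - η)..(b + η), ‖G s‖ ^ 2 := by
    intro c d h1 h2 h3
    rw [intervalIntegral_eq_Icc h2, intervalIntegral_eq_Icc (h1.trans (h2.trans h3))]
    exact setIntegral_mono_set hG
      (Eventually.of_forall fun s => sq_nonneg _) (Eventually.of_forall (Icc_subset_Icc h1 h3))
  rcases le_or_gt μ 0 with h0 | h0
  · have h1 := energy_sq_le (z := z) (G := G) (m := -μ) (by rwa [abs_of_nonpos h0] at hμ) hη hab
      (by rw [neg_neg]; exact h.mono ⟨le_rfl, by linarith⟩ ⟨by linarith, by linarith⟩)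
      (hG.mono_set (Icc_subset_Icc_right (by linarith)))
    have h2 := mul_le_mul_of_nonneg_left (hmono (a - η) b le_rfl (by linarith) (by linarith))
      (by linarith : 0 ≤ 1 + η)
    rw [neg_sq] at h1
    linarith [sq_nonneg ‖z (b + η)‖]
  -- A growing mode becomes a decaying one under time reversal, so it is controlled from the right
  -- end of the interval.
  · have e1 : -(b + η) = -b - η := by ring
    have hr := h.reflect
    have e2 : -(a - η) = -a + η := by ring
    rw [e1, e2] at hr
    have hG' : IntegrableOn (fun s => ‖-G (-s)‖ ^ 2) (Icc (-b - η) (-a + η)) := by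
      have := (Measure.measurePreserving_neg (volume : Measure ℝ)).integrableOn_comp_preimage
        (f := fun s => ‖G s‖ ^ 2) (s := Icc (a - η) (b + η))
        (Homeomorph.neg ℝ).measurableEmbedding
      have e : Neg.neg ⁻¹' Icc (a - η) (b + η) = Icc (-b - η) (-a + η) := by
        ext x; simp only [mem_preimage, mem_Icc]
        constructor <;> rintro ⟨h, h'⟩ <;> constructor <;> linarith
      rw [← e]
      simp only [norm_neg]
      exact this.2 hG
    have h1 := energy_sq_le (z := fun s => z (-s)) (G := fun s => -G (-s)) (m := μ)
      (by rwa [abs_of_pos h0] at hμ) hη (neg_le_neg hab)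
      ((hr.mono ⟨le_rfl, by linarith⟩ ⟨by linarith, by linarith⟩).congr
        (fun s _ => by push_cast; ring) fun s _ => rfl)
      (hG'.mono_set (Icc_subset_Icc_right (by linarith)))
    simp only [norm_neg] at h1
    rw [intervalIntegral.integral_comp_neg (fun s => ‖z s‖ ^ 2),
      intervalIntegral.integral_comp_neg (fun s => ‖G s‖ ^ 2), neg_neg, neg_neg,
      show -(-b - η) = b + η by ring] at h1
    have h2 := mul_le_mul_of_nonneg_left (hmono a (b + η) (by linarith) (by linarith) le_rfl)
      (by linarith : 0 ≤ 1 + η)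
    linarith [sq_nonneg ‖z (a - η)‖]

end Energy

/-! #### Summation over the modes -/

theorem tsum_integral_sq_ne_top {ι : Type} [Countable ι] {f : ℝ → L2seq ι} {m : Measure ℝ}
    (hf : MemLp f 2 m) :
    ∑' i, ENNReal.ofReal (∫ s, ‖f s i‖ ^ 2 ∂m) ≠ ⊤ := by
  have h2 : Integrable (fun s => ‖f s‖ ^ 2) m := hf.integrable_norm_pow two_ne_zero
  have hm := fun i => L2seq.measurable_apply hf.aestronglyMeasurable i
  have hi : ∀ i, Integrable (fun s => ‖f s i‖ ^ 2) m := fun i =>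
    h2.mono' ((hm i).norm.pow 2) (Eventually.of_forall fun s => by
      rw [Real.norm_of_nonneg (sq_nonneg _)]
      exact pow_le_pow_left₀ (norm_nonneg _) (L2seq.norm_apply_le _ i) 2)
  have e : ∀ i, ENNReal.ofReal (∫ s, ‖f s i‖ ^ 2 ∂m)
      = ∫⁻ s, ENNReal.ofReal (‖f s i‖ ^ 2) ∂m := fun i =>
    ofReal_integral_eq_lintegral_ofReal (hi i) (Eventually.of_forall fun s => sq_nonneg _)
  simp only [e]
  rw [← lintegral_tsum fun i => (hi i).aestronglyMeasurable.aemeasurable.ennreal_ofReal]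
  have e2 : ∀ s, ∑' i, ENNReal.ofReal (‖f s i‖ ^ 2) = ENNReal.ofReal (‖f s‖ ^ 2) := fun s => by
    rw [L2seq.norm_sq, ENNReal.ofReal_tsum_of_nonneg (fun i => sq_nonneg _) (f s).summable_sq]
  simp only [e2]
  rw [← ofReal_integral_eq_lintegral_ofReal h2 (Eventually.of_forall fun s => sq_nonneg _)]
  exact ENNReal.ofReal_ne_top

open Classical in
/-- The sequence `(1 + |k|) v`, if it is square-summable. -/
def lift (v : L2seq Mode) : L2seq Mode :=
  if h : Memℓp (fun i : Mode => ((1 + |(i.1 : ℝ)| : ℝ) : ℂ) * v i) 2 then ⟨_, h⟩ else 0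

theorem lift_apply {v : L2seq Mode}
    (h : Memℓp (fun i : Mode => ((1 + |(i.1 : ℝ)| : ℝ) : ℂ) * v i) 2) (i : Mode) :
    lift v i = ((1 + |(i.1 : ℝ)| : ℝ) : ℂ) * v i := by
  rw [lift, dif_pos h]

theorem abs_ev (i : Mode) : |ev i| = |(i.1 : ℝ)| := by
  rw [ev, abs_mul, abs_sg, one_mul, abs_abs]

theorem frequency_cases (i : Mode) : i.1 = 0 ∨ 1 ≤ |ev i| := by
  rw [abs_ev]
  by_cases h : i.1 = 0
  · exact Or.inl h
  · exact Or.inr (by exact_mod_cast Int.one_le_abs h)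

/-- Solutions with a square-integrable right-hand side gain a derivative. -/
theorem memLp_lift {z G : ℝ → L2seq Mode} {a b η : ℝ} (hη : 0 < η) (hab : a ≤ b)
    (hz : ContinuousOn z (Icc (a - η) (b + η)))
    (hG : MemLp G 2 (volume.restrict (Icc (a - η) (b + η))))
    (h : ∀ i, IsPrim (fun s => (ev i : ℂ) * z s i + G s i) (fun s => z s i) (a - η) (b + η)) :
    MemLp (fun s => lift (z s)) 2 (volume.restrict (Icc a b)) ∧
    ∀ᵐ s ∂volume.restrict (Icc a b),
      Memℓp (fun i : Mode => ((1 + |(i.1 : ℝ)| : ℝ) : ℂ) * z s i) 2 := by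
  have hsub : Icc a b ⊆ Icc (a - η) (b + η) := Icc_subset_Icc (by linarith) (by linarith)
  have hG2 : ∀ i, IntegrableOn (fun s => ‖G s i‖ ^ 2) (Icc (a - η) (b + η)) := fun i =>
    (hG.integrable_norm_pow two_ne_zero).mono'
      ((L2seq.measurable_apply hG.aestronglyMeasurable i).norm.pow 2)
      (Eventually.of_forall fun s => by
        rw [Real.norm_of_nonneg (sq_nonneg _)]
        exact pow_le_pow_left₀ (norm_nonneg _) (L2seq.norm_apply_le _ i) 2)
  have hzL : MemLp z 2 (volume.restrict (Icc a b)) := by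
    obtain ⟨c, hc⟩ := isCompact_Icc.exists_bound_of_continuousOn (hz.mono hsub)
    refine MemLp.of_bound ((hz.mono hsub).aestronglyMeasurable measurableSet_Icc) c ?_
    filter_upwards [ae_restrict_mem measurableSet_Icc] with s hs using hc s hs
  have hzi : ∀ i, ContinuousOn (fun s => ‖z s i‖ ^ 2) (Icc a b) := fun i =>
    (L2seq.continuousOn_apply (hz.mono hsub) i).norm.pow 2
  -- The factor 4 comes from (1 + |k|)² ≤ 4|k|² for k ≠ 0. At k = 0 the weight is 1 and the
  -- continuous term ∫|z|² suffices.
  set c := 4 * ((1 + η) / η) with hc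
  have hc1 : 4 / η ≤ c := by rw [hc, mul_div_assoc']; gcongr; linarith
  have hbound : ∀ i, ∫ s in Icc a b, ((1 + |(i.1 : ℝ)|) * ‖z s i‖) ^ 2
      ≤ c * (‖z (a - η) i‖ ^ 2 + ‖z (b + η) i‖ ^ 2
        + ∫ s in Icc (a - η) (b + η), ‖G s i‖ ^ 2) + ∫ s in Icc a b, ‖z s i‖ ^ 2 := by
    intro i
    have hΓ : 0 ≤ ∫ s in Icc (a - η) (b + η), ‖G s i‖ ^ 2 := integral_nonneg fun s => sq_nonneg _
    have hΖ : 0 ≤ ∫ s in Icc a b, ‖z s i‖ ^ 2 := integral_nonneg fun s => sq_nonneg _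
    simp only [mul_pow]
    rw [integral_const_mul]
    rcases frequency_cases i with h0 | h1
    · rw [h0, Int.cast_zero, abs_zero, add_zero, one_pow, one_mul]
      have : 0 ≤ c := by positivity
      linarith [mul_nonneg this (add_nonneg (add_nonneg (sq_nonneg ‖z (a - η) i‖)
        (sq_nonneg ‖z (b + η) i‖)) hΓ)]
    · have h2 := frequency_sq_le h1 hη hab (h i) (hG2 i)
      rw [intervalIntegral_eq_Icc hab, intervalIntegral_eq_Icc (by linarith), ← sq_abs (ev i),
        abs_ev] at h2
      rw [abs_ev] at h1
      have h3 : (1 + |(i.1 : ℝ)|) ^ 2 ≤ 4 * |(i.1 : ℝ)| ^ 2 := by nlinarith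
      set Z := ∫ s in Icc a b, ‖z s i‖ ^ 2
      set Γ := ∫ s in Icc (a - η) (b + η), ‖G s i‖ ^ 2
      have h4 : |(i.1 : ℝ)| ^ 2 * Z ≤ (‖z (a - η) i‖ ^ 2 + ‖z (b + η) i‖ ^ 2 + (1 + η) * Γ) / η := by
        rw [le_div_iff₀ hη]; linarith
      calc (1 + |(i.1 : ℝ)|) ^ 2 * Z ≤ 4 * |(i.1 : ℝ)| ^ 2 * Z := mul_le_mul_of_nonneg_right h3 hΖ
        _ ≤ 4 * ((‖z (a - η) i‖ ^ 2 + ‖z (b + η) i‖ ^ 2 + (1 + η) * Γ) / η) := by linarith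
        _ = 4 / η * (‖z (a - η) i‖ ^ 2 + ‖z (b + η) i‖ ^ 2) + c * Γ := by rw [hc]; ring
        _ ≤ c * (‖z (a - η) i‖ ^ 2 + ‖z (b + η) i‖ ^ 2) + c * Γ := by gcongr
        _ ≤ _ := by linarith
  have hfin : ∑' i : Mode, ENNReal.ofReal (∫ s in Icc a b, ((1 + |(i.1 : ℝ)|) * ‖z s i‖) ^ 2)
      ≠ ⊤ := by
    have hs : ∀ v : L2seq Mode, ∑' i, ENNReal.ofReal (‖v i‖ ^ 2) ≠ ⊤ := fun v => by
      rw [← ENNReal.ofReal_tsum_of_nonneg (fun i => sq_nonneg _) v.summable_sq]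
      exact ENNReal.ofReal_ne_top
    refine ne_top_of_le_ne_top (b := ENNReal.ofReal c * (∑' i, ENNReal.ofReal (‖z (a - η) i‖ ^ 2)
      + ∑' i, ENNReal.ofReal (‖z (b + η) i‖ ^ 2)
      + ∑' i, ENNReal.ofReal (∫ s in Icc (a - η) (b + η), ‖G s i‖ ^ 2))
      + ∑' i, ENNReal.ofReal (∫ s in Icc a b, ‖z s i‖ ^ 2)) ?_ ?_
    · refine ENNReal.add_ne_top.2 ⟨ENNReal.mul_ne_top ENNReal.ofReal_ne_top
        (ENNReal.add_ne_top.2 ⟨ENNReal.add_ne_top.2 ⟨hs _, hs _⟩, ?_⟩), ?_⟩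
      · exact tsum_integral_sq_ne_top hG
      · exact tsum_integral_sq_ne_top hzL
    · rw [← ENNReal.tsum_add, ← ENNReal.tsum_add, ← ENNReal.tsum_mul_left, ← ENNReal.tsum_add]
      refine ENNReal.tsum_le_tsum fun i => ?_
      have hΓ : 0 ≤ ∫ s in Icc (a - η) (b + η), ‖G s i‖ ^ 2 := integral_nonneg fun s => sq_nonneg _
      have hΖ : 0 ≤ ∫ s in Icc a b, ‖z s i‖ ^ 2 := integral_nonneg fun s => sq_nonneg _
      rw [← ENNReal.ofReal_add (by positivity) (by positivity),
        ← ENNReal.ofReal_add (by positivity) hΓ, ← ENNReal.ofReal_mul (by positivity),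
        ← ENNReal.ofReal_add (by positivity) hΖ]
      exact ENNReal.ofReal_le_ofReal (hbound i)
  have hint : ∀ i : Mode, IntegrableOn (fun s => ((1 + |(i.1 : ℝ)|) * ‖z s i‖) ^ 2) (Icc a b) :=
    fun i => by
      simp only [mul_pow]
      exact (continuousOn_const.mul (hzi i)).integrableOn_Icc
  have hlin : ∫⁻ s in Icc a b, ∑' i : Mode, ENNReal.ofReal (((1 + |(i.1 : ℝ)|) * ‖z s i‖) ^ 2)
      ≠ ⊤ := by
    rw [lintegral_tsum fun i => (hint i).aestronglyMeasurable.aemeasurable.ennreal_ofReal]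
    have e : ∀ i : Mode, ENNReal.ofReal (∫ s in Icc a b, ((1 + |(i.1 : ℝ)|) * ‖z s i‖) ^ 2)
        = ∫⁻ s in Icc a b, ENNReal.ofReal (((1 + |(i.1 : ℝ)|) * ‖z s i‖) ^ 2) := fun i =>
      ofReal_integral_eq_lintegral_ofReal (hint i) (Eventually.of_forall fun s => sq_nonneg _)
    simpa only [e] using hfin
  have hnorm : ∀ (s : ℝ) (i : Mode), ‖((1 + |(i.1 : ℝ)| : ℝ) : ℂ) * z s i‖
      = (1 + |(i.1 : ℝ)|) * ‖z s i‖ := fun s i => by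
    rw [norm_mul, Complex.norm_real, Real.norm_of_nonneg (by positivity)]
  have hmem : ∀ᵐ s ∂volume.restrict (Icc a b),
      Memℓp (fun i : Mode => ((1 + |(i.1 : ℝ)| : ℝ) : ℂ) * z s i) 2 := by
    filter_upwards [ae_lt_top' (AEMeasurable.tsum fun i =>
      (hint i).aestronglyMeasurable.aemeasurable.ennreal_ofReal) hlin] with s hs
    rw [L2seq.memℓp_iff]
    simp only [hnorm]
    refine (ENNReal.summable_toReal hs.ne).congr fun i => ?_
    rw [ENNReal.toReal_ofReal (sq_nonneg _)]
  refine ⟨?_, hmem⟩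
  have hmeas : AEStronglyMeasurable (fun s => lift (z s)) (volume.restrict (Icc a b)) := by
    refine L2seq.measurable_of_apply fun i => ?_
    refine ((L2seq.measurable_apply hzL.aestronglyMeasurable i).const_mul
      ((1 + |(i.1 : ℝ)| : ℝ) : ℂ)).congr ?_
    filter_upwards [hmem] with s hs
    rw [lift_apply hs]
  refine (memLp_two_iff_integrable_sq_norm hmeas).2 ⟨hmeas.norm.pow 2, ?_⟩
  rw [hasFiniteIntegral_iff_ofReal (Eventually.of_forall fun s => sq_nonneg _)]
  refine lt_of_le_of_lt (lintegral_mono_ae ?_) hlin.lt_top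
  filter_upwards [hmem] with s hs
  rw [L2seq.norm_sq, ENNReal.ofReal_tsum_of_nonneg (fun i => sq_nonneg _) (lift (z s)).summable_sq]
  refine le_of_eq (tsum_congr fun i => ?_)
  rw [lift_apply hs, hnorm]

end Bilaplace

namespace Bilaplace

/-! ### Mild solutions are weak solutions -/

section PairCLM

/-- The inclusion of `H^σ(S¹)` into `L²(S¹)`. -/
def toSeq (σ : ℝ) (h : 0 ≤ σ) : HS σ →L[ℂ] L2seq ℤ :=
  LinearMap.mkContinuous
    { toFun := fun u => HS.toL2 0 (HS.incl h u)
      map_add' := fun u v => by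
        rw [← map_add]
        congr 1
      map_smul' := fun z u => by
        rw [RingHom.id_apply, ← map_smul]
        congr 1 }
    1 (fun u => by
      rw [HS.norm_eq]
      refine L2seq.norm_le_of_forall zero_le_one fun k => ?_
      change ‖(wt 0 k : ℂ) * (HS.incl h u).coeff k‖ ≤ 1 * ‖(wt σ k : ℂ) * u.coeff k‖
      rw [HS.coeff_incl, norm_mul, norm_mul, Complex.norm_real, Complex.norm_real,
        Real.norm_of_nonneg (wt_pos _ k).le, Real.norm_of_nonneg (wt_pos _ k).le, one_mul]
      exact mul_le_mul_of_nonneg_right (wt_mono h k) (norm_nonneg _))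

theorem toSeq_apply (σ : ℝ) (h : 0 ≤ σ) (u : HS σ) (k : ℤ) : toSeq σ h u k = u.coeff k := by
  change (wt 0 k : ℂ) * (HS.incl h u).coeff k = _
  rw [HS.wt_zero, HS.coeff_incl, Complex.ofReal_one, one_mul]

/-- The `L²(S¹)` inner product as a real bilinear map. -/
def pairCLM (σ : ℝ) (h : 0 ≤ σ) : HS σ →L[ℝ] HS σ →L[ℝ] ℂ :=
  ((isBoundedBilinearMap_inner (𝕜 := ℂ) (E := L2seq ℤ)).toContinuousLinearMap.flip.bilinearComp
    ((toSeq σ h).restrictScalars ℝ) ((toSeq σ h).restrictScalars ℝ))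

theorem pairCLM_apply (σ : ℝ) (h : 0 ≤ σ) (u v : HS σ) : pairCLM σ h u v = HS.pair u v := by
  change inner ℂ (toSeq σ h v) (toSeq σ h u) = _
  rw [lp.inner_eq_tsum, HS.pair]
  refine tsum_congr fun k => ?_
  rw [toSeq_apply, toSeq_apply, RCLike.inner_apply]

/-- The `L²(S¹)⁴` inner product as a real bilinear map. -/
def pairXCLM : XSp →L[ℝ] XSp →L[ℝ] ℂ :=
  let p₁ : XSp →L[ℝ] HS 2 := ContinuousLinearMap.fst ℝ _ _
  let q₁ : XSp →L[ℝ] HS 1 × HS 1 × HS 0 := ContinuousLinearMap.snd ℝ _ _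
  let p₂ : XSp →L[ℝ] HS 1 := (ContinuousLinearMap.fst ℝ _ _).comp q₁
  let q₂ : XSp →L[ℝ] HS 1 × HS 0 := (ContinuousLinearMap.snd ℝ _ _).comp q₁
  let p₃ : XSp →L[ℝ] HS 1 := (ContinuousLinearMap.fst ℝ _ _).comp q₂
  let p₄ : XSp →L[ℝ] HS 0 := (ContinuousLinearMap.snd ℝ _ _).comp q₂
  (pairCLM 2 zero_le_two).bilinearComp p₁ p₁ + (pairCLM 1 zero_le_one).bilinearComp p₂ p₂
    + (pairCLM 1 zero_le_one).bilinearComp p₃ p₃ + (pairCLM 0 le_rfl).bilinearComp p₄ p₄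

theorem pairXCLM_apply (U V : XSp) : pairXCLM U V = pairX U V := by
  change pairCLM 2 _ U.1 V.1 + pairCLM 1 _ U.2.1 V.2.1 + pairCLM 1 _ U.2.2.1 V.2.2.1
    + pairCLM 0 _ U.2.2.2 V.2.2.2 = _
  rw [pairCLM_apply, pairCLM_apply, pairCLM_apply, pairCLM_apply, pairX]

end PairCLM

section LiftY

variable {ε : ℝ}

theorem wt_one_mul_inv_le (k : ℤ) : wt 1 k * (1 + |(k : ℝ)|)⁻¹ ≤ 1 := by
  rw [← div_eq_mul_inv]
  exact div_le_one_of_le₀ (wt_one_le k) (by positivity)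

/-- The element of `Y` whose coordinates, divided by `1 + |k|`, are given. -/
def liftY (hε : 0 < ε) : L2seq Mode →L[ℂ] YSp :=
  have h₁ : ∀ k : ℤ, wt 3 k * |(wt 1 k * dd ε k * (1 + |(k : ℝ)|))⁻¹| ≤ (2 + 1 / ε) * 1 := fun k => by
    have h1 := wt_pos 1 k
    have h2 := dd_pos hε k
    have e : wt 1 k ^ 3 * (wt 1 k * dd ε k * (1 + |(k : ℝ)|))⁻¹
        = (wt 1 k * (dd ε k)⁻¹) * (wt 1 k * (1 + |(k : ℝ)|)⁻¹) := by field_simp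
    rw [wt_three, abs_of_pos (by positivity), e]
    exact mul_le_mul (wt_mul_inv_dd_le hε k) (wt_one_mul_inv_le k) (by positivity) (by positivity)
  have h₂ : ∀ k : ℤ, wt 2 k * |(wt 1 k * (1 + |(k : ℝ)|))⁻¹| ≤ 1 := fun k => by
    have h1 := wt_pos 1 k
    have e : wt 1 k ^ 2 * (wt 1 k * (1 + |(k : ℝ)|))⁻¹ = wt 1 k * (1 + |(k : ℝ)|)⁻¹ := by field_simp
    rw [wt_two, abs_of_pos (by positivity), e]
    exact wt_one_mul_inv_le k
  have h₃ : ∀ k : ℤ, wt 2 k * |(dd ε k * (1 + |(k : ℝ)|))⁻¹| ≤ (2 + 1 / ε) * 1 := fun k => by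
    have h1 := wt_pos 1 k
    have h2 := dd_pos hε k
    have e : wt 1 k ^ 2 * (dd ε k * (1 + |(k : ℝ)|))⁻¹
        = (wt 1 k * (dd ε k)⁻¹) * (wt 1 k * (1 + |(k : ℝ)|)⁻¹) := by field_simp
    rw [wt_two, abs_of_pos (by positivity), e]
    exact mul_le_mul (wt_mul_inv_dd_le hε k) (wt_one_mul_inv_le k) (by positivity) (by positivity)
  have h₄ : ∀ k : ℤ, wt 1 k * |(1 + |(k : ℝ)|)⁻¹| ≤ 1 := fun k => by
    rw [abs_of_pos (by positivity)]
    exact wt_one_mul_inv_le k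
  (toHS 3 (true, true) _ _ h₁ + toHS 3 (true, false) _ _ h₁).prod
    ((toHS 2 (true, true) _ _ h₂ - toHS 2 (true, false) _ _ h₂).prod
      ((toHS 2 (false, true) _ _ h₃ + toHS 2 (false, false) _ _ h₃).prod
        (toHS 1 (false, true) _ _ h₄ - toHS 1 (false, false) _ _ h₄)))

theorem toX_liftY (hε : 0 < ε) {v w : L2seq Mode}
    (h : ∀ i : Mode, w i = ((1 + |(i.1 : ℝ)| : ℝ) : ℂ) * v i) :
    toX (liftY hε w) = (psi hε).symm v := by
  have hne : ∀ k : ℤ, ((1 + |(k : ℝ)| : ℝ) : ℂ) ≠ 0 := fun k => by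
    have : (0 : ℝ) < 1 + |(k : ℝ)| := by positivity
    exact_mod_cast this.ne'
  have hinv : ∀ k : ℤ, (((1 + |(k : ℝ)|)⁻¹ : ℝ) : ℂ) * ((1 + |(k : ℝ)| : ℝ) : ℂ) = 1 := fun k => by
    rw [Complex.ofReal_inv, inv_mul_cancel₀ (hne k)]
  rw [psi_symm_apply]
  refine Prod.ext (HS.ext fun k => ?_) (Prod.ext (HS.ext fun k => ?_)
    (Prod.ext (HS.ext fun k => ?_) (HS.ext fun k => ?_)))
  · have e : (toX (liftY hε w)).1.coeff k
        = ((wt 1 k * dd ε k * (1 + |(k : ℝ)|))⁻¹ : ℝ) * w (k, true, true)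
          + ((wt 1 k * dd ε k * (1 + |(k : ℝ)|))⁻¹ : ℝ) * w (k, true, false) := rfl
    rw [e, coeff_out₁, h, h, mul_inv, Complex.ofReal_mul]
    linear_combination ((wt 1 k * dd ε k)⁻¹ : ℝ) * (v (k, true, true) + v (k, true, false)) * hinv k
  · have e : (toX (liftY hε w)).2.1.coeff k
        = ((wt 1 k * (1 + |(k : ℝ)|))⁻¹ : ℝ) * w (k, true, true)
          - ((wt 1 k * (1 + |(k : ℝ)|))⁻¹ : ℝ) * w (k, true, false) := rfl
    rw [e, coeff_out₂, h, h, mul_inv, Complex.ofReal_mul]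
    linear_combination ((wt 1 k)⁻¹ : ℝ) * (v (k, true, true) - v (k, true, false)) * hinv k
  · have e : (toX (liftY hε w)).2.2.1.coeff k
        = ((dd ε k * (1 + |(k : ℝ)|))⁻¹ : ℝ) * w (k, false, true)
          + ((dd ε k * (1 + |(k : ℝ)|))⁻¹ : ℝ) * w (k, false, false) := rfl
    rw [e, coeff_out₃, h, h, mul_inv, Complex.ofReal_mul]
    linear_combination ((dd ε k)⁻¹ : ℝ) * (v (k, false, true) + v (k, false, false)) * hinv k
  · have e : (toX (liftY hε w)).2.2.2.coeff k
        = ((1 + |(k : ℝ)|)⁻¹ : ℝ) * w (k, false, true)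
          - ((1 + |(k : ℝ)|)⁻¹ : ℝ) * w (k, false, false) := rfl
    rw [e, coeff_out₄, h, h]
    linear_combination (v (k, false, true) - v (k, false, false)) * hinv k

end LiftY

/-! #### Local integrability -/

theorem locL2_of_Icc {E : Type*} [NormedAddCommGroup E] {f : ℝ → E} {O : Set ℝ} (hO : IsOpen O)
    (hc : O.OrdConnected)
    (h : ∀ a b, a < b → Icc a b ⊆ O → MemLp f 2 (volume.restrict (Icc a b))) : LocL2 f O := by
  intro K hKO hK
  rcases K.eq_empty_or_nonempty with rfl | hKn
  · simp
  obtain ⟨a, b, hab, h1, h2⟩ := exists_Icc_of_isCompact hK hKO hO hc hKn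
  exact (h a b hab h1).mono_measure (Measure.restrict_mono (h2.trans Ioo_subset_Icc_self) le_rfl)

theorem ae_restrict_of_Icc {P : ℝ → Prop} {O : Set ℝ} (hO : IsOpen O)
    (h : ∀ a b, a < b → Icc a b ⊆ O → ∀ᵐ s ∂volume.restrict (Icc a b), P s) :
    ∀ᵐ s ∂volume.restrict O, P s := by
  rw [ae_restrict_iff' hO.measurableSet, ae_iff]
  refine measure_null_of_locally_null _ fun x hx => ?_
  have hxO : x ∈ O := by
    by_contra hx'
    exact hx fun h' => absurd h' hx'
  obtain ⟨δ, hδ, hb⟩ := Metric.isOpen_iff.1 hO x hxO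
  have hsub : Icc (x - δ / 2) (x + δ / 2) ⊆ O := fun y hy => hb (by
    rw [Metric.mem_ball, Real.dist_eq, abs_lt]; constructor <;> linarith [hy.1, hy.2])
  have h1 := h (x - δ / 2) (x + δ / 2) (by linarith) hsub
  rw [ae_restrict_iff' measurableSet_Icc, ae_iff] at h1
  refine ⟨_, inter_mem_nhdsWithin _ (Icc_mem_nhds (by linarith : x - δ / 2 < x)
    (by linarith : x < x + δ / 2)), measure_mono_null (fun y hy => ?_) h1⟩
  intro h'
  exact hy.1 fun _ => h' hy.2

section Weak

variable {s₁ ε : ℝ} {th : ℝ → ℝ} {Θ : ℝ}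

/-- Square integrability in time, rather than mere integrability, is what the gain of a derivative
requires of the right-hand side. -/
theorem memLp_coefC (hε : 0 < ε) (hth : Continuous th) (hΘ : ∀ s, |th s| ≤ Θ) (p : ℝ × Pot s₁)
    (a : ℝ) : MemLp (coefC hε th p) 2 (volume.restrict (Icc a s₁)) := by
  have hr : MemLp (rr th p) 2 (volume.restrict (Icc a s₁)) := by
    have h1 := (memLp_two_iff_integrable_sq
      (integrable_rr hth hΘ p).aestronglyMeasurable).2 (integrable_rr_sq hth hΘ p)
    exact h1.mono_measure (Measure.restrict_mono Icc_subset_Iic_self le_rfl)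
  have hm : AEStronglyMeasurable (decay hε th p) (volume.restrict (Icc a s₁)) :=
    (measurable_decay hε hth hΘ p).mono_measure
      (Measure.restrict_mono Icc_subset_Iic_self le_rfl)
  have hr' : MemLp (fun s => (‖opE hε‖ + ‖opA hε‖) * rr th p s) 2 (volume.restrict (Icc a s₁)) :=
    hr.const_mul _
  have h1 : MemLp (decay hε th p) 2 (volume.restrict (Icc a s₁)) :=
    hr'.mono' hm (Eventually.of_forall fun s => norm_decay_le p hε s)
  have h2 : MemLp (fun _ : ℝ => (ε : ℂ) • jordan) 2 (volume.restrict (Icc a s₁)) := memLp_const _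
  exact MemLp.add (ε := L2seq Mode →L[ℂ] L2seq Mode) h2 h1

theorem memLp_clm_apply {ι : Type} {C : ℝ → L2seq ι →L[ℂ] L2seq ι} {z : ℝ → L2seq ι} {a b : ℝ}
    (hz : ContinuousOn z (Icc a b)) (hC : MemLp C 2 (volume.restrict (Icc a b))) :
    MemLp (fun s => C s (z s)) 2 (volume.restrict (Icc a b)) := by
  obtain ⟨c, hc⟩ := isCompact_Icc.exists_bound_of_continuousOn hz
  refine MemLp.of_le_mul (c := c) hC ((ContinuousLinearMap.id ℂ
    (L2seq ι →L[ℂ] L2seq ι)).aestronglyMeasurable_comp₂ hC.aestronglyMeasurable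
      (hz.aestronglyMeasurable measurableSet_Icc)) ?_
  filter_upwards [ae_restrict_mem measurableSet_Icc] with s hs
  rw [mul_comm]
  exact ((C s).le_opNorm _).trans (mul_le_mul_of_nonneg_left (hc s hs) (norm_nonneg _))

/-- On compact subintervals of the interior, the perturbation applied to the continuous solution is
square-integrable, so the energy estimates place (1 + |k|)z in L² and the solution in Y. Its
derivative, computed mode by mode, is then an L² function with values in X, and the weak
formulations follow by integration by parts. -/
theorem isWeakSolution_of_isMild (hε : 0 < ε) (hth : Continuous th) (hΘ : ∀ s, |th s| ≤ Θ)
    {lam : ℝ} {ρ : Pot s₁} {J : Set ℝ} (hJ : J.OrdConnected) (hJs : J ⊆ Iic s₁) {U : ℝ → XSp}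
    (h : IsMild ev (coefC hε th (lam, ρ)) J fun s => psi hε (U s)) :
    IsWeakSolution (rhs th lam ρ) J U := by
  have hU : ContinuousOn U J := by
    have := (psi hε).symm.continuous.comp_continuousOn h.1
    simpa [Function.comp_def] using this
  set O := interior J with hOdef
  have hO : IsOpen O := isOpen_interior
  have hOJ : O ⊆ J := interior_subset
  have hc : O.OrdConnected := hJ.interior
  set z : ℝ → L2seq Mode := fun s => psi hε (U s) with hz
  set C := coefC hε th (lam, ρ) with hC
  have hCi : ∀ a b, a ≤ b → Icc a b ⊆ O → IntegrableOn C (Icc a b) := fun a b hab hI =>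
    (integrableOn_coefC hε hth hΘ (lam, ρ) a).mono_set
      (Icc_subset_Icc_right (hJs (hOJ (hI (right_mem_Icc.2 hab)))))
  have hCL : ∀ a b, a ≤ b → Icc a b ⊆ O →
      MemLp (fun s => C s (z s)) 2 (volume.restrict (Icc a b)) := fun a b hab hI =>
    memLp_clm_apply (h.1.mono (hI.trans hOJ))
      ((memLp_coefC hε hth hΘ (lam, ρ) a).mono_measure (Measure.restrict_mono
        (Icc_subset_Icc_right (hJs (hOJ (hI (right_mem_Icc.2 hab))))) le_rfl))
  have hprim : ∀ a b, a ≤ b → Icc a b ⊆ O → ∀ i,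
      IsPrim (fun s => (ev i : ℂ) * z s i + C s (z s) i) (fun s => z s i) a b := fun a b hab hI i =>
    h.isPrim hJ (hOJ (hI (left_mem_Icc.2 hab))) (hOJ (hI (right_mem_Icc.2 hab)))
      (hCi a b hab hI) i
  have hlift : ∀ a b, a < b → Icc a b ⊆ O →
      MemLp (fun s => lift (z s)) 2 (volume.restrict (Icc a b)) ∧
      ∀ᵐ s ∂volume.restrict (Icc a b),
        Memℓp (fun i : Mode => ((1 + |(i.1 : ℝ)| : ℝ) : ℂ) * z s i) 2 := by
    intro a b hab hI
    obtain ⟨a', b', -, h1, h2⟩ := exists_Icc_of_isCompact isCompact_Icc hI hO hc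
      ⟨a, left_mem_Icc.2 hab.le⟩
    have ha := (h2 (left_mem_Icc.2 hab.le)).1
    have hb := (h2 (right_mem_Icc.2 hab.le)).2
    set η := min (a - a') (b' - b) with hη
    have hη0 : 0 < η := lt_min (by linarith) (by linarith)
    have hη1 : η ≤ a - a' := min_le_left _ _
    have hη2 : η ≤ b' - b := min_le_right _ _
    have hI' : Icc (a - η) (b + η) ⊆ O := (Icc_subset_Icc (by linarith) (by linarith)).trans h1
    exact memLp_lift hη0 hab.le (h.1.mono (hI'.trans hOJ)) (hCL _ _ (by linarith) hI')
      (hprim _ _ (by linarith) hI')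
  have hae : ∀ᵐ s ∂volume.restrict O,
      Memℓp (fun i : Mode => ((1 + |(i.1 : ℝ)| : ℝ) : ℂ) * z s i) 2 :=
    ae_restrict_of_Icc hO fun a b hab hI => (hlift a b hab hI).2
  -- The unbounded multiplication by eigenvalues is written as a bounded diagonal operator applied
  -- to the lifted sequence (1 + |k|)z, which makes the derivative measurable and square-integrable
  -- in ℓ².
  set e : Mode → ℝ := fun i => ev i / (1 + |(i.1 : ℝ)|) with he
  have he1 : ∀ i, |e i| ≤ 1 := fun i => by
    rw [he]
    beta_reduce
    rw [abs_div, abs_ev, abs_of_pos (by positivity : 0 < 1 + |(i.1 : ℝ)|)]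
    exact div_le_one_of_le₀ (by linarith) (by positivity)
  set D : ℝ → L2seq Mode := fun s => L2seq.dmul e (lift (z s)) + C s (z s) with hD
  have hDL : ∀ a b, a < b → Icc a b ⊆ O → MemLp D 2 (volume.restrict (Icc a b)) :=
    fun a b hab hI => MemLp.add ((L2seq.dmul e).comp_memLp' (hlift a b hab hI).1)
      (hCL a b hab.le hI)
  have hDi : ∀ s, Memℓp (fun i : Mode => ((1 + |(i.1 : ℝ)| : ℝ) : ℂ) * z s i) 2 → ∀ i,
      D s i = (ev i : ℂ) * z s i + C s (z s) i := fun s hs i => by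
    have hne : ((1 + |(i.1 : ℝ)| : ℝ) : ℂ) ≠ 0 := by
      have : (0 : ℝ) < 1 + |(i.1 : ℝ)| := by positivity
      exact_mod_cast this.ne'
    rw [hD]
    beta_reduce
    rw [L2seq.add_apply, L2seq.dmul_apply he1, lift_apply hs, he]
    beta_reduce
    rw [Complex.ofReal_div, ← mul_assoc, div_mul_cancel₀ _ hne]
  have hDprim : ∀ a b, a < b → Icc a b ⊆ O → IsPrim D z a b := by
    intro a b hab hI
    have hDint : IntegrableOn D (Icc a b) := (hDL a b hab hI).integrable one_le_two
    refine ⟨hDint, fun s hs => L2seq.ext_apply fun i => ?_⟩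
    have hss : Icc a s ⊆ Icc a b := Icc_subset_Icc_right hs.2
    have h1 := (hprim a b hab.le hI i).eq s hs
    rw [L2seq.add_apply, h1, intervalIntegral_eq_Icc hs.1, intervalIntegral_eq_Icc hs.1,
      L2seq.apply_integral (hDint.mono_set hss)]
    congr 1
    refine integral_congr_ae ?_
    filter_upwards [ae_restrict_of_ae_restrict_of_subset hss (hlift a b hab hI).2] with x hx
    exact (hDi x hx i).symm
  set R : XSp →L[ℝ] XSp := ContinuousLinearMap.id ℝ XSp
  set S : L2seq Mode →L[ℝ] XSp :=
    ((psi hε).symm : L2seq Mode →L[ℂ] XSp).restrictScalars ℝ with hS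
  have hSz : ∀ s, S (z s) = U s := fun s => (psi hε).symm_apply_apply (U s)
  have hUprim : ∀ a b, a < b → Icc a b ⊆ O → IsPrim (fun s => S (D s)) U a b := fun a b hab hI =>
    ((hDprim a b hab hI).map S).congr (fun _ _ => rfl) fun s _ => (hSz s).symm
  have hUL : LocL2 U O := fun K hKO hK => by
    have : IsFiniteMeasure (volume.restrict K) :=
      ⟨by rw [Measure.restrict_apply_univ]; exact hK.measure_lt_top⟩
    obtain ⟨c, hc⟩ := hK.exists_bound_of_continuousOn (hU.mono (hKO.trans hOJ))
    refine MemLp.of_bound ((hU.mono (hKO.trans hOJ)).aestronglyMeasurable hK.measurableSet) c ?_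
    filter_upwards [ae_restrict_mem hK.measurableSet] with s hs using hc s hs
  refine ⟨hU, ⟨hUL, fun s => S (D s), locL2_of_Icc hO hc fun a b hab hI =>
    S.comp_memLp' (hDL a b hab hI), fun φ hφ => ?_⟩, fun s => liftY hε (lift (z s)),
    locL2_of_Icc hO hc fun a b hab hI => (liftY hε).comp_memLp' (hlift a b hab hI).1, ?_, ?_⟩
  · exact IsPrim.integral_test (ContinuousLinearMap.lsmul ℝ ℝ).flip hO hc hUprim hφ
  · filter_upwards [hae] with s hs
    rw [toX_liftY hε (lift_apply hs)]
    exact hSz s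
  · intro V hV
    have h1 := IsPrim.integral_test pairXCLM hO hc hUprim hV
    simp only [pairXCLM_apply] at h1
    rw [h1, neg_neg]
    refine integral_congr_ae ?_
    filter_upwards [hae] with s hs
    congr 1
    refine (psi hε).injective (L2seq.ext_apply fun i => ?_)
    rw [psi_rhs, toX_liftY hε (lift_apply hs)]
    change psi hε ((psi hε).symm (D s)) i = _
    rw [ContinuousLinearEquiv.apply_symm_apply, ContinuousLinearEquiv.apply_symm_apply, hDi s hs]

theorem isWeakSolution_iff (hε : 0 < ε) (hth : Continuous th) (hΘ : ∀ s, |th s| ≤ Θ)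
    {lam : ℝ} {ρ : Pot s₁} {J : Set ℝ} (hJ : J.OrdConnected) (hJs : J ⊆ Iic s₁) {U : ℝ → XSp} :
    IsWeakSolution (rhs th lam ρ) J U
      ↔ IsMild ev (coefC hε th (lam, ρ)) J fun s => psi hε (U s) :=
  ⟨isMild_of_isWeakSolution hε hth hΘ hJ hJs, isWeakSolution_of_isMild hε hth hΘ hJ hJs⟩

end Weak

end Bilaplace

namespace Bilaplace

/-! ### From mild solutions to exponential dichotomies -/

namespace GlobalSol

variable {ι E : Type} [Countable ι] [NormedAddCommGroup E] [NormedSpace ℝ E]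
variable {μ : ι → ℝ} {C : E → ℝ → L2seq ι →L[ℂ] L2seq ι} {s₁ κ κ' : ℝ}
  {Φm Φp : E → ℝ → ℝ → L2seq ι →L[ℂ] L2seq ι}

theorem sub_eq (h : GlobalSol μ C s₁ κ κ' Φm Φp) (p : E) {t : ℝ} (ht : t ≤ s₁) (v : L2seq ι) :
    v - Φm p t t v = Φp p t t v := by
  rw [sub_eq_iff_eq_add']
  exact (h.jump p t ht v).jump.symm

/-- The solution after t, restarted at s with zero part before s, solves the jump problem at s, and
uniqueness identifies it. With s = t this says that P(t) is a projection, and in general that the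
forward evolution stays in its range. -/
theorem proj_stable (h : GlobalSol μ C s₁ κ κ' Φm Φp)
    (hCi : ∀ p a, IntegrableOn (C p) (Icc a s₁)) (p : E) {t s : ℝ} (hts : t ≤ s) (hs : s ≤ s₁)
    (v : L2seq ι) : Φm p s s (Φm p s t v) = Φm p s t v := by
  have hj := h.jump p t (hts.trans hs) v
  have hj' : IsJump μ (C p) s₁ κ (ContinuousLinearMap.id ℂ _) s (Φm p s t v)
      (fun s' => Φm p s' t v) 0 :=
    ⟨hj.mild_m.mono (Icc_subset_Icc_left hts), IsMild.zero, ⟨0, fun _ _ => by simp⟩,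
      by simp, hj.orth⟩
  exact ((h.jump p s hs _).unique (fun x hx => hx) (hCi p) hs hj').1 ⟨le_rfl, hs⟩

/-- Dually, the solution before t restricted to (-∞, s] solves the jump problem at s with zero part
after s. -/
theorem proj_unstable (h : GlobalSol μ C s₁ κ κ' Φm Φp)
    (hCi : ∀ p a, IntegrableOn (C p) (Icc a s₁)) (p : E) {t s : ℝ} (hst : s ≤ t) (ht : t ≤ s₁)
    (v : L2seq ι) : Φm p s s (Φp p s t v) = 0 := by
  have hj := h.jump p t ht v
  obtain ⟨c, hc⟩ := hj.growth
  have hj' : IsJump μ (C p) s₁ κ (ContinuousLinearMap.id ℂ _) s (Φp p s t v)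
      0 (fun s' => Φp p s' t v) :=
    ⟨IsMild.zero, hj.mild_p.mono (Iic_subset_Iic.2 hst), ⟨c, fun s' hs' => hc s' (hs'.trans hst)⟩,
      by simp, fun x _ => by simp⟩
  exact ((h.jump p s (hst.trans ht) _).unique (fun x hx => hx) (hCi p) (hst.trans ht) hj').1
    ⟨le_rfl, hst.trans ht⟩

end GlobalSol

section Conj

variable {X H : Type} [NormedAddCommGroup X] [NormedSpace ℂ X] [NormedAddCommGroup H]
  [NormedSpace ℂ H] (e : X ≃L[ℂ] H)

/-- Transport of operators along an isomorphism. -/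
def transport : (H →L[ℂ] H) →L[ℂ] (X →L[ℂ] X) :=
  (ContinuousLinearMap.compL ℂ X H X (e.symm : H →L[ℂ] X)).comp
    ((ContinuousLinearMap.compL ℂ X H H).flip (e : X →L[ℂ] H))

theorem transport_apply (A : H →L[ℂ] H) (U : X) : transport e A U = e.symm (A (e U)) := rfl

theorem apply_transport (A : H →L[ℂ] H) (U : X) : e (transport e A U) = A (e U) := by
  rw [transport_apply, e.apply_symm_apply]

theorem norm_transport_le {A : H →L[ℂ] H} {K : ℝ} (hA : ∀ v, ‖A v‖ ≤ K * ‖v‖) (hK : 0 ≤ K)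
    (U : X) : ‖transport e A U‖
      ≤ K * ((‖(e : X →L[ℂ] H)‖ + 1) * (‖(e.symm : H →L[ℂ] X)‖ + 1)) * ‖U‖ := by
  have h1 : ‖e U‖ ≤ (‖(e : X →L[ℂ] H)‖ + 1) * ‖U‖ :=
    ((e : X →L[ℂ] H).le_opNorm U).trans
      (mul_le_mul_of_nonneg_right (by linarith) (norm_nonneg _))
  have h2 : ‖e.symm (A (e U))‖ ≤ (‖(e.symm : H →L[ℂ] X)‖ + 1) * ‖A (e U)‖ :=
    ((e.symm : H →L[ℂ] X).le_opNorm _).trans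
      (mul_le_mul_of_nonneg_right (by linarith) (norm_nonneg _))
  rw [transport_apply]
  calc _ ≤ (‖(e.symm : H →L[ℂ] X)‖ + 1) * (K * ((‖(e : X →L[ℂ] H)‖ + 1) * ‖U‖)) := by
        refine h2.trans (mul_le_mul_of_nonneg_left ((hA _).trans ?_) (by positivity))
        exact mul_le_mul_of_nonneg_left h1 hK
    _ = _ := by ring

/-- Transport of operators into spaces of curves along an isomorphism. -/
def transportCurves (I : Set ℝ) : (H →L[ℂ] BoundedContinuousFunction I H) →L[ℂ]
    (X →L[ℂ] BoundedContinuousFunction I X) :=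
  (ContinuousLinearMap.compL ℂ X (BoundedContinuousFunction I H) (BoundedContinuousFunction I X)
    ((e.symm : H →L[ℂ] X).compLeftContinuousBounded I)).comp
    ((ContinuousLinearMap.compL ℂ X H (BoundedContinuousFunction I H)).flip (e : X →L[ℂ] H))

theorem transportCurves_apply (I : Set ℝ) (F : H →L[ℂ] BoundedContinuousFunction I H) (U : X)
    (s : I) : transportCurves e I F U s = e.symm (F (e U) s) := rfl

end Conj

variable {E : Type*} [NormedAddCommGroup E] [NormedSpace ℝ E]

theorem smoothCurves_transport {H : Type} [NormedAddCommGroup H] [NormedSpace ℂ H]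
    (e : XSp ≃L[ℂ] H) {I : Set ℝ} {w : ℝ → ℝ} {Φ : E → ℝ → H →L[ℂ] H}
    {F : E → H →L[ℂ] BoundedContinuousFunction I H} (hF : ContDiff ℝ ∞ F)
    (hFe : ∀ p v, ∀ s : I, F p v s = (w s : ℂ) • Φ p s v) (D : Set E) :
    SmoothCurves D I w fun p s => transport e (Φ p s) := by
  refine ⟨fun p => transportCurves e I (F p),
    (((transportCurves e I).restrictScalars ℝ).contDiff.comp hF).contDiffOn, fun p _ U s => ?_⟩
  rw [transportCurves_apply, hFe, map_smul, transport_apply]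

theorem contDiffOn_eval {X : Type} [NormedAddCommGroup X] [NormedSpace ℂ X] {D : Set E}
    {I : Set ℝ} {F : E → X →L[ℂ] BoundedContinuousFunction I X} (hF : ContDiffOn ℝ ∞ F D) (s : I)
    (z : ℂ) {Ψ : E → X →L[ℂ] X} (hΨ : ∀ p ∈ D, ∀ U, Ψ p U = z • F p U s) :
    ContDiffOn ℝ ∞ Ψ D := by
  let L : (X →L[ℂ] BoundedContinuousFunction I X) →L[ℂ] (X →L[ℂ] X) :=
    z • ContinuousLinearMap.compL ℂ X (BoundedContinuousFunction I X) X
      (BoundedContinuousFunction.evalCLM ℂ s)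
  exact ((L.restrictScalars ℝ).contDiff.comp_contDiffOn hF).congr fun p hp =>
    ContinuousLinearMap.ext fun U => hΨ p hp U

/-- Evaluation at a time is bounded on curves, so smoothness at fixed times follows from smoothness
of curves after division by the weight. -/
theorem SmoothCurves.contDiffOn {D : Set E} {I : Set ℝ} {w : ℝ → ℝ} {Φ : E → ℝ → XSp →L[ℂ] XSp}
    (h : SmoothCurves D I w Φ) {s : ℝ} (hs : s ∈ I) (hw : w s ≠ 0) :
    ContDiffOn ℝ ∞ (fun p => Φ p s) D := by
  obtain ⟨F, hF, hFe⟩ := h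
  have hw' : (w s : ℂ) ≠ 0 := by exact_mod_cast hw
  refine contDiffOn_eval hF ⟨s, hs⟩ (w s : ℂ)⁻¹ fun p hp U => ?_
  rw [hFe p hp U ⟨s, hs⟩, smul_smul, inv_mul_cancel₀ hw', one_smul]

/-! ### Assembly of the dichotomies for the original system -/

section Dichotomies

variable {κ κ' δ : ℝ} {s₁ ε : ℝ} {th : ℝ → ℝ} {Θ : ℝ}

theorem isUniqueSolution_forward (hε : 0 < ε) (hth : Continuous th) (hΘ : ∀ s, |th s| ≤ Θ)
    {lam : ℝ} {ρ : Pot s₁} {t : ℝ} {U₀ : XSp} {U : ℝ → XSp}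
    (hU : IsMild ev (coefC hε th (lam, ρ)) (Icc t s₁) fun s => psi hε (U s)) (h0 : U t = U₀) :
    IsUniqueSolution (rhs th lam ρ) (Iic s₁ ∩ Ici t) t U₀ U := by
  have hI : Iic s₁ ∩ Ici t = Icc t s₁ := by rw [inter_comm, Ici_inter_Iic]
  have hs : Icc t s₁ ⊆ Iic s₁ := Icc_subset_Iic_self
  rw [hI]
  refine ⟨(isWeakSolution_iff hε hth hΘ ordConnected_Icc hs).2 hU, h0, fun V hV hV0 s hst => ?_⟩
  have hV' := (isWeakSolution_iff hε hth hΘ ordConnected_Icc hs).1 hV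
  have hd := hV'.sub hU fun a ha b hb => (integrableOn_coefC hε hth hΘ _ a).mono_set
    (Icc_subset_Icc_right hb.2)
  have := hd.eq_zero_forward (integrableOn_coefC hε hth hΘ _ t)
    (by rw [Pi.sub_apply, hV0, h0, sub_self]) hst
  exact (psi hε).injective (sub_eq_zero.1 this)

theorem isUniqueSolution_backward (hε : 0 < ε) (hth : Continuous th) (hΘ : ∀ s, |th s| ≤ Θ)
    {lam : ℝ} {ρ : Pot s₁} {t : ℝ} (ht : t ≤ s₁) {U₀ : XSp} {U : ℝ → XSp}
    (hU : IsMild ev (coefC hε th (lam, ρ)) (Iic t) fun s => psi hε (U s)) (h0 : U t = U₀) :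
    IsUniqueSolution (rhs th lam ρ) (Iic s₁ ∩ Iic t) t U₀ U := by
  have hI : Iic s₁ ∩ Iic t = Iic t := inter_eq_right.2 (Iic_subset_Iic.2 ht)
  have hs : Iic t ⊆ Iic s₁ := Iic_subset_Iic.2 ht
  rw [hI]
  refine ⟨(isWeakSolution_iff hε hth hΘ ordConnected_Iic hs).2 hU, h0, fun V hV hV0 s hst => ?_⟩
  have hV' := (isWeakSolution_iff hε hth hΘ ordConnected_Iic hs).1 hV
  have hCi : ∀ a, ∀ b ≤ t, IntegrableOn (coefC hε th (lam, ρ)) (Icc a b) := fun a b hb =>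
    (integrableOn_coefC hε hth hΘ _ a).mono_set (Icc_subset_Icc_right (hb.trans ht))
  have hd := hV'.sub hU fun a _ b hb => hCi a b hb
  have := (hd.mono (Icc_subset_Iic_self : Icc s t ⊆ Iic t)).eq_zero_backward (hCi s t le_rfl)
    (by rw [Pi.sub_apply, hV0, h0, sub_self]) ⟨le_rfl, hst⟩
  exact (psi hε).injective (sub_eq_zero.1 this)

theorem isExpDichotomy_of_globalSol (hκ : κ < κ') (hε : 0 < ε) (hth : Continuous th)
    (hΘ : ∀ s, |th s| ≤ Θ) {Φm Φp : ℝ × Pot s₁ → ℝ → ℝ → L2seq Mode →L[ℂ] L2seq Mode}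
    (h : GlobalSol ev (coefC (s₁ := s₁) hε th) s₁ κ κ' Φm Φp) (lam : ℝ) (ρ : Pot s₁) :
    ∃ K, IsExpDichotomy (rhs th lam ρ) (Iic s₁) K κ κ'
      (fun t => transport (psi hε) (Φm (lam, ρ) t t))
      (fun s t => transport (psi hε) (Φm (lam, ρ) s t))
      (fun s t => transport (psi hε) (Φp (lam, ρ) s t)) := by
  obtain ⟨K, hK, hb⟩ := h.bound (lam, ρ)
  have hCi := fun p a => integrableOn_coefC (s₁ := s₁) hε hth hΘ p a
  have key := fun {A : L2seq Mode →L[ℂ] L2seq Mode} {r : ℝ}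
    (hA : ∀ v, ‖A v‖ ≤ K * Real.exp r * ‖v‖) => norm_transport_le (psi hε) hA (by positivity)
  refine ⟨K * ((‖(psi hε : XSp →L[ℂ] L2seq Mode)‖ + 1)
    * (‖((psi hε).symm : L2seq Mode →L[ℂ] XSp)‖ + 1)), by positivity, hκ, ?_, ?_, ?_, ?_, ?_, ?_,
    ?_, ?_⟩
  · intro s hs U
    refine (psi hε).injective ?_
    rw [apply_transport, apply_transport]
    exact h.proj_stable hCi _ le_rfl hs _
  · intro U
    exact (psi hε).symm.continuous.comp_continuousOn (h.cont (lam, ρ) (psi hε U))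
  · intro t ht U
    refine isUniqueSolution_forward hε hth hΘ ?_ rfl
    simp only [apply_transport]
    exact (h.jump _ t ht _).mild_m
  · intro t ht s hs hts U
    refine (key (r := κ * (s - t)) (fun v => (hb t ht).1 s hts hs v) U).trans_eq ?_
    ring
  · intro t ht U
    refine isUniqueSolution_backward hε hth hΘ ht ?_ ?_
    · simp only [apply_transport]
      exact (h.jump _ t ht _).mild_p
    · refine (psi hε).injective ?_
      rw [map_sub, apply_transport, apply_transport, h.sub_eq _ ht]
  · intro t ht s hs hst U
    refine (key (r := κ' * (s - t)) (fun v => (hb t ht).2 s hst v) U).trans_eq ?_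
    ring
  · intro t ht s hs hts U
    refine ⟨transport (psi hε) (Φm (lam, ρ) s t) U, (psi hε).injective ?_⟩
    rw [ContinuousLinearMap.coe_coe, apply_transport, apply_transport]
    exact h.proj_stable hCi _ hts hs _
  · intro t ht s hs hst U
    refine LinearMap.mem_ker.2 ((psi hε).injective ?_)
    rw [ContinuousLinearMap.coe_coe, apply_transport, apply_transport, map_zero]
    exact h.proj_unstable hCi _ hst ht _

theorem smoothDichotomies_of_globalSol (hε : 0 < ε)
    {Φm Φp : ℝ × Pot s₁ → ℝ → ℝ → L2seq Mode →L[ℂ] L2seq Mode}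
    (h : GlobalSol ev (coefC (s₁ := s₁) hε th) s₁ κ κ' Φm Φp) (D : Set (ℝ × Pot s₁)) :
    SmoothDichotomies D (Iic s₁) κ κ' (fun p t => transport (psi hε) (Φm p t t))
      (fun p s t => transport (psi hε) (Φm p s t))
      (fun p s t => transport (psi hε) (Φp p s t)) := by
  have hm : ∀ t ∈ Iic s₁, SmoothCurves D (Iic s₁ ∩ Ici t) (fun s => Real.exp (-κ * (s - t)))
      fun p s => transport (psi hε) (Φm p s t) := fun t ht => by
    obtain ⟨F, hF, hFe⟩ := h.smooth_m t ht
    exact smoothCurves_transport (psi hε) (Φ := fun p s => Φm p s t) hF hFe D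
  have hp : ∀ t ∈ Iic s₁, SmoothCurves D (Iic s₁ ∩ Iic t) (fun s => Real.exp (-κ' * (s - t)))
      fun p s => transport (psi hε) (Φp p s t) := fun t ht => by
    obtain ⟨F, hF, hFe⟩ := h.smooth_p t ht
    exact smoothCurves_transport (psi hε) (Φ := fun p s => Φp p s t) hF hFe D
  exact ⟨fun s hs => (hm s hs).contDiffOn ⟨hs, le_refl s⟩ (Real.exp_ne_zero _),
    fun t ht s hs hts => (hm t ht).contDiffOn ⟨hs, hts⟩ (Real.exp_ne_zero _),
    fun t ht s hs hst => (hp t ht).contDiffOn ⟨hs, hst⟩ (Real.exp_ne_zero _), hm, hp⟩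

theorem exists_dichotomies (G : Gap κ κ' δ) (hth : Continuous th) (hΘ : ∀ s, |th s| ≤ Θ) (s₁ : ℝ) :
    ∃ (P : ℝ × Pot s₁ → ℝ → XSp →L[ℂ] XSp) (Φs Φu : ℝ × Pot s₁ → ℝ → ℝ → XSp →L[ℂ] XSp),
      (∀ lam ρ, ∃ K, IsExpDichotomy (rhs th lam ρ) (Iic s₁) K κ κ' (P (lam, ρ)) (Φs (lam, ρ))
        (Φu (lam, ρ))) ∧
      ∀ D, SmoothDichotomies D (Iic s₁) κ κ' P Φs Φu := by
  have hδ := G.δ_pos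
  -- This choice of ε bounds the nilpotent part, integrated against the kernel of total mass 2/δ, by
  -- 1/8.
  have hε : 0 < δ / (16 * (‖jordan‖ + 1)) := by positivity
  have hεδ : δ / (16 * (‖jordan‖ + 1)) * ‖jordan‖ * (2 / δ) ≤ 1 / 8 := by
    rw [show δ / (16 * (‖jordan‖ + 1)) * ‖jordan‖ * (2 / δ)
      = 1 / 8 * (‖jordan‖ / (‖jordan‖ + 1)) by field_simp; ring]
    have : ‖jordan‖ / (‖jordan‖ + 1) ≤ 1 := div_le_one_of_le₀ (by linarith) (by positivity)
    linarith
  obtain ⟨Φm, Φp, h⟩ := exists_globalSol_coefC (s₁ := s₁) G hε hεδ hth hΘ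
  exact ⟨_, _, _, isExpDichotomy_of_globalSol G.lt hε hth hΘ h, smoothDichotomies_of_globalSol hε h⟩

end Dichotomies

/-- The relevant eigenvalues are -1 below and 0 above, and δ is the smaller of the distances of the
rates to them. For rates in (0, 1) the neighbours are 0 and 1. -/
theorem Gap.of_neg {κ κ' : ℝ} (h₁ : -1 < κ) (h₂ : κ < κ') (h₃ : κ' < 0) :
    Gap κ κ' (min (κ + 1) (-κ')) := by
  refine ⟨h₂, lt_min (by linarith) (by linarith), (min_le_left _ _).trans (by linarith),
    fun m => ?_, by linarith, by linarith⟩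
  rcases le_or_gt 0 m with hm | hm
  · have : (0 : ℝ) ≤ m := by exact_mod_cast hm
    exact Or.inr (by linarith [min_le_right (κ + 1) (-κ')])
  · have : (m : ℝ) ≤ -1 := by exact_mod_cast Int.le_sub_one_of_lt hm
    exact Or.inl (by linarith [min_le_left (κ + 1) (-κ')])

theorem Gap.of_pos {κ κ' : ℝ} (h₁ : 0 < κ) (h₂ : κ < κ') (h₃ : κ' < 1) :
    Gap κ κ' (min κ (1 - κ')) := by
  refine ⟨h₂, lt_min (by linarith) (by linarith), (min_le_left _ _).trans (by linarith),
    fun m => ?_, by linarith, by linarith⟩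
  rcases le_or_gt m 0 with hm | hm
  · have : (m : ℝ) ≤ 0 := by exact_mod_cast hm
    exact Or.inl (by linarith [min_le_left κ (1 - κ')])
  · have : (1 : ℝ) ≤ m := by exact_mod_cast hm
    exact Or.inr (by linarith [min_le_right κ (1 - κ')])

theorem continuous_profile {θ : EuclideanSpace ℝ (Fin 2) → ℝ} (hθ : Continuous θ) :
    Continuous (profile θ) := by
  refine hθ.comp ((PiLp.continuous_toLp 2 _).comp ?_)
  exact (continuous_single (A := fun _ : Fin 2 => ℝ) 0).comp Real.continuous_exp

theorem exists_abs_profile_le {θ : EuclideanSpace ℝ (Fin 2) → ℝ} (hθ : Continuous θ) {r₀ : ℝ}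
    (hsupp : tsupport θ ⊆ Metric.ball 0 r₀) : ∃ Θ, ∀ s, |profile θ s| ≤ Θ := by
  have hc : HasCompactSupport θ :=
    (Metric.isBounded_ball.subset hsupp).isCompact_closure.of_isClosed_subset isClosed_closure
      subset_closure
  obtain ⟨Θ, hΘ⟩ := hc.exists_bound_of_continuous hθ
  exact ⟨Θ, fun s => hΘ _⟩

end Bilaplace

end

theorem mainTheorem3 (r₀ r₁ : ℝ) (hr₀ : 0 < r₀) (hr₁ : r₀ ≤ r₁)
    (θ : EuclideanSpace ℝ (Fin 2) → ℝ) (hθ : ContDiff ℝ ∞ θ)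
    (hsupp : tsupport θ ⊆ Metric.ball 0 r₀) (hrad : ∀ x y, ‖x‖ = ‖y‖ → θ x = θ y)
    (κs κcu κcs κu : ℝ) (h₁ : -1 < κs) (h₂ : κs < κcu) (h₃ : κcu < 0)
    (h₄ : 0 < κcs) (h₅ : κcs < κu) (h₆ : κu < 1) :
    ∃ (𝒰 : Set (Bilaplace.Pot (Real.log r₁)))
      (Ps Pcs : ℝ × Bilaplace.Pot (Real.log r₁) → ℝ → Bilaplace.XSp →L[ℂ] Bilaplace.XSp)
      (Φs Φcu Φcs Φu :
        ℝ × Bilaplace.Pot (Real.log r₁) → ℝ → ℝ → Bilaplace.XSp →L[ℂ] Bilaplace.XSp),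
      IsOpen 𝒰 ∧ 0 ∈ 𝒰 ∧
      (∀ (lam : ℝ), ∀ ρ ∈ 𝒰,
        (∃ K, Bilaplace.IsExpDichotomy (Bilaplace.rhs (Bilaplace.profile θ) lam ρ)
          (Iic (Real.log r₁)) K κs κcu (Ps (lam, ρ)) (Φs (lam, ρ)) (Φcu (lam, ρ))) ∧
        (∃ K, Bilaplace.IsExpDichotomy (Bilaplace.rhs (Bilaplace.profile θ) lam ρ)
          (Iic (Real.log r₁)) K κcs κu (Pcs (lam, ρ)) (Φcs (lam, ρ)) (Φu (lam, ρ)))) ∧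
      Bilaplace.SmoothDichotomies (univ ×ˢ 𝒰) (Iic (Real.log r₁)) κs κcu Ps Φs Φcu ∧
      Bilaplace.SmoothDichotomies (univ ×ˢ 𝒰) (Iic (Real.log r₁)) κcs κu Pcs Φcs Φu := by
  have hth := Bilaplace.continuous_profile hθ.continuous
  obtain ⟨Θ, hΘ⟩ := Bilaplace.exists_abs_profile_le hθ.continuous hsupp
  obtain ⟨Ps, Φs, Φcu, hs, hs'⟩ :=
    Bilaplace.exists_dichotomies (Bilaplace.Gap.of_neg h₁ h₂ h₃) hth hΘ (Real.log r₁)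
  obtain ⟨Pcs, Φcs, Φu, hu, hu'⟩ :=
    Bilaplace.exists_dichotomies (Bilaplace.Gap.of_pos h₄ h₅ h₆) hth hΘ (Real.log r₁)
  -- The construction needs no smallness of the potential, so the neighbourhood is the whole space.
  exact ⟨univ, Ps, Pcs, Φs, Φcu, Φcs, Φu, isOpen_univ, mem_univ _,
    fun lam ρ _ => ⟨hs lam ρ, hu lam ρ⟩, hs' _, hu' _⟩
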